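/- **Theorem 1.3.** Let $(M,\lambda)$ be a three-dimensional contact manifold (smooth, Hausdorff, second countable, without boundary; $\lambda$ is a smooth 1-form with $\lambda\wedge d\lambda$ nowhere zero), with Reeb vector field $X_\lambda$ given by $\lambda(X_\lambda)=1$, $d\lambda(X_\lambda,\cdot)=0$. Let $\mathcal L\subset M$ be a Legendrian knot (a smoothly embedded circle tangent to $\ker\lambda$) which is the boundary of a compact smoothly embedded surface $\mathcal D'\subset M$. For an embedded surface $\mathcal D$, a point $p\in\mathcal D$ is called singular if $T_p\mathcal D=\ker\lambda(p)$. If $\sigma$ is an area form on $\mathcal D$ near $p$ and the vector field $Z$ is defined by $i_Z\sigma=\lambda|_{\mathcal D}$, a singular point $p$ is called elliptic if the two eigenvalues of the linearization $Z'(p)$ do not lie on the imaginary axis and have positive product. Assume that $\mathcal D'$ has only finitely many singular points. Then for every neighbourhood $V$ of the diagonal in $M\times M$ there are an embedded surface $\mathcal D$ and a smooth complex structure $J:\ker\lambda\to\ker\lambda$ such that: * $\mathcal D$ is a $V$-small $C^0$-perturbation of $\mathcal D'$: $\mathcal D'=F'(S)$ and $\mathcal D=F(S)$ for smooth embeddings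 $F',F:S\to M$ of one compact surface $S$ with boundary, and $(F'(q),F(q))\in V$ for all $q\in S$; * $\partial\mathcal D=\partial\mathcal D'=\mathcal L$, and $\mathcal D$ has the same singular points and the same elliptic singular points as $\mathcal D'$; * $J$ is $d\lambda$-compatible, that is, $d\lambda\circ(\mathrm{Id}\times J)$ is a bundle metric on $\ker\lambda$; and such that the following holds. Let $\tilde J$ be the almost complex structure on $\mathbb R\times M$ which equals $J$ on $\ker\lambda$ and maps $\partial/\partial t$ (the generator of the $\mathbb R$-factor) to $X_\lambda$ and $X_\lambda$ to $-\partial/\partial t$. Let $\mathcal D^*$ be $\mathcal D$ without its singular points, let $\mathcal S=\mathbb R\times[0,1]$, and consider the boundary value problem for smooth maps $$\tilde u=(a,u):\mathcal S\to\mathbb R\times M,\quad \partial_s\tilde u+\tilde J(\tilde u)\,\partial_t\tilde u=0,\quad \tilde u(s,0)\in\mathbb R\times\mathcal L,\quad \tilde u(s,1)\in\{0\}\times\mathcal D^*,\quad 0<E(\tilde u)<\infty,$$ where $E(\tilde u)=\sup_\phi\int_{\mathcal S}\tilde u^*d(\phi\lambda)$, the supremum being over all $\phi\in C^\infty(\mathbb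 R,[0,1])$ with $\phi'\ge0$. For every elliptic singular point $e\in\mathcal L$ of $\mathcal D$ and every neighbourhood $N$ of $(0,e)$ in $\mathbb R\times M$ there are embedded solutions $\tilde u_\tau$, $0<\tau<1$, of this problem, with $\tilde u_\tau(\mathcal S)\subset N$, such that * $\tilde u_\tau(\mathcal S)\cap\tilde u_{\tau'}(\mathcal S)=\emptyset$ if $\tau\ne\tau'$; * $\tilde u_\tau\to(0,e)$ as $\tau\to0$, uniformly on $\mathcal S$ with all derivatives (in a chart around $(0,e)$); * $\tilde u_\tau$ depends smoothly on $\tau$, that is, $(\tau,z)\mapsto\tilde u_\tau(z)$ is smooth on $(0,1)\times\mathcal S$. -/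

import Mathlib

open Set Filter MeasureTheory
open scoped Manifold ContDiff Topology ENNReal

noncomputable section

/-- Euclidean space of dimension `n`, the model space of the manifolds below. -/
abbrev Euc (n : ℕ) : Type := EuclideanSpace ℝ (Fin n)

section Forms

variable {M : Type*} [TopologicalSpace M] [ChartedSpace (Euc 3) M]

/-- The coordinate expression of a 1-form `α` in the preferred chart `φ` at `p`: the pullback of `α`
under `φ⁻¹`, a 1-form on an open subset of `ℝ³`. -/
def localForm (α : ∀ p : M, TangentSpace (𝓡 3) p →L[ℝ] ℝ) (p : M) (y : Euc 3) : Euc 3 →L[ℝ] ℝ :=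
  (α ((extChartAt (𝓡 3) p).symm y)).comp
    (mfderiv 𝓘(ℝ, Euc 3) (𝓡 3) (extChartAt (𝓡 3) p).symm y)

/-- The exterior derivative of a 1-form on a 3-manifold, as a bilinear form on each tangent space,
`dα (v, w) = ∂_v (α w) - ∂_w (α v)` for coordinate-constant `v`, `w`, so that
`d (x dθ) = dx ∧ dθ`.  It is computed at `p` in the preferred chart at `p`, through which Mathlib
identifies `T_p M` with `ℝ³`. -/
def extD (α : ∀ p : M, TangentSpace (𝓡 3) p →L[ℝ] ℝ) (p : M) :
    TangentSpace (𝓡 3) p →L[ℝ] TangentSpace (𝓡 3) p →L[ℝ] ℝ :=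
  let D : Euc 3 →L[ℝ] Euc 3 →L[ℝ] ℝ := fderiv ℝ (localForm α p) (extChartAt (𝓡 3) p p)
  D - D.flip

end Forms

/-- The value `(α ∧ β) (u, v, w)` of the wedge product of a linear form and a skew bilinear form. -/
def wedge₁₂ (α : Euc 3 →L[ℝ] ℝ) (β : Euc 3 →L[ℝ] Euc 3 →L[ℝ] ℝ) (u v w : Euc 3) : ℝ :=
  α u * β v w + α v * β w u + α w * β u v

/-- A (smooth) contact form on a 3-manifold: a smooth 1-form `λ` such that the 3-form `λ ∧ dλ`
vanishes nowhere. -/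
structure ContactForm (M : Type*) [TopologicalSpace M] [ChartedSpace (Euc 3) M]
    [IsManifold (𝓡 3) ∞ M] where
  /-- The underlying field of linear forms. -/
  form : ∀ p : M, TangentSpace (𝓡 3) p →L[ℝ] ℝ
  /-- Smoothness, as a section of the cotangent bundle. -/
  smooth : ContMDiff (𝓡 3) ((𝓡 3).prod 𝓘(ℝ, Euc 3 →L[ℝ] ℝ)) ∞
    (fun p => Bundle.TotalSpace.mk' (Euc 3 →L[ℝ] ℝ)
      (E := fun p : M => TangentSpace (𝓡 3) p →L[ℝ] ℝ) p (form p))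
  /-- The contact condition. -/
  contact : ∀ p : M, ∃ u v w : Euc 3, wedge₁₂ (form p) (extD form p) u v w ≠ 0

/-- If `(α ∧ β) (u, v, w) ≠ 0` and a combination of `u, v, w` inserted in `α ∧ β` gives zero, then the
coefficients vanish. -/
theorem coeff_eq_zero_of_wedge (α : Euc 3 →L[ℝ] ℝ) (β : Euc 3 →L[ℝ] Euc 3 →L[ℝ] ℝ)
    (hβ : ∀ v w, β v w = -β w v) {u v w : Euc 3} (h : wedge₁₂ α β u v w ≠ 0) {a b c : ℝ}
    (h0 : ∀ x y, wedge₁₂ α β (a • u + b • v + c • w) x y = 0) : a = 0 ∧ b = 0 ∧ c = 0 := by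
  have self : ∀ v, β v v = 0 := fun v => by linarith [hβ v v]
  have e0 := h0 v w
  have e1 := h0 w u
  have e2 := h0 u v
  simp only [wedge₁₂, map_add, map_smul, add_apply, smul_apply, smul_eq_mul, self] at e0 e1 e2
  rw [hβ w v] at e0
  rw [hβ u w] at e1
  rw [hβ v u] at e2
  refine ⟨(mul_eq_zero.1 ?_).resolve_right h, (mul_eq_zero.1 ?_).resolve_right h,
    (mul_eq_zero.1 ?_).resolve_right h⟩ <;> (simp only [wedge₁₂]; linarith)

/-- Linear algebra behind the Reeb vector field: if `α ∧ β ≠ 0` then exactly one vector `X`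
satisfies `α X = 1` and `β (X, ·) = 0`. -/
theorem existsUnique_reeb (α : Euc 3 →L[ℝ] ℝ) (β : Euc 3 →L[ℝ] Euc 3 →L[ℝ] ℝ)
    (hβ : ∀ v w, β v w = -β w v) (h : ∃ u v w : Euc 3, wedge₁₂ α β u v w ≠ 0) :
    ∃! X : Euc 3, α X = 1 ∧ ∀ w, β X w = 0 := by
  obtain ⟨u, v, w, h⟩ := h
  have self : ∀ v, β v v = 0 := fun v => by linarith [hβ v v]
  have hli : LinearIndependent ℝ ![u, v, w] := by
    refine Fintype.linearIndependent_iff.2 fun c hc => ?_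
    have hc' : c 0 • u + c 1 • v + c 2 • w = 0 := by
      simpa [Fin.sum_univ_three] using hc
    have := coeff_eq_zero_of_wedge α β hβ h (a := c 0) (b := c 1) (c := c 2)
      (fun x y => by rw [hc']; simp [wedge₁₂])
    intro i
    fin_cases i
    exacts [this.1, this.2.1, this.2.2]
  have hspan : ∀ x : Euc 3, ∃ a b c : ℝ, x = a • u + b • v + c • w := by
    intro x
    have hx : x ∈ Submodule.span ℝ (Set.range ![u, v, w]) := by
      rw [hli.span_eq_top_of_card_eq_finrank (by simp)]; trivial
    obtain ⟨c, hc⟩ := (Submodule.mem_span_range_iff_exists_fun ℝ).1 hx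
    exact ⟨c 0, c 1, c 2, by rw [← hc]; simp [Fin.sum_univ_three]⟩
  have hX0 : ∀ x, β (β v w • u + β w u • v + β u v • w) x = 0 := by
    intro x
    obtain ⟨a, b, c, rfl⟩ := hspan x
    simp only [map_add, map_smul, add_apply, smul_apply, smul_eq_mul, self]
    rw [hβ v u, hβ w v, hβ u w]
    ring
  have hα : α (β v w • u + β w u • v + β u v • w) = wedge₁₂ α β u v w := by
    simp only [wedge₁₂, map_add, map_smul, smul_eq_mul]; ring
  have hX : ∃ X : Euc 3, α X = 1 ∧ ∀ w, β X w = 0 := by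
    refine ⟨(wedge₁₂ α β u v w)⁻¹ • (β v w • u + β w u • v + β u v • w), ?_, fun x => ?_⟩
    · rw [map_smul, hα, smul_eq_mul, inv_mul_cancel₀ h]
    · rw [map_smul, smul_apply, hX0, smul_zero]
  obtain ⟨X, hX1, hXβ⟩ := hX
  refine ⟨X, ⟨hX1, hXβ⟩, fun Y ⟨hY1, hYβ⟩ => ?_⟩
  obtain ⟨a, b, c, hZ⟩ := hspan (Y - X)
  have hZβ : ∀ x, β (Y - X) x = 0 := fun x => by rw [map_sub, sub_apply, hYβ, hXβ, sub_self]
  obtain ⟨rfl, rfl, rfl⟩ := coeff_eq_zero_of_wedge α β hβ h (a := a) (b := b) (c := c)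
    (fun x y => by
      have hZα : α (Y - X) = 0 := by rw [map_sub, hY1, hX1, sub_self]
      rw [← hZ, wedge₁₂, hZα, hβ y (Y - X), hZβ, hZβ]
      ring)
  rw [← sub_eq_zero, hZ]
  simp

section Contact

variable {M : Type*} [TopologicalSpace M] [ChartedSpace (Euc 3) M] [IsManifold (𝓡 3) ∞ M]

/-- The 2-form `dλ`. -/
def ContactForm.d (lam : ContactForm M) (p : M) :
    TangentSpace (𝓡 3) p →L[ℝ] TangentSpace (𝓡 3) p →L[ℝ] ℝ :=
  extD lam.form p

/-- The defining equations of the Reeb vector field have exactly one solution at each point. -/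
theorem ContactForm.existsUnique_reeb (lam : ContactForm M) (p : M) :
    ∃! X : TangentSpace (𝓡 3) p, lam.form p X = 1 ∧ ∀ w, lam.d p X w = 0 := by
  refine _root_.existsUnique_reeb (lam.form p) (lam.d p) ?_ (lam.contact p)
  intro v w
  simp only [ContactForm.d, extD]
  exact (neg_sub _ _).symm

/-- The Reeb vector field `X` of `λ`: `λ X = 1` and `dλ (X, ·) = 0`. -/
def ContactForm.reeb (lam : ContactForm M) (p : M) : TangentSpace (𝓡 3) p :=
  (lam.existsUnique_reeb p).choose

/-- A smooth `dλ`-compatible complex structure on the contact structure `ξ = ker λ`.  The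
endomorphism `J p` of `ξ_p` is recorded as an endomorphism of `T_p M`, extended by zero on the Reeb
direction (that is, as `J ∘ π` where `π : TM → ξ` is the projection along the Reeb field). -/
structure CompatibleJ (lam : ContactForm M) where
  /-- The underlying endomorphism field. -/
  J : ∀ p : M, TangentSpace (𝓡 3) p →L[ℝ] TangentSpace (𝓡 3) p
  /-- Smoothness, as a section of the endomorphism bundle of `TM`. -/
  smooth : ContMDiff (𝓡 3) ((𝓡 3).prod 𝓘(ℝ, Euc 3 →L[ℝ] Euc 3)) ∞
    (fun p => Bundle.TotalSpace.mk' (Euc 3 →L[ℝ] Euc 3)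
      (E := fun p : M => TangentSpace (𝓡 3) p →L[ℝ] TangentSpace (𝓡 3) p) p (J p))
  /-- `J` is extended by zero on the Reeb direction. -/
  map_reeb : ∀ p, J p (lam.reeb p) = 0
  /-- `J` maps `ξ` to `ξ`. -/
  map_ker : ∀ p v, lam.form p v = 0 → lam.form p (J p v) = 0
  /-- `J² = -1` on `ξ`. -/
  sq : ∀ p v, lam.form p v = 0 → J p (J p v) = -v
  /-- `dλ ∘ (Id × J)` is symmetric on `ξ`. -/
  symm : ∀ p v w, lam.form p v = 0 → lam.form p w = 0 → lam.d p v (J p w) = lam.d p w (J p v)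
  /-- `dλ ∘ (Id × J)` is positive definite on `ξ`. -/
  pos : ∀ p v, lam.form p v = 0 → v ≠ 0 → 0 < lam.d p v (J p v)

/-- The almost complex structure `J̃` on `ℝ × M`: it equals `J` on `ξ`, it sends `∂/∂t` (the
generator of the `ℝ`-factor) to the Reeb field `X`, and `X` to `-∂/∂t`.  Thus
`J̃ (c, v) = (-λ v, c X + J (π v))`.  It does not depend on the `ℝ`-component of the base point. -/
def CompatibleJ.tilde {lam : ContactForm M} (J : CompatibleJ lam) (p : M)
    (ζ : ℝ × TangentSpace (𝓡 3) p) : ℝ × TangentSpace (𝓡 3) p :=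
  (-lam.form p ζ.2, ζ.1 • lam.reeb p + J.J p ζ.2)

/-- `γ` parametrizes a Legendrian knot: a smooth embedding of the circle, tangent to `ker λ`. -/
structure IsLegendrianKnot (lam : ContactForm M) (γ : Circle → M) : Prop where
  embedding : Manifold.IsSmoothEmbedding (𝓡 1) (𝓡 3) ∞ γ
  legendrian : ∀ (z : Circle) (v : TangentSpace (𝓡 1) z),
    lam.form (γ z) (mfderiv (𝓡 1) (𝓡 3) γ z v) = 0

section Surface

variable {S : Type*} [TopologicalSpace S] [ChartedSpace (EuclideanHalfSpace 2) S]

/-- The point `F q` of the surface `F : S → M` is singular: its tangent plane is `ker λ`. -/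
def IsSingularAt (lam : ContactForm M) (F : S → M) (q : S) : Prop :=
  Set.range (mfderiv (𝓡∂ 2) (𝓡 3) F q) = {v | lam.form (F q) v = 0}

/-- The set of singular points (in `M`) of the surface `F : S → M`. -/
def singularPoints (lam : ContactForm M) (F : S → M) : Set M := F '' {q | IsSingularAt lam F q}

/-- The vector field `Z` which directs the characteristic foliation of the surface `F : S → M`, in
the preferred chart of `S` at `q`.  It is defined by `i_Z σ = F^* λ` for the local area form
`σ = dx₀ ∧ dx₁`: if `F^* λ = α₀ dx₀ + α₁ dx₁` then `Z = (α₁, -α₀)`. -/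
def charField (lam : ContactForm M) (F : S → M) (q : S) (y : Euc 2) : Euc 2 :=
  let α : Euc 2 → ℝ := fun w =>
    lam.form (F ((extChartAt (𝓡∂ 2) q).symm y))
      (mfderivWithin 𝓘(ℝ, Euc 2) (𝓡 3) (F ∘ (extChartAt (𝓡∂ 2) q).symm) (range (𝓡∂ 2)) y w)
  !₂[α (EuclideanSpace.single 1 1), -α (EuclideanSpace.single 0 1)]

/-- The linearization `Z'(q)` of `Z` at (a zero) `q`, in the preferred chart at `q`.  At a boundary
point the derivative is taken within the half plane. -/
def charLinearization (lam : ContactForm M) (F : S → M) (q : S) : Euc 2 →L[ℝ] Euc 2 :=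
  fderivWithin ℝ (charField lam F q) (range (𝓡∂ 2)) (extChartAt (𝓡∂ 2) q q)

/-- `q` is an elliptic singular point of the surface `F : S → M`: it is singular, the eigenvalues
`μ₁, μ₂` of the linearization of `Z` do not lie on the imaginary axis (nondegeneracy), and
`μ₁ μ₂ > 0`.  (The product is the determinant of a real matrix, hence real.)  Another area form, or
another chart, changes the linearization by a conjugation and a nonzero real factor, which does not
affect this condition. -/
def IsEllipticAt (lam : ContactForm M) (F : S → M) (q : S) : Prop :=
  IsSingularAt lam F q ∧
  ∃ μ₁ μ₂ : ℂ,
    ((charLinearization lam F q).toLinearMap.charpoly.map (algebraMap ℝ ℂ)).roots = {μ₁, μ₂} ∧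
    μ₁.re ≠ 0 ∧ μ₂.re ≠ 0 ∧ 0 < (μ₁ * μ₂).re

/-- The set of elliptic singular points (in `M`) of the surface `F : S → M`. -/
def ellipticPoints (lam : ContactForm M) (F : S → M) : Set M := F '' {q | IsEllipticAt lam F q}

end Surface

/-- The strip `ℝ × [0, 1]`, with coordinates `z = (s, t)`. -/
def strip : Set (ℝ × ℝ) := {z | 0 ≤ z.2 ∧ z.2 ≤ 1}

/-- The derivative of `ũ = (a, u) : ℝ × [0, 1] → ℝ × M` at `z` in the direction `w`, as an element of
`ℝ × T_{u(z)} M`; `w = (1, 0)` gives `∂_s ũ` and `w = (0, 1)` gives `∂_t ũ`. -/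
def stripDeriv (U : ℝ × ℝ → ℝ × M) (z w : ℝ × ℝ) : ℝ × TangentSpace (𝓡 3) (U z).2 :=
  (fderivWithin ℝ (fun z => (U z).1) strip z w,
    mfderivWithin 𝓘(ℝ, ℝ × ℝ) (𝓡 3) (fun z => (U z).2) strip z w)

/-- The functions `φ ∈ C^∞(ℝ, [0, 1])` with `φ' ≥ 0` that enter the energy. -/
def EnergyCutoff : Type :=
  {φ : ℝ → ℝ // ContDiff ℝ ∞ φ ∧ (∀ x, φ x ∈ Icc (0 : ℝ) 1) ∧ ∀ x, 0 ≤ deriv φ x}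

/-- The 2-form `d(φ λ) = φ' da ∧ λ + φ dλ` on `ℝ × M` at the point `(a, p)`. -/
def dCutoff (lam : ContactForm M) (φ : ℝ → ℝ) (a : ℝ) (p : M)
    (ζ η : ℝ × TangentSpace (𝓡 3) p) : ℝ :=
  deriv φ a * (ζ.1 * lam.form p η.2 - η.1 * lam.form p ζ.2) + φ a * lam.d p ζ.2 η.2

/-- The energy `E(ũ) = sup_φ ∫_{ℝ × [0, 1]} ũ^* d(φ λ)`.  For a pseudoholomorphic strip the integrand
is pointwise nonnegative, so that the integral always makes sense in `[0, ∞]`. -/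
def energy (lam : ContactForm M) (U : ℝ × ℝ → ℝ × M) : ℝ≥0∞ :=
  ⨆ φ : EnergyCutoff, ∫⁻ z in strip,
    ENNReal.ofReal (dCutoff lam φ.1 (U z).1 (U z).2 (stripDeriv U z (1, 0)) (stripDeriv U z (0, 1)))

/-- `ũ` is a (smooth) solution of the boundary value problem on the strip `ℝ × [0, 1]`, for the knot
`L ⊆ M` and the set `Dstar ⊆ M` (the surface without its singular points). -/
structure IsStripSolution {lam : ContactForm M} (J : CompatibleJ lam) (L Dstar : Set M)
    (U : ℝ × ℝ → ℝ × M) : Prop where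
  smooth : ContMDiffOn 𝓘(ℝ, ℝ × ℝ) (𝓘(ℝ, ℝ).prod (𝓡 3)) ∞ U strip
  /-- `∂_s ũ + J̃(ũ) ∂_t ũ = 0`. -/
  holomorphic : ∀ z ∈ strip,
    stripDeriv U z (1, 0) + J.tilde (U z).2 (stripDeriv U z (0, 1)) = 0
  boundary_zero : ∀ s : ℝ, (U (s, 0)).2 ∈ L
  boundary_one : ∀ s : ℝ, (U (s, 1)).1 = 0 ∧ (U (s, 1)).2 ∈ Dstar
  energy_pos : 0 < energy lam U
  energy_lt_top : energy lam U < ⊤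

/-- `ũ` is an embedding of the strip into `ℝ × M`: an immersion which is a homeomorphism onto its
image. -/
structure IsEmbeddedStrip (U : ℝ × ℝ → ℝ × M) : Prop where
  immersion : ∀ z ∈ strip, Function.Injective (stripDeriv U z)
  embedding : Topology.IsEmbedding (strip.domRestrict U)

/-- The maps `ũ_τ` converge to the point `(0, e)`, uniformly on the strip and with all derivatives,
as `τ → 0+`.  Derivatives are taken in the chart of `ℝ × M` given by the preferred chart of `M` at
`e`, whose domain contains the strips for all small `τ`. -/
def ConvergesWithDerivatives (U : ℝ → ℝ × ℝ → ℝ × M) (e : M) : Prop :=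
  (∀ᶠ τ in 𝓝[>] (0 : ℝ), ∀ z ∈ strip, (U τ z).2 ∈ (chartAt (Euc 3) e).source) ∧
  ∀ k : ℕ, TendstoUniformlyOn
    (fun τ => iteratedFDerivWithin ℝ k
      (fun z => (((U τ z).1, extChartAt (𝓡 3) e (U τ z).2) : ℝ × Euc 3)) strip)
    (iteratedFDerivWithin ℝ k
      (fun _ => ((0, extChartAt (𝓡 3) e e) : ℝ × Euc 3)) strip)
    (𝓝[>] 0) strip

end Contact

end

/-! Near an elliptic point `e` on the knot choose coordinates `(v, z) ∈ ℂ × ℝ` in which the surface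
is the half plane `z = 0`, `0 ≤ re v` and the knot is `z = 0`, `re v = 0`. The idea is to bend the
surface near `e` until `λ` restricts to it as `(x dy - y dx) / 2` in suitable coordinates, and to
choose `J` near `e` so that multiplication by `i` in these coordinates gives explicit solutions.

Solutions. Let `Φ` parametrize the bent surface by `ξ ∈ ℂ`, and let `J` map the projection of `Φ_*
η` to `ker λ` (along the Reeb field) to that of `Φ_* (i η)`. If `ξ` is a holomorphic function on the
strip, then `(a, Φ ξ)` with `a = (|ξ|² - c²) / 4` is pseudoholomorphic. Take for `ξ` the conformal
map onto the right half disc of radius `c` given by a hyperbolic tangent: the edge `t = 0` goes to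
the imaginary axis, which is the knot, and the edge `t = 1` to the arc `|ξ| = c`, where `a = 0`.
Different radii give disjoint strips, since `|ξ|² / 4 - a` determines `c`. The energy is finite
because its density is the divergence of a field of size `O(1 / (1 + s²))` (`div_energyFlux`). All
derivatives tend to zero with the radius, because `ξ` solves an autonomous differential equation.
See `RadialAt`, `isStripSolution_radialStrip` and `IsRadialParam.exists_strips`.

Bending. The graph `z = h v` has a radial characteristic foliation if `Dh(v) v = f(v, h v) v`, where
`f` is the slope of the contact planes. This is an ordinary differential equation on each ray;
solving it on all rays at once by the inverse function theorem in `C([0, 1])` gives a smooth `h`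
(`exists_ray_solution`), which vanishes on the imaginary axis because the knot is Legendrian. On the
graph `λ` is `G · (x dy - y dx)` (`exists_eq_mul_crossProd`), and `G 0 ≠ 0` because the eigenvalues
at `e` have nonzero sum. A change of coordinates then turns `G` into `1 / 2`.

Keeping the singular points. The graph is cut off to `μ h`. To first order the restricted form is
proportional to `μ B - a`, where `a` is the derivative of the slope along the plane and `B` its
symmetric part. Ellipticity means `det a > 0` and a nonzero skew part, which keeps `det (μ B - a)`
positive for `0 ≤ μ ≤ 1`. With a logarithmic cutoff the term `h Dμ` is small compared with `|v|`, so
no new singular point arises (`exists_cutoff_ray_solution`).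

Globally the finitely many elliptic points on the knot are treated in disjoint neighbourhoods, and
`J` is glued from local ones: without the condition `J² = -1` the admissible endomorphisms form a
convex set, and a scalar factor restores that condition at the end (`exists_compatibleJ`). -/

noncomputable section

/-! ### Pullbacks of the contact form and naturality of the exterior derivative. -/

section Pullback

variable {M : Type*} [TopologicalSpace M] [ChartedSpace (Euc 3) M] [IsManifold (𝓡 3) ∞ M]
  {E E' : Type*} [NormedAddCommGroup E] [NormedSpace ℝ E] [NormedAddCommGroup E'] [NormedSpace ℝ E']

/-- The pullback `f^* λ` of a contact form under a map from a normed space. -/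
def pullForm (lam : ContactForm M) (f : E → M) (x : E) : E →L[ℝ] ℝ :=
  (lam.form (f x)).comp (mfderiv 𝓘(ℝ, E) (𝓡 3) f x)

theorem localForm_eq_pullForm (lam : ContactForm M) (p : M) :
    localForm lam.form p = pullForm lam (extChartAt (𝓡 3) p).symm := rfl

theorem pullForm_apply (lam : ContactForm M) (f : E → M) (x v : E) :
    pullForm lam f x v = lam.form (f x) (mfderiv 𝓘(ℝ, E) (𝓡 3) f x v) := rfl

/-- In the trivialization of `TM` at `f x` both the form and the derivative of `f` are smooth
families of linear maps between fixed spaces; in their composite the trivialization cancels against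
its inverse. -/
theorem contDiffAt_pullForm (lam : ContactForm M) {f : E → M} {x : E}
    (hf : ContMDiffAt 𝓘(ℝ, E) (𝓡 3) ∞ f x) : ContDiffAt ℝ ∞ (pullForm lam f) x := by
  have h1 : ContMDiffAt 𝓘(ℝ, E) 𝓘(ℝ, E →L[ℝ] Euc 3) ∞
      (inTangentCoordinates 𝓘(ℝ, E) (𝓡 3) id f (mfderiv 𝓘(ℝ, E) (𝓡 3) f) x) x :=
    hf.mfderiv_const (by simp)
  have h2 := ((lam.smooth (f x)).comp x hf)
  rw [contMDiffAt_hom_bundle] at h2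
  have h3 := h2.2.clm_comp h1
  rw [← contMDiffAt_iff_contDiffAt]
  refine h3.congr_of_eventuallyEq ?_
  have hmem : ∀ᶠ y in 𝓝 x, f y ∈ (chartAt (Euc 3) (f x)).source :=
    hf.continuousAt.eventually_mem ((chartAt (Euc 3) (f x)).open_source.mem_nhds (mem_chart_source _ _))
  filter_upwards [hmem] with y hy
  ext v
  have hb : f y ∈ (trivializationAt (Euc 3) (TangentSpace (𝓡 3)) (f x)).baseSet := by simpa using hy
  simp only [Function.comp_apply, ContinuousLinearMap.inCoordinates, inTangentCoordinates]
  simp only [pullForm, Bundle.Trivial.fiberBundle_trivializationAt', TangentBundle.symmL_model_space,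
    Bundle.Trivial.continuousLinearMapAt_trivialization, ContinuousLinearMap.id_comp]
  change lam.form (f y) _ = lam.form (f y) _
  congr 1
  exact ((trivializationAt (Euc 3) (TangentSpace (𝓡 3) (M := M)) (f x)).symmL_continuousLinearMapAt
    (R := ℝ) hb _).symm

theorem pullForm_comp (lam : ContactForm M) {f : E → M} {g : E' → E} {y : E'}
    (hf : MDifferentiableAt 𝓘(ℝ, E) (𝓡 3) f (g y)) (hg : DifferentiableAt ℝ g y) :
    pullForm lam (f ∘ g) y = (pullForm lam f (g y)).comp (fderiv ℝ g y) := by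
  ext v
  simp only [pullForm, ContinuousLinearMap.comp_apply]
  rw [mfderiv_comp y hf hg.mdifferentiableAt, mfderiv_eq_fderiv]
  rfl

theorem pullForm_congr (lam : ContactForm M) {f g : E → M} {x : E} (h : f =ᶠ[𝓝 x] g) :
    pullForm lam f x = pullForm lam g x := by
  ext v
  simp only [pullForm]
  rw [h.mfderiv_eq, h.eq_of_nhds]

/-- The exterior derivative of a 1-form on a normed space, `dβ (v, w) = ∂_v (β w) - ∂_w (β v)`. -/
def skewDeriv (β : E → E →L[ℝ] ℝ) (x v w : E) : ℝ := fderiv ℝ β x v w - fderiv ℝ β x w v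

/-- The product rule produces `Dβ` on pushed-forward vectors and a term `β (D²g (v, w))`; the latter
is symmetric in `v, w` and disappears on skew-symmetrizing. -/
theorem skewDeriv_pullback {β : E → E →L[ℝ] ℝ} {g : E' → E} {y : E'}
    (hβ : DifferentiableAt ℝ β (g y)) (hg : ContDiffAt ℝ ∞ g y) (v w : E') :
    skewDeriv (fun y => (β (g y)).comp (fderiv ℝ g y)) y v w =
      skewDeriv β (g y) (fderiv ℝ g y v) (fderiv ℝ g y w) := by
  have hg1 : HasFDerivAt g (fderiv ℝ g y) y := (hg.differentiableAt (by simp)).hasFDerivAt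
  have hg2 : HasFDerivAt (fderiv ℝ g) (fderiv ℝ (fderiv ℝ g) y) y :=
    ((hg.fderiv_right (m := ∞) (by simp)).differentiableAt (by simp)).hasFDerivAt
  have hb : HasFDerivAt (fun y => β (g y)) ((fderiv ℝ β (g y)).comp (fderiv ℝ g y)) y :=
    hβ.hasFDerivAt.comp y hg1
  have hsymm : fderiv ℝ (fderiv ℝ g) y v w = fderiv ℝ (fderiv ℝ g) y w v :=
    (hg.isSymmSndFDerivAt (by simpa using ENat.LEInfty.out)).eq v w
  have := (hb.clm_comp hg2).fderiv
  simp only [skewDeriv]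
  rw [this]
  simp [hsymm]

theorem lam_d_apply (lam : ContactForm M) (p : M) (v w : TangentSpace (𝓡 3) p) :
    lam.d p v w = skewDeriv (localForm lam.form p) (extChartAt (𝓡 3) p p) v w := rfl

theorem contMDiffAt_extChartAt_symm' (p : M) {y : Euc 3} (hy : y ∈ (extChartAt (𝓡 3) p).target) :
    ContMDiffAt 𝓘(ℝ, Euc 3) (𝓡 3) ∞ (extChartAt (𝓡 3) p).symm y :=
  (contMDiffOn_extChartAt_symm p).contMDiffAt ((isOpen_extChartAt_target p).mem_nhds hy)

theorem mfderiv_extChartAt_symm_self (p : M) :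
    mfderiv 𝓘(ℝ, Euc 3) (𝓡 3) (extChartAt (𝓡 3) p).symm (extChartAt (𝓡 3) p p) =
      ContinuousLinearMap.id ℝ (Euc 3) := by
  have := mfderivWithin_range_extChartAt_symm (I := 𝓡 3) (x := p)
  rw [ModelWithCorners.range_eq_univ, mfderivWithin_univ] at this
  exact this

/-- Naturality of the exterior derivative: `dλ (f_* v, f_* w) = d (f^* λ) (v, w)`. -/
theorem lam_d_mfderiv (lam : ContactForm M) {f : E → M} {x : E}
    (hf : ContMDiffAt 𝓘(ℝ, E) (𝓡 3) ∞ f x) (v w : E) :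
    lam.d (f x) (mfderiv 𝓘(ℝ, E) (𝓡 3) f x v) (mfderiv 𝓘(ℝ, E) (𝓡 3) f x w) =
      skewDeriv (pullForm lam f) x v w := by
  set p := f x with hp
  set g : E → Euc 3 := fun y => extChartAt (𝓡 3) p (f y) with hg
  have hgs : ContDiffAt ℝ ∞ g x := by
    rw [← contMDiffAt_iff_contDiffAt]
    exact (contMDiffAt_extChartAt (x := p)).comp x hf
  have hmem : ∀ᶠ y in 𝓝 x, f y ∈ (extChartAt (𝓡 3) p).source :=
    hf.continuousAt.eventually_mem (extChartAt_source_mem_nhds p)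
  have hfg : ∀ᶠ y in 𝓝 x, f y = ((extChartAt (𝓡 3) p).symm ∘ g) y := by
    filter_upwards [hmem] with y hy
    exact ((extChartAt (𝓡 3) p).left_inv hy).symm
  have hgd : ∀ᶠ y in 𝓝 x, DifferentiableAt ℝ g y := by
    filter_upwards [(hgs.of_le (m := 1) (by exact_mod_cast le_top)).eventually (by simp)] with y hy
    exact hy.differentiableAt (by simp)
  have hgx : g x = extChartAt (𝓡 3) p p := rfl
  have htar : ∀ᶠ y in 𝓝 x, g y ∈ (extChartAt (𝓡 3) p).target := by
    filter_upwards [hmem] with y hy using (extChartAt (𝓡 3) p).map_source hy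
  -- Near `x` the map `f` factors through the chart at `p`, so `f^* λ` is the pullback under `g` of
  -- the chart expression by which `dλ` is defined at `p`.
  have hpull : pullForm lam f =ᶠ[𝓝 x]
      fun y => (localForm lam.form p (g y)).comp (fderiv ℝ g y) := by
    filter_upwards [hfg.eventually_nhds, hgd, htar] with y hy hyd hyt
    rw [pullForm_congr lam hy, localForm_eq_pullForm, pullForm_comp lam _ hyd]
    exact (contMDiffAt_extChartAt_symm' p hyt).mdifferentiableAt (by simp)
  -- Tangent vectors at `p` are identified with `ℝ³` by this very chart, so its derivative at `p` is
  -- the identity.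
  have hder : mfderiv 𝓘(ℝ, E) (𝓡 3) f x = fderiv ℝ g x := by
    have h1 : mfderiv 𝓘(ℝ, E) (𝓡 3) f x =
        mfderiv 𝓘(ℝ, E) (𝓡 3) ((extChartAt (𝓡 3) p).symm ∘ g) x := Filter.EventuallyEq.mfderiv_eq hfg
    rw [h1, mfderiv_comp x
      ((contMDiffAt_extChartAt_symm' p htar.self_of_nhds).mdifferentiableAt (by simp))
      hgd.self_of_nhds.mdifferentiableAt, hgx, mfderiv_extChartAt_symm_self, mfderiv_eq_fderiv]
    exact ContinuousLinearMap.id_comp _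
  have hloc : DifferentiableAt ℝ (localForm lam.form p) (g x) := by
    rw [localForm_eq_pullForm]
    exact (contDiffAt_pullForm lam
      (contMDiffAt_extChartAt_symm' p htar.self_of_nhds)).differentiableAt (by simp)
  have h2 : skewDeriv (pullForm lam f) x v w =
      skewDeriv (fun y => (localForm lam.form p (g y)).comp (fderiv ℝ g y)) x v w := by
    simp only [skewDeriv]
    rw [hpull.fderiv_eq]
  rw [h2, skewDeriv_pullback hloc hgs, hder, lam_d_apply, hgx]
  rfl

end Pullback

/-! ### Germs of smooth functions. -/

section SmoothNear

variable {E F G : Type*} [NormedAddCommGroup E] [NormedSpace ℝ E] [NormedAddCommGroup F]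
  [NormedSpace ℝ F] [NormedAddCommGroup G] [NormedSpace ℝ G]

/-- `f` is smooth in a neighbourhood of `x`. -/
def SmoothNear (f : E → F) (x : E) : Prop := ∀ᶠ y in 𝓝 x, ContDiffAt ℝ ∞ f y

theorem SmoothNear.at {f : E → F} {x : E} (h : SmoothNear f x) : ContDiffAt ℝ ∞ f x := h.self_of_nhds

theorem SmoothNear.differentiableAt {f : E → F} {x : E} (h : SmoothNear f x) :
    DifferentiableAt ℝ f x := h.at.differentiableAt (by simp)

theorem SmoothNear.hasFDerivAt {f : E → F} {x : E} (h : SmoothNear f x) :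
    HasFDerivAt f (fderiv ℝ f x) x := h.differentiableAt.hasFDerivAt

theorem SmoothNear.continuousAt {f : E → F} {x : E} (h : SmoothNear f x) : ContinuousAt f x :=
  h.at.continuousAt

/-- The reason for a separate notion: `ContDiffAt ℝ ∞` at one point gives for each finite order a
neighbourhood that may shrink with the order, whereas germs are used below on one common
neighbourhood. -/
theorem SmoothNear.comp {g : F → G} {f : E → F} {x : E} (hg : SmoothNear g (f x))
    (hf : SmoothNear f x) : SmoothNear (fun y => g (f y)) x := by
  filter_upwards [hf, hf.continuousAt.eventually hg] with y h1 h2 using h2.comp y h1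

theorem SmoothNear.fderiv {f : E → F} {x : E} (hf : SmoothNear f x) :
    SmoothNear (fderiv ℝ f) x := by
  filter_upwards [hf] with y h using h.fderiv_right (by simp)

theorem SmoothNear.congr {f g : E → F} {x : E} (hf : SmoothNear f x) (h : g =ᶠ[𝓝 x] f) :
    SmoothNear g x := by
  filter_upwards [hf, h.eventually_nhds] with y h1 h2 using h1.congr_of_eventuallyEq h2

theorem ContDiff.smoothNear {f : E → F} (hf : ContDiff ℝ ∞ f) (x : E) : SmoothNear f x :=
  Eventually.of_forall fun _ => hf.contDiffAt

/-- Smooth inverse function theorem, with smoothness on neighbourhoods. -/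
theorem SmoothNear.exists_localInverse [CompleteSpace E] {f : E → F} {x : E}
    (hf : SmoothNear f x) (e : E ≃L[ℝ] F) (he : HasFDerivAt f (e : E →L[ℝ] F) x) :
    ∃ g : F → E, g (f x) = x ∧ SmoothNear g (f x) ∧ (∀ᶠ z in 𝓝 (f x), f (g z) = z) ∧
      ∀ᶠ y in 𝓝 x, g (f y) = y := by
  let Φ := hf.at.toOpenPartialHomeomorph f he (by simp)
  have hΦ : (Φ : E → F) = f := rfl
  have hx : x ∈ Φ.source := hf.at.mem_toOpenPartialHomeomorph_source he (by simp)
  have hfx : f x ∈ Φ.target := Φ.map_source hx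
  have hg : Φ.symm (f x) = x := Φ.left_inv hx
  have hc : ContinuousAt Φ.symm (f x) := Φ.continuousAt_symm hfx
  refine ⟨Φ.symm, hg, ?_, ?_, ?_⟩
  -- Invertible linear maps form an open set, so the inverse function theorem applies at every point
  -- near `x`, and the inverse is smooth near `f x` and not only at it.
  · have hinv : ∀ᶠ y in 𝓝 x, _root_.fderiv ℝ f y ∈
        Set.range ((↑) : (E ≃L[ℝ] F) → (E →L[ℝ] F)) := by
      have := (hf.fderiv.continuousAt).eventually_mem (by rw [he.fderiv]; exact e.nhds)
      exact this
    have h1 : ∀ᶠ z in 𝓝 (f x), ContDiffAt ℝ ∞ f (Φ.symm z) ∧ _root_.fderiv ℝ f (Φ.symm z) ∈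
        Set.range ((↑) : (E ≃L[ℝ] F) → (E →L[ℝ] F)) := by
      have h2 := hf.and hinv
      rw [← hg] at h2
      exact hc.eventually h2
    filter_upwards [h1, Φ.open_target.mem_nhds hfx] with z ⟨hz1, e', he'⟩ hz
    refine Φ.contDiffAt_symm (f₀' := e') hz ?_ hz1
    change HasFDerivAt f _ _
    rw [show (e' : E →L[ℝ] F) = _root_.fderiv ℝ f (Φ.symm z) from he']
    exact (hz1.differentiableAt (by simp)).hasFDerivAt
  · filter_upwards [Φ.open_target.mem_nhds hfx] with z hz using Φ.right_inv hz
  · filter_upwards [Φ.open_source.mem_nhds hx] with z hz using Φ.left_inv hz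

/-- A germ of a smooth function extends to a globally smooth function. -/
theorem SmoothNear.exists_contDiff [FiniteDimensional ℝ E] {f : E → F} {x : E}
    (hf : SmoothNear f x) : ∃ g : E → F, ContDiff ℝ ∞ g ∧ g =ᶠ[𝓝 x] f := by
  obtain ⟨r, hr, hball⟩ := Metric.eventually_nhds_iff_ball.1 hf
  let χ : ContDiffBump x := ⟨r / 4, r / 2, by positivity, by linarith⟩
  refine ⟨fun y => χ y • f y, ?_, ?_⟩
  · refine contDiff_iff_contDiffAt.2 fun y => ?_
    by_cases hy : y ∈ Metric.ball x r
    · exact χ.contDiff.contDiffAt.smul (hball y hy)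
    · have : (fun y => χ y • f y) =ᶠ[𝓝 y] fun _ => 0 := by
        have hy' : y ∈ (Metric.closedBall x (r / 2))ᶜ := by
          simp only [Metric.mem_ball, not_lt] at hy
          simp only [mem_compl_iff, Metric.mem_closedBall, not_le]
          linarith
        filter_upwards [Metric.isClosed_closedBall.isOpen_compl.mem_nhds hy'] with z hz
        have : χ z = 0 := χ.zero_of_le_dist (by
          simp only [mem_compl_iff, Metric.mem_closedBall, not_le] at hz
          exact hz.le)
        simp [this]
      exact contDiffAt_const.congr_of_eventuallyEq this
  · filter_upwards [χ.eventuallyEq_one] with y hy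
    simp [hy]

end SmoothNear

/-! ### Smoothness of superposition operators on `C(K, E)`. -/

section Nemytskii

universe u

variable {K : Type*} [TopologicalSpace K] [CompactSpace K] {E F : Type u} [NormedAddCommGroup E]
  [NormedSpace ℝ E] [NormedAddCommGroup F] [NormedSpace ℝ F]

/-- Pointwise application of a continuous family of linear maps, as a continuous bilinear map. -/
def applyBilin (K : Type*) [TopologicalSpace K] [CompactSpace K] (E F : Type*)
    [NormedAddCommGroup E] [NormedSpace ℝ E] [NormedAddCommGroup F] [NormedSpace ℝ F] :
    C(K, E →L[ℝ] F) →L[ℝ] C(K, E) →L[ℝ] C(K, F) :=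
  LinearMap.mkContinuous₂
    (LinearMap.mk₂ ℝ (fun (A : C(K, E →L[ℝ] F)) (η : C(K, E)) => (⟨fun k => A k (η k), by fun_prop⟩ : C(K, F)))
      (fun _ _ _ => by ext; simp) (fun _ _ _ => by ext; simp) (fun _ _ _ => by ext; simp)
      (fun _ _ _ => by ext; simp)) 1 fun A η => by
    rw [ContinuousMap.norm_le _ (by positivity)]
    intro k
    calc ‖A k (η k)‖ ≤ ‖A k‖ * ‖η k‖ := (A k).le_opNorm _
      _ ≤ ‖A‖ * ‖η‖ := by 
        exact mul_le_mul (ContinuousMap.norm_coe_le_norm _ _) (ContinuousMap.norm_coe_le_norm _ _)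
          (norm_nonneg _) (norm_nonneg A)
      _ = 1 * ‖A‖ * ‖η‖ := by ring

@[simp] theorem applyBilin_apply (A : C(K, E →L[ℝ] F)) (η : C(K, E)) (k : K) :
    applyBilin K E F A η k = A k (η k) := rfl

theorem contDiff_applyBilin : ContDiff ℝ ∞ fun A : C(K, E →L[ℝ] F) => applyBilin K E F A :=
  ContinuousLinearMap.contDiff (𝕜 := ℝ) (E := C(K, E →L[ℝ] F)) (F := C(K, E) →L[ℝ] C(K, F))
    (applyBilin K E F)

/-- The Nemytskii (superposition) operator `γ ↦ G ∘ γ`. -/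
def nemytskii (K : Type*) [TopologicalSpace K] (G : E → F) (hG : Continuous G) (γ : C(K, E)) :
    C(K, F) := (⟨G, hG⟩ : C(E, F)).comp γ

/-- For fixed `k` this is the mean value inequality on the segment from `γ k` to `γ k + η k`. It is
uniform in `k` because `γ ↦ fderiv ℝ G ∘ γ` is continuous for the sup norm. -/
theorem hasFDerivAt_nemytskii {G : E → F} (hG : ContDiff ℝ ∞ G) (γ : C(K, E)) :
    HasFDerivAt (nemytskii K G hG.continuous)
      (applyBilin K E F (nemytskii K (fderiv ℝ G) (hG.continuous_fderiv (by simp)) γ)) γ := by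
  rw [hasFDerivAt_iff_isLittleO_nhds_zero, Asymptotics.isLittleO_iff]
  intro c hc
  have hcont : Continuous (nemytskii K (fderiv ℝ G) (hG.continuous_fderiv (by simp))) :=
    ContinuousMap.continuous_postcomp _
  obtain ⟨δ, hδ, hball⟩ := Metric.continuousAt_iff.1 (hcont.continuousAt (x := γ)) c hc
  filter_upwards [Metric.ball_mem_nhds (0 : C(K, E)) hδ] with η hη
  rw [ContinuousMap.norm_le _ (by positivity)]
  intro k
  have hseg := (convex_segment (γ k) (γ k + η k)).norm_image_sub_le_of_norm_hasFDerivWithin_le'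
    (f := G) (f' := fderiv ℝ G) (φ := fderiv ℝ G (γ k)) (C := c)
    (fun x _ => (hG.differentiable (by simp) x).hasFDerivAt.hasFDerivWithinAt) ?_
    (left_mem_segment ℝ _ _) (right_mem_segment ℝ _ _)
  · have h1 : ‖η k‖ ≤ ‖η‖ := ContinuousMap.norm_coe_le_norm _ _
    simp only [add_sub_cancel_left] at hseg
    calc _ = ‖G (γ k + η k) - G (γ k) - fderiv ℝ G (γ k) (η k)‖ := rfl
      _ ≤ c * ‖η k‖ := hseg
      _ ≤ c * ‖η‖ := by gcongr
  · intro x hx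
    rw [segment_eq_image'] at hx
    obtain ⟨t, ht, rfl⟩ := hx
    -- A point of the segment is the value at `k` of the curve `γ + t • η`, so sup norm continuity
    -- controls the derivative there.
    have h2 : dist (γ + t • η) γ < δ := by
      rw [dist_eq_norm, add_sub_cancel_left, norm_smul, Real.norm_of_nonneg ht.1]
      have : ‖η‖ < δ := by simpa using hη
      nlinarith [norm_nonneg η, ht.2]
    have h3 := (hball h2).le
    rw [dist_eq_norm, ContinuousMap.norm_le _ hc.le] at h3
    simpa [nemytskii] using h3 k

theorem contDiff_nemytskii {G : E → F} (hG : ContDiff ℝ ∞ G) :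
    ContDiff ℝ ∞ (nemytskii K G hG.continuous) := by
  rw [contDiff_infty]
  intro n
  -- The derivative is again a superposition operator, now of `fderiv ℝ G` with values in `E →L[ℝ]
  -- F`. Hence `F` has to vary, and `E` and `F` share a universe.
  induction n generalizing F with
  | zero =>
    simp only [CharP.cast_eq_zero, contDiff_zero]
    exact ContinuousMap.continuous_postcomp _
  | succ n ih =>
    push_cast
    rw [contDiff_succ_iff_fderiv]
    refine ⟨fun γ => (hasFDerivAt_nemytskii hG γ).differentiableAt, by simp, ?_⟩
    have : fderiv ℝ (nemytskii K G hG.continuous) = fun γ => applyBilin K E F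
        (nemytskii K (fderiv ℝ G) (hG.continuous_fderiv (by simp)) γ) :=
      funext fun γ => (hasFDerivAt_nemytskii hG γ).fderiv
    rw [this]
    exact (applyBilin K E F).contDiff.comp (ih (hG.fderiv_right (m := ∞) (by simp)))

end Nemytskii

/-! ### Integration from zero as a bounded operator. -/

section Volterra

/-- The Volterra operator `g ↦ (r ↦ ∫₀ʳ g)` on `C([0, 1])`. -/
def volterra : C(Icc (0 : ℝ) 1, ℝ) →L[ℝ] C(Icc (0 : ℝ) 1, ℝ) :=
  LinearMap.mkContinuous
    { toFun := fun g => ⟨fun r => ∫ s in (0 : ℝ)..r, IccExtend zero_le_one g s, by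
        have h : Continuous (IccExtend zero_le_one g) := g.continuous.Icc_extend'
        exact (intervalIntegral.continuous_primitive (fun a b => h.intervalIntegrable a b) 0).comp
          continuous_subtype_val⟩
      map_add' := fun g₁ g₂ => by
        ext r
        have h₁ : Continuous (IccExtend zero_le_one g₁) := g₁.continuous.Icc_extend'
        have h₂ : Continuous (IccExtend zero_le_one g₂) := g₂.continuous.Icc_extend'
        exact intervalIntegral.integral_add (h₁.intervalIntegrable _ _) (h₂.intervalIntegrable _ _)
      map_smul' := fun c g => by
        ext r
        exact intervalIntegral.integral_const_mul c _ } 1 fun g => by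
    rw [ContinuousMap.norm_le _ (by positivity)]
    intro r
    have h := intervalIntegral.norm_integral_le_of_norm_le_const (a := 0) (b := (r : ℝ)) (C := ‖g‖)
      (f := IccExtend zero_le_one g) (fun s _ => ContinuousMap.norm_coe_le_norm g _)
    refine h.trans ?_
    have h0 := r.2.1
    have h1 := r.2.2
    rw [sub_zero, abs_of_nonneg h0]
    nlinarith [norm_nonneg g]

theorem volterra_apply (g : C(Icc (0 : ℝ) 1, ℝ)) (r : Icc (0 : ℝ) 1) :
    volterra g r = ∫ s in (0 : ℝ)..r, IccExtend zero_le_one g s := rfl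

end Volterra

/-! ### Solving a differential equation along all rays at once. -/

section Rays

variable {E : Type} [NormedAddCommGroup E] [NormedSpace ℝ E] [FiniteDimensional ℝ E]

/-- The constant functions, as a linear map into `C([0, 1], E)`. -/
def constCLM (E : Type) [NormedAddCommGroup E] [NormedSpace ℝ E] [FiniteDimensional ℝ E] :
    E →L[ℝ] C(Icc (0 : ℝ) 1, E) :=
  LinearMap.toContinuousLinearMap
    { toFun := fun v => ContinuousMap.const _ v
      map_add' := fun _ _ => rfl
      map_smul' := fun _ _ => rfl }

/-- The rays `r ↦ r v`, as a linear map into `C([0, 1], E)`. -/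
def rayCLM (E : Type) [NormedAddCommGroup E] [NormedSpace ℝ E] [FiniteDimensional ℝ E] :
    E →L[ℝ] C(Icc (0 : ℝ) 1, E) :=
  LinearMap.toContinuousLinearMap
    { toFun := fun v => ⟨fun r => (r : ℝ) • v, by fun_prop⟩
      map_add' := fun _ _ => by ext; simp
      map_smul' := fun c v => by ext r; exact smul_comm (r : ℝ) c v }

@[simp] theorem rayCLM_apply (v : E) (r : Icc (0 : ℝ) 1) : rayCLM E v r = (r : ℝ) • v := rfl

@[simp] theorem constCLM_apply (v : E) (r : Icc (0 : ℝ) 1) : constCLM E v r = v := rfl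

/-- The map `(v, γ) ↦ (r ↦ (r v, γ r))`. -/
def graphCLM (E : Type) [NormedAddCommGroup E] [NormedSpace ℝ E] [FiniteDimensional ℝ E] :
    E × C(Icc (0 : ℝ) 1, ℝ) →L[ℝ] C(Icc (0 : ℝ) 1, E × ℝ) :=
  ((ContinuousLinearMap.compLeftContinuous ℝ (Icc (0 : ℝ) 1) (.inl ℝ E ℝ)).comp (rayCLM E)).comp
      (.fst ℝ _ _) +
    (ContinuousLinearMap.compLeftContinuous ℝ (Icc (0 : ℝ) 1) (.inr ℝ E ℝ)).comp (.snd ℝ _ _)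

@[simp] theorem graphCLM_apply (x : E × C(Icc (0 : ℝ) 1, ℝ)) (r : Icc (0 : ℝ) 1) :
    graphCLM E x r = ((r : ℝ) • x.1, x.2 r) := by
  simp [graphCLM]

/-- The right-hand side `r ↦ ∫₀ʳ f (ρ v, γ ρ) v dρ` of the integral equation of the rays. -/
def rayOp (f : E × ℝ → E →L[ℝ] ℝ) (hf : Continuous f) (x : E × C(Icc (0 : ℝ) 1, ℝ)) :
    C(Icc (0 : ℝ) 1, ℝ) :=
  volterra (applyBilin _ E ℝ (nemytskii _ f hf (graphCLM E x)) (constCLM E x.1))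

theorem rayOp_apply (f : E × ℝ → E →L[ℝ] ℝ) (hf : Continuous f) (v : E)
    (γ : C(Icc (0 : ℝ) 1, ℝ)) (r : Icc (0 : ℝ) 1) :
    rayOp f hf (v, γ) r =
      ∫ s in (0 : ℝ)..r, IccExtend zero_le_one (fun ρ : Icc (0 : ℝ) 1 => f ((ρ : ℝ) • v, γ ρ) v) s := by
  rw [rayOp, volterra_apply]
  congr 1
  ext s
  simp [IccExtend, nemytskii]

/-- The contraction `r ↦ t r` of the unit interval. -/
def contractMap (t : Icc (0 : ℝ) 1) : C(Icc (0 : ℝ) 1, Icc (0 : ℝ) 1) :=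
  ⟨fun r => ⟨t * r, mul_nonneg t.2.1 r.2.1, mul_le_one₀ t.2.2 r.2.1 r.2.2⟩, by fun_prop⟩

/-- Substituting `s ↦ t s`: a solution along `v`, restricted to `[0, t]` and reparametrized, solves
the equation along `t • v`. Together with uniqueness this makes the curves on the rays fit together
to one function of `v`. -/
theorem rayOp_contract (g : E × ℝ → E →L[ℝ] ℝ) (hg : Continuous g) (v : E)
    (γ : C(Icc (0 : ℝ) 1, ℝ)) (t : Icc (0 : ℝ) 1) :
    (rayOp g hg (v, γ)).comp (contractMap t) =
      rayOp g hg ((t : ℝ) • v, γ.comp (contractMap t)) := by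
  ext r
  rw [ContinuousMap.comp_apply, rayOp_apply, rayOp_apply]
  have hm : ((contractMap t r : Icc (0 : ℝ) 1) : ℝ) = t * r := rfl
  rw [hm]
  have h6 := intervalIntegral.mul_integral_comp_mul_left (a := 0) (b := (r : ℝ)) (c := (t : ℝ))
    (f := IccExtend zero_le_one (fun ρ : Icc (0 : ℝ) 1 => g ((ρ : ℝ) • v, γ ρ) v))
  rw [mul_zero] at h6
  rw [← h6, ← intervalIntegral.integral_const_mul]
  apply intervalIntegral.integral_congr
  intro s hs
  rw [uIcc_of_le r.2.1] at hs
  have hs1 : s ∈ Icc (0 : ℝ) 1 := ⟨hs.1, hs.2.trans r.2.2⟩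
  have hs2 : (t : ℝ) * s ∈ Icc (0 : ℝ) 1 :=
    ⟨mul_nonneg t.2.1 hs1.1, mul_le_one₀ t.2.2 hs1.1 hs1.2⟩
  have h7 : (s * (t : ℝ)) • v = ((t : ℝ) * s) • v := by rw [mul_comm]
  simp only [IccExtend_of_mem zero_le_one _ hs1, IccExtend_of_mem zero_le_one _ hs2]
  rw [map_smul, smul_eq_mul, smul_smul, h7]
  rfl

theorem contDiff_rayOp {f : E × ℝ → E →L[ℝ] ℝ} (hf : ContDiff ℝ ∞ f) :
    ContDiff ℝ ∞ (rayOp f hf.continuous) := by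
  have h1 : ContDiff ℝ ∞ fun x : E × C(Icc (0 : ℝ) 1, ℝ) =>
      applyBilin (Icc (0 : ℝ) 1) E ℝ (nemytskii _ f hf.continuous (graphCLM E x)) :=
    contDiff_applyBilin.comp ((contDiff_nemytskii hf).comp (graphCLM E).contDiff)
  exact volterra.contDiff.comp (h1.clm_apply ((constCLM E).contDiff.comp contDiff_fst))

/-- The operator is a product of the coefficient `f` along the graph and the direction `v`. Both
factors vanish at the origin, so both terms of the product rule do. -/
theorem hasFDerivAt_rayOp_zero {f : E × ℝ → E →L[ℝ] ℝ} (hf : ContDiff ℝ ∞ f) (h0 : f 0 = 0) :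
    HasFDerivAt (rayOp f hf.continuous) (0 : E × C(Icc (0 : ℝ) 1, ℝ) →L[ℝ] _) 0 := by
  have h1 : ContDiff ℝ ∞ fun x : E × C(Icc (0 : ℝ) 1, ℝ) =>
      applyBilin (Icc (0 : ℝ) 1) E ℝ (nemytskii _ f hf.continuous (graphCLM E x)) :=
    contDiff_applyBilin.comp ((contDiff_nemytskii hf).comp (graphCLM E).contDiff)
  have h2 := ((h1.differentiable (by simp)) 0).hasFDerivAt.clm_apply
    (((constCLM E).comp (.fst ℝ E C(Icc (0 : ℝ) 1, ℝ))).hasFDerivAt (x := 0))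
  have h3 := volterra.hasFDerivAt.comp _ h2
  refine h3.congr_fderiv ?_
  have h4 : nemytskii (Icc (0 : ℝ) 1) f hf.continuous (graphCLM E 0) = 0 := by
    ext1 r
    simp only [nemytskii, map_zero]
    exact h0
  rw [h4, map_zero]
  refine ContinuousLinearMap.ext fun x => ?_
  simp

/-- The integral equation of the rays has a solution near the origin, locally unique and smooth in the
direction of the ray. -/
theorem exists_ray_family {g : E × ℝ → E →L[ℝ] ℝ} (hg : ContDiff ℝ ∞ g) (hg0 : g 0 = 0) :
    ∃ γ : E → C(Icc (0 : ℝ) 1, ℝ), SmoothNear γ 0 ∧ γ 0 = 0 ∧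
      (∀ᶠ v in 𝓝 (0 : E), γ v = rayOp g hg.continuous (v, γ v)) ∧
      ∃ δ > 0, ∀ (v : E) (η : C(Icc (0 : ℝ) 1, ℝ)), ‖v‖ < δ → ‖η‖ < δ →
        η = rayOp g hg.continuous (v, η) → η = γ v := by
  -- The derivative of `Θ` at the origin is the identity. Its local inverse gives both the solution
  -- curves, as the preimages of `(v, 0)`, and their uniqueness.
  let Θ : E × C(Icc (0 : ℝ) 1, ℝ) → E × C(Icc (0 : ℝ) 1, ℝ) := fun x =>
    (x.1, x.2 - rayOp g hg.continuous x)
  have hΘ : ContDiff ℝ ∞ Θ := contDiff_fst.prodMk (contDiff_snd.sub (contDiff_rayOp hg))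
  have hΘ' : HasFDerivAt Θ ((ContinuousLinearEquiv.refl ℝ (E × C(Icc (0 : ℝ) 1, ℝ)) :
      _ ≃L[ℝ] _) : _ →L[ℝ] _) 0 := by
    refine (hasFDerivAt_fst.prodMk
      (hasFDerivAt_snd.sub (hasFDerivAt_rayOp_zero hg hg0))).congr_fderiv ?_
    ext x <;> simp
  have hΘ0 : Θ 0 = 0 := by
    have : rayOp g hg.continuous 0 = 0 := by
      simp [rayOp]
    simp [Θ, this]
  obtain ⟨I, hI0, hIs, hI1, hI2⟩ := (hΘ.smoothNear 0).exists_localInverse _ hΘ'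
  rw [hΘ0] at hI0 hIs hI1
  -- the solution curves
  let γ : E → C(Icc (0 : ℝ) 1, ℝ) := fun v => (I (v, 0)).2
  have hpair : SmoothNear (fun v : E => ((v, 0) : E × C(Icc (0 : ℝ) 1, ℝ))) 0 :=
    (contDiff_id.prodMk contDiff_const).smoothNear _
  have hγs : SmoothNear γ 0 := by
    have h1 : SmoothNear (fun v : E => I (v, 0)) 0 := SmoothNear.comp hIs hpair
    exact (contDiff_snd.smoothNear _).comp h1
  have hγ0 : γ 0 = 0 := by
    change (I 0).2 = 0
    rw [hI0]; rfl
  have hγeq : ∀ᶠ v in 𝓝 (0 : E), γ v = rayOp g hg.continuous (v, γ v) := by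
    filter_upwards [hpair.continuousAt.eventually hI1] with v hv
    have h1 : (I (v, 0)).1 = v := congrArg Prod.fst hv
    have h2 : (I (v, 0)).2 - rayOp g hg.continuous (I (v, 0)) = 0 := congrArg Prod.snd hv
    have h3 : I (v, 0) = (v, γ v) := Prod.ext h1 rfl
    rw [h3] at h2
    exact sub_eq_zero.1 h2
  refine ⟨γ, hγs, hγ0, hγeq, ?_⟩
  · obtain ⟨δ, hδ, hball⟩ := Metric.eventually_nhds_iff_ball.1 hI2
    refine ⟨δ, hδ, fun v η hv hη h => ?_⟩
    have h1 := hball (v, η) (by simp [Prod.norm_def, hv, hη])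
    have h2 : Θ (v, η) = (v, 0) := by simp only [Θ, ← h, sub_self]
    rw [h2] at h1
    simp only [γ, h1]

/-- The first-order equation `Dh(v) v = f(v, h v) v` has a smooth solution near the origin, obtained
by solving an ordinary differential equation along each ray. -/
theorem exists_ray_solution {f : E × ℝ → E →L[ℝ] ℝ} (hf : SmoothNear f 0) (h0 : f 0 = 0) :
    ∃ h : E → ℝ, SmoothNear h 0 ∧ h 0 = 0 ∧ (∀ᶠ v in 𝓝 0, fderiv ℝ h v v = f (v, h v) v) ∧
      ∀ W : Submodule ℝ E, (∀ᶠ v in 𝓝 0, v ∈ W → f (v, 0) v = 0) →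
        ∀ᶠ v in 𝓝 0, v ∈ W → h v = 0 := by
  obtain ⟨g, hg, hgf⟩ := hf.exists_contDiff
  have hg0 : g 0 = 0 := hgf.self_of_nhds.trans h0
  obtain ⟨γ, hγs, hγ0, hγeq, δ, hδ, huniq⟩ := exists_ray_family hg hg0
  let one : Icc (0 : ℝ) 1 := ⟨1, by simp⟩
  let h : E → ℝ := fun v => γ v one
  have hhs : SmoothNear h 0 :=
    ((ContinuousMap.evalCLM ℝ one : C(Icc (0 : ℝ) 1, ℝ) →L[ℝ] ℝ).contDiff.smoothNear _).comp hγs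
  have hγsmall : ∀ᶠ v in 𝓝 (0 : E), ‖γ v‖ < δ := by
    have := hγs.continuousAt.norm
    rw [ContinuousAt, hγ0, norm_zero] at this
    exact this.eventually (gt_mem_nhds hδ)
  -- The curve belonging to `t • v` is the contracted curve belonging to `v`, by uniqueness;
  -- evaluate both at the endpoint.
  have hray : ∀ᶠ v in 𝓝 (0 : E), ∀ t : Icc (0 : ℝ) 1, h ((t : ℝ) • v) = γ v t := by
    filter_upwards [hγsmall, hγeq, Metric.ball_mem_nhds (0 : E) hδ] with v h1 h2 h3 t
    set m := contractMap t with hm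
    have h4 : (γ v).comp m = γ ((t : ℝ) • v) := by
      apply huniq
      · rw [norm_smul, Real.norm_of_nonneg t.2.1]
        have : ‖v‖ < δ := by simpa using h3
        nlinarith [t.2.2, norm_nonneg v]
      · refine lt_of_le_of_lt ?_ h1
        rw [ContinuousMap.norm_le _ (norm_nonneg _)]
        intro r
        rw [ContinuousMap.comp_apply]
        exact (γ v).norm_coe_le_norm (m r)
      · rw [← rayOp_contract, ← h2]
    have h5 := congrArg (fun η : C(Icc (0 : ℝ) 1, ℝ) => η one) h4
    simp only [ContinuousMap.comp_apply] at h5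
    have h6 : m one = t := Subtype.ext (mul_one _)
    rw [h6] at h5
    exact h5.symm
  have hgfv : ∀ᶠ v in 𝓝 (0 : E), g (v, h v) = f (v, h v) := by
    have hc : ContinuousAt (fun v : E => (v, h v)) 0 := continuousAt_id.prodMk hhs.continuousAt
    have h00 : h 0 = 0 := by simp [h, hγ0]
    have h1 : (fun v : E => (v, h v)) 0 = 0 := Prod.ext rfl h00
    rw [← h1] at hgf
    exact hc.eventually hgf
  refine ⟨h, hhs, by simp [h, hγ0], ?_, ?_⟩
  · filter_upwards [hray, hγeq, hhs, hgfv] with v h1 h2 h3 h4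
    have hd1 : HasDerivAt (fun t : ℝ => h (t • v)) (fderiv ℝ h v v) 1 := by
      have h5 : HasFDerivAt h (fderiv ℝ h v) ((1 : ℝ) • v) := by
        rw [one_smul]; exact (h3.differentiableAt (by simp)).hasFDerivAt
      have h6 : HasDerivAt (fun t : ℝ => t • v) v 1 := by
        simpa using (hasDerivAt_id (1 : ℝ)).smul_const v
      exact h5.comp_hasDerivAt 1 h6
    have hcont : Continuous (IccExtend zero_le_one
        (fun ρ : Icc (0 : ℝ) 1 => g ((ρ : ℝ) • v, γ v ρ) v)) := by
      refine Continuous.Icc_extend' ?_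
      have := hg.continuous
      fun_prop
    have hd2 : HasDerivAt (fun t : ℝ => ∫ s in (0 : ℝ)..t, IccExtend zero_le_one
        (fun ρ : Icc (0 : ℝ) 1 => g ((ρ : ℝ) • v, γ v ρ) v) s) (f (v, h v) v) 1 := by
      have h5 := intervalIntegral.integral_hasDerivAt_right (hcont.intervalIntegrable 0 1)
        (hcont.stronglyMeasurableAtFilter _ _) hcont.continuousAt
      refine h5.congr_deriv ?_
      rw [IccExtend_of_mem zero_le_one _ (by simp : (1 : ℝ) ∈ Icc (0 : ℝ) 1), ← h4]
      simp [h, one]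
    -- The two expressions for `h (t • v)` agree only for `t ≤ 1`, so the derivatives at the
    -- endpoint `1` are compared within the interval.
    have hu : UniqueDiffWithinAt ℝ (Icc (0 : ℝ) 1) 1 :=
      uniqueDiffOn_Icc zero_lt_one 1 (by simp)
    refine hu.eq_deriv _ hd1.hasDerivWithinAt (hd2.hasDerivWithinAt.congr (fun t ht => ?_) ?_)
    · rw [h1 ⟨t, ht⟩]
      conv_lhs => rw [h2]
      rw [rayOp_apply]
    · have := h1 one
      simp only [one] at this
      rw [this]
      conv_lhs => rw [h2]
      rw [rayOp_apply]
  · intro W hW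
    obtain ⟨ε, hε, hball⟩ := Metric.eventually_nhds_iff_ball.1 hW
    have hgf0 : ∀ᶠ v in 𝓝 (0 : E), g (v, 0) = f (v, 0) := by
      have hc : ContinuousAt (fun v : E => (v, (0 : ℝ))) 0 := by fun_prop
      exact hc.eventually hgf
    obtain ⟨ε', hε', hball'⟩ := Metric.eventually_nhds_iff_ball.1 hgf0
    filter_upwards [Metric.ball_mem_nhds (0 : E) hε, Metric.ball_mem_nhds (0 : E) hδ,
      Metric.ball_mem_nhds (0 : E) hε'] with v h1 h2 h3 hvW
    -- Along a direction in `W` the zero curve solves the integral equation, so by uniqueness it is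
    -- the solution.
    have h4 : (0 : C(Icc (0 : ℝ) 1, ℝ)) = γ v := by
      refine huniq v 0 (by simpa using h2) (by simpa using hδ) ?_
      ext r
      rw [rayOp_apply]
      have : (fun ρ : Icc (0 : ℝ) 1 => g ((ρ : ℝ) • v, (0 : C(Icc (0 : ℝ) 1, ℝ)) ρ) v) =
          fun _ => 0 := by
        ext ρ
        have hn : ‖(ρ : ℝ) • v‖ ≤ ‖v‖ := by
          rw [norm_smul, Real.norm_of_nonneg ρ.2.1]
          nlinarith [ρ.2.2, norm_nonneg v]
        have hb1 : (ρ : ℝ) • v ∈ Metric.ball (0 : E) ε := by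
          simp only [Metric.mem_ball, dist_zero_right] at h1 ⊢; linarith
        have hb2 : (ρ : ℝ) • v ∈ Metric.ball (0 : E) ε' := by
          simp only [Metric.mem_ball, dist_zero_right] at h3 ⊢; linarith
        have h5 := hball _ hb1 (W.smul_mem _ hvW)
        rw [ContinuousMap.zero_apply, hball' _ hb2]
        -- The hypothesis on `W` evaluates the form at `ρ v` on `ρ v`. Off the origin divide by `ρ`;
        -- at the origin the form itself vanishes.
        by_cases hρ : (ρ : ℝ) = 0
        · rw [hρ, zero_smul]
          change f 0 v = 0
          simp [h0]
        · rw [map_smul, smul_eq_mul] at h5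
          exact (mul_eq_zero.1 h5).resolve_left hρ
      rw [this]
      simp [IccExtend]
    simp [h, ← h4]

omit [FiniteDimensional ℝ E] in
/-- Hadamard's lemma: the average `∫₀¹ f (r v) dr` of a smooth germ along rays is a smooth germ. -/
theorem SmoothNear.exists_ray_average {F : Type} [NormedAddCommGroup F] [NormedSpace ℝ F]
    {f : F → ℝ} [FiniteDimensional ℝ F] (L : E →L[ℝ] C(Icc (0 : ℝ) 1, F)) (hf : SmoothNear f 0) :
    SmoothNear (fun v => ∫ s in (0 : ℝ)..1, f (IccExtend zero_le_one (L v) s)) 0 := by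
  obtain ⟨g, hg, hgf⟩ := hf.exists_contDiff
  have h1 : ContDiff ℝ ∞ fun v : E => volterra (nemytskii (Icc (0 : ℝ) 1) g hg.continuous (L v))
      ⟨1, by simp⟩ :=
    (ContinuousMap.evalCLM ℝ _ : C(Icc (0 : ℝ) 1, ℝ) →L[ℝ] ℝ).contDiff.comp
      (volterra.contDiff.comp ((contDiff_nemytskii hg).comp L.contDiff))
  refine (h1.smoothNear 0).congr ?_
  obtain ⟨ε, hε, hball⟩ := Metric.eventually_nhds_iff_ball.1 hgf
  have hL : ∀ᶠ v in 𝓝 (0 : E), ‖L v‖ < ε := by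
    have := L.continuous.norm.tendsto 0
    rw [map_zero, norm_zero] at this
    exact this.eventually (gt_mem_nhds hε)
  filter_upwards [hL] with v hv
  rw [volterra_apply]
  apply intervalIntegral.integral_congr
  intro s _
  refine (hball _ ?_).symm
  rw [mem_ball_zero_iff]
  exact (ContinuousMap.norm_coe_le_norm (L v) _).trans_lt hv

end Rays

/-! ### Logarithmic cutoff functions. -/

section Cutoff

theorem exists_bound_deriv_smoothTransition : ∃ C, ∀ x, |deriv Real.smoothTransition x| ≤ C := by
  have hc : Continuous (deriv Real.smoothTransition) :=
    (Real.smoothTransition.contDiff (n := 1)).continuous_deriv le_rfl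
  obtain ⟨C, hC⟩ := isCompact_Icc.exists_bound_of_continuousOn (s := Icc (0 : ℝ) 1) hc.continuousOn
  refine ⟨C, fun x => ?_⟩
  have hC0 : 0 ≤ C := (norm_nonneg _).trans (hC 0 (by simp))
  rcases lt_or_ge x 0 with h | h
  · have : Real.smoothTransition =ᶠ[𝓝 x] fun _ => 0 := by
      filter_upwards [gt_mem_nhds h] with y hy using Real.smoothTransition.zero_of_nonpos hy.le
    simp [this.deriv_eq, hC0]
  rcases lt_or_ge 1 x with h' | h'
  · have : Real.smoothTransition =ᶠ[𝓝 x] fun _ => 1 := by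
      filter_upwards [lt_mem_nhds h'] with y hy using Real.smoothTransition.one_of_one_le hy.le
    simp [this.deriv_eq, hC0]
  · exact hC x ⟨h, h'⟩

/-- Logarithmic cutoff functions: the scale-invariant quantity `|Dμ(v)| |v|` is as small as desired. -/
theorem exists_log_cutoff {E : Type*} [NormedAddCommGroup E] [InnerProductSpace ℝ E] {δ ρ : ℝ}
    (hδ : 0 < δ) (hρ : 0 < ρ) :
    ∃ μ : E → ℝ, ContDiff ℝ ∞ μ ∧ (∀ v, 0 ≤ μ v ∧ μ v ≤ 1) ∧ (∀ᶠ v in 𝓝 0, μ v = 1) ∧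
      (∀ v, ρ ≤ ‖v‖ → μ v = 0) ∧ ∀ v, ‖fderiv ℝ μ v‖ * ‖v‖ ≤ δ := by
  obtain ⟨C, hC⟩ := exists_bound_deriv_smoothTransition
  have hC0 : 0 ≤ C := (abs_nonneg _).trans (hC 0)
  -- The final estimate is `|Dμ| |v| ≤ 2 C ε`; the summand `1` keeps the denominator positive when
  -- `C = 0`.
  set ε := δ / (2 * C + 1) with hε
  have hεpos : 0 < ε := by positivity
  -- This regularizes the logarithm at the origin; the value is chosen so that `u 0 = 2 > 1`, whence
  -- `μ = 1` near the origin.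
  set η := Real.exp (2 * Real.log ρ - 2 / ε) with hη
  have hηpos : 0 < η := Real.exp_pos _
  let u : E → ℝ := fun v => ε * (2 * Real.log ρ - Real.log (‖v‖ ^ 2 + η))
  have hu : ContDiff ℝ ∞ u :=
    contDiff_const.mul (contDiff_const.sub
      (((contDiff_norm_sq ℝ).add contDiff_const).log fun v => by positivity))
  have hu' : ∀ v, HasFDerivAt u (-(ε * (2 / (‖v‖ ^ 2 + η))) • innerSL ℝ v) v := by
    intro v
    have h1 : HasFDerivAt (fun v : E => ‖v‖ ^ 2 + η) (2 • innerSL ℝ v) v := by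
      simpa using (hasStrictFDerivAt_norm_sq v).hasFDerivAt.add_const η
    have h2 := ((h1.log (by positivity)).const_sub (2 * Real.log ρ)).const_mul ε
    refine h2.congr_fderiv ?_
    ext w
    simp
    ring
  refine ⟨fun v => Real.smoothTransition (u v), Real.smoothTransition.contDiff.comp hu,
    fun v => ⟨Real.smoothTransition.nonneg _, Real.smoothTransition.le_one _⟩, ?_, ?_, ?_⟩
  · have h0 : 1 < u 0 := by
      simp only [u, norm_zero, hη]
      rw [zero_pow two_ne_zero, zero_add, Real.log_exp]
      field_simp
      norm_num
    filter_upwards [hu.continuous.continuousAt.eventually (lt_mem_nhds h0)] with v hv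
    exact Real.smoothTransition.one_of_one_le (le_of_lt hv)
  · intro v hv
    apply Real.smoothTransition.zero_of_nonpos
    apply mul_nonpos_of_nonneg_of_nonpos hεpos.le
    have : Real.log (ρ ^ 2) ≤ Real.log (‖v‖ ^ 2 + η) :=
      Real.log_le_log (by positivity) (by nlinarith)
    rw [Real.log_pow] at this
    push_cast at this
    linarith
  · intro v
    have h1 : HasDerivAt Real.smoothTransition (deriv Real.smoothTransition (u v)) (u v) :=
      ((Real.smoothTransition.contDiff (n := 1)).differentiable (by simp) _).hasDerivAt
    have h2 := (h1.comp_hasFDerivAt v (hu' v)).fderiv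
    have h3 : fderiv ℝ (fun v => Real.smoothTransition (u v)) v =
      deriv Real.smoothTransition (u v) • -(ε * (2 / (‖v‖ ^ 2 + η))) • innerSL ℝ v := h2
    rw [h3, norm_smul, norm_smul, innerSL_apply_norm, norm_neg, Real.norm_eq_abs,
      Real.norm_of_nonneg (by positivity)]
    have h4 : ‖v‖ ^ 2 / (‖v‖ ^ 2 + η) ≤ 1 := (div_le_one (by positivity)).2 (by linarith)
    calc |deriv Real.smoothTransition (u v)| * (ε * (2 / (‖v‖ ^ 2 + η)) * ‖v‖) * ‖v‖
        = |deriv Real.smoothTransition (u v)| * (2 * ε) * (‖v‖ ^ 2 / (‖v‖ ^ 2 + η)) := by ring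
      _ ≤ C * (2 * ε) * 1 := by
          gcongr
          exact hC _
      _ = δ * (2 * C / (2 * C + 1)) := by rw [hε]; field_simp
      _ ≤ δ * 1 := by
          gcongr
          exact (div_le_one (by positivity)).2 (by linarith)
      _ = δ := mul_one _

end Cutoff

/-! ### One-forms on the plane that annihilate the radial vector field. -/

section Plane

/-- The standard area form on `ℂ`. -/
def crossProd (v w : ℂ) : ℝ := v.re * w.im - v.im * w.re

theorem clm_complex_apply {F : Type*} [NormedAddCommGroup F] [NormedSpace ℝ F] (L : ℂ →L[ℝ] F)
    (w : ℂ) : L w = w.re • L 1 + w.im • L Complex.I := by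
  rw [← map_smul, ← map_smul, ← map_add]
  congr 1
  apply Complex.ext <;> simp

theorem eq_zero_of_eventually_re_ne_zero {F : ℂ → ℝ} {v : ℂ} (hF : ContinuousAt F v)
    (h : ∀ᶠ w in 𝓝 v, w.re ≠ 0 → F w = 0) : F v = 0 := by
  by_cases hv : v.re = 0
  · have ht : Tendsto (fun ε : ℝ => v + ε) (𝓝[≠] 0) (𝓝 v) := by
      have : ContinuousAt (fun ε : ℝ => v + ε) 0 := by fun_prop
      have h2 := this.tendsto
      simp only [Complex.ofReal_zero, add_zero] at h2
      exact h2.mono_left nhdsWithin_le_nhds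
    refine tendsto_nhds_unique (hF.tendsto.comp ht) (tendsto_const_nhds.congr' ?_)
    filter_upwards [ht.eventually h, self_mem_nhdsWithin] with ε h1 h2
    exact (h1 (by simpa [hv] using h2)).symm
  · exact h.self_of_nhds hv

theorem eq_zero_of_eventually_im_ne_zero {F : ℂ → ℝ} {v : ℂ} (hF : ContinuousAt F v)
    (h : ∀ᶠ w in 𝓝 v, w.im ≠ 0 → w.re = v.re → F w = 0) : F v = 0 := by
  by_cases hv : v.im = 0
  · have ht : Tendsto (fun ε : ℝ => v + ε * Complex.I) (𝓝[≠] 0) (𝓝 v) := by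
      have : ContinuousAt (fun ε : ℝ => v + ε * Complex.I) 0 := by fun_prop
      have h2 := this.tendsto
      simp only [Complex.ofReal_zero, zero_mul, add_zero] at h2
      exact h2.mono_left nhdsWithin_le_nhds
    refine tendsto_nhds_unique (hF.tendsto.comp ht) (tendsto_const_nhds.congr' ?_)
    filter_upwards [ht.eventually h, self_mem_nhdsWithin] with ε h1 h2
    exact (h1 (by simpa [hv] using h2) (by simp)).symm
  · exact h.self_of_nhds hv rfl

/-- A smooth 1-form near the origin of `ℂ` which annihilates the radial vector field is a smooth
multiple of `x dy - y dx`. -/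
theorem exists_eq_mul_crossProd {β : ℂ → ℂ →L[ℝ] ℝ} (hβ : SmoothNear β 0)
    (hrad : ∀ᶠ v in 𝓝 0, β v v = 0) :
    ∃ G : ℂ → ℝ, SmoothNear G 0 ∧ (∀ᶠ v in 𝓝 0, ∀ w, β v w = G v * crossProd v w) ∧
      skewDeriv β 0 1 Complex.I = 2 * G 0 := by
  let b : ℂ → ℝ := fun v => β v Complex.I
  have happly : ∀ w : ℂ, ContDiff ℝ ∞ fun A : ℂ →L[ℝ] ℝ => A w := fun w =>
    (ContinuousLinearMap.apply ℝ ℝ w).contDiff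
  have hb : SmoothNear b 0 := ((happly Complex.I).smoothNear _).comp hβ
  have hb1 : SmoothNear (fun v => fderiv ℝ b v 1) 0 := ((happly 1).smoothNear _).comp hb.fderiv
  -- The horizontal segment from the imaginary axis to `v`. The factor `G` is the average of `∂b/∂x`
  -- along it, as in Hadamard's lemma.
  let L : ℂ →L[ℝ] C(Icc (0 : ℝ) 1, ℂ) :=
    (rayCLM ℂ).comp (Complex.ofRealCLM.comp Complex.reCLM) +
      (constCLM ℂ).comp (Complex.imCLM.smulRight Complex.I)
  have hL : ∀ v r, L v r = (r : ℝ) * v.re + v.im * Complex.I := by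
    intro v r
    simp [L]
  let G : ℂ → ℝ := fun v => ∫ s in (0 : ℝ)..1, (fun v => fderiv ℝ b v 1) (IccExtend zero_le_one (L v) s)
  have hG : SmoothNear G 0 := hb1.exists_ray_average L
  obtain ⟨ε, hε, hball⟩ := Metric.eventually_nhds_iff_ball.1 (hb.and (hβ.and hrad))
  -- On the imaginary axis the radial condition reads `im v * b v = 0`. Dividing by `im v` leaves
  -- out only the origin, which continuity adds.
  have hb0 : ∀ y : ℝ, |y| < ε → b (y * Complex.I) = 0 := by
    intro y hy
    have hmem : (y * Complex.I : ℂ) ∈ Metric.ball (0 : ℂ) ε := by simpa using hy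
    refine eq_zero_of_eventually_im_ne_zero (hball _ hmem).1.continuousAt ?_
    filter_upwards [Metric.isOpen_ball.mem_nhds hmem] with w hw h1 h2
    have h3 := (hball w hw).2.2
    rw [clm_complex_apply, h2] at h3
    simpa [h1] using h3
  have hbG : ∀ v ∈ Metric.ball (0 : ℂ) ε, b v = v.re * G v := by
    intro v hv
    have hline : ∀ s ∈ Icc (0 : ℝ) 1, (s * v.re + v.im * Complex.I : ℂ) ∈ Metric.ball (0 : ℂ) ε := by
      intro s hs
      rw [mem_ball_zero_iff] at hv ⊢
      refine lt_of_le_of_lt ?_ hv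
      rw [← sq_le_sq₀ (norm_nonneg _) (norm_nonneg _), ← Complex.normSq_eq_norm_sq,
        ← Complex.normSq_eq_norm_sq, Complex.normSq_apply, Complex.normSq_apply]
      simp only [Complex.add_re, Complex.mul_re, Complex.ofReal_re, Complex.ofReal_im, Complex.I_re,
        Complex.I_im, Complex.add_im, Complex.mul_im]
      have : s ^ 2 ≤ 1 := by nlinarith [hs.1, hs.2]
      nlinarith [sq_nonneg v.re]
    have hder : ∀ s ∈ uIcc (0 : ℝ) 1, HasDerivAt (fun s : ℝ => b (s * v.re + v.im * Complex.I))
        (v.re * fderiv ℝ b (s * v.re + v.im * Complex.I) 1) s := by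
      intro s hs
      rw [uIcc_of_le zero_le_one] at hs
      have h1 := ((hball _ (hline s hs)).1.differentiableAt (by simp)).hasFDerivAt
      have h2 : HasDerivAt (fun s : ℝ => (s * v.re + v.im * Complex.I : ℂ)) (v.re : ℂ) s := by
        have := ((Complex.ofRealCLM.hasDerivAt (x := s)).mul_const (v.re : ℂ)).add_const
          (v.im * Complex.I : ℂ)
        simpa using this
      refine (h1.comp_hasDerivAt s h2).congr_deriv ?_
      rw [clm_complex_apply (fderiv ℝ b _) (v.re : ℂ)]
      simp
    have hcont : ContinuousOn (fun s : ℝ => v.re * fderiv ℝ b (s * v.re + v.im * Complex.I) 1)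
        (uIcc 0 1) := by
      intro s hs
      rw [uIcc_of_le zero_le_one] at hs
      have h1 : ContinuousAt (fderiv ℝ b) (s * v.re + v.im * Complex.I) :=
        ((hball _ (hline s hs)).1.fderiv_right (m := ∞) (by simp)).continuousAt
      have h2 : ContinuousAt (fun s : ℝ => (s * v.re + v.im * Complex.I : ℂ)) s := by fun_prop
      have h3 : ContinuousAt (fun s : ℝ => fderiv ℝ b (s * v.re + v.im * Complex.I)) s :=
        ContinuousAt.comp (f := fun s : ℝ => (s * v.re + v.im * Complex.I : ℂ)) h1 h2
      exact (continuousAt_const.mul (h3.clm_apply continuousAt_const)).continuousWithinAt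
    have h4 := intervalIntegral.integral_eq_sub_of_hasDerivAt hder hcont.intervalIntegrable
    rw [intervalIntegral.integral_const_mul] at h4
    have h5 : ∫ s in (0 : ℝ)..1, fderiv ℝ b (s * v.re + v.im * Complex.I) 1 = G v := by
      apply intervalIntegral.integral_congr
      intro s hs
      rw [uIcc_of_le zero_le_one] at hs
      simp only [IccExtend_of_mem zero_le_one _ hs, hL]
    have h6 : |v.im| < ε := (Complex.abs_im_le_norm v).trans_lt (by simpa using hv)
    have h7 := hb0 _ h6
    rw [h5] at h4
    simp only [Complex.ofReal_one, one_mul, Complex.ofReal_zero, zero_mul, zero_add, h7,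
      Complex.re_add_im, sub_zero] at h4
    exact h4.symm
  -- With `b = re * G` the radial condition becomes `re v * (β v 1 + im v * G v) = 0`; cancel `re v`
  -- off the axis and use continuity on it.
  have hone : ∀ᶠ v in 𝓝 (0 : ℂ), β v 1 = -(v.im * G v) := by
    filter_upwards [Metric.ball_mem_nhds (0 : ℂ) hε, hG] with v hv hGv
    have hc : ContinuousAt (fun v => β v 1 + v.im * G v) v :=
      ((hball v hv).2.1.continuousAt.clm_apply continuousAt_const).add
        (Complex.continuous_im.continuousAt.mul hGv.continuousAt)
    have := eq_zero_of_eventually_re_ne_zero hc (by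
      filter_upwards [Metric.isOpen_ball.mem_nhds hv] with w hw hwre
      have h1 := (hball w hw).2.2
      have h2 : β w Complex.I = w.re * G w := hbG w hw
      rw [clm_complex_apply, h2] at h1
      simp only [smul_eq_mul] at h1
      have h3 : w.re * (β w 1 + w.im * G w) = 0 := by linarith
      exact (mul_eq_zero.1 h3).resolve_left hwre)
    linarith
  have hmain : ∀ᶠ v in 𝓝 (0 : ℂ), ∀ w, β v w = G v * crossProd v w := by
    filter_upwards [Metric.ball_mem_nhds (0 : ℂ) hε, hone] with v hv h1 w
    have h2 : β v Complex.I = v.re * G v := hbG v hv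
    rw [clm_complex_apply, h1, h2, crossProd]
    simp only [smul_eq_mul]
    ring
  refine ⟨G, hG, hmain, ?_⟩
  let Ω : ℂ →L[ℝ] ℂ →L[ℝ] ℝ :=
    Complex.reCLM.smulRight Complex.imCLM - Complex.imCLM.smulRight Complex.reCLM
  have hΩ : ∀ v w, Ω v w = crossProd v w := fun v w => by simp [Ω, crossProd]
  have hβΩ : β =ᶠ[𝓝 0] fun v => G v • Ω v := by
    filter_upwards [hmain] with v hv
    refine ContinuousLinearMap.ext fun w => ?_
    simp [hv, hΩ]
  -- Since `Ω 0 = 0`, the derivative of `G` does not contribute, and skew-symmetrizing `G 0 • Ω`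
  -- gives the factor `2`.
  have hd : HasFDerivAt β (G 0 • Ω + (fderiv ℝ G 0).smulRight (Ω 0)) 0 :=
    (hG.hasFDerivAt.smul Ω.hasFDerivAt).congr_of_eventuallyEq hβΩ
  rw [skewDeriv, hd.fderiv]
  simp [hΩ, crossProd]
  ring

end Plane

/-! ### Cutting off a ray solution without creating new zeros. -/

section Perturbation

variable {f : ℂ × ℝ → ℂ →L[ℝ] ℝ} {h : ℂ → ℝ}

theorem tendsto_smul_zero (v : ℂ) : Tendsto (fun t : ℝ => t • v) (𝓝[≠] 0) (𝓝 0) := by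
  have : ContinuousAt (fun t : ℝ => t • v) 0 := by fun_prop
  have h2 := this.tendsto
  simp only [zero_smul] at h2
  exact h2.mono_left nhdsWithin_le_nhds

theorem continuousAt_graph (hh : SmoothNear h 0) (hh0 : h 0 = 0) :
    Tendsto (fun v : ℂ => (v, h v)) (𝓝 0) (𝓝 0) := by
  have := (continuousAt_id (x := (0 : ℂ))).prodMk hh.continuousAt
  rw [ContinuousAt, hh0] at this
  exact this

/-- Apply the equation at `t • v`, divide by `t`, and let `t` tend to zero. -/
theorem fderiv_ray_solution_zero (hf : SmoothNear f 0) (hf0 : f 0 = 0) (hh : SmoothNear h 0)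
    (hh0 : h 0 = 0) (heq : ∀ᶠ v in 𝓝 0, fderiv ℝ h v v = f (v, h v) v) : fderiv ℝ h 0 = 0 := by
  refine ContinuousLinearMap.ext fun v => ?_
  have h1 : Tendsto (fun t : ℝ => fderiv ℝ h (t • v) v - f (t • v, h (t • v)) v) (𝓝[≠] 0)
      (𝓝 (fderiv ℝ h 0 v - f 0 v)) := by
    have a1 : Tendsto (fun t : ℝ => fderiv ℝ h (t • v)) (𝓝[≠] 0) (𝓝 (fderiv ℝ h 0)) :=
      hh.fderiv.continuousAt.tendsto.comp (tendsto_smul_zero v)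
    have a2 : Tendsto (fun t : ℝ => f (t • v, h (t • v))) (𝓝[≠] 0) (𝓝 (f 0)) :=
      hf.continuousAt.tendsto.comp ((continuousAt_graph hh hh0).comp (tendsto_smul_zero v))
    have a3 := (ContinuousLinearMap.apply ℝ ℝ v).continuous
    exact ((a3.tendsto _).comp a1).sub ((a3.tendsto _).comp a2)
  have h2 : Tendsto (fun t : ℝ => fderiv ℝ h (t • v) v - f (t • v, h (t • v)) v) (𝓝[≠] 0) (𝓝 0) := by
    refine tendsto_const_nhds.congr' ?_
    filter_upwards [(tendsto_smul_zero v).eventually heq, self_mem_nhdsWithin] with t ht ht0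
    rw [map_smul, map_smul, smul_eq_mul, smul_eq_mul] at ht
    rw [mul_left_cancel₀ ht0 ht, sub_self]
  have h3 := tendsto_nhds_unique h1 h2
  rw [hf0] at h3
  simpa using h3

theorem hasFDerivAt_graph_form (hf : SmoothNear f 0) (hh : SmoothNear h 0) (hh0 : h 0 = 0)
    (hdh : fderiv ℝ h 0 = 0) : HasFDerivAt (fun v => f (v, h v))
      ((fderiv ℝ f 0).comp (.inl ℝ ℂ ℝ)) 0 := by
  have h1 : HasFDerivAt (fun v : ℂ => (v, h v)) (.inl ℝ ℂ ℝ) 0 := by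
    have := (hasFDerivAt_id (𝕜 := ℝ) (0 : ℂ)).prodMk hh.hasFDerivAt
    rw [hdh] at this
    exact this
  have h2 : HasFDerivAt f (fderiv ℝ f 0) ((fun v : ℂ => (v, h v)) 0) := by
    simp only [hh0]; exact hf.hasFDerivAt
  exact h2.comp 0 h1

/-- The equation at `t • v`, divided by `t`, is an identity in `t` that may be differentiated at `t
= 0`. It follows that the Hessian of `h` is the symmetric part of the derivative of `f` along the
plane. -/
theorem second_fderiv_ray_solution (hf : SmoothNear f 0) (hf0 : f 0 = 0) (hh : SmoothNear h 0)
    (hh0 : h 0 = 0) (heq : ∀ᶠ v in 𝓝 0, fderiv ℝ h v v = f (v, h v) v) (v : ℂ) :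
    fderiv ℝ (fderiv ℝ h) 0 v v = fderiv ℝ f 0 (v, 0) v := by
  have hdh := fderiv_ray_solution_zero hf hf0 hh hh0 heq
  have h1 : HasFDerivAt (fun v => fderiv ℝ h v - f (v, h v)) _ 0 :=
    hh.fderiv.hasFDerivAt.sub (hasFDerivAt_graph_form hf hh hh0 hdh)
  have h2 : HasDerivAt (fun t : ℝ => t • v) v 0 := by
    simpa using (hasDerivAt_id (0 : ℝ)).smul_const v
  have h3 : HasDerivAt (fun t : ℝ => (fderiv ℝ h (t • v) - f (t • v, h (t • v))) v)
      ((fderiv ℝ (fderiv ℝ h) 0 - (fderiv ℝ f 0).comp (.inl ℝ ℂ ℝ)) v v) 0 := by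
    have h4 : HasDerivAt ((fun v => fderiv ℝ h v - f (v, h v)) ∘ fun t : ℝ => t • v)
        ((fderiv ℝ (fderiv ℝ h) 0 - (fderiv ℝ f 0).comp (.inl ℝ ℂ ℝ)) v) 0 :=
      HasFDerivAt.comp_hasDerivAt (0 : ℝ) (by simpa using h1) h2
    have := h4.clm_apply (hasDerivAt_const (0 : ℝ) v)
    simpa using this
  have h5 : (fun t : ℝ => (fderiv ℝ h (t • v) - f (t • v, h (t • v))) v) =ᶠ[𝓝 0] fun _ => 0 := by
    have hc : Tendsto (fun t : ℝ => t • v) (𝓝 0) (𝓝 0) := by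
      have : ContinuousAt (fun t : ℝ => t • v) 0 := by fun_prop
      simpa using this.tendsto
    filter_upwards [hc.eventually heq] with t ht
    by_cases ht0 : t = 0
    · subst ht0
      have h00 : ((0 : ℂ), (0 : ℝ)) = 0 := rfl
      simp [hdh, hh0, h00, hf0]
    · rw [map_smul, map_smul, smul_eq_mul, smul_eq_mul] at ht
      rw [sub_apply, mul_left_cancel₀ ht0 ht, sub_self]
  have h6 := h3.unique ((hasDerivAt_const (0 : ℝ) (0 : ℝ)).congr_of_eventuallyEq h5)
  simpa [sub_eq_zero] using h6

/-- Interpolation between a bilinear form `a` on the plane and its skew part: if `det a > 0` and the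
skew part does not vanish, then all forms `μ B - a`, `0 ≤ μ ≤ 1`, are nondegenerate, where `B` is the
symmetric part of `a`. -/
theorem exists_lower_bound_interpolation (a B : ℂ →L[ℝ] ℂ →L[ℝ] ℝ) (hB : ∀ v w, B v w = B w v)
    (haB : ∀ v, B v v = a v v)
    (hdet : 0 < a 1 1 * a Complex.I Complex.I - a 1 Complex.I * a Complex.I 1)
    (hskew : a 1 Complex.I ≠ a Complex.I 1) :
    ∃ m > 0, ∀ t ∈ Icc (0 : ℝ) 1, ∀ v, m * ‖v‖ ≤ ‖(t • B - a) v‖ := by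
  have key : ∀ t ∈ Icc (0 : ℝ) 1, ∀ v, (t • B - a) v = 0 → v = 0 := by
    intro t ht v hv
    have e1 := congrArg (fun L : ℂ →L[ℝ] ℝ => L 1) hv
    have e2 := congrArg (fun L : ℂ →L[ℝ] ℝ => L Complex.I) hv
    rw [clm_complex_apply (t • B - a) v] at e1 e2
    simp only [add_apply, smul_apply, sub_apply, smul_eq_mul, zero_apply] at e1 e2
    have b1 := haB 1
    have b2 := haB Complex.I
    have b3 := haB (1 + Complex.I)
    have b4 := hB 1 Complex.I
    simp only [map_add, add_apply] at b3
    have b5 : B 1 Complex.I = (a 1 Complex.I + a Complex.I 1) / 2 := by linarith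
    have b6 : B Complex.I 1 = (a 1 Complex.I + a Complex.I 1) / 2 := by linarith
    rw [b1, b6] at e1
    rw [b2, b5] at e2
    set p := a 1 1
    set q := a 1 Complex.I
    set r := a Complex.I 1
    set s := a Complex.I Complex.I
    -- With `B` the symmetric part of `a`, `det (t B - a) = (1 - t)² det a + (1 - (1 - t)²) (q - r)²
    -- / 4`. The first term is positive for `t < 1`, the second one at `t = 1`.
    have hD : 0 < (t * p - p) * (t * s - s) -
        (t * ((q + r) / 2) - q) * (t * ((q + r) / 2) - r) := by
      have hk : 0 < (q - r) ^ 2 := by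
        have := sub_ne_zero.2 hskew
        positivity
      have : (t * p - p) * (t * s - s) - (t * ((q + r) / 2) - q) * (t * ((q + r) / 2) - r) =
          (1 - t) ^ 2 * (p * s - q * r) + (1 - (1 - t) ^ 2) * ((q - r) ^ 2 / 4) := by ring
      rw [this]
      rcases eq_or_lt_of_le ht.2 with h1 | h1
      · rw [h1]; norm_num; exact hk
      · have h2 : 0 < (1 - t) ^ 2 := by have : 0 < 1 - t := by linarith
                                        positivity
        have h3 : (1 - t) ^ 2 ≤ 1 := by nlinarith [ht.1]
        have h4 : 0 ≤ (1 - (1 - t) ^ 2) * ((q - r) ^ 2 / 4) := by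
          apply mul_nonneg <;> linarith
        have h5 := mul_pos h2 hdet
        linarith
    apply Complex.ext
    · rw [Complex.zero_re]
      refine (mul_eq_zero.1 ?_).resolve_left hD.ne'
      linear_combination (t * s - s) * e1 - (t * ((q + r) / 2) - r) * e2
    · rw [Complex.zero_im]
      refine (mul_eq_zero.1 ?_).resolve_left hD.ne'
      linear_combination (t * p - p) * e2 - (t * ((q + r) / 2) - q) * e1
  -- Nondegeneracy becomes a uniform bound on the compact set of parameters and unit vectors, and
  -- extends to all `v` by homogeneity.
  have hcomp : IsCompact (Icc (0 : ℝ) 1 ×ˢ Metric.sphere (0 : ℂ) 1) :=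
    isCompact_Icc.prod (isCompact_sphere _ _)
  have hcont : Continuous fun x : ℝ × ℂ => ‖(x.1 • B - a) x.2‖ := by fun_prop
  obtain ⟨x, hx, hmin⟩ := hcomp.exists_isMinOn
    ⟨(0, 1), by simp⟩ hcont.continuousOn
  refine ⟨‖(x.1 • B - a) x.2‖, ?_, fun t ht v => ?_⟩
  · rw [gt_iff_lt, norm_pos_iff]
    intro h0
    have := key x.1 hx.1 x.2 h0
    have h1 := hx.2
    rw [this] at h1
    simp at h1
  · by_cases hv : v = 0
    · simp [hv]
    have hnv : 0 < ‖v‖ := norm_pos_iff.2 hv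
    have h1 := hmin (a := (t, ‖v‖⁻¹ • v)) ⟨ht, by simp [hnv.ne']⟩
    simp only [mem_ofPred_eq, map_smul, norm_smul, norm_inv, norm_norm] at h1
    rwa [inv_mul_eq_div, le_div_iff₀ hnv] at h1

/-- `‖Dh v‖` is at most a multiple of `‖v‖`; integrate this over the ball of radius `‖v‖` by the
mean value inequality. -/
theorem exists_quadratic_bound (hh : SmoothNear h 0) (hh0 : h 0 = 0) (hdh : fderiv ℝ h 0 = 0) :
    ∃ C ≥ 0, ∀ᶠ v in 𝓝 (0 : ℂ), |h v| ≤ C * ‖v‖ ^ 2 := by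
  have h1 := hh.fderiv.hasFDerivAt.isBigO_sub
  obtain ⟨C, hC, hb⟩ := h1.exists_nonneg
  obtain ⟨ε, hε, hball⟩ := Metric.eventually_nhds_iff_ball.1 (hb.bound.and hh)
  refine ⟨C, hC, ?_⟩
  filter_upwards [Metric.ball_mem_nhds (0 : ℂ) hε] with v hv
  have h2 := (convex_closedBall (0 : ℂ) ‖v‖).norm_image_sub_le_of_norm_hasFDerivWithin_le
    (f := h) (f' := fderiv ℝ h) (C := C * ‖v‖) (x := 0) (y := v) ?_ ?_ (by simp) (by simp)
  · rw [hh0, sub_zero, sub_zero, Real.norm_eq_abs] at h2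
    linarith [h2, sq ‖v‖]
  · intro x hx
    have hx' : x ∈ Metric.ball (0 : ℂ) ε := by
      rw [mem_closedBall_zero_iff] at hx
      rw [mem_ball_zero_iff] at hv ⊢
      linarith
    exact ((hball x hx').2.differentiableAt (by simp)).hasFDerivAt.hasFDerivWithinAt
  · intro x hx
    rw [mem_closedBall_zero_iff] at hx
    have hx' : x ∈ Metric.ball (0 : ℂ) ε := by
      rw [mem_ball_zero_iff] at hv ⊢
      linarith
    have h3 := (hball x hx').1
    rw [hdh, sub_zero, sub_zero] at h3
    exact h3.trans (by gcongr)

/-- Cutting off a ray solution `h` logarithmically creates no new zeros of `Dk - f(·, k)`. -/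
theorem exists_cutoff_ray_solution (hf : SmoothNear f 0) (hf0 : f 0 = 0) (hh : ContDiff ℝ ∞ h)
    (hh0 : h 0 = 0) (heq : ∀ᶠ v in 𝓝 0, fderiv ℝ h v v = f (v, h v) v)
    (hdet : 0 < fderiv ℝ f 0 (1, 0) 1 * fderiv ℝ f 0 (Complex.I, 0) Complex.I -
      fderiv ℝ f 0 (1, 0) Complex.I * fderiv ℝ f 0 (Complex.I, 0) 1)
    (hskew : fderiv ℝ f 0 (1, 0) Complex.I ≠ fderiv ℝ f 0 (Complex.I, 0) 1) :
    ∀ᶠ ρ in 𝓝[>] (0 : ℝ), ∃ μ : ℂ → ℝ, ContDiff ℝ ∞ μ ∧ (∀ᶠ v in 𝓝 0, μ v = 1) ∧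
      (∀ v, ρ ≤ ‖v‖ → μ v = 0) ∧ (∀ v, |μ v * h v| ≤ ρ) ∧
      ∀ v, v ≠ 0 → ‖v‖ ≤ ρ → fderiv ℝ (fun v => μ v * h v) v ≠ f (v, μ v * h v) := by
  have hs := hh.smoothNear 0
  have hdh := fderiv_ray_solution_zero hf hf0 hs hh0 heq
  have hsecond := second_fderiv_ray_solution hf hf0 hs hh0 heq
  set B := fderiv ℝ (fderiv ℝ h) 0 with hB
  set a : ℂ →L[ℝ] ℂ →L[ℝ] ℝ := (fderiv ℝ f 0).comp (.inl ℝ ℂ ℝ) with ha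
  have hBsymm : ∀ v w, B v w = B w v := fun v w =>
    (hh.contDiffAt.isSymmSndFDerivAt (by simpa using ENat.LEInfty.out)).eq v w
  obtain ⟨m, hm, hlow⟩ := exists_lower_bound_interpolation a B hBsymm
    (fun v => by rw [hsecond]; rfl) (by simpa [ha] using hdet) (by simpa [ha] using hskew)
  obtain ⟨C, hC, hsq⟩ := exists_quadratic_bound hs hh0 hdh
  -- first-order expansions
  set b : ℝ := ‖fderiv ℝ f 0 (0, 1)‖ with hb
  have e1 : ∀ᶠ v in 𝓝 (0 : ℂ), ‖fderiv ℝ h v - B v‖ ≤ m / 8 * ‖v‖ := by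
    have := hs.fderiv.hasFDerivAt.isLittleO.bound (show 0 < m / 8 by positivity)
    simpa [hdh] using this
  have e2 : ∀ᶠ x in 𝓝 (0 : ℂ × ℝ), ‖f x - fderiv ℝ f 0 x‖ ≤ m / 8 * ‖x‖ := by
    have := hf.hasFDerivAt.isLittleO.bound (show 0 < m / 8 by positivity)
    simpa [hf0] using this
  obtain ⟨r₁, hr₁, hball₁⟩ := Metric.eventually_nhds_iff_ball.1 (e1.and hsq)
  obtain ⟨r₂, hr₂, hball₂⟩ := Metric.eventually_nhds_iff_ball.1 e2
  have small : ∀ᶠ ρ in 𝓝[>] (0 : ℝ), 0 < ρ ∧ ρ < r₁ ∧ ρ < r₂ ∧ C * ρ < 1 ∧ b * C * ρ < m / 8 := by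
    have hid : Tendsto (fun ρ : ℝ => ρ) (𝓝[>] 0) (𝓝 0) := tendsto_id.mono_left nhdsWithin_le_nhds
    have h1 : Tendsto (fun ρ : ℝ => C * ρ) (𝓝[>] 0) (𝓝 0) := by simpa using hid.const_mul C
    have h2 : Tendsto (fun ρ : ℝ => b * C * ρ) (𝓝[>] 0) (𝓝 0) := by simpa using hid.const_mul (b * C)
    filter_upwards [self_mem_nhdsWithin, hid.eventually (gt_mem_nhds hr₁),
      hid.eventually (gt_mem_nhds hr₂), h1.eventually (gt_mem_nhds one_pos),
      h2.eventually (gt_mem_nhds (show 0 < m / 8 by positivity))] with ρ a1 a2 a3 a4 a5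
    exact ⟨a1, a2, a3, a4, a5⟩
  filter_upwards [small] with ρ ⟨hρ, hρ₁, hρ₂, hρC, hρb⟩
  -- This `δ` makes the worst term harmless: `|h v| ‖Dμ v‖ ≤ C ‖v‖² ‖Dμ v‖ ≤ C δ ‖v‖ ≤ m / 8 * ‖v‖`.
  -- A cutoff at a single scale would only make it comparable with `‖v‖`.
  obtain ⟨μ, hμ, hμ01, hμ1, hμ0, hμδ⟩ := exists_log_cutoff (E := ℂ)
    (δ := m / (8 * (C + 1))) (by positivity) hρ
  have hest : ∀ v : ℂ, ‖v‖ ≤ ρ → |μ v * h v| ≤ C * ‖v‖ ^ 2 := by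
    intro v hv
    have h1 := (hball₁ v (by rw [mem_ball_zero_iff]; linarith)).2
    rw [abs_mul, abs_of_nonneg (hμ01 v).1]
    calc μ v * |h v| ≤ 1 * |h v| := by gcongr; exact (hμ01 v).2
      _ ≤ _ := by rw [one_mul]; exact h1
  refine ⟨μ, hμ, hμ1, hμ0, fun v => ?_, fun v hv0 hv => ?_⟩
  · rcases le_or_gt ρ ‖v‖ with h1 | h1
    · simp [hμ0 v h1, hρ.le]
    · refine (hest v h1.le).trans ?_
      nlinarith [norm_nonneg v, mul_nonneg hC (norm_nonneg v)]
  · have hnv : 0 < ‖v‖ := norm_pos_iff.2 hv0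
    have hvb := hball₁ v (by rw [mem_ball_zero_iff]; linarith)
    set k := μ v * h v with hk
    have hkle := hest v hv
    have hkv : |k| ≤ ‖v‖ := by
      refine hkle.trans ?_
      nlinarith [mul_nonneg hC (norm_nonneg v)]
    have hx : ‖(v, k)‖ = ‖v‖ := by
      rw [Prod.norm_def]
      exact max_eq_left hkv
    have hf2 := hball₂ (v, k) (by rw [mem_ball_zero_iff, hx]; linarith)
    rw [hx] at hf2
    have hsplit : fderiv ℝ f 0 (v, k) = a v + k • fderiv ℝ f 0 (0, 1) := by
      rw [ha, ContinuousLinearMap.comp_apply, ← map_smul, ← map_add]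
      simp
    have hprod : fderiv ℝ (fun v => μ v * h v) v = μ v • fderiv ℝ h v + h v • fderiv ℝ μ v :=
      fderiv_fun_mul (hμ.differentiable (by simp) v) (hh.differentiable (by simp) v)
    intro hcontra
    rw [hprod] at hcontra
    -- At a zero the leading term equals a sum of four errors, each at most `m / 8 * ‖v‖`: the
    -- Taylor remainders of `Dh` and `f`, the cutoff term, and the dependence of `f` on the height.
    -- This contradicts the lower bound `m * ‖v‖`.
    have hid : (μ v • B - a) v = -(μ v • (fderiv ℝ h v - B v)) - h v • fderiv ℝ μ v +
        (f (v, k) - fderiv ℝ f 0 (v, k)) + k • fderiv ℝ f 0 (0, 1) := by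
      rw [← hcontra, hsplit, sub_apply, smul_apply]
      module
    have hlow' := hlow (μ v) (hμ01 v) v
    have n1 : ‖μ v • (fderiv ℝ h v - B v)‖ ≤ m / 8 * ‖v‖ := by
      rw [norm_smul, Real.norm_of_nonneg (hμ01 v).1]
      calc μ v * ‖fderiv ℝ h v - B v‖ ≤ 1 * ‖fderiv ℝ h v - B v‖ := by
            gcongr; exact (hμ01 v).2
        _ ≤ _ := by rw [one_mul]; exact hvb.1
    have n2 : ‖h v • fderiv ℝ μ v‖ ≤ m / 8 * ‖v‖ := by
      rw [norm_smul, Real.norm_eq_abs]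
      calc |h v| * ‖fderiv ℝ μ v‖ ≤ C * ‖v‖ ^ 2 * ‖fderiv ℝ μ v‖ := by gcongr; exact hvb.2
        _ = C * ‖v‖ * (‖fderiv ℝ μ v‖ * ‖v‖) := by ring
        _ ≤ C * ‖v‖ * (m / (8 * (C + 1))) := by gcongr; exact hμδ v
        _ = m / 8 * ‖v‖ * (C / (C + 1)) := by field_simp
        _ ≤ m / 8 * ‖v‖ * 1 := by
            gcongr
            exact (div_le_one (by positivity)).2 (by linarith)
        _ = _ := mul_one _
    have n3 : ‖k • fderiv ℝ f 0 (0, 1)‖ ≤ m / 8 * ‖v‖ := by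
      rw [norm_smul, Real.norm_eq_abs, ← hb]
      have hb0 : 0 ≤ b := norm_nonneg _
      calc |k| * b ≤ C * ‖v‖ ^ 2 * b := by gcongr
        _ = b * C * ‖v‖ * ‖v‖ := by ring
        _ ≤ b * C * ρ * ‖v‖ := by gcongr
        _ ≤ m / 8 * ‖v‖ := by gcongr
    have hn : ‖(μ v • B - a) v‖ ≤ m / 8 * ‖v‖ + m / 8 * ‖v‖ + m / 8 * ‖v‖ + m / 8 * ‖v‖ := by
      rw [hid]
      refine (norm_add_le _ _).trans (add_le_add ((norm_add_le _ _).trans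
        (add_le_add ((norm_sub_le _ _).trans (add_le_add ?_ n2)) hf2)) n3)
      rw [norm_neg]
      exact n1
    nlinarith [mul_pos hm hnv]

end Perturbation

/-! ### Linear algebra of compatible complex structures on a contact plane. -/

section TameAlgebra

variable {α : Euc 3 →L[ℝ] ℝ} {β : Euc 3 →L[ℝ] Euc 3 →L[ℝ] ℝ} {X : Euc 3}

/-- Three vectors on which `α ∧ β` does not vanish span the space. -/
theorem span_of_wedge (hβ : ∀ v w, β v w = -β w v) {u v w : Euc 3}
    (h : wedge₁₂ α β u v w ≠ 0) (x : Euc 3) : ∃ a b c : ℝ, x = a • u + b • v + c • w := by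
  have hli : LinearIndependent ℝ ![u, v, w] := by
    refine Fintype.linearIndependent_iff.2 fun c hc => ?_
    have hc' : c 0 • u + c 1 • v + c 2 • w = 0 := by
      simpa [Fin.sum_univ_three] using hc
    have := coeff_eq_zero_of_wedge α β hβ h (a := c 0) (b := c 1) (c := c 2)
      (fun x y => by rw [hc']; simp [wedge₁₂])
    intro i
    fin_cases i
    exacts [this.1, this.2.1, this.2.2]
  have hx : x ∈ Submodule.span ℝ (Set.range ![u, v, w]) := by
    rw [hli.span_eq_top_of_card_eq_finrank (by simp)]; trivial
  obtain ⟨c, hc⟩ := (Submodule.mem_span_range_iff_exists_fun ℝ).1 hx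
  exact ⟨c 0, c 1, c 2, by rw [← hc]; simp [Fin.sum_univ_three]⟩

/-- The endomorphism which, along the projection `π = 1 - α ⊗ X` onto `ker α`, maps `π v₁` to `π v₂`
and `π v₂` to `-π v₁`. -/
def frameRotation (α : Euc 3 →L[ℝ] ℝ) (β : Euc 3 →L[ℝ] Euc 3 →L[ℝ] ℝ) (X v₁ v₂ : Euc 3) :
    Euc 3 →L[ℝ] Euc 3 :=
  (β v₁ v₂)⁻¹ • ((β.flip v₂).smulRight (v₂ - α v₂ • X) + (β.flip v₁).smulRight (v₁ - α v₁ • X))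

theorem frameRotation_apply (v₁ v₂ w : Euc 3) : frameRotation α β X v₁ v₂ w =
    (β v₁ v₂)⁻¹ • (β w v₂ • (v₂ - α v₂ • X) + β w v₁ • (v₁ - α v₁ • X)) := by
  simp [frameRotation]

/-- Endomorphisms of the form `A = A ∘ π` for which `β (·, A ·)` is an inner product on `ker α`. -/
structure IsTame (α : Euc 3 →L[ℝ] ℝ) (β : Euc 3 →L[ℝ] Euc 3 →L[ℝ] ℝ) (X : Euc 3)
    (A : Euc 3 →L[ℝ] Euc 3) : Prop where
  map_reeb : A X = 0
  map_ker : ∀ v, α (A v) = 0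
  symm : ∀ v w, β v (A w) = β w (A v)
  pos : ∀ v, α v = 0 → v ≠ 0 → 0 < β v (A v)

/-- This is what allows gluing by a partition of unity. The condition `A² = -1` is not convex, so it
is left out of `IsTame` and restored afterwards by a scalar factor. -/
theorem convex_isTame : Convex ℝ {A | IsTame α β X A} := by
  rw [convex_iff_forall_pos]
  intro A hA B hB s t hs ht _
  refine ⟨?_, fun v => ?_, fun v w => ?_, fun v hv hv0 => ?_⟩
  · simp [hA.map_reeb, hB.map_reeb]
  · simp [hA.map_ker, hB.map_ker]
  · simp [hA.symm v w, hB.symm v w]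
  · have h1 := hA.pos v hv hv0
    have h2 := hB.pos v hv hv0
    simp only [add_apply, smul_apply, map_add, map_smul, smul_eq_mul]
    positivity

theorem wedge_reeb (hβX : ∀ w, β X w = 0) (hα : α X = 1) (hβ : ∀ v w, β v w = -β w v)
    (v w : Euc 3) : wedge₁₂ α β X v w = β v w := by
  have : β w X = 0 := by rw [hβ, hβX, neg_zero]
  simp [wedge₁₂, hα, hβX, this]

/-- The quadratic form is `(β(v, v₂)² + β(v, v₁)²) / β(v₁, v₂)`. Since `X, v₁, v₂` is a basis, both
squares vanish only for multiples of `X`, and these meet `ker α` in zero. -/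
theorem isTame_frameRotation (hβX : ∀ w, β X w = 0) (hα : α X = 1)
    (hβ : ∀ v w, β v w = -β w v) {v₁ v₂ : Euc 3} (h : 0 < β v₁ v₂) :
    IsTame α β X (frameRotation α β X v₁ v₂) := by
  have hX : ∀ w, β w X = 0 := fun w => by rw [hβ, hβX, neg_zero]
  have hself : ∀ w, β w w = 0 := fun w => by linarith [hβ w w]
  refine ⟨?_, fun v => ?_, fun v w => ?_, fun v hv hv0 => ?_⟩
  · simp [frameRotation_apply, hβX]
  · simp [frameRotation_apply, hα]
  · simp only [frameRotation_apply, map_smul, map_add, map_sub, hX, smul_eq_mul]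
    ring
  · have h1 : β v (frameRotation α β X v₁ v₂ v) = (β v₁ v₂)⁻¹ * (β v v₂ ^ 2 + β v v₁ ^ 2) := by
      simp only [frameRotation_apply, map_smul, map_add, map_sub, hX, smul_eq_mul]
      ring
    rw [h1]
    apply mul_pos (inv_pos.2 h)
    by_contra hcon
    have e1 : β v v₂ = 0 := by nlinarith [sq_nonneg (β v v₁), sq_nonneg (β v v₂)]
    have e2 : β v v₁ = 0 := by nlinarith [sq_nonneg (β v v₁), sq_nonneg (β v v₂)]
    obtain ⟨a, b, c, hv'⟩ := span_of_wedge (α := α) hβ (u := X) (v := v₁) (w := v₂)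
      (by rw [wedge_reeb hβX hα hβ]; exact h.ne') v
    rw [hv'] at e1 e2
    simp only [map_add, map_smul, add_apply, smul_apply, hβX, smul_eq_mul, hself] at e1 e2
    have hb : b = 0 := by
      refine (mul_eq_zero.1 ?_).resolve_right h.ne'
      linarith
    have hc : c = 0 := by
      refine (mul_eq_zero.1 ?_).resolve_right h.ne'
      rw [hβ v₂ v₁] at e2
      linarith
    rw [hb, hc, zero_smul, zero_smul, add_zero, add_zero] at hv'
    rw [hv', map_smul, hα, smul_eq_mul, mul_one] at hv
    exact hv0 (by rw [hv', hv, zero_smul])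

theorem frameRotation_apply_left
    (hβ : ∀ v w, β v w = -β w v) {v₁ v₂ : Euc 3} (h : 0 < β v₁ v₂) :
    frameRotation α β X v₁ v₂ v₁ = v₂ - α v₂ • X := by
  have hself : ∀ w, β w w = 0 := fun w => by linarith [hβ w w]
  rw [frameRotation_apply, hself, zero_smul, add_zero, smul_smul, inv_mul_cancel₀ h.ne', one_smul]

theorem frameRotation_apply_right
    (hβ : ∀ v w, β v w = -β w v) {v₁ v₂ : Euc 3} (h : 0 < β v₁ v₂) :
    frameRotation α β X v₁ v₂ v₂ = -(v₁ - α v₁ • X) := by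
  have hself : ∀ w, β w w = 0 := fun w => by linarith [hβ w w]
  rw [frameRotation_apply, hself, zero_smul, zero_add, smul_smul, hβ v₂ v₁, mul_neg,
    inv_mul_cancel₀ h.ne', neg_one_smul]

/-- The number `δ` with `A² = -δ` on `ker α`. -/
def negSq (A : Euc 3 →L[ℝ] Euc 3) : ℝ := -(LinearMap.trace ℝ (Euc 3) (A.comp A).toLinearMap) / 2

/-- Here `A² = -δ (1 - α ⊗ X)`, and the projection `1 - α ⊗ X` onto the plane has trace `2`.
Expressing `δ` by a trace makes it visibly smooth in `A` and independent of coordinates. -/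
theorem negSq_eq {A : Euc 3 →L[ℝ] Euc 3} {δ : ℝ} (hα : α X = 1) (hAX : A X = 0)
    (h : ∀ v, α v = 0 → A (A v) = -δ • v) : negSq A = δ := by
  have h1 : (A.comp A).toLinearMap = (-δ) • (LinearMap.id - α.toLinearMap.smulRight X) := by
    ext1 w
    have h2 := h (w - α w • X) (by simp [hα])
    rw [map_sub, map_smul, hAX, smul_zero, sub_zero] at h2
    simpa using h2
  rw [negSq, h1, map_smul, map_sub, LinearMap.trace_id, LinearMap.trace_smulRight]
  simp [hα]
  ring

theorem exists_ker_ne_zero (α : Euc 3 →L[ℝ] ℝ) : ∃ v, α v = 0 ∧ v ≠ 0 := by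
  have h1 : 0 < Module.finrank ℝ (LinearMap.ker α.toLinearMap) := by
    have h2 := LinearMap.finrank_range_add_finrank_ker α.toLinearMap
    have h3 : Module.finrank ℝ (LinearMap.range α.toLinearMap) ≤ 1 := by
      simpa using Submodule.finrank_le (LinearMap.range α.toLinearMap)
    simp at h2
    omega
  have := Module.finrank_pos_iff.1 h1
  obtain ⟨v, hv⟩ := exists_ne (0 : LinearMap.ker α.toLinearMap)
  exact ⟨v, v.2, fun h => hv (Subtype.ext h)⟩

/-- For `v ≠ 0` in the plane, `X, v, A v` is a basis. Expand `A (A v)` in it: the `X`-component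
vanishes because the image lies in `ker α`, the `A v`-component by symmetry of `β(·, A ·)`, and
positivity at `A v` makes the remaining coefficient negative. -/
theorem IsTame.sq {A : Euc 3 →L[ℝ] Euc 3} (hA : IsTame α β X A) (hβX : ∀ w, β X w = 0)
    (hα : α X = 1) (hβ : ∀ v w, β v w = -β w v) :
    0 < negSq A ∧ ∀ v, α v = 0 → A (A v) = -negSq A • v := by
  have hself : ∀ w, β w w = 0 := fun w => by linarith [hβ w w]
  have hX : ∀ w, β w X = 0 := fun w => by rw [hβ, hβX, neg_zero]
  obtain ⟨v, hv, hv0⟩ := exists_ker_ne_zero α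
  have hpos := hA.pos v hv hv0
  have hspan := span_of_wedge (α := α) hβ (u := X) (v := v) (w := A v)
      (by rw [wedge_reeb hβX hα hβ]; exact hpos.ne')
  obtain ⟨a, b, c, habc⟩ := hspan (A (A v))
  have ha : a = 0 := by
    have := congrArg α habc
    simpa [hA.map_ker, hα, hv] using this.symm
  have hc : c = 0 := by
    have h1 := hA.symm v (A v)
    rw [hself, habc, ha] at h1
    simp only [map_add, map_smul, hX, hself, smul_eq_mul, mul_zero, zero_add] at h1
    exact (mul_eq_zero.1 h1).resolve_right hpos.ne'
  rw [ha, hc, zero_smul, zero_smul, zero_add, add_zero] at habc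
  have hAv0 : A v ≠ 0 := fun h => by rw [h, map_zero] at hpos; exact lt_irrefl _ hpos
  have hb : b < 0 := by
    have h1 := hA.pos (A v) (hA.map_ker v) hAv0
    rw [habc, map_smul, smul_eq_mul, hβ] at h1
    nlinarith
  have hall : ∀ w, α w = 0 → A (A w) = -(-b) • w := by
    intro w hw
    obtain ⟨p, q, r, hpqr⟩ := hspan w
    have hp : p = 0 := by
      have := congrArg α hpqr
      simpa [hA.map_ker, hα, hv, hw] using this.symm
    rw [hpqr, hp, zero_smul, zero_add, map_add, map_smul, map_smul, map_add, map_smul, map_smul,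
      habc, map_smul, neg_neg, smul_add, smul_comm, smul_comm r b]
  have hneg := negSq_eq hα hA.map_reeb hall
  rw [hneg]
  exact ⟨by linarith, hall⟩

theorem negSq_frameRotation (hβX : ∀ w, β X w = 0) (hα : α X = 1)
    (hβ : ∀ v w, β v w = -β w v) {v₁ v₂ : Euc 3} (h : 0 < β v₁ v₂) :
    negSq (frameRotation α β X v₁ v₂) = 1 := by
  have ht := isTame_frameRotation (α := α) hβX hα hβ h
  have hX : ∀ w, β w X = 0 := fun w => by rw [hβ, hβX, neg_zero]
  set A := frameRotation α β X v₁ v₂ with hA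
  have h1 : A v₁ = v₂ - α v₂ • X := frameRotation_apply_left hβ h
  have h2 : A v₂ = -(v₁ - α v₁ • X) := frameRotation_apply_right hβ h
  have h3 : A (A (v₁ - α v₁ • X)) = -(v₁ - α v₁ • X) := by
    rw [map_sub, map_smul, ht.map_reeb, smul_zero, sub_zero, h1, map_sub, map_smul, ht.map_reeb,
      smul_zero, sub_zero, h2]
  have h4 := (ht.sq hβX hα hβ).2 (v₁ - α v₁ • X) (by simp [hα])
  rw [h3] at h4
  have h5 := congrArg (fun x => β x v₂) h4
  simp only [neg_smul, map_neg, map_smul, neg_apply, smul_apply, map_sub, sub_apply, hβX,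
    smul_eq_mul, mul_zero, sub_zero] at h5
  nlinarith

/-- Explicit formula for the Reeb vector. -/
theorem eq_reeb_formula (hβ : ∀ v w, β v w = -β w v) (hα : α X = 1) (hβX : ∀ w, β X w = 0)
    {u v w : Euc 3} (h : wedge₁₂ α β u v w ≠ 0) :
    X = (wedge₁₂ α β u v w)⁻¹ • (β v w • u + β w u • v + β u v • w) := by
  have self : ∀ v, β v v = 0 := fun v => by linarith [hβ v v]
  obtain ⟨a, b, c, rfl⟩ := span_of_wedge hβ h X
  have e0 := hβX u
  have e1 := hβX v
  have e2 := hβX w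
  simp only [map_add, map_smul, add_apply, smul_apply, smul_eq_mul, self] at hα e0 e1 e2
  rw [hβ w u] at *
  rw [hβ v u] at e0
  rw [hβ w v] at e1
  have ha : wedge₁₂ α β u v w * a = β v w := by
    simp only [wedge₁₂, hβ w u]
    linear_combination β v w * hα + α w * e1 - α v * e2
  have hb : wedge₁₂ α β u v w * b = -β u w := by
    simp only [wedge₁₂, hβ w u]
    linear_combination -β u w * hα - α w * e0 + α u * e2
  have hc : wedge₁₂ α β u v w * c = β u v := by
    simp only [wedge₁₂, hβ w u]
    linear_combination β u v * hα + α v * e0 - α u * e1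
  rw [← ha, ← hb, ← hc, mul_smul, mul_smul, mul_smul, ← smul_add, ← smul_add, smul_smul,
    inv_mul_cancel₀ h, one_smul]

end TameAlgebra

/-! ### Smoothness of the Reeb field and of frame rotations, in trivializations. -/

section SmoothSections

variable {M : Type*} [TopologicalSpace M] [ChartedSpace (Euc 3) M] [IsManifold (𝓡 3) ∞ M]
  {E : Type*} [NormedAddCommGroup E] [NormedSpace ℝ E]

theorem lam_d_skew (lam : ContactForm M) (p : M) (v w : TangentSpace (𝓡 3) p) :
    lam.d p v w = -lam.d p w v := by
  rw [lam_d_apply, lam_d_apply]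
  exact (neg_sub _ _).symm

theorem ContDiffAt.clm_flip {F G H : Type*} [NormedAddCommGroup F] [NormedSpace ℝ F]
    [NormedAddCommGroup G] [NormedSpace ℝ G] [NormedAddCommGroup H] [NormedSpace ℝ H]
    {β : E → F →L[ℝ] G →L[ℝ] H} {x : E} (hβ : ContDiffAt ℝ ∞ β x) :
    ContDiffAt ℝ ∞ (fun y => (β y).flip) x := by
  have h : ContDiff ℝ ∞ fun f : F →L[ℝ] G →L[ℝ] H => f.flip :=
    ContinuousLinearMap.contDiff (𝕜 := ℝ) (E := F →L[ℝ] G →L[ℝ] H) (F := G →L[ℝ] F →L[ℝ] H)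
      (ContinuousLinearMap.flipₗᵢ ℝ F G H).toContinuousLinearEquiv.toContinuousLinearMap
  exact h.contDiffAt.comp x hβ

theorem form_reeb (lam : ContactForm M) (p : M) : lam.form p (lam.reeb p) = 1 :=
  (lam.existsUnique_reeb p).choose_spec.1.1

theorem d_reeb (lam : ContactForm M) (p : M) (w : TangentSpace (𝓡 3) p) :
    lam.d p (lam.reeb p) w = 0 :=
  (lam.existsUnique_reeb p).choose_spec.1.2 w

/-- Base points often agree only propositionally, as in `φ.symm (φ q) = q`, while fibre types depend
on them. Reading vectors in `Euc 3` permits the substitution. -/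
theorem form_congr (lam : ContactForm M) {p q : M} (h : p = q) (x : Euc 3) :
    (lam.form p : Euc 3 →L[ℝ] ℝ) x = (lam.form q : Euc 3 →L[ℝ] ℝ) x := by
  subst h; rfl

theorem d_congr (lam : ContactForm M) {p q : M} (h : p = q) (x y : Euc 3) :
    (lam.d p : Euc 3 →L[ℝ] Euc 3 →L[ℝ] ℝ) x y = (lam.d q : Euc 3 →L[ℝ] Euc 3 →L[ℝ] ℝ) x y := by
  subst h; rfl

/-- The identification of `T_q M` with `ℝ³` through the preferred chart at `p`. -/
def toCoord (p q : M) : Euc 3 →L[ℝ] Euc 3 :=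
  (trivializationAt (Euc 3) (TangentSpace (𝓡 3) (M := M)) p).continuousLinearMapAt ℝ q

/-- The inverse of `toCoord`. -/
def ofCoord (p q : M) : Euc 3 →L[ℝ] Euc 3 :=
  (trivializationAt (Euc 3) (TangentSpace (𝓡 3) (M := M)) p).symmL ℝ q

theorem ofCoord_toCoord {p q : M} (hq : q ∈ (chartAt (Euc 3) p).source) (v : Euc 3) :
    ofCoord p q (toCoord p q v) = v :=
  (trivializationAt (Euc 3) (TangentSpace (𝓡 3) (M := M)) p).symmL_continuousLinearMapAt
    (R := ℝ) (by simpa using hq) _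

theorem ofCoord_eq {p q : M} (hq : q ∈ (chartAt (Euc 3) p).source) :
    ofCoord p q = mfderiv 𝓘(ℝ, Euc 3) (𝓡 3) (extChartAt (𝓡 3) p).symm (extChartAt (𝓡 3) p q) := by
  have := TangentBundle.symmL_trivializationAt (𝕜 := ℝ) (I := 𝓡 3) (x₀ := p) hq
  rw [ModelWithCorners.range_eq_univ, mfderivWithin_univ] at this
  exact this

theorem toCoord_eq {p q : M} (hq : q ∈ (chartAt (Euc 3) p).source) :
    toCoord p q = mfderiv (𝓡 3) 𝓘(ℝ, Euc 3) (extChartAt (𝓡 3) p) q :=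
  TangentBundle.continuousLinearMapAt_trivializationAt (𝕜 := ℝ) (I := 𝓡 3) (x₀ := p) hq

omit [IsManifold (𝓡 3) ∞ M] in
theorem eventually_mem_chart_source (p : M) : ∀ᶠ q in 𝓝 p, q ∈ (chartAt (Euc 3) p).source :=
  (chartAt (Euc 3) p).open_source.mem_nhds (mem_chart_source _ _)

/-- The contact form in the trivialization at `p`. -/
def coordForm (lam : ContactForm M) (p q : M) : Euc 3 →L[ℝ] ℝ :=
  ContinuousLinearMap.comp (lam.form q : Euc 3 →L[ℝ] ℝ) (ofCoord p q)

/-- The 2-form `dλ` in the trivialization at `p`. -/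
def coordD (lam : ContactForm M) (p q : M) : Euc 3 →L[ℝ] Euc 3 →L[ℝ] ℝ :=
  ContinuousLinearMap.bilinearComp (lam.d q : Euc 3 →L[ℝ] Euc 3 →L[ℝ] ℝ) (ofCoord p q) (ofCoord p q)

theorem contMDiffAt_coordForm (lam : ContactForm M) (p : M) :
    ContMDiffAt (𝓡 3) 𝓘(ℝ, Euc 3 →L[ℝ] ℝ) ∞ (coordForm lam p) p := by
  have h1 : ContDiffAt ℝ ∞ (pullForm lam (extChartAt (𝓡 3) p).symm) (extChartAt (𝓡 3) p p) :=
    contDiffAt_pullForm lam (contMDiffAt_extChartAt_symm' p (mem_extChartAt_target p))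
  refine (h1.comp_contMDiffAt (contMDiffAt_extChartAt (x := p))).congr_of_eventuallyEq ?_
  filter_upwards [eventually_mem_chart_source p] with q hq
  refine ContinuousLinearMap.ext fun v => ?_
  rw [coordForm, ofCoord_eq hq]
  exact (form_congr lam ((extChartAt (𝓡 3) p).left_inv (by simpa using hq)) _).symm

/-- By definition `lam.d q` uses the preferred chart at `q`, which need not depend continuously on
`q`. Naturality expresses it for all `q` near `p` in the single chart at `p`, where it is a
derivative of a smooth form. -/
theorem contMDiffAt_coordD (lam : ContactForm M) (p : M) :
    ContMDiffAt (𝓡 3) 𝓘(ℝ, Euc 3 →L[ℝ] Euc 3 →L[ℝ] ℝ) ∞ (coordD lam p) p := by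
  have h1 : ContDiffAt ℝ ∞ (pullForm lam (extChartAt (𝓡 3) p).symm) (extChartAt (𝓡 3) p p) :=
    contDiffAt_pullForm lam (contMDiffAt_extChartAt_symm' p (mem_extChartAt_target p))
  have h2 := h1.fderiv_right (m := ∞) (by simp)
  have h3 : ContDiffAt ℝ ∞ (fun y => fderiv ℝ (pullForm lam (extChartAt (𝓡 3) p).symm) y -
      (fderiv ℝ (pullForm lam (extChartAt (𝓡 3) p).symm) y).flip) (extChartAt (𝓡 3) p p) :=
    h2.sub h2.clm_flip
  refine (h3.comp_contMDiffAt (contMDiffAt_extChartAt (x := p))).congr_of_eventuallyEq ?_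
  filter_upwards [eventually_mem_chart_source p] with q hq
  refine ContinuousLinearMap.ext fun v => ContinuousLinearMap.ext fun w => ?_
  have hq' : q ∈ (extChartAt (𝓡 3) p).source := by simpa using hq
  have h4 := lam_d_mfderiv lam
    (contMDiffAt_extChartAt_symm' p ((extChartAt (𝓡 3) p).map_source hq')) v w
  rw [coordD, ofCoord_eq hq]
  exact (d_congr lam ((extChartAt (𝓡 3) p).left_inv hq') _ _).symm.trans h4

theorem coordForm_toCoord (lam : ContactForm M) {p q : M} (hq : q ∈ (chartAt (Euc 3) p).source)
    (v : Euc 3) : coordForm lam p q (toCoord p q v) = lam.form q v :=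
  congrArg (lam.form q : Euc 3 →L[ℝ] ℝ) (ofCoord_toCoord hq v)

theorem coordD_toCoord (lam : ContactForm M) {p q : M} (hq : q ∈ (chartAt (Euc 3) p).source)
    (v w : Euc 3) : coordD lam p q (toCoord p q v) w = lam.d q v (ofCoord p q w) :=
  congrArg (fun x => (lam.d q : Euc 3 →L[ℝ] Euc 3 →L[ℝ] ℝ) x (ofCoord p q w)) (ofCoord_toCoord hq v)

theorem coordD_skew (lam : ContactForm M) (p q : M) (v w : Euc 3) :
    coordD lam p q v w = -coordD lam p q w v := lam_d_skew lam q _ _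

/-- The Reeb vector is a rational expression in `λ` and `dλ` whose denominator is the value of `λ ∧
dλ` on a fixed frame, nonzero near `p` by the contact condition. -/
theorem contMDiffAt_coordReeb (lam : ContactForm M) (p : M) :
    ContMDiffAt (𝓡 3) 𝓘(ℝ, Euc 3) ∞ (fun q => toCoord p q (lam.reeb q)) p := by
  obtain ⟨u, v, w, huvw⟩ := lam.contact p
  have hα := contMDiffAt_coordForm lam p
  have hβ := contMDiffAt_coordD lam p
  have hα' : ∀ x : Euc 3, ContMDiffAt (𝓡 3) 𝓘(ℝ, ℝ) ∞ (fun q => coordForm lam p q x) p :=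
    fun x => hα.clm_apply contMDiffAt_const
  have hβ' : ∀ x y : Euc 3, ContMDiffAt (𝓡 3) 𝓘(ℝ, ℝ) ∞ (fun q => coordD lam p q x y) p :=
    fun x y => (hβ.clm_apply contMDiffAt_const).clm_apply contMDiffAt_const
  set u' := toCoord p p u
  set v' := toCoord p p v
  set w' := toCoord p p w
  have hW : ContMDiffAt (𝓡 3) 𝓘(ℝ, ℝ) ∞
      (fun q => wedge₁₂ (coordForm lam p q) (coordD lam p q) u' v' w') p :=
    (((hα' u').mul (hβ' v' w')).add ((hα' v').mul (hβ' w' u'))).add ((hα' w').mul (hβ' u' v'))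
  have hp := mem_chart_source (Euc 3) p
  have hW0 : wedge₁₂ (coordForm lam p p) (coordD lam p p) u' v' w' ≠ 0 := by
    simp only [wedge₁₂, u', v', w']
    rw [coordForm_toCoord lam hp, coordForm_toCoord lam hp, coordForm_toCoord lam hp,
      coordD_toCoord lam hp, coordD_toCoord lam hp, coordD_toCoord lam hp, ofCoord_toCoord hp,
      ofCoord_toCoord hp, ofCoord_toCoord hp]
    exact huvw
  have hX : ContMDiffAt (𝓡 3) 𝓘(ℝ, Euc 3) ∞ (fun q =>
      (wedge₁₂ (coordForm lam p q) (coordD lam p q) u' v' w')⁻¹ •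
        (coordD lam p q v' w' • u' + coordD lam p q w' u' • v' + coordD lam p q u' v' • w')) p :=
    (hW.inv₀ hW0).smul ((((hβ' v' w').smul contMDiffAt_const).add
      ((hβ' w' u').smul contMDiffAt_const)).add ((hβ' u' v').smul contMDiffAt_const))
  refine hX.congr_of_eventuallyEq ?_
  filter_upwards [eventually_mem_chart_source p, hW.continuousAt.eventually_ne hW0] with q hq hq'
  refine eq_reeb_formula (coordD_skew lam p q) ?_ (fun w => ?_) hq'
  · exact (coordForm_toCoord lam hq _).trans (form_reeb lam q)
  · exact (coordD_toCoord lam hq _ _).trans (d_reeb lam q _)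

/-- The vector field `q ↦ f_* η` along a local diffeomorphism `f` with inverse `g`. -/
def pushField (f : E → M) (g : M → E) (η : E) (q : M) : Euc 3 :=
  mfderiv 𝓘(ℝ, E) (𝓡 3) f (g q) η

theorem contMDiffAt_coord_pushField {f : E → M} {g : M → E} {p : M}
    (hf : ContMDiffAt 𝓘(ℝ, E) (𝓡 3) ∞ f (g p)) (hg : ContMDiffAt (𝓡 3) 𝓘(ℝ, E) ∞ g p)
    (hfg : ∀ᶠ q in 𝓝 p, f (g q) = q) (η : E) :
    ContMDiffAt (𝓡 3) 𝓘(ℝ, Euc 3) ∞ (fun q => toCoord p q (pushField f g η q)) p := by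
  have hp : f (g p) = p := hfg.self_of_nhds
  have hs : ContMDiffAt 𝓘(ℝ, E) 𝓘(ℝ, Euc 3) ∞ (fun x => extChartAt (𝓡 3) p (f x)) (g p) := by
    have h1 : ContMDiffAt (𝓡 3) 𝓘(ℝ, Euc 3) ∞ (extChartAt (𝓡 3) p) (f (g p)) := by
      rw [hp]; exact contMDiffAt_extChartAt
    exact h1.comp (g p) hf
  have h2 := (contMDiffAt_iff_contDiffAt.1 hs).fderiv_right (m := ∞) (by simp)
  have h3 : ContMDiffAt (𝓡 3) 𝓘(ℝ, Euc 3) ∞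
      (fun q => fderiv ℝ (fun x => extChartAt (𝓡 3) p (f x)) (g q) η) p :=
    (h2.comp_contMDiffAt hg).clm_apply contMDiffAt_const
  have hfd : ∀ᶠ x in 𝓝 (g p), MDifferentiableAt 𝓘(ℝ, E) (𝓡 3) f x := by
    have h4 : ContMDiffAt 𝓘(ℝ, E) (𝓡 3) 1 f (g p) := hf.of_le (by exact_mod_cast le_top)
    filter_upwards [(contMDiffAt_iff_contMDiffAt_nhds (by simp)).1 h4] with x hx using hx.mdifferentiableAt (by simp)
  refine h3.congr_of_eventuallyEq ?_
  filter_upwards [eventually_mem_chart_source p, hg.continuousAt.eventually hfd, hfg] with q hq h4 h5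
  rw [toCoord_eq hq, pushField]
  have hmd : MDifferentiableAt (𝓡 3) 𝓘(ℝ, Euc 3) (extChartAt (𝓡 3) p) (f (g q)) := by
    rw [h5]; exact mdifferentiableAt_extChartAt hq
  have h6 := mfderiv_comp (g q) hmd h4
  rw [mfderiv_eq_fderiv] at h6
  have h7 := congrArg (fun L : E →L[ℝ] Euc 3 => L η) h6
  refine Eq.trans ?_ h7.symm
  have h8 : ∀ (a b : M) (hab : a = b) (x : Euc 3),
      (mfderiv (𝓡 3) 𝓘(ℝ, Euc 3) (extChartAt (𝓡 3) p) b : Euc 3 →L[ℝ] Euc 3) x =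
        (mfderiv (𝓡 3) 𝓘(ℝ, Euc 3) (extChartAt (𝓡 3) p) a : Euc 3 →L[ℝ] Euc 3) x := by
    intro a b hab x; subst hab; rfl
  exact h8 _ _ h5 _

/-- Smoothness of an endomorphism field, read in the trivialization at `p`. -/
theorem contMDiffAt_endo_iff (A : ∀ p : M, TangentSpace (𝓡 3) p →L[ℝ] TangentSpace (𝓡 3) p) (p : M) :
    ContMDiffAt (𝓡 3) ((𝓡 3).prod 𝓘(ℝ, Euc 3 →L[ℝ] Euc 3)) ∞
      (fun p => Bundle.TotalSpace.mk' (Euc 3 →L[ℝ] Euc 3)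
        (E := fun p : M => TangentSpace (𝓡 3) p →L[ℝ] TangentSpace (𝓡 3) p) p (A p)) p ↔
    ContMDiffAt (𝓡 3) 𝓘(ℝ, Euc 3 →L[ℝ] Euc 3) ∞
      (fun q => (toCoord p q).comp ((A q : Euc 3 →L[ℝ] Euc 3).comp (ofCoord p q))) p := by
  rw [contMDiffAt_hom_bundle]
  exact ⟨fun h => h.2, fun h => ⟨contMDiffAt_id, h⟩⟩

/-- The frame rotation of two vector fields. -/
def rotationField (lam : ContactForm M) (V₁ V₂ : M → Euc 3) (p : M) :
    TangentSpace (𝓡 3) p →L[ℝ] TangentSpace (𝓡 3) p :=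
  frameRotation (lam.form p) (lam.d p) (lam.reeb p) (V₁ p) (V₂ p)

theorem ContDiffAt.frameRotation {F : Type*} [NormedAddCommGroup F] [NormedSpace ℝ F]
    {α : F → Euc 3 →L[ℝ] ℝ} {β : F → Euc 3 →L[ℝ] Euc 3 →L[ℝ] ℝ} {X v₁ v₂ : F → Euc 3} {x : F}
    (hα : ContDiffAt ℝ ∞ α x) (hβ : ContDiffAt ℝ ∞ β x) (hX : ContDiffAt ℝ ∞ X x)
    (h₁ : ContDiffAt ℝ ∞ v₁ x) (h₂ : ContDiffAt ℝ ∞ v₂ x) (h0 : β x (v₁ x) (v₂ x) ≠ 0) :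
    ContDiffAt ℝ ∞ (fun y => _root_.frameRotation (α y) (β y) (X y) (v₁ y) (v₂ y)) x := by
  have hflip : ContDiffAt ℝ ∞ (fun y => (β y).flip) x :=
    hβ.clm_flip
  refine (((hβ.clm_apply h₁).clm_apply h₂).inv h0).smul ?_
  exact ((hflip.clm_apply h₂).smulRight (h₂.sub ((hα.clm_apply h₂).smul hX))).add
    ((hflip.clm_apply h₁).smulRight (h₁.sub ((hα.clm_apply h₁).smul hX)))

/-- The rotation is natural under linear isomorphisms, so in a trivialization it is the rotation
built from the coordinate expressions of all its ingredients. -/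
theorem frameRotation_conj (α : Euc 3 →L[ℝ] ℝ) (β : Euc 3 →L[ℝ] Euc 3 →L[ℝ] ℝ) (X v₁ v₂ : Euc 3)
    {T S : Euc 3 →L[ℝ] Euc 3} (hST : ∀ v, S (T v) = v) :
    frameRotation (α.comp S) (β.bilinearComp S S) (T X) (T v₁) (T v₂) =
      T.comp ((frameRotation α β X v₁ v₂).comp S) := by
  refine ContinuousLinearMap.ext fun w => ?_
  simp only [ContinuousLinearMap.comp_apply, frameRotation_apply, hST,
    ContinuousLinearMap.bilinearComp_apply]
  simp only [map_smul, map_add, map_sub]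

theorem contMDiffAt_rotationField (lam : ContactForm M) {V₁ V₂ : M → Euc 3} {p : M}
    (h₁ : ContMDiffAt (𝓡 3) 𝓘(ℝ, Euc 3) ∞ (fun q => toCoord p q (V₁ q)) p)
    (h₂ : ContMDiffAt (𝓡 3) 𝓘(ℝ, Euc 3) ∞ (fun q => toCoord p q (V₂ q)) p)
    (h0 : 0 < (lam.d p : Euc 3 →L[ℝ] Euc 3 →L[ℝ] ℝ) (V₁ p) (V₂ p)) :
    ContMDiffAt (𝓡 3) ((𝓡 3).prod 𝓘(ℝ, Euc 3 →L[ℝ] Euc 3)) ∞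
      (fun p => Bundle.TotalSpace.mk' (Euc 3 →L[ℝ] Euc 3)
        (E := fun p : M => TangentSpace (𝓡 3) p →L[ℝ] TangentSpace (𝓡 3) p) p
          (rotationField lam V₁ V₂ p)) p := by
  rw [contMDiffAt_endo_iff]
  have hp := mem_chart_source (Euc 3) p
  have hall := (contMDiffAt_coordForm lam p).prodMk_space ((contMDiffAt_coordD lam p).prodMk_space
    ((contMDiffAt_coordReeb lam p).prodMk_space (h₁.prodMk_space h₂)))
  have hG : ContDiffAt ℝ ∞ (fun y : (Euc 3 →L[ℝ] ℝ) × (Euc 3 →L[ℝ] Euc 3 →L[ℝ] ℝ) × Euc 3 ×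
      Euc 3 × Euc 3 => frameRotation y.1 y.2.1 y.2.2.1 y.2.2.2.1 y.2.2.2.2)
      (coordForm lam p p, coordD lam p p, toCoord p p (lam.reeb p), toCoord p p (V₁ p),
        toCoord p p (V₂ p)) := by
    refine ContDiffAt.frameRotation contDiffAt_fst contDiffAt_snd.fst contDiffAt_snd.snd.fst
      contDiffAt_snd.snd.snd.fst contDiffAt_snd.snd.snd.snd ?_
    rw [coordD_toCoord lam hp, ofCoord_toCoord hp]
    exact h0.ne'
  refine (ContDiffAt.comp_contMDiffAt (f := fun q => (coordForm lam p q, coordD lam p q,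
    toCoord p q (lam.reeb q), toCoord p q (V₁ q), toCoord p q (V₂ q))) hG hall).congr_of_eventuallyEq ?_
  filter_upwards [eventually_mem_chart_source p] with q hq
  exact (frameRotation_conj _ _ _ _ _ (fun v => ofCoord_toCoord hq v)).symm

theorem isTame_rotationField (lam : ContactForm M) {V₁ V₂ : M → Euc 3} {p : M}
    (h0 : 0 < (lam.d p : Euc 3 →L[ℝ] Euc 3 →L[ℝ] ℝ) (V₁ p) (V₂ p)) :
    IsTame (lam.form p) (lam.d p) (lam.reeb p) (rotationField lam V₁ V₂ p) :=
  isTame_frameRotation (d_reeb lam p) (form_reeb lam p) (lam_d_skew lam p) h0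

/-- A trace does not change under conjugation by the trivialization, so the function is a polynomial
in the smooth coordinate matrix of `A`. -/
theorem contMDiff_negSq {A : ∀ p : M, TangentSpace (𝓡 3) p →L[ℝ] TangentSpace (𝓡 3) p}
    (hA : ContMDiff (𝓡 3) ((𝓡 3).prod 𝓘(ℝ, Euc 3 →L[ℝ] Euc 3)) ∞
      (fun p => Bundle.TotalSpace.mk' (Euc 3 →L[ℝ] Euc 3)
        (E := fun p : M => TangentSpace (𝓡 3) p →L[ℝ] TangentSpace (𝓡 3) p) p (A p))) :
    ContMDiff (𝓡 3) 𝓘(ℝ, ℝ) ∞ (fun p => negSq (A p)) := by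
  intro p
  have h1 := (contMDiffAt_endo_iff A p).1 (hA p)
  let tr : (Euc 3 →L[ℝ] Euc 3) →L[ℝ] ℝ := LinearMap.toContinuousLinearMap
    ((LinearMap.trace ℝ (Euc 3)).comp (ContinuousLinearMap.coeLM ℝ))
  have h2 : ContDiff ℝ ∞ fun B : Euc 3 →L[ℝ] Euc 3 => negSq B := by
    have : ContDiff ℝ ∞ fun B : Euc 3 →L[ℝ] Euc 3 => -(tr (B.comp B)) / 2 :=
      (tr.contDiff.comp (contDiff_id.clm_comp contDiff_id)).neg.div_const 2
    exact this
  refine (h2.contDiffAt.comp_contMDiffAt h1).congr_of_eventuallyEq ?_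
  filter_upwards [eventually_mem_chart_source p] with q hq
  set B : Euc 3 →L[ℝ] Euc 3 := A q with hB
  have e1 : ((toCoord p q).comp (B.comp (ofCoord p q))).comp
      ((toCoord p q).comp (B.comp (ofCoord p q))) =
      (toCoord p q).comp ((B.comp B).comp (ofCoord p q)) := by
    refine ContinuousLinearMap.ext fun w => ?_
    simp only [ContinuousLinearMap.comp_apply, ofCoord_toCoord hq]
  simp only [Function.comp_apply]
  change negSq B = negSq ((toCoord p q).comp (B.comp (ofCoord p q)))
  rw [negSq, negSq, e1]
  congr 2
  have e2 := LinearMap.trace_comp_comm' (R := ℝ) (ofCoord p q : Euc 3 →L[ℝ] Euc 3).toLinearMap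
    ((toCoord p q).comp (B.comp B)).toLinearMap
  have e3 : (ofCoord p q : Euc 3 →L[ℝ] Euc 3).toLinearMap ∘ₗ ((toCoord p q).comp (B.comp B)).toLinearMap
      = (B.comp B).toLinearMap := by
    ext1 w
    simp only [LinearMap.comp_apply, ContinuousLinearMap.coe_coe, ContinuousLinearMap.comp_apply,
      ofCoord_toCoord hq]
  rw [e3] at e2
  exact e2.symm

end SmoothSections

/-! ### Compatible complex structures with prescribed germs. -/

section CompatibleStructure

variable {M : Type*} [TopologicalSpace M] [ChartedSpace (Euc 3) M]
  {E : Type*} [NormedAddCommGroup E] [NormedSpace ℝ E]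

/-- `Φ` is a smooth local parametrization of `M` around `e`, with local inverse `Q`. -/
structure IsLocalParam (Φ : E → M) (Q : M → E) (e : M) : Prop where
  smooth : ∀ᶠ x in 𝓝 (Q e), ContMDiffAt 𝓘(ℝ, E) (𝓡 3) ∞ Φ x
  smooth_inv : ∀ᶠ q in 𝓝 e, ContMDiffAt (𝓡 3) 𝓘(ℝ, E) ∞ Q q
  left_inv : ∀ᶠ x in 𝓝 (Q e), Q (Φ x) = x
  right_inv : ∀ᶠ q in 𝓝 e, Φ (Q q) = q

variable [IsManifold (𝓡 3) ∞ M]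

theorem isLocalParam_extChartAt (e : M) :
    IsLocalParam (extChartAt (𝓡 3) e).symm (extChartAt (𝓡 3) e) e where
  smooth := by
    filter_upwards [(isOpen_extChartAt_target e).mem_nhds (mem_extChartAt_target e)] with x hx
    exact contMDiffAt_extChartAt_symm' e hx
  smooth_inv := by
    filter_upwards [(isOpen_extChartAt_source e).mem_nhds (mem_extChartAt_source (I := 𝓡 3) e)]
      with q hq
    exact contMDiffAt_extChartAt' (by simpa using hq)
  left_inv := by
    filter_upwards [(isOpen_extChartAt_target e).mem_nhds (mem_extChartAt_target e)] with x hx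
    exact (extChartAt (𝓡 3) e).right_inv hx
  right_inv := by
    filter_upwards [(isOpen_extChartAt_source e).mem_nhds (mem_extChartAt_source (I := 𝓡 3) e)]
      with q hq
    exact (extChartAt (𝓡 3) e).left_inv hq

theorem IsLocalParam.eventually_contMDiffAt_rotationField (lam : ContactForm M) {Φ : E → M}
    {Q : M → E} {e : M} (h : IsLocalParam Φ Q e) {η ζ : E}
    (h0 : 0 < (lam.d e : Euc 3 →L[ℝ] Euc 3 →L[ℝ] ℝ) (pushField Φ Q η e) (pushField Φ Q ζ e)) :
    ∀ᶠ q in 𝓝 e, ContMDiffAt (𝓡 3) ((𝓡 3).prod 𝓘(ℝ, Euc 3 →L[ℝ] Euc 3)) ∞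
      (fun p => Bundle.TotalSpace.mk' (Euc 3 →L[ℝ] Euc 3)
        (E := fun p : M => TangentSpace (𝓡 3) p →L[ℝ] TangentSpace (𝓡 3) p) p
          (rotationField lam (pushField Φ Q η) (pushField Φ Q ζ) p)) q ∧
      0 < (lam.d q : Euc 3 →L[ℝ] Euc 3 →L[ℝ] ℝ) (pushField Φ Q η q) (pushField Φ Q ζ q) := by
  have hsm : ∀ᶠ q in 𝓝 e, ∀ ξ : E,
      ContMDiffAt (𝓡 3) 𝓘(ℝ, Euc 3) ∞ (fun q' => toCoord q q' (pushField Φ Q ξ q')) q := by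
    filter_upwards [h.smooth_inv.self_of_nhds.continuousAt.eventually h.smooth, h.smooth_inv,
      h.right_inv.eventually_nhds] with q h1 h2 h3 ξ
    exact contMDiffAt_coord_pushField h1 h2 h3 ξ
  have hpos : ∀ᶠ q in 𝓝 e,
      0 < (lam.d q : Euc 3 →L[ℝ] Euc 3 →L[ℝ] ℝ) (pushField Φ Q η q) (pushField Φ Q ζ q) := by
    have hc : ContMDiffAt (𝓡 3) 𝓘(ℝ, ℝ) ∞ (fun q => coordD lam e q
        (toCoord e q (pushField Φ Q η q)) (toCoord e q (pushField Φ Q ζ q))) e :=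
      ((contMDiffAt_coordD lam e).clm_apply (hsm.self_of_nhds η)).clm_apply (hsm.self_of_nhds ζ)
    have heq : ∀ q ∈ (chartAt (Euc 3) e).source, coordD lam e q
        (toCoord e q (pushField Φ Q η q)) (toCoord e q (pushField Φ Q ζ q)) =
        (lam.d q : Euc 3 →L[ℝ] Euc 3 →L[ℝ] ℝ) (pushField Φ Q η q) (pushField Φ Q ζ q) := by
      intro q hq
      rw [coordD_toCoord lam hq, ofCoord_toCoord hq]
    have he := heq e (mem_chart_source _ _)
    rw [← he] at h0
    filter_upwards [hc.continuousAt.eventually (lt_mem_nhds h0), eventually_mem_chart_source e]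
      with q h1 h2
    rw [← heq q h2]
    exact h1
  filter_upwards [hsm, hpos] with q h1 h2
  exact ⟨contMDiffAt_rotationField lam (h1 η) (h1 ζ) h2, h2⟩

theorem exists_d_pos (lam : ContactForm M) (p : M) :
    ∃ v w : Euc 3, 0 < (lam.d p : Euc 3 →L[ℝ] Euc 3 →L[ℝ] ℝ) v w := by
  by_contra! hcon
  obtain ⟨u, v, w, h⟩ := lam.contact p
  have h0 : ∀ v w : Euc 3, (extD lam.form p : Euc 3 →L[ℝ] Euc 3 →L[ℝ] ℝ) v w = 0 := by
    intro v w
    refine le_antisymm (hcon v w) ?_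
    have := hcon w v
    have h1 : (lam.d p : Euc 3 →L[ℝ] Euc 3 →L[ℝ] ℝ) v w =
      -(lam.d p : Euc 3 →L[ℝ] Euc 3 →L[ℝ] ℝ) w v := lam_d_skew lam p v w
    change 0 ≤ (lam.d p : Euc 3 →L[ℝ] Euc 3 →L[ℝ] ℝ) v w
    linarith
  have h1 : ∀ (α : Euc 3 →L[ℝ] ℝ) (β : Euc 3 →L[ℝ] Euc 3 →L[ℝ] ℝ), (∀ v w, β v w = 0) →
      wedge₁₂ α β u v w = 0 := fun α β hβ => by simp only [wedge₁₂, hβ, mul_zero, add_zero]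
  exact h (h1 _ _ h0)

theorem inv_sqrt_smul_sq {F : Type*} [NormedAddCommGroup F] [NormedSpace ℝ F] {A : F →L[ℝ] F}
    {v : F} {δ : ℝ} (hδ : 0 < δ) (h : A (A v) = -δ • v) :
    ((√δ)⁻¹ • A) (((√δ)⁻¹ • A) v) = -v := by
  have h2 : (√δ)⁻¹ * (√δ)⁻¹ * δ = 1 := by
    rw [← mul_inv, Real.mul_self_sqrt hδ.le, inv_mul_cancel₀ hδ.ne']
  rw [smul_apply, smul_apply, map_smul, smul_smul, h, neg_smul, smul_neg, smul_smul, h2, one_smul]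

/-- A tame endomorphism field can be normalised to a compatible complex structure. -/
theorem exists_compatibleJ_of_isTame (lam : ContactForm M)
    {A : ∀ p : M, TangentSpace (𝓡 3) p →L[ℝ] TangentSpace (𝓡 3) p}
    (hA : ContMDiff (𝓡 3) ((𝓡 3).prod 𝓘(ℝ, Euc 3 →L[ℝ] Euc 3)) ∞
      (fun p => Bundle.TotalSpace.mk' (Euc 3 →L[ℝ] Euc 3)
        (E := fun p : M => TangentSpace (𝓡 3) p →L[ℝ] TangentSpace (𝓡 3) p) p (A p)))
    (ht : ∀ p, IsTame (lam.form p) (lam.d p) (lam.reeb p) (A p)) :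
    ∃ J : CompatibleJ lam, ∀ p, negSq (A p) = 1 → J.J p = A p := by
  have hsq := fun p => (ht p).sq (d_reeb lam p) (form_reeb lam p) (lam_d_skew lam p)
  have hc : ContMDiff (𝓡 3) 𝓘(ℝ, ℝ) ∞ fun p => (√(negSq (A p)))⁻¹ := by
    intro p
    have h1 : ContDiffAt ℝ ∞ (fun x : ℝ => (√x)⁻¹) (negSq (A p)) :=
      (Real.contDiffAt_sqrt (hsq p).1.ne').inv (Real.sqrt_pos.2 (hsq p).1).ne'
    exact ContDiffAt.comp_contMDiffAt (f := fun p => negSq (A p)) h1 (contMDiff_negSq hA p)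
  have hpos : ∀ p, 0 < (√(negSq (A p)))⁻¹ := fun p => inv_pos.2 (Real.sqrt_pos.2 (hsq p).1)
  refine ⟨⟨fun p => (√(negSq (A p)))⁻¹ • A p, ?_, fun p => ?_, fun p v hv => ?_, fun p v hv => ?_,
    fun p v w _ _ => ?_, fun p v hv hv0 => ?_⟩, fun p hp => ?_⟩
  · exact hc.smul_section hA
  · exact (congrArg (fun x : Euc 3 => (√(negSq (A p)))⁻¹ • x) (ht p).map_reeb).trans (smul_zero _)
  · rw [smul_apply, map_smul]
    exact smul_eq_zero_of_right _ ((ht p).map_ker v)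
  · exact inv_sqrt_smul_sq (hsq p).1 ((hsq p).2 v hv)
  · rw [smul_apply, smul_apply, map_smul, map_smul]
    exact congrArg _ ((ht p).symm v w)
  · rw [smul_apply, map_smul]
    exact mul_pos (hpos p) ((ht p).pos v hv hv0)
  · change (√(negSq (A p)))⁻¹ • A p = A p
    rw [hp, Real.sqrt_one, inv_one, one_smul]

/-- There is a compatible complex structure with prescribed germs at finitely many points. -/
theorem exists_compatibleJ [T2Space M] [SecondCountableTopology M] (lam : ContactForm M)
    {T : Set M} (hT : T.Finite) {Φ : M → E → M} {Q : M → M → E} {η ζ : E}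
    (h : ∀ e ∈ T, IsLocalParam (Φ e) (Q e) e ∧ 0 < (lam.d e : Euc 3 →L[ℝ] Euc 3 →L[ℝ] ℝ)
      (pushField (Φ e) (Q e) η e) (pushField (Φ e) (Q e) ζ e)) :
    ∃ J : CompatibleJ lam, ∀ e ∈ T, ∀ᶠ p in 𝓝 e,
      J.J p = rotationField lam (pushField (Φ e) (Q e) η) (pushField (Φ e) (Q e) ζ) p ∧
      0 < (lam.d p : Euc 3 →L[ℝ] Euc 3 →L[ℝ] ℝ)
        (pushField (Φ e) (Q e) η p) (pushField (Φ e) (Q e) ζ p) := by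
  have : LocallyCompactSpace M := ChartedSpace.locallyCompactSpace (Euc 3) M
  set R : M → ∀ p : M, TangentSpace (𝓡 3) p →L[ℝ] TangentSpace (𝓡 3) p := fun e =>
    rotationField lam (pushField (Φ e) (Q e) η) (pushField (Φ e) (Q e) ζ) with hR
  obtain ⟨U, hU, hdisj⟩ := hT.t2_separation
  have hG : ∀ e, ∃ G : Set M, IsOpen G ∧ (e ∈ T → e ∈ G ∧ ∀ p ∈ G,
      ContMDiffAt (𝓡 3) ((𝓡 3).prod 𝓘(ℝ, Euc 3 →L[ℝ] Euc 3)) ∞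
      (fun p => Bundle.TotalSpace.mk' (Euc 3 →L[ℝ] Euc 3)
        (E := fun p : M => TangentSpace (𝓡 3) p →L[ℝ] TangentSpace (𝓡 3) p) p (R e p)) p ∧
      0 < (lam.d p : Euc 3 →L[ℝ] Euc 3 →L[ℝ] ℝ)
        (pushField (Φ e) (Q e) η p) (pushField (Φ e) (Q e) ζ p)) := by
    intro e
    by_cases he : e ∈ T
    · obtain ⟨G, hG, hGo, heG⟩ := eventually_nhds_iff.1
        ((h e he).1.eventually_contMDiffAt_rotationField lam (h e he).2)
      exact ⟨G, hGo, fun _ => ⟨heG, hG⟩⟩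
    · exact ⟨∅, isOpen_empty, fun h => absurd h he⟩
  choose G hGo hG using hG
  have hK : ∀ e, ∃ K : Set M, IsClosed K ∧ (e ∈ T → K ∈ 𝓝 e ∧ K ⊆ U e ∩ G e) := by
    intro e
    by_cases he : e ∈ T
    · obtain ⟨K, hK, hKc, hKs⟩ := exists_mem_nhds_isClosed_subset
        (((hU e).2.inter (hGo e)).mem_nhds ⟨(hU e).1, (hG e he).1⟩)
      exact ⟨K, hKc, fun _ => ⟨hK, hKs⟩⟩
    · exact ⟨∅, isClosed_empty, fun h => absurd h he⟩
  choose K hKc hK using hK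
  -- The prescription `A = R e p` on the closed set `K e` is an affine condition, so the fibrewise
  -- constraints stay convex and a partition of unity yields a global section.
  let t : ∀ p : M, Set (TangentSpace (𝓡 3) p →L[ℝ] TangentSpace (𝓡 3) p) := fun p =>
    {A | IsTame (lam.form p) (lam.d p) (lam.reeb p) A} ∩ {A | ∀ e ∈ T, p ∈ K e → A = R e p}
  have htame : ∀ e ∈ T, ∀ p ∈ G e, IsTame (lam.form p) (lam.d p) (lam.reeb p) (R e p) :=
    fun e he p hp => isTame_rotationField lam ((hG e he).2 p hp).2
  have hconv : ∀ p, Convex ℝ (t p) := by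
    intro p
    refine Convex.inter convex_isTame ?_
    intro A hA B hB a b ha hb hab e he hp
    rw [hA e he hp, hB e he hp, ← add_smul, hab, one_smul]
  obtain ⟨A, hA⟩ := exists_contMDiffSection_forall_mem_convex_of_local (n := (⊤ : ℕ∞)) (𝓡 3)
    (F_fiber := Euc 3 →L[ℝ] Euc 3)
    (fun p : M => TangentSpace (𝓡 3) p →L[ℝ] TangentSpace (𝓡 3) p) t hconv (by
      intro x₀
      by_cases hx : ∃ e ∈ T, x₀ ∈ K e
      · obtain ⟨e, he, hx⟩ := hx
        refine ⟨U e ∩ G e, ((hU e).2.inter (hGo e)).mem_nhds ((hK e he).2 hx), R e,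
          fun y hy => ((hG e he).2 y hy.2).1.contMDiffWithinAt,
          fun y hy => ⟨htame e he y hy.2, fun e' he' hy' => ?_⟩⟩
        -- The sets `K e'` lie in the disjoint sets `U e'`, so on this neighbourhood only one
        -- prescription is active.
        have : e = e' := by
          by_contra hne
          exact (Set.disjoint_left.1 (hdisj he he' hne) hy.1) ((hK e' he').2 hy').1
        rw [this]
      · push Not at hx
        obtain ⟨v, w, hvw⟩ := exists_d_pos lam x₀
        have hloc := isLocalParam_extChartAt (M := M) x₀
        have hid : ∀ v, pushField (extChartAt (𝓡 3) x₀).symm (extChartAt (𝓡 3) x₀) v x₀ = v :=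
          fun v => congrArg (fun L : Euc 3 →L[ℝ] Euc 3 => L v) (mfderiv_extChartAt_symm_self x₀)
        have hev := hloc.eventually_contMDiffAt_rotationField lam (η := v) (ζ := w)
          (by rw [hid, hid]; exact hvw)
        -- Away from the prescribed sets, a finite closed union, any rotation of two chart vectors
        -- on which `dλ` is positive will do.
        have hcl : IsClosed (⋃ e ∈ T, K e) := hT.isClosed_biUnion fun e _ => hKc e
        have hmem : (⋃ e ∈ T, K e)ᶜ ∈ 𝓝 x₀ := hcl.isOpen_compl.mem_nhds (by simpa using hx)
        refine ⟨_, inter_mem hmem hev, _, fun y hy => hy.2.1.contMDiffWithinAt,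
          fun y hy => ⟨isTame_rotationField lam hy.2.2, fun e he hye => ?_⟩⟩
        exact absurd (mem_biUnion he hye) hy.1)
  obtain ⟨J, hJ⟩ := exists_compatibleJ_of_isTame lam A.contMDiff fun p => (hA p).1
  refine ⟨J, fun e he => ?_⟩
  filter_upwards [(hK e he).1] with p hp
  have h1 := (hA p).2 e he hp
  have h2 := ((hG e he).2 p ((hK e he).2 hp).2).2
  refine ⟨?_, h2⟩
  rw [hJ p, h1]
  rw [h1]
  -- A frame rotation already squares to `-1`, so the normalization does not change the prescribed
  -- germs.
  exact negSq_frameRotation (d_reeb lam p) (form_reeb lam p) (lam_d_skew lam p) h2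

end CompatibleStructure

/-! ### The conformal map from the strip to a half disc. -/

section StripMap

open Complex (I)

/-- The identification `(s, t) ↦ s + i t`. -/
def pairToComplex : ℝ × ℝ →L[ℝ] ℂ :=
  (ContinuousLinearMap.fst ℝ ℝ ℝ).smulRight 1 + (ContinuousLinearMap.snd ℝ ℝ ℝ).smulRight I

theorem pairToComplex_apply (z : ℝ × ℝ) : pairToComplex z = z.1 + z.2 * I := by
  simp [pairToComplex]

/-- The map `exp (π z / 2)`, from the strip onto the first quadrant. -/
def stripExp (z : ℝ × ℝ) : ℂ := Complex.exp (↑(Real.pi / 2) * pairToComplex z)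

/-- The map `tanh (π z / 4)`, from the strip to the upper half disc. -/
def stripDisc (z : ℝ × ℝ) : ℂ := (stripExp z - 1) / (stripExp z + 1)

theorem stripExp_re (z : ℝ × ℝ) :
    (stripExp z).re = Real.exp (Real.pi / 2 * z.1) * Real.cos (Real.pi / 2 * z.2) := by
  simp [stripExp, pairToComplex_apply, Complex.exp_re]

theorem stripExp_im (z : ℝ × ℝ) :
    (stripExp z).im = Real.exp (Real.pi / 2 * z.1) * Real.sin (Real.pi / 2 * z.2) := by
  simp [stripExp, pairToComplex_apply, Complex.exp_im]

theorem norm_stripExp (z : ℝ × ℝ) : ‖stripExp z‖ = Real.exp (Real.pi / 2 * z.1) := by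
  simp [stripExp, pairToComplex_apply, Complex.norm_exp]

theorem stripExp_re_nonneg {z : ℝ × ℝ} (hz : z ∈ strip) : 0 ≤ (stripExp z).re := by
  rw [stripExp_re]
  refine mul_nonneg (Real.exp_pos _).le (Real.cos_nonneg_of_mem_Icc ⟨?_, ?_⟩)
  · nlinarith [Real.pi_pos, hz.1]
  · nlinarith [Real.pi_pos, hz.2]

theorem stripExp_add_one_ne {z : ℝ × ℝ} (hz : z ∈ strip) : stripExp z + 1 ≠ 0 := by
  intro h
  have := congrArg Complex.re h
  simp only [Complex.add_re, Complex.one_re, Complex.zero_re] at this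
  linarith [stripExp_re_nonneg hz]

theorem stripExp_ne_zero (z : ℝ × ℝ) : stripExp z ≠ 0 := Complex.exp_ne_zero _

theorem hasFDerivAt_stripExp (z : ℝ × ℝ) :
    HasFDerivAt stripExp ((stripExp z * ↑(Real.pi / 2)) • pairToComplex) z := by
  have h1 : HasFDerivAt (fun z => (↑(Real.pi / 2) : ℂ) * pairToComplex z)
      ((↑(Real.pi / 2) : ℂ) • pairToComplex) z := pairToComplex.hasFDerivAt.const_mul _
  have h2 := h1.cexp
  rw [smul_smul] at h2
  exact h2

theorem one_sub_stripDisc_sq {z : ℝ × ℝ} (hz : z ∈ strip) :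
    1 - stripDisc z ^ 2 = 4 * stripExp z / (stripExp z + 1) ^ 2 := by
  have := stripExp_add_one_ne hz
  rw [stripDisc]
  field_simp
  ring

/-- This is `tanh' = 1 - tanh²`. The derivative is a polynomial in the value, which later bounds the
derivatives of all orders. -/
theorem hasFDerivAt_stripDisc {z : ℝ × ℝ} (hz : z ∈ strip) :
    HasFDerivAt stripDisc ((↑(Real.pi / 4) * (1 - stripDisc z ^ 2)) • pairToComplex) z := by
  have h0 := stripExp_add_one_ne hz
  have h1 := hasFDerivAt_stripExp z
  have h2 := (h1.sub_const 1).mul ((hasDerivAt_inv h0).comp_hasFDerivAt z (h1.add_const 1))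
  refine (h2.congr_fderiv ?_).congr_of_eventuallyEq (Eventually.of_forall fun y => div_eq_mul_inv _ _)
  refine ContinuousLinearMap.ext fun w => ?_
  rw [one_sub_stripDisc_sq hz]
  simp only [add_apply, smul_apply, smul_eq_mul, Function.comp_apply]
  push_cast
  field_simp
  ring

theorem contDiffAt_stripDisc {z : ℝ × ℝ} (hz : z ∈ strip) : ContDiffAt ℝ ∞ stripDisc z := by
  have h1 : ContDiff ℝ ∞ stripExp := (contDiff_const.mul pairToComplex.contDiff).cexp
  have h2 := (h1.contDiffAt.sub (contDiffAt_const (c := (1 : ℂ)))).mul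
    ((h1.contDiffAt.add (contDiffAt_const (c := (1 : ℂ)))).inv (stripExp_add_one_ne hz))
  exact h2.congr_of_eventuallyEq (Eventually.of_forall fun y => div_eq_mul_inv _ _)

theorem normSq_stripExp_add_one {z : ℝ × ℝ} (hz : z ∈ strip) :
    1 + ‖stripExp z‖ ^ 2 ≤ ‖stripExp z + 1‖ ^ 2 := by
  rw [← Complex.normSq_eq_norm_sq, ← Complex.normSq_eq_norm_sq, Complex.normSq_apply,
    Complex.normSq_apply]
  simp only [Complex.add_re, Complex.add_im, Complex.one_re, Complex.one_im]
  nlinarith [stripExp_re_nonneg hz]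

/-- The exponential has nonnegative real part on the strip, and the Cayley transform maps the right
half plane to the unit disc. -/
theorem norm_stripDisc_le {z : ℝ × ℝ} (hz : z ∈ strip) : ‖stripDisc z‖ ≤ 1 := by
  rw [stripDisc, norm_div]
  refine div_le_one_of_le₀ ?_ (norm_nonneg _)
  refine abs_le_of_sq_le_sq' ?_ (norm_nonneg _) |>.2
  rw [← Complex.normSq_eq_norm_sq, ← Complex.normSq_eq_norm_sq, Complex.normSq_apply,
    Complex.normSq_apply]
  simp only [Complex.add_re, Complex.add_im, Complex.one_re, Complex.one_im, Complex.sub_re,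
    Complex.sub_im]
  nlinarith [stripExp_re_nonneg hz]

theorem stripDisc_im_zero (s : ℝ) : (stripDisc (s, 0)).im = 0 := by
  have h1 : stripExp (s, 0) = (Real.exp (Real.pi / 2 * s) : ℝ) := by
    apply Complex.ext <;> simp [stripExp_re, stripExp_im, -Complex.ofReal_exp]
  rw [stripDisc, h1]
  have : ((Real.exp (Real.pi / 2 * s) : ℝ) - 1 : ℂ) / ((Real.exp (Real.pi / 2 * s) : ℝ) + 1) =
      (((Real.exp (Real.pi / 2 * s) - 1) / (Real.exp (Real.pi / 2 * s) + 1) : ℝ) : ℂ) := by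
    push_cast; rfl
  rw [this, Complex.ofReal_im]

/-- The exponential maps the upper edge to the positive imaginary axis, and the Cayley transform
maps this to the upper unit semicircle. -/
theorem stripDisc_one (s : ℝ) : ‖stripDisc (s, 1)‖ = 1 ∧ 0 < (stripDisc (s, 1)).im := by
  have h1 : stripExp (s, 1) = (Real.exp (Real.pi / 2 * s) : ℝ) * I := by
    apply Complex.ext <;> simp [stripExp_re, stripExp_im, -Complex.ofReal_exp]
  have hy := Real.exp_pos (Real.pi / 2 * s)
  set y := Real.exp (Real.pi / 2 * s)
  have hn1 : Complex.normSq ((y : ℂ) * I - 1) = 1 + y ^ 2 := by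
    rw [Complex.normSq_apply]; simp; ring
  have hn2 : Complex.normSq ((y : ℂ) * I + 1) = 1 + y ^ 2 := by
    rw [Complex.normSq_apply]; simp; ring
  have hpos : 0 < 1 + y ^ 2 := by positivity
  rw [stripDisc, h1]
  constructor
  · have h2 : ‖((y : ℂ) * I - 1) / ((y : ℂ) * I + 1)‖ ^ 2 = 1 := by
      rw [← Complex.normSq_eq_norm_sq, map_div₀, hn1, hn2, div_self hpos.ne']
    have h3 := norm_nonneg (((y : ℂ) * I - 1) / ((y : ℂ) * I + 1))
    nlinarith
  · rw [Complex.div_im, hn2]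
    simp
    rw [← sub_pos]
    ring_nf
    positivity

/-- With `x = π s / 2` the modulus is at most `π exp x / (1 + exp (2 x)) = π / (2 cosh x)`, and `2
cosh x ≥ 2 + x² ≥ 1 + s²`. An integrable bound in `s` is all the energy estimate needs. -/
theorem norm_deriv_stripDisc_le {z : ℝ × ℝ} (hz : z ∈ strip) :
    ‖(↑(Real.pi / 4) * (1 - stripDisc z ^ 2) : ℂ)‖ ≤ Real.pi * (1 + z.1 ^ 2)⁻¹ := by
  have h1 := normSq_stripExp_add_one hz
  rw [one_sub_stripDisc_sq hz, norm_mul, norm_div, norm_mul, norm_pow, Complex.norm_real,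
    Real.norm_of_nonneg (by positivity), norm_stripExp] at *
  simp only [Complex.norm_ofNat]
  set x := Real.pi / 2 * z.1 with hx
  have h2 : 1 + x ^ 2 / 2 ≤ Real.cosh x := by
    have := Real.cosh_two_mul (x / 2)
    rw [show 2 * (x / 2) = x by ring, Real.cosh_sq] at this
    have h3 : (x / 2) ^ 2 ≤ Real.sinh (x / 2) ^ 2 := by
      rw [sq_le_sq, Real.abs_sinh]
      exact Real.self_le_sinh_iff.2 (abs_nonneg _)
    nlinarith
  have h4 : (1 + z.1 ^ 2) * Real.exp x ≤ 1 + Real.exp x ^ 2 := by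
    have h5 : 1 + Real.exp x ^ 2 = 2 * Real.cosh x * Real.exp x := by
      rw [Real.cosh_eq, Real.exp_neg]
      have := (Real.exp_pos x).ne'
      field_simp
      ring
    rw [h5]
    refine mul_le_mul_of_nonneg_right ?_ (Real.exp_pos x).le
    have h6 : z.1 ^ 2 ≤ x ^ 2 := by
      rw [hx, mul_pow]
      have : 1 ≤ (Real.pi / 2) ^ 2 := by nlinarith [Real.pi_gt_three]
      nlinarith [sq_nonneg z.1]
    linarith
  have h7 : 0 < ‖stripExp z + 1‖ ^ 2 := by have := sq_nonneg (Real.exp x); linarith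
  have h8 : 0 < 1 + z.1 ^ 2 := by positivity
  rw [← div_eq_mul_inv, le_div_iff₀ h8, mul_div_assoc', div_mul_eq_mul_div, div_le_iff₀ h7]
  nlinarith [Real.pi_pos, mul_le_mul_of_nonneg_left (h4.trans h1) Real.pi_pos.le]

theorem deriv_stripDisc_ne_zero {z : ℝ × ℝ} (hz : z ∈ strip) :
    (↑(Real.pi / 4) * (1 - stripDisc z ^ 2) : ℂ) ≠ 0 := by
  rw [one_sub_stripDisc_sq hz]
  refine mul_ne_zero (by exact_mod_cast (by positivity)) (div_ne_zero (mul_ne_zero (by norm_num)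
    (stripExp_ne_zero z)) (pow_ne_zero _ (stripExp_add_one_ne hz)))

theorem one_sub_stripDisc_ne_zero {z : ℝ × ℝ} (hz : z ∈ strip) : 1 - stripDisc z ≠ 0 := by
  have := stripExp_add_one_ne hz
  rw [stripDisc, sub_ne_zero, ne_eq, eq_div_iff this, one_mul]
  intro h
  have h2 : (2 : ℂ) = 0 := by linear_combination h
  norm_num at h2

theorem stripDisc_inverse {z : ℝ × ℝ} (hz : z ∈ strip) :
    (1 + stripDisc z) / (1 - stripDisc z) = stripExp z := by
  have h1 := one_sub_stripDisc_ne_zero hz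
  rw [div_eq_iff h1, stripDisc]
  have := stripExp_add_one_ne hz
  field_simp
  ring

/-- A left inverse of `stripDisc`. -/
def discStrip (w : ℂ) : ℝ × ℝ :=
  Complex.equivRealProdCLM ((2 / Real.pi : ℝ) * Complex.log ((1 + w) / (1 - w)))

theorem discStrip_stripDisc {z : ℝ × ℝ} (hz : z ∈ strip) : discStrip (stripDisc z) = z := by
  rw [discStrip, stripDisc_inverse hz, stripExp, Complex.log_exp]
  · have : ((2 / Real.pi : ℝ) : ℂ) * (↑(Real.pi / 2) * pairToComplex z) = pairToComplex z := by
      rw [← mul_assoc, ← Complex.ofReal_mul]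
      have : (2 / Real.pi) * (Real.pi / 2) = 1 := by have := Real.pi_pos.ne'; field_simp
      rw [this, Complex.ofReal_one, one_mul]
    rw [this, pairToComplex_apply]
    ext <;> simp [Complex.equivRealProdCLM_apply]
  · simp [pairToComplex_apply]
    nlinarith [Real.pi_pos, hz.1]
  · simp [pairToComplex_apply]
    nlinarith [Real.pi_pos, hz.2]

theorem continuousAt_discStrip {z : ℝ × ℝ} (hz : z ∈ strip) :
    ContinuousAt discStrip (stripDisc z) := by
  have h1 : ContinuousAt (fun w : ℂ => (1 + w) / (1 - w)) (stripDisc z) :=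
    (continuousAt_const.add continuousAt_id).div (continuousAt_const.sub continuousAt_id)
      (one_sub_stripDisc_ne_zero hz)
  -- The values lie in the closed right half plane without zero, away from the cut of the logarithm.
  have h2 : stripExp z ∈ Complex.slitPlane := by
    rw [Complex.mem_slitPlane_iff]
    rcases (stripExp_re_nonneg hz).lt_or_eq with h | h
    · exact Or.inl h
    · refine Or.inr fun h3 => stripExp_ne_zero z (Complex.ext h.symm h3)
  have h3 : ContinuousAt (fun w : ℂ => Complex.log ((1 + w) / (1 - w))) (stripDisc z) := by
    refine ContinuousAt.clog h1 ?_
    rw [stripDisc_inverse hz]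
    exact h2
  exact Complex.equivRealProdCLM.continuous.continuousAt.comp (continuousAt_const.mul h3)

theorem uniqueDiffOn_strip : UniqueDiffOn ℝ strip := by
  have : strip = (univ : Set ℝ) ×ˢ Icc (0 : ℝ) 1 := by ext z; simp [strip]
  rw [this]
  exact uniqueDiffOn_univ.prod (uniqueDiffOn_Icc zero_lt_one)

end StripMap

/-! ### Uniform convergence with all derivatives. -/

section UniformDerivatives

variable {X F G : Type*} [NormedAddCommGroup X] [NormedSpace ℝ X]
  [NormedAddCommGroup F] [NormedSpace ℝ F] [NormedAddCommGroup G] [NormedSpace ℝ G]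

/-- The iterated derivatives of a solution of `Df = G ∘ f` are functions of `f`. -/
theorem exists_iteratedFDerivWithin_eq_comp {s : Set X} (hs : UniqueDiffOn ℝ s) {f : X → F}
    {g : F → X →L[ℝ] F} (hg : ContDiff ℝ ∞ g) (hf : ∀ z ∈ s, HasFDerivWithinAt f (g (f z)) s z)
    (n : ℕ) : ∃ P : F → ContinuousMultilinearMap ℝ (fun _ : Fin n => X) F, ContDiff ℝ ∞ P ∧
      ∀ z ∈ s, iteratedFDerivWithin ℝ n f s z = P (f z) := by
  induction n with
  | zero =>
    refine ⟨fun w => (continuousMultilinearCurryFin0 ℝ X F).symm w,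
      (continuousMultilinearCurryFin0 ℝ X F).symm.contDiff, fun z _ => ?_⟩
    rw [iteratedFDerivWithin_zero_eq_comp]
    rfl
  | succ n ih =>
    obtain ⟨P, hP, hPe⟩ := ih
    refine ⟨fun w => (continuousMultilinearCurryLeftEquiv ℝ (fun _ : Fin (n + 1) => X) F).symm
      ((fderiv ℝ P w).comp (g w)), ?_, fun z hz => ?_⟩
    · exact (LinearIsometryEquiv.contDiff _).comp
        ((hP.fderiv_right (m := ∞) (by simp)).clm_comp hg)
    · rw [iteratedFDerivWithin_succ_eq_comp_left, Function.comp_apply]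
      congr 1
      have h1 : HasFDerivWithinAt (fun z => P (f z)) ((fderiv ℝ P (f z)).comp (g (f z))) s z :=
        (hP.differentiable (by simp) (f z)).hasFDerivAt.comp_hasFDerivWithinAt z (hf z hz)
      exact (h1.congr (fun y hy => hPe y hy) (hPe z hz)).fderivWithin (hs z hz)

theorem exists_bound_iteratedFDerivWithin [ProperSpace F] {s : Set X} (hs : UniqueDiffOn ℝ s)
    {f : X → F} {g : F → X →L[ℝ] F} (hg : ContDiff ℝ ∞ g)
    (hf : ∀ z ∈ s, HasFDerivWithinAt f (g (f z)) s z) {R : ℝ} (hR : ∀ z ∈ s, ‖f z‖ ≤ R) (n : ℕ) :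
    ∃ C, ∀ z ∈ s, ‖iteratedFDerivWithin ℝ n f s z‖ ≤ C := by
  obtain ⟨P, hP, hPe⟩ := exists_iteratedFDerivWithin_eq_comp hs hg hf n
  obtain ⟨C, hC⟩ := (isCompact_closedBall (0 : F) R).exists_bound_of_continuousOn
    hP.continuous.continuousOn
  exact ⟨C, fun z hz => by rw [hPe z hz]; exact hC _ (by simpa using hR z hz)⟩

/-- One constant for all orders up to `n`, chosen at least `1` so that `D ≤ D ^ i`, the form of
bound required by the estimate for derivatives of a composition. -/
theorem exists_uniform_bound {s : Set X} {f : X → F} {n : ℕ}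
    (h : ∀ i ≤ n, ∃ C, ∀ z ∈ s, ‖iteratedFDerivWithin ℝ i f s z‖ ≤ C) :
    ∃ D, 1 ≤ D ∧ ∀ i ≤ n, ∀ z ∈ s, ‖iteratedFDerivWithin ℝ i f s z‖ ≤ D := by
  induction n with
  | zero =>
    obtain ⟨C, hC⟩ := h 0 le_rfl
    refine ⟨max 1 C, le_max_left _ _, fun i hi z hz => ?_⟩
    obtain rfl : i = 0 := by omega
    exact (hC z hz).trans (le_max_right _ _)
  | succ n ih =>
    obtain ⟨D, hD1, hD⟩ := ih fun i hi => h i (by omega)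
    obtain ⟨C, hC⟩ := h (n + 1) le_rfl
    refine ⟨max D C, hD1.trans (le_max_left _ _), fun i hi z hz => ?_⟩
    rcases Nat.lt_or_ge i (n + 1) with h1 | h1
    · exact (hD i (by omega) z hz).trans (le_max_left _ _)
    · obtain rfl : i = n + 1 := by omega
      exact (hC z hz).trans (le_max_right _ _)

/-- The derivatives are jointly continuous in `(τ, w)` and vanish identically for `τ = 0`;
compactness of the ball makes the smallness uniform in `w`. -/
theorem eventually_iteratedFDeriv_scaled_lt [ProperSpace F] {H : F → G} (hH : ContDiff ℝ ∞ H)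
    (R : ℝ) {δ : ℝ} (hδ : 0 < δ) (i : ℕ) : ∀ᶠ τ in 𝓝 (0 : ℝ), ∀ w ∈ Metric.closedBall (0 : F) R,
      ‖iteratedFDeriv ℝ i (fun w => H (τ • w) - H 0) w‖ < δ := by
  have hform : ∀ (τ : ℝ) (w : F), iteratedFDeriv ℝ i (fun w => H (τ • w) - H 0) w =
      τ ^ i • iteratedFDeriv ℝ i H (τ • w) - iteratedFDeriv ℝ i (fun _ => H 0) w := by
    intro τ w
    have h1 : ContDiff ℝ i fun w : F => H (τ • w) :=
      (hH.comp (contDiff_const_smul τ)).of_le (by exact_mod_cast le_top)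
    have h2 : ContDiff ℝ i H := hH.of_le (by exact_mod_cast le_top)
    have h3 := congrFun (iteratedFDeriv_comp_const_smul τ h2) w
    rw [← h3]
    exact iteratedFDeriv_sub_apply h1.contDiffAt contDiff_const.contDiffAt
  have hcont : Continuous fun p : ℝ × F => iteratedFDeriv ℝ i (fun w => H (p.1 • w) - H 0) p.2 := by
    simp only [hform]
    have h2 : Continuous (iteratedFDeriv ℝ i H) :=
      hH.continuous_iteratedFDeriv (by exact_mod_cast le_top)
    have h3 : Continuous (iteratedFDeriv ℝ i fun _ : F => H 0) :=
      (contDiff_const (n := ∞)).continuous_iteratedFDeriv (by exact_mod_cast le_top)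
    exact ((continuous_fst.pow i).smul (h2.comp (continuous_fst.smul continuous_snd))).sub
      (h3.comp continuous_snd)
  have hzero : ∀ w : F, iteratedFDeriv ℝ i (fun w => H ((0 : ℝ) • w) - H 0) w = 0 := by
    intro w
    simp only [zero_smul, sub_self]
    rw [iteratedFDeriv_fun_zero]
    rfl
  refine (isCompact_closedBall (0 : F) R).eventually_forall_of_forall_eventually fun w _ => ?_
  have h4 : ContinuousAt (fun p : ℝ × F =>
      ‖iteratedFDeriv ℝ i (fun w => H (p.1 • w) - H 0) p.2‖) (0, w) := hcont.norm.continuousAt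
  have h5 : ‖iteratedFDeriv ℝ i (fun w => H ((0 : ℝ) • w) - H 0) w‖ < δ := by
    rw [hzero, norm_zero]; exact hδ
  exact h4.eventually (gt_mem_nhds h5)

/-- If all derivatives of `y` are bounded on `s` then `H (τ • y)` converges to `H 0` uniformly on `s`
with all derivatives. -/
theorem tendstoUniformlyOn_iteratedFDerivWithin_scaled [ProperSpace F] {H : F → G}
    (hH : ContDiff ℝ ∞ H) {s : Set X} (hs : UniqueDiffOn ℝ s) {y : X → F} (hy : ContDiffOn ℝ ∞ y s)
    (hb : ∀ n, ∃ C, ∀ z ∈ s, ‖iteratedFDerivWithin ℝ n y s z‖ ≤ C) (k : ℕ) :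
    TendstoUniformlyOn (fun τ : ℝ => iteratedFDerivWithin ℝ k (fun z => H (τ • y z)) s)
      (iteratedFDerivWithin ℝ k (fun _ => H 0) s) (𝓝 0) s := by
  obtain ⟨D, hD1, hD⟩ := exists_uniform_bound (n := k) fun i _ => hb i
  rw [Metric.tendstoUniformlyOn_iff]
  intro ε hε
  have hkD : 0 < (k.factorial : ℝ) * D ^ k := by positivity
  -- The derivative of order `k` of the composition is bounded by `k! * δ * D ^ k`, which this
  -- choice makes equal to `ε / 2`.
  set δ := ε / (2 * (k.factorial * D ^ k)) with hδ
  have hδ0 : 0 < δ := by positivity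
  have hev : ∀ᶠ τ in 𝓝 (0 : ℝ), ∀ i ∈ Finset.range (k + 1), ∀ w ∈ Metric.closedBall (0 : F) D,
      ‖iteratedFDeriv ℝ i (fun w => H (τ • w) - H 0) w‖ < δ :=
    (Finset.eventually_all _).2 fun i _ => eventually_iteratedFDeriv_scaled_lt hH D hδ0 i
  filter_upwards [hev] with τ hτ z hz
  have hHτ : ContDiff ℝ ∞ fun w => H (τ • w) - H 0 :=
    (hH.comp (contDiff_const_smul τ)).sub contDiff_const
  have hyz : ‖y z‖ ≤ D := by
    have := hD 0 (Nat.zero_le _) z hz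
    rwa [norm_iteratedFDerivWithin_zero] at this
  have h1 := norm_iteratedFDerivWithin_comp_le (𝕜 := ℝ) (g := fun w => H (τ • w) - H 0) (f := y)
    (n := k) (N := ∞) (s := s) (t := univ) (x := z) hHτ.contDiffOn hy (by exact_mod_cast le_top)
    uniqueDiffOn_univ hs (mapsTo_univ _ _) hz (C := δ) (D := D)
    (fun i hi => by
      rw [iteratedFDerivWithin_univ]
      exact (hτ i (by simp; omega) (y z) (by simpa using hyz)).le)
    (fun i hi1 hik => (hD i hik z hz).trans (le_self_pow₀ hD1 (by omega)))
  have h2 : iteratedFDerivWithin ℝ k ((fun w => H (τ • w) - H 0) ∘ y) s z =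
      iteratedFDerivWithin ℝ k (fun z => H (τ • y z)) s z -
        iteratedFDerivWithin ℝ k (fun _ => H 0) s z := by
    have h3 : ContDiffOn ℝ k (fun z => H (τ • y z)) s :=
      (hH.comp_contDiffOn (hy.const_smul τ)).of_le (by exact_mod_cast le_top)
    exact iteratedFDerivWithin_sub_apply (h3 z hz) contDiffWithinAt_const hs hz
  rw [dist_comm, dist_eq_norm, ← h2]
  refine h1.trans_lt ?_
  have h4 : (k.factorial : ℝ) * δ * D ^ k = ε / 2 := by
    rw [hδ]
    field_simp
  rw [h4]
  linarith

end UniformDerivatives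

/-! ### Explicit pseudoholomorphic strips. -/

section StripSolutions

open Complex (I)

variable {M : Type*} [TopologicalSpace M] [ChartedSpace (Euc 3) M]

/-- The curve `-i c tanh (π z / 4)`, which maps the strip to the right half disc of radius `c`. -/
def halfDiscMap (c : ℝ) (z : ℝ × ℝ) : ℂ := -(I * c) * stripDisc z

/-- The factor by which the derivative of `halfDiscMap c` at `z` multiplies. -/
def halfDiscDeriv (c : ℝ) (z : ℝ × ℝ) : ℂ := -(I * c) * (↑(Real.pi / 4) * (1 - stripDisc z ^ 2))

theorem hasFDerivAt_halfDiscMap (c : ℝ) {z : ℝ × ℝ} (hz : z ∈ strip) :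
    HasFDerivAt (halfDiscMap c) (halfDiscDeriv c z • pairToComplex) z := by
  have := (hasFDerivAt_stripDisc hz).const_mul (-(I * c))
  rwa [smul_smul] at this

theorem contDiffAt_halfDiscMap (c : ℝ) {z : ℝ × ℝ} (hz : z ∈ strip) :
    ContDiffAt ℝ ∞ (halfDiscMap c) z :=
  contDiffAt_const.mul (contDiffAt_stripDisc hz)

theorem norm_halfDiscMap (c : ℝ) (z : ℝ × ℝ) : ‖halfDiscMap c z‖ = |c| * ‖stripDisc z‖ := by
  simp [halfDiscMap]

theorem norm_halfDiscMap_le (c : ℝ) {z : ℝ × ℝ} (hz : z ∈ strip) : ‖halfDiscMap c z‖ ≤ |c| := by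
  rw [norm_halfDiscMap]
  exact mul_le_of_le_one_right (abs_nonneg _) (norm_stripDisc_le hz)

theorem norm_halfDiscDeriv_le (c : ℝ) {z : ℝ × ℝ} (hz : z ∈ strip) :
    ‖halfDiscDeriv c z‖ ≤ |c| * (Real.pi * (1 + z.1 ^ 2)⁻¹) := by
  rw [halfDiscDeriv, norm_mul]
  refine mul_le_mul (by simp) (norm_deriv_stripDisc_le hz) (norm_nonneg _) (abs_nonneg _)

theorem halfDiscDeriv_ne_zero {c : ℝ} (hc : c ≠ 0) {z : ℝ × ℝ} (hz : z ∈ strip) :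
    halfDiscDeriv c z ≠ 0 :=
  mul_ne_zero (by simpa using hc) (deriv_stripDisc_ne_zero hz)

/-- The `ℝ`-component of the explicit solutions. -/
def stripHeight (c : ℝ) (z : ℝ × ℝ) : ℝ := 1 / 4 * (‖halfDiscMap c z‖ ^ 2 - c ^ 2)

/-- Real part of `conj ξ * η`. -/
def dotProd (ξ η : ℂ) : ℝ := ξ.re * η.re + ξ.im * η.im

theorem hasFDerivAt_stripHeight (c : ℝ) {z : ℝ × ℝ} (hz : z ∈ strip) :
    HasFDerivAt (stripHeight c) ((1 / 2 : ℝ) • (innerSL ℝ (halfDiscMap c z)).comp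
      (halfDiscDeriv c z • pairToComplex)) z := by
  have h1 := ((hasFDerivAt_halfDiscMap c hz).norm_sq.sub_const (c ^ 2)).const_mul (1 / 4 : ℝ)
  refine h1.congr_fderiv (ContinuousLinearMap.ext fun w => ?_)
  simp only [smul_apply, ContinuousLinearMap.comp_apply, smul_eq_mul]
  ring

theorem stripHeight_deriv_apply (c : ℝ) (z w : ℝ × ℝ) :
    ((1 / 2 : ℝ) • (innerSL ℝ (halfDiscMap c z)).comp (halfDiscDeriv c z • pairToComplex)) w =
      1 / 2 * dotProd (halfDiscMap c z) (halfDiscDeriv c z * pairToComplex w) := by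
  simp only [smul_apply, ContinuousLinearMap.comp_apply, smul_eq_mul, innerSL_apply_apply,
    Complex.inner, dotProd, Complex.mul_re, Complex.conj_re, Complex.conj_im]
  ring

theorem contDiffAt_stripHeight (c : ℝ) {z : ℝ × ℝ} (hz : z ∈ strip) :
    ContDiffAt ℝ ∞ (stripHeight c) z :=
  contDiffAt_const.mul (((contDiffAt_halfDiscMap c hz).norm_sq ℝ).sub contDiffAt_const)

/-- The explicit solutions, for a parametrization `Φ` in which the contact form is radial on the
plane `ℂ × 0`. -/
def radialStrip (Φ : ℂ × ℝ → M) (c : ℝ) (z : ℝ × ℝ) : ℝ × M :=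
  (stripHeight c z, Φ (halfDiscMap c z, 0))

variable {Φ : ℂ × ℝ → M} {c : ℝ} {z : ℝ × ℝ}

theorem contMDiffAt_radialStrip (hz : z ∈ strip)
    (hΦ : ContMDiffAt 𝓘(ℝ, ℂ × ℝ) (𝓡 3) ∞ Φ (halfDiscMap c z, 0)) :
    ContMDiffAt 𝓘(ℝ, ℝ × ℝ) (𝓘(ℝ, ℝ).prod (𝓡 3)) ∞ (radialStrip Φ c) z := by
  have h1 : ContDiffAt ℝ ∞ (fun z => ((halfDiscMap c z, 0) : ℂ × ℝ)) z :=
    (contDiffAt_halfDiscMap c hz).prodMk contDiffAt_const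
  exact (contDiffAt_stripHeight c hz).contMDiffAt.prodMk
    (ContMDiffAt.comp (g := Φ) (f := fun z => ((halfDiscMap c z, 0) : ℂ × ℝ)) z hΦ h1.contMDiffAt)

theorem stripDeriv_radialStrip [IsManifold (𝓡 3) ∞ M] (hz : z ∈ strip)
    (hΦ : ContMDiffAt 𝓘(ℝ, ℂ × ℝ) (𝓡 3) ∞ Φ (halfDiscMap c z, 0)) (w : ℝ × ℝ) :
    stripDeriv (radialStrip Φ c) z w =
      (1 / 2 * dotProd (halfDiscMap c z) (halfDiscDeriv c z * pairToComplex w),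
        mfderiv 𝓘(ℝ, ℂ × ℝ) (𝓡 3) Φ (halfDiscMap c z, 0)
          (halfDiscDeriv c z * pairToComplex w, (0 : ℝ))) := by
  refine Prod.ext ?_ ?_
  · have h1 := (hasFDerivAt_stripHeight c hz).hasFDerivWithinAt.fderivWithin
      (uniqueDiffOn_strip z hz)
    exact (congrArg (fun L : ℝ × ℝ →L[ℝ] ℝ => L w) h1).trans (stripHeight_deriv_apply c z w)
  · have h1 : HasFDerivAt (fun z => ((halfDiscMap c z, 0) : ℂ × ℝ))
        ((halfDiscDeriv c z • pairToComplex).prod 0) z :=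
      (hasFDerivAt_halfDiscMap c hz).prodMk (hasFDerivAt_const _ _)
    have h2 := HasMFDerivAt.comp (g := Φ) (f := fun z => ((halfDiscMap c z, 0) : ℂ × ℝ)) z
      (hΦ.mdifferentiableAt (by simp)).hasMFDerivAt h1.hasMFDerivAt
    have h3 := h2.hasMFDerivWithinAt (s := strip) |>.mfderivWithin
      (uniqueDiffOn_strip z hz).uniqueMDiffWithinAt
    exact congrArg (fun L : ℝ × ℝ →L[ℝ] Euc 3 => L w) h3

/-- The properties of a radial parametrization at a point of the plane `ℂ × 0` that make the explicit
strips solutions of the boundary value problem. -/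
structure RadialAt [IsManifold (𝓡 3) ∞ M] {lam : ContactForm M} (J : CompatibleJ lam)
    (L Dstar : Set M) (Φ : ℂ × ℝ → M) (Q : M → ℂ × ℝ) (ξ : ℂ) : Prop where
  smooth : ContMDiffAt 𝓘(ℝ, ℂ × ℝ) (𝓡 3) ∞ Φ (ξ, 0)
  smooth_inv : ContMDiffAt (𝓡 3) 𝓘(ℝ, ℂ × ℝ) ∞ Q (Φ (ξ, 0))
  left_inv : Q (Φ (ξ, 0)) = (ξ, 0)
  form_eq : ∀ η : ℂ, pullForm lam Φ (ξ, 0) (η, 0) = 1 / 2 * crossProd ξ η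
  d_eq : ∀ η ζ : ℂ, lam.d (Φ (ξ, 0)) (mfderiv 𝓘(ℝ, ℂ × ℝ) (𝓡 3) Φ (ξ, 0) (η, (0 : ℝ)))
    (mfderiv 𝓘(ℝ, ℂ × ℝ) (𝓡 3) Φ (ξ, 0) (ζ, (0 : ℝ))) = crossProd η ζ
  J_eq : ∀ η : ℂ, J.J (Φ (ξ, 0)) (mfderiv 𝓘(ℝ, ℂ × ℝ) (𝓡 3) Φ (ξ, 0) (η, (0 : ℝ))) =
    mfderiv 𝓘(ℝ, ℂ × ℝ) (𝓡 3) Φ (ξ, 0) (I * η, (0 : ℝ)) -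
      (1 / 2 * crossProd ξ (I * η)) • lam.reeb (Φ (ξ, 0))
  knot : ξ.re = 0 → Φ (ξ, 0) ∈ L
  surface : 0 ≤ ξ.re → ξ ≠ 0 → Φ (ξ, 0) ∈ Dstar

variable [IsManifold (𝓡 3) ∞ M] {lam : ContactForm M} {J : CompatibleJ lam} {L Dstar : Set M}
  {Q : M → ℂ × ℝ}

theorem pairToComplex_one_zero : pairToComplex (1, 0) = 1 := by simp [pairToComplex_apply]

theorem pairToComplex_zero_one : pairToComplex (0, 1) = I := by simp [pairToComplex_apply]

theorem crossProd_mul_I (ξ η : ℂ) : crossProd ξ (η * I) = dotProd ξ η := by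
  simp [crossProd, dotProd]

theorem dotProd_mul_I (ξ η : ℂ) : dotProd ξ (η * I) = -crossProd ξ η := by
  simp [crossProd, dotProd]; ring

/-- For a complex differentiable `ξ` the height satisfies `a_s = λ(u_t)` and `a_t = -λ(u_s)`,
because `λ` is `(x dy - y dx) / 2` on the plane and `a` differs from `|ξ|² / 4` by a constant. In
the contact planes the equation is complex linearity of `Dξ`, since `J` acts there as multiplication
by `i`. -/
theorem radialStrip_holomorphic (hz : z ∈ strip) (h : RadialAt J L Dstar Φ Q (halfDiscMap c z)) :
    stripDeriv (radialStrip Φ c) z (1, 0) +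
      J.tilde (radialStrip Φ c z).2 (stripDeriv (radialStrip Φ c) z (0, 1)) = 0 := by
  rw [stripDeriv_radialStrip hz h.smooth, stripDeriv_radialStrip hz h.smooth,
    pairToComplex_one_zero, pairToComplex_zero_one, mul_one]
  set ξ := halfDiscMap c z with hξ
  set κ := halfDiscDeriv c z
  have h1 := h.form_eq (κ * I)
  have h2 := h.J_eq (κ * I)
  have h3 : I * (κ * I) = -κ := by linear_combination κ * Complex.I_mul_I
  rw [crossProd_mul_I] at h1
  rw [h3] at h2
  have h4 : mfderiv 𝓘(ℝ, ℂ × ℝ) (𝓡 3) Φ (ξ, 0) (-κ, (0 : ℝ)) =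
      -mfderiv 𝓘(ℝ, ℂ × ℝ) (𝓡 3) Φ (ξ, 0) (κ, (0 : ℝ)) := by
    have hD : ∀ D : ℂ × ℝ →L[ℝ] Euc 3, D (-κ, (0 : ℝ)) = -D (κ, (0 : ℝ)) := fun D => by
      rw [← map_neg]; simp
    exact hD _
  have h5 : crossProd ξ (-κ) = -crossProd ξ κ := by simp [crossProd]; ring
  refine Prod.ext ?_ ?_
  · change 1 / 2 * dotProd ξ κ + -pullForm lam Φ (ξ, 0) (κ * I, 0) = 0
    rw [h1]; ring
  · change mfderiv 𝓘(ℝ, ℂ × ℝ) (𝓡 3) Φ (ξ, 0) (κ, (0 : ℝ)) +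
      ((1 / 2 * dotProd ξ (κ * I)) • lam.reeb (Φ (ξ, 0)) +
        J.J (Φ (ξ, 0)) (mfderiv 𝓘(ℝ, ℂ × ℝ) (𝓡 3) Φ (ξ, 0) (κ * I, (0 : ℝ)))) = 0
    rw [h2, h4, h5, dotProd_mul_I]
    module

theorem dCutoff_radialStrip (φ : ℝ → ℝ) (hz : z ∈ strip)
    (h : RadialAt J L Dstar Φ Q (halfDiscMap c z)) :
    dCutoff lam φ (radialStrip Φ c z).1 (radialStrip Φ c z).2
      (stripDeriv (radialStrip Φ c) z (1, 0)) (stripDeriv (radialStrip Φ c) z (0, 1)) =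
    deriv φ (stripHeight c z) * ((1 / 2 * dotProd (halfDiscMap c z) (halfDiscDeriv c z)) ^ 2 +
        (1 / 2 * crossProd (halfDiscMap c z) (halfDiscDeriv c z)) ^ 2) +
      φ (stripHeight c z) * ‖halfDiscDeriv c z‖ ^ 2 := by
  rw [stripDeriv_radialStrip hz h.smooth, stripDeriv_radialStrip hz h.smooth,
    pairToComplex_one_zero, pairToComplex_zero_one, mul_one]
  set ξ := halfDiscMap c z with hξ
  set κ := halfDiscDeriv c z
  have h1 := h.form_eq (κ * I)
  have h0 := h.form_eq κ
  have h2 := h.d_eq κ (κ * I)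
  rw [crossProd_mul_I] at h1 h2
  change deriv φ (stripHeight c z) * (1 / 2 * dotProd ξ κ * pullForm lam Φ (ξ, 0) (κ * I, 0) -
    1 / 2 * dotProd ξ (κ * I) * pullForm lam Φ (ξ, 0) (κ, 0)) + φ (stripHeight c z) *
    lam.d (Φ (ξ, 0)) (mfderiv 𝓘(ℝ, ℂ × ℝ) (𝓡 3) Φ (ξ, 0) (κ, (0 : ℝ)))
      (mfderiv 𝓘(ℝ, ℂ × ℝ) (𝓡 3) Φ (ξ, 0) (κ * I, (0 : ℝ))) = _
  rw [h1, h0, h2, dotProd_mul_I, ← Complex.normSq_eq_norm_sq, Complex.normSq_apply]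
  simp only [dotProd]
  ring

theorem halfDiscMap_zero_re (c s : ℝ) : (halfDiscMap c (s, 0)).re = 0 := by
  simp [halfDiscMap, stripDisc_im_zero]

theorem halfDiscMap_one (hc : 0 < c) (s : ℝ) :
    ‖halfDiscMap c (s, 1)‖ = c ∧ 0 < (halfDiscMap c (s, 1)).re := by
  obtain ⟨h1, h2⟩ := stripDisc_one s
  refine ⟨by rw [norm_halfDiscMap, h1, mul_one, abs_of_pos hc], ?_⟩
  simp [halfDiscMap]
  positivity

/-- The component in `M` is already injective: `dλ` restricts to the area form on the plane, which
detects vectors, and the derivative of `halfDiscMap` is multiplication by a nonzero number. -/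
theorem stripDeriv_radialStrip_injective (hc : 0 < c) (hz : z ∈ strip)
    (h : RadialAt J L Dstar Φ Q (halfDiscMap c z)) :
    Function.Injective (stripDeriv (radialStrip Φ c) z) := by
  intro w w' hw
  rw [stripDeriv_radialStrip hz h.smooth, stripDeriv_radialStrip hz h.smooth] at hw
  have h1 := congrArg Prod.snd hw
  simp only at h1
  set η := halfDiscDeriv c z * pairToComplex w
  set η' := halfDiscDeriv c z * pairToComplex w'
  have h2 : ∀ ζ : ℂ, crossProd η ζ = crossProd η' ζ := fun ζ => by
    rw [← h.d_eq, ← h.d_eq, h1]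
  have h3 := h2 1
  have h4 := h2 I
  simp [crossProd] at h3 h4
  have h5 : η = η' := Complex.ext h4 h3
  have h6 : pairToComplex w = pairToComplex w' := mul_left_cancel₀ (halfDiscDeriv_ne_zero hc.ne' hz) h5
  rw [pairToComplex_apply, pairToComplex_apply] at h6
  have h7 := congrArg Complex.re h6
  have h8 := congrArg Complex.im h6
  simp at h7 h8
  exact Prod.ext h7 h8

theorem isEmbedding_of_leftInverse {X Y : Type*} [TopologicalSpace X] [TopologicalSpace Y]
    {s : Set X} {f : X → Y} {g : Y → X} (hf : ContinuousOn f s) (hgf : ∀ x ∈ s, g (f x) = x)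
    (hg : ∀ x ∈ s, ContinuousAt g (f x)) : Topology.IsEmbedding (s.domRestrict f) := by
  refine ⟨Topology.isInducing_iff_nhds.2 fun x => le_antisymm ?_ ?_, fun x y hxy => ?_⟩
  · exact (continuousOn_iff_continuous_domRestrict.1 hf).continuousAt.tendsto.le_comap
  · rw [nhds_subtype_eq_comap]
    have h1 := hg x x.2
    have h2 : Tendsto g (𝓝 (f x)) (𝓝 (x : X)) := by
      have := h1.tendsto
      rwa [hgf x x.2] at this
    calc comap (s.domRestrict f) (𝓝 (s.domRestrict f x))
        ≤ comap (s.domRestrict f) (comap g (𝓝 (x : X))) := comap_mono h2.le_comap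
      _ = comap Subtype.val (𝓝 (x : X)) := by
        rw [comap_comap]
        congr 1
        funext y
        exact hgf y y.2
  · refine Subtype.ext ?_
    rw [← hgf x x.2, ← hgf y y.2]
    exact congrArg g hxy

theorem isEmbeddedStrip_radialStrip (hc : 0 < c)
    (h : ∀ z ∈ strip, RadialAt J L Dstar Φ Q (halfDiscMap c z)) :
    IsEmbeddedStrip (radialStrip Φ c) where
  immersion z hz := stripDeriv_radialStrip_injective hc hz (h z hz)
  embedding := by
    have hmul : ∀ z, I * (c : ℂ)⁻¹ * halfDiscMap c z = stripDisc z := by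
      intro z
      have : (c : ℂ) ≠ 0 := by exact_mod_cast hc.ne'
      rw [halfDiscMap]
      field_simp
      linear_combination -stripDisc z * Complex.I_sq
    refine isEmbedding_of_leftInverse
      -- A left inverse of the strip: recover `ξ` by `Q`, rescale and rotate it to the unit half
      -- disc, and apply the inverse conformal map.
      (g := fun p : ℝ × M => discStrip (I * (c : ℂ)⁻¹ * (Q p.2).1)) (fun z hz =>
      (contMDiffAt_radialStrip hz (h z hz).smooth).continuousAt.continuousWithinAt)
      (fun z hz => ?_) (fun z hz => ?_)
    · simp only [radialStrip]
      rw [(h z hz).left_inv, hmul, discStrip_stripDisc hz]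
    · have h1 : ContinuousAt (fun p : ℝ × M => I * (c : ℂ)⁻¹ * (Q p.2).1) (radialStrip Φ c z) := by
        have h2 : ContinuousAt Q (radialStrip Φ c z).2 := (h z hz).smooth_inv.continuousAt
        exact continuousAt_const.mul (continuousAt_fst.comp (h2.comp continuousAt_snd))
      refine ContinuousAt.comp (g := discStrip) ?_ h1
      have h3 : I * (c : ℂ)⁻¹ * (Q (radialStrip Φ c z).2).1 = stripDisc z := by
        simp only [radialStrip]
        rw [(h z hz).left_inv, hmul]
      rw [h3]
      exact continuousAt_discStrip hz

/-- Over the same point `ξ` the two heights differ by `(c² - c'²) / 4`. -/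
theorem disjoint_radialStrip {c' : ℝ} (hc : 0 < c) (hc' : 0 < c') (hne : c ≠ c')
    (h : ∀ z ∈ strip, RadialAt J L Dstar Φ Q (halfDiscMap c z))
    (h' : ∀ z ∈ strip, RadialAt J L Dstar Φ Q (halfDiscMap c' z)) :
    Disjoint (radialStrip Φ c '' strip) (radialStrip Φ c' '' strip) := by
  rw [Set.disjoint_left]
  rintro _ ⟨z, hz, rfl⟩ ⟨z', hz', heq⟩
  have h1 := congrArg Prod.fst heq
  have h2 := congrArg (fun p => Q p.2) heq
  simp only [radialStrip] at h1 h2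
  rw [(h z hz).left_inv, (h' z' hz').left_inv] at h2
  have h3 : halfDiscMap c' z' = halfDiscMap c z := congrArg Prod.fst h2
  rw [stripHeight, stripHeight, h3] at h1
  apply hne
  nlinarith

end StripSolutions

/-! ### Energy of the explicit strips. -/

section StripEnergy

open Complex (I)

theorem dotProd_eq_inner (ξ η : ℂ) : dotProd ξ η = inner ℝ ξ η := by
  simp [dotProd, Complex.inner]; ring

theorem abs_dotProd_le (ξ η : ℂ) : |dotProd ξ η| ≤ ‖ξ‖ * ‖η‖ := by
  rw [dotProd_eq_inner]; exact abs_real_inner_le_norm ξ η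

/-- The value of `κ` is irrelevant. Only complex linearity matters, because it makes the
second-order terms cancel in `div_energyFlux`. -/
theorem hasFDerivAt_halfDiscDeriv (c : ℝ) {z : ℝ × ℝ} (hz : z ∈ strip) : ∃ κ : ℂ,
    HasFDerivAt (halfDiscDeriv c) (κ • pairToComplex) z := by
  have h1 := ((((hasFDerivAt_stripDisc hz).pow 2).const_sub 1).const_mul
    (↑(Real.pi / 4) : ℂ)).const_mul (-(I * c))
  refine ⟨-(I * c) * (↑(Real.pi / 4) *
    -(2 * stripDisc z * (↑(Real.pi / 4) * (1 - stripDisc z ^ 2)))), h1.congr_fderiv ?_⟩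
  refine ContinuousLinearMap.ext fun w => ?_
  simp
  ring

/-- The components of the vector field whose divergence is the energy density. -/
def energyFlux (φ : ℝ → ℝ) (c : ℝ) (ν : ℂ) (z : ℝ × ℝ) : ℝ :=
  φ (stripHeight c z) * (1 / 2 * dotProd (halfDiscMap c z) (halfDiscDeriv c z * ν))

/-- The integrand of the energy of the explicit solutions. -/
def energyDensity (φ : ℝ → ℝ) (c : ℝ) (z : ℝ × ℝ) : ℝ :=
  deriv φ (stripHeight c z) * ((1 / 2 * dotProd (halfDiscMap c z) (halfDiscDeriv c z)) ^ 2 +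
      (1 / 2 * crossProd (halfDiscMap c z) (halfDiscDeriv c z)) ^ 2) +
    φ (stripHeight c z) * ‖halfDiscDeriv c z‖ ^ 2

variable {φ : ℝ → ℝ} {c : ℝ} {z : ℝ × ℝ}

theorem contDiffAt_halfDiscDeriv (c : ℝ) (hz : z ∈ strip) : ContDiffAt ℝ ∞ (halfDiscDeriv c) z :=
  contDiffAt_const.mul (contDiffAt_const.mul
    ((contDiffAt_const (c := (1 : ℂ))).sub ((contDiffAt_stripDisc hz).pow 2)))

theorem hasFDerivAt_energyFlux (hφ : ContDiff ℝ ∞ φ) (hz : z ∈ strip) : ∃ κ : ℂ, ∀ ν : ℂ,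
    ∃ L : ℝ × ℝ →L[ℝ] ℝ, HasFDerivAt (energyFlux φ c ν) L z ∧ ∀ w, L w =
      deriv φ (stripHeight c z) * (1 / 2 *
        dotProd (halfDiscMap c z) (halfDiscDeriv c z * pairToComplex w)) *
        (1 / 2 * dotProd (halfDiscMap c z) (halfDiscDeriv c z * ν)) +
      φ (stripHeight c z) * (1 / 2 *
        (dotProd (halfDiscDeriv c z * pairToComplex w) (halfDiscDeriv c z * ν) +
        dotProd (halfDiscMap c z) (κ * pairToComplex w * ν))) := by
  obtain ⟨κ, hκ⟩ := hasFDerivAt_halfDiscDeriv c hz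
  refine ⟨κ, fun ν => ?_⟩
  have h1 : HasFDerivAt (fun z => φ (stripHeight c z)) _ z :=
    (((hφ.differentiable (by simp)) (stripHeight c z)).hasDerivAt).comp_hasFDerivAt z
      (hasFDerivAt_stripHeight c hz)
  have h2 := ((hasFDerivAt_halfDiscMap c hz).inner ℝ (hκ.mul_const ν)).const_mul (1 / 2 : ℝ)
  have h3 := h1.mul h2
  refine ⟨_, h3.congr_of_eventuallyEq (Eventually.of_forall fun y => ?_), fun w => ?_⟩
  · simp only [energyFlux, dotProd_eq_inner, Pi.mul_apply]
  · have h4 : ν * (κ * pairToComplex w) = κ * pairToComplex w * ν := by ring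
    simp only [add_apply, smul_apply, ContinuousLinearMap.comp_apply, innerSL_apply_apply,
      fderivInnerCLM_apply, ContinuousLinearMap.prod_apply, smul_eq_mul, dotProd_eq_inner, h4]
    ring

/-- The energy density is the divergence of the energy flux. -/
theorem div_energyFlux (hφ : ContDiff ℝ ∞ φ) (hz : z ∈ strip) :
    DifferentiableAt ℝ (energyFlux φ c 1) z ∧ DifferentiableAt ℝ (energyFlux φ c I) z ∧
    fderiv ℝ (energyFlux φ c 1) z (1, 0) + fderiv ℝ (energyFlux φ c I) z (0, 1) =
      energyDensity φ c z := by
  obtain ⟨κ, h⟩ := hasFDerivAt_energyFlux (c := c) hφ hz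
  obtain ⟨L₁, h1, hL1⟩ := h 1
  obtain ⟨L₂, h2, hL2⟩ := h I
  refine ⟨h1.differentiableAt, h2.differentiableAt, ?_⟩
  rw [h1.fderiv, h2.fderiv, hL1, hL2, pairToComplex_one_zero, pairToComplex_zero_one, mul_one,
    energyDensity, ← Complex.normSq_eq_norm_sq, Complex.normSq_apply]
  -- The terms with `κ` enter with the factors `1 * 1` and `I * I` and cancel.
  simp [dotProd, crossProd]
  ring

theorem continuousOn_energyDensity (hφ : ContDiff ℝ ∞ φ) :
    ContinuousOn (energyDensity φ c) strip := by
  intro z hz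
  have h1 := (contDiffAt_stripHeight c hz).continuousAt
  have h2 := (contDiffAt_halfDiscMap c hz).continuousAt
  have h3 := (contDiffAt_halfDiscDeriv c hz).continuousAt
  have hre : Continuous Complex.re := Complex.continuous_re
  have him : Continuous Complex.im := Complex.continuous_im
  have h2r := hre.continuousAt.comp h2
  have h2i := him.continuousAt.comp h2
  have h3r := hre.continuousAt.comp h3
  have h3i := him.continuousAt.comp h3
  have h4 : ContinuousAt (fun z => deriv φ (stripHeight c z)) z :=
    (hφ.continuous_deriv (by simp)).continuousAt.comp h1
  have h5 : ContinuousAt (fun z => φ (stripHeight c z)) z := hφ.continuous.continuousAt.comp h1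
  refine ContinuousAt.continuousWithinAt ?_
  unfold energyDensity dotProd crossProd
  exact (h4.mul (((continuousAt_const.mul ((h2r.mul h3r).add (h2i.mul h3i))).pow 2).add
    ((continuousAt_const.mul ((h2r.mul h3i).sub (h2i.mul h3r))).pow 2))).add (h5.mul (h3.norm.pow 2))

theorem energyDensity_nonneg (hφ0 : ∀ x, 0 ≤ φ x) (hφ' : ∀ x, 0 ≤ deriv φ x) :
    0 ≤ energyDensity φ c z := by
  have h1 := hφ0 (stripHeight c z)
  have h2 := hφ' (stripHeight c z)
  unfold energyDensity
  positivity

theorem abs_energyFlux_le (hφ01 : ∀ x, φ x ∈ Icc (0 : ℝ) 1) (hz : z ∈ strip) {ν : ℂ}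
    (hν : ‖ν‖ = 1) : |energyFlux φ c ν z| ≤ Real.pi / 2 * c ^ 2 * (1 + z.1 ^ 2)⁻¹ := by
  have h1 := abs_dotProd_le (halfDiscMap c z) (halfDiscDeriv c z * ν)
  rw [norm_mul, hν, mul_one] at h1
  have h2 : ‖halfDiscMap c z‖ * ‖halfDiscDeriv c z‖ ≤ |c| * (|c| * (Real.pi * (1 + z.1 ^ 2)⁻¹)) :=
    mul_le_mul (norm_halfDiscMap_le c hz) (norm_halfDiscDeriv_le c hz) (norm_nonneg _)
      (abs_nonneg _)
  have h3 : |c| * |c| = c ^ 2 := by rw [abs_mul_abs_self, sq]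
  have h4 := hφ01 (stripHeight c z)
  rw [energyFlux, abs_mul, abs_mul, abs_of_nonneg h4.1, abs_of_pos (by norm_num : (0 : ℝ) < 1 / 2)]
  have h5 : 0 ≤ |dotProd (halfDiscMap c z) (halfDiscDeriv c z * ν)| := abs_nonneg _
  calc φ (stripHeight c z) * (1 / 2 * |dotProd (halfDiscMap c z) (halfDiscDeriv c z * ν)|)
      ≤ 1 * (1 / 2 * |dotProd (halfDiscMap c z) (halfDiscDeriv c z * ν)|) :=
        mul_le_mul_of_nonneg_right h4.2 (by positivity)
    _ ≤ 1 * (1 / 2 * (|c| * (|c| * (Real.pi * (1 + z.1 ^ 2)⁻¹)))) := by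
        have := h1.trans h2
        gcongr
    _ = Real.pi / 2 * c ^ 2 * (1 + z.1 ^ 2)⁻¹ := by rw [← h3]; ring

/-- Divergence theorem on `[-n, n] × [0, 1]`. With `C = π c² / 2` the flux is at most `C / (1 +
s²)`, so each horizontal side contributes at most `C π` and each vertical side at most `C`,
independently of `n` and of `φ`. -/
theorem setIntegral_energyDensity_le (hφ : ContDiff ℝ ∞ φ) (hφ01 : ∀ x, φ x ∈ Icc (0 : ℝ) 1)
    {n : ℝ} (hn : 0 ≤ n) : IntegrableOn (energyDensity φ c) (Icc (-n, 0) (n, 1)) ∧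
      ∫ z in Icc (-n, (0 : ℝ)) (n, 1), energyDensity φ c z ≤
        Real.pi / 2 * c ^ 2 * (2 * Real.pi + 2) := by
  have hsub : Icc (-n, (0 : ℝ)) (n, 1) ⊆ strip := fun z hz => ⟨hz.1.2, hz.2.2⟩
  have hintegrable : IntegrableOn (energyDensity φ c) (Icc (-n, (0 : ℝ)) (n, 1)) :=
    ((continuousOn_energyDensity hφ).mono hsub).integrableOn_compact isCompact_Icc
  refine ⟨hintegrable, ?_⟩
  have hle : ((-n, 0) : ℝ × ℝ) ≤ (n, 1) := ⟨by linarith, zero_le_one⟩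
  have hdiv := fun z (hz : z ∈ Icc (-n, (0 : ℝ)) (n, 1)) => div_energyFlux (c := c) hφ (hsub hz)
  have hIoo : ∀ x ∈ Ioo (-n) n ×ˢ Ioo (0 : ℝ) 1, x ∈ Icc (-n, (0 : ℝ)) (n, 1) := fun x hx =>
    ⟨⟨hx.1.1.le, hx.2.1.le⟩, ⟨hx.1.2.le, hx.2.2.le⟩⟩
  have h1 := integral_divergence_prod_Icc_of_hasFDerivAt_of_le (energyFlux φ c 1)
    (energyFlux φ c I) (fderiv ℝ (energyFlux φ c 1)) (fderiv ℝ (energyFlux φ c I)) (-n, 0) (n, 1) hle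
    (fun z hz => (hdiv z hz).1.continuousAt.continuousWithinAt)
    (fun z hz => (hdiv z hz).2.1.continuousAt.continuousWithinAt)
    (fun z hz => (hdiv z (hIoo z hz)).1.hasFDerivAt)
    (fun z hz => (hdiv z (hIoo z hz)).2.1.hasFDerivAt)
    (hintegrable.congr_fun (fun z hz => (hdiv z hz).2.2.symm) measurableSet_Icc)
  rw [setIntegral_congr_fun measurableSet_Icc fun z hz => (hdiv z hz).2.2] at h1
  rw [h1]
  set C := Real.pi / 2 * c ^ 2 with hC
  have hC0 : 0 ≤ C := by positivity
  have hor : ∀ t ∈ Icc (0 : ℝ) 1, |∫ x in (-n)..n, energyFlux φ c I (x, t)| ≤ C * Real.pi := by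
    intro t ht
    have hb : IntervalIntegrable (fun x : ℝ => C * (1 + x ^ 2)⁻¹) volume (-n) n :=
      (intervalIntegral.intervalIntegrable_inv_one_add_sq).const_mul C
    have h2 : ‖∫ x in (-n)..n, energyFlux φ c I (x, t)‖ ≤ ∫ x in (-n)..n, C * (1 + x ^ 2)⁻¹ :=
      intervalIntegral.norm_integral_le_of_norm_le (by linarith)
        (Eventually.of_forall fun x _ => abs_energyFlux_le hφ01 (z := (x, t)) ht (by simp)) hb
    rw [intervalIntegral.integral_const_mul, integral_inv_one_add_sq] at h2
    refine h2.trans (mul_le_mul_of_nonneg_left ?_ hC0)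
    have := Real.arctan_lt_pi_div_two n
    have := Real.neg_pi_div_two_lt_arctan (-n)
    linarith
  have hver : ∀ x : ℝ, |∫ y in (0 : ℝ)..1, energyFlux φ c 1 (x, y)| ≤ C := by
    intro x
    have h2 := intervalIntegral.norm_integral_le_of_norm_le_const (a := (0 : ℝ)) (b := 1)
      (f := fun y => energyFlux φ c 1 (x, y)) (C := C) (fun y hy => by
        rw [uIoc_of_le zero_le_one] at hy
        refine (abs_energyFlux_le hφ01 (z := (x, y)) ⟨hy.1.le, hy.2⟩ (by simp)).trans ?_
        refine mul_le_of_le_one_right hC0 (inv_le_one_of_one_le₀ ?_)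
        nlinarith [sq_nonneg x])
    simpa using h2
  have e1 := abs_le.1 (hor 1 ⟨zero_le_one, le_rfl⟩)
  have e2 := abs_le.1 (hor 0 ⟨le_rfl, zero_le_one⟩)
  have e3 := abs_le.1 (hver n)
  have e4 := abs_le.1 (hver (-n))
  simp only
  nlinarith

theorem lintegral_energyDensity_le (hφ : ContDiff ℝ ∞ φ) (hφ01 : ∀ x, φ x ∈ Icc (0 : ℝ) 1)
    (hφ' : ∀ x, 0 ≤ deriv φ x) : ∫⁻ z in strip, ENNReal.ofReal (energyDensity φ c z) ≤
      ENNReal.ofReal (Real.pi / 2 * c ^ 2 * (2 * Real.pi + 2)) := by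
  have hun : strip = ⋃ n : ℕ, Icc (-(n : ℝ), (0 : ℝ)) (n, 1) := by
    ext z
    simp only [strip, mem_ofPred_eq, mem_iUnion, mem_Icc, Prod.le_def]
    refine ⟨fun h => ?_, fun ⟨n, h⟩ => ⟨h.1.2, h.2.2⟩⟩
    obtain ⟨n, hn⟩ := exists_nat_ge |z.1|
    obtain ⟨h1, h2⟩ := abs_le.1 hn
    exact ⟨n, ⟨h1, h.1⟩, ⟨h2, h.2⟩⟩
  have hdir : Directed (· ⊆ ·) fun n : ℕ => Icc (-(n : ℝ), (0 : ℝ)) ((n : ℝ), 1) := by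
    refine directed_of_isDirected_le fun m n hmn => Icc_subset_Icc ?_ ?_
    · exact ⟨by simpa using hmn, le_rfl⟩
    · exact ⟨by simpa using hmn, le_rfl⟩
  rw [hun, setLIntegral_iUnion_of_directed _ hdir]
  refine iSup_le fun n => ?_
  obtain ⟨h1, h2⟩ := setIntegral_energyDensity_le (c := c) hφ hφ01 (Nat.cast_nonneg n)
  rw [← ofReal_integral_eq_lintegral_ofReal h1
    (Eventually.of_forall fun z => energyDensity_nonneg (fun x => (hφ01 x).1) hφ')]
  exact ENNReal.ofReal_le_ofReal h2

theorem measurableSet_strip : MeasurableSet strip :=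
  ((isClosed_le continuous_const continuous_snd).inter
    (isClosed_le continuous_snd continuous_const)).measurableSet

/-- For `φ = 1` the density is `‖halfDiscDeriv c z‖²`, continuous and nowhere zero, hence bounded
below on a unit square. -/
theorem lintegral_energyDensity_one_pos (hc : 0 < c) :
    0 < ∫⁻ z in strip, ENNReal.ofReal (energyDensity (fun _ => 1) c z) := by
  set K : Set (ℝ × ℝ) := Icc (0, 0) (1, 1) with hK
  have hsub : K ⊆ strip := fun z hz => ⟨hz.1.2, hz.2.2⟩
  have hpos : ∀ z ∈ K, 0 < energyDensity (fun _ => 1) c z := by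
    intro z hz
    have := norm_pos_iff.2 (halfDiscDeriv_ne_zero hc.ne' (hsub hz))
    simp [energyDensity]
    positivity
  obtain ⟨z₀, hz₀, hmin⟩ := (isCompact_Icc (a := ((0, 0) : ℝ × ℝ)) (b := (1, 1))).exists_isMinOn
    ⟨(0, 0), ⟨le_rfl, by constructor <;> simp⟩⟩
    ((continuousOn_energyDensity (c := c) (φ := fun _ => 1) contDiff_const).mono hsub)
  have hvol : 0 < volume K := by
    have : K = Icc (0 : ℝ) 1 ×ˢ Icc (0 : ℝ) 1 := by rw [Icc_prod_Icc]
    rw [this, Measure.volume_eq_prod, Measure.prod_prod]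
    simp
  calc (0 : ℝ≥0∞) < ENNReal.ofReal (energyDensity (fun _ => 1) c z₀) * volume K :=
        ENNReal.mul_pos (ENNReal.ofReal_pos.2 (hpos z₀ hz₀)).ne' hvol.ne'
    _ = ∫⁻ _ in K, ENNReal.ofReal (energyDensity (fun _ => 1) c z₀) := by
        rw [setLIntegral_const]
    _ ≤ ∫⁻ z in K, ENNReal.ofReal (energyDensity (fun _ => 1) c z) :=
        setLIntegral_mono' measurableSet_Icc fun z hz => ENNReal.ofReal_le_ofReal (hmin hz)
    _ ≤ _ := lintegral_mono_set hsub

variable {M : Type*} [TopologicalSpace M] [ChartedSpace (Euc 3) M] [IsManifold (𝓡 3) ∞ M]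
  {lam : ContactForm M} {J : CompatibleJ lam} {L Dstar : Set M} {Φ : ℂ × ℝ → M} {Q : M → ℂ × ℝ}

theorem isStripSolution_radialStrip (hc : 0 < c)
    (h : ∀ z ∈ strip, RadialAt J L Dstar Φ Q (halfDiscMap c z)) :
    IsStripSolution J L Dstar (radialStrip Φ c) := by
  have hE : ∀ φ : ℝ → ℝ, ∫⁻ z in strip, ENNReal.ofReal (dCutoff lam φ (radialStrip Φ c z).1
      (radialStrip Φ c z).2 (stripDeriv (radialStrip Φ c) z (1, 0))
      (stripDeriv (radialStrip Φ c) z (0, 1))) =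
      ∫⁻ z in strip, ENNReal.ofReal (energyDensity φ c z) := fun φ =>
    setLIntegral_congr_fun measurableSet_strip fun z hz =>
      congrArg ENNReal.ofReal (dCutoff_radialStrip φ hz (h z hz))
  refine ⟨fun z hz => (contMDiffAt_radialStrip hz (h z hz).smooth).contMDiffWithinAt,
    fun z hz => radialStrip_holomorphic hz (h z hz), fun s => ?_, fun s => ⟨?_, ?_⟩, ?_, ?_⟩
  · exact (h (s, 0) ⟨le_rfl, zero_le_one⟩).knot (halfDiscMap_zero_re c s)
  · simp [radialStrip, stripHeight, (halfDiscMap_one hc s).1]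
  · have h1 := halfDiscMap_one hc s
    exact (h (s, 1) ⟨zero_le_one, le_rfl⟩).surface h1.2.le fun h0 => by simp [h0] at h1
  · refine lt_of_lt_of_le (lintegral_energyDensity_one_pos hc) ?_
    rw [← hE]
    exact le_iSup (fun φ : EnergyCutoff => ∫⁻ z in strip, ENNReal.ofReal (dCutoff lam φ.1
      (radialStrip Φ c z).1 (radialStrip Φ c z).2 (stripDeriv (radialStrip Φ c) z (1, 0))
      (stripDeriv (radialStrip Φ c) z (0, 1))))
      ⟨fun _ => 1, contDiff_const, fun _ => ⟨zero_le_one, le_rfl⟩, fun _ => by simp⟩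
  · refine lt_of_le_of_lt (iSup_le fun φ => ?_)
      (ENNReal.ofReal_lt_top (r := Real.pi / 2 * c ^ 2 * (2 * Real.pi + 2)))
    rw [hE]
    exact lintegral_energyDensity_le φ.2.1 φ.2.2.1 φ.2.2.2

end StripEnergy

/-! ### The family of strips in a radial parametrization. -/

section RadialParametrization

open Complex (I)

variable {M : Type*} [TopologicalSpace M] [ChartedSpace (Euc 3) M] [IsManifold (𝓡 3) ∞ M]

/-- A parametrization around a boundary point `e` of a surface, adapted to a contact form: the
surface corresponds to the half plane `0 ≤ re`, its boundary to the imaginary axis, and the contact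
form pulls back to `(x dy - y dx) / 2` on the plane. -/
structure IsRadialParam (lam : ContactForm M) (L Dstar : Set M) (Φ : ℂ × ℝ → M) (Q : M → ℂ × ℝ)
    (e : M) : Prop extends IsLocalParam Φ Q e where
  center : Q e = 0
  radial : ∀ᶠ ξ in 𝓝 (0 : ℂ), ∀ η, pullForm lam Φ (ξ, 0) (η, 0) = 1 / 2 * crossProd ξ η
  knot : ∀ᶠ ξ in 𝓝 (0 : ℂ), ξ.re = 0 → Φ (ξ, 0) ∈ L
  surface : ∀ᶠ ξ in 𝓝 (0 : ℂ), 0 ≤ ξ.re → ξ ≠ 0 → Φ (ξ, 0) ∈ Dstar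

variable {lam : ContactForm M} {L Dstar : Set M} {Φ : ℂ × ℝ → M} {Q : M → ℂ × ℝ} {e : M}

theorem tendsto_prodMk_zero : Tendsto (fun ξ : ℂ => ((ξ, 0) : ℂ × ℝ)) (𝓝 0) (𝓝 0) :=
  (continuous_id.prodMk continuous_const).tendsto' _ _ rfl

/-- The bilinear form `crossProd`, as a continuous linear map. -/
def crossProdL : ℂ →L[ℝ] ℂ →L[ℝ] ℝ :=
  Complex.reCLM.smulRight Complex.imCLM - Complex.imCLM.smulRight Complex.reCLM

theorem crossProdL_apply (ξ η : ℂ) : crossProdL ξ η = crossProd ξ η := by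
  simp [crossProdL, crossProd]

theorem IsRadialParam.apply_zero (h : IsRadialParam lam L Dstar Φ Q e) : Φ 0 = e := by
  rw [← h.center]; exact h.right_inv.self_of_nhds

theorem IsRadialParam.eventually_smooth (h : IsRadialParam lam L Dstar Φ Q e) :
    ∀ᶠ ξ in 𝓝 (0 : ℂ), ContMDiffAt 𝓘(ℝ, ℂ × ℝ) (𝓡 3) ∞ Φ (ξ, 0) := by
  have := h.smooth
  rw [h.center] at this
  exact tendsto_prodMk_zero.eventually this

theorem IsRadialParam.tendsto (h : IsRadialParam lam L Dstar Φ Q e) :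
    Tendsto (fun ξ : ℂ => Φ (ξ, 0)) (𝓝 0) (𝓝 e) := by
  have h1 := h.eventually_smooth.self_of_nhds.continuousAt
  have h2 : Tendsto Φ (𝓝 0) (𝓝 (Φ 0)) := h1
  rw [h.apply_zero] at h2
  exact h2.comp tendsto_prodMk_zero

omit [IsManifold (𝓡 3) ∞ M] in
theorem mfderiv_comp_prodMk {ξ : ℂ} (hΦ : MDifferentiableAt 𝓘(ℝ, ℂ × ℝ) (𝓡 3) Φ (ξ, 0)) (η : ℂ) :
    (mfderiv 𝓘(ℝ, ℂ) (𝓡 3) (Φ ∘ fun ξ : ℂ => ((ξ, 0) : ℂ × ℝ)) ξ : ℂ →L[ℝ] Euc 3) η =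
      (mfderiv 𝓘(ℝ, ℂ × ℝ) (𝓡 3) Φ (ξ, 0) : ℂ × ℝ →L[ℝ] Euc 3) (η, 0) := by
  have h1 : HasFDerivAt (fun ξ : ℂ => ((ξ, 0) : ℂ × ℝ)) (ContinuousLinearMap.inl ℝ ℂ ℝ) ξ :=
    (ContinuousLinearMap.inl ℝ ℂ ℝ).hasFDerivAt
  have h2 := HasMFDerivAt.comp (g := Φ) (f := fun ξ : ℂ => ((ξ, 0) : ℂ × ℝ)) ξ hΦ.hasMFDerivAt
    h1.hasMFDerivAt
  exact congrArg (fun L : ℂ →L[ℝ] Euc 3 => L η) h2.mfderiv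

/-- Restriction to the plane commutes with the exterior derivative, and `d ((x dy - y dx) / 2) = dx
∧ dy`. -/
theorem IsRadialParam.eventually_d_eq (h : IsRadialParam lam L Dstar Φ Q e) :
    ∀ᶠ ξ in 𝓝 (0 : ℂ), ∀ η ζ : ℂ,
      lam.d (Φ (ξ, 0)) (mfderiv 𝓘(ℝ, ℂ × ℝ) (𝓡 3) Φ (ξ, 0) (η, (0 : ℝ)))
        (mfderiv 𝓘(ℝ, ℂ × ℝ) (𝓡 3) Φ (ξ, 0) (ζ, (0 : ℝ))) = crossProd η ζ := by
  filter_upwards [h.eventually_smooth.eventually_nhds, h.radial.eventually_nhds] with ξ h1 h2 η ζ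
  set f : ℂ → M := Φ ∘ fun ξ : ℂ => ((ξ, 0) : ℂ × ℝ) with hf
  have hfs : ContMDiffAt 𝓘(ℝ, ℂ) (𝓡 3) ∞ f ξ := by
    have h3 : ContDiff ℝ ∞ (fun ξ : ℂ => ((ξ, 0) : ℂ × ℝ)) := contDiff_id.prodMk contDiff_const
    exact ContMDiffAt.comp (g := Φ) (f := fun ξ : ℂ => ((ξ, 0) : ℂ × ℝ)) ξ h1.self_of_nhds
      h3.contMDiff.contMDiffAt
  have h4 := lam_d_mfderiv lam hfs η ζ
  have h5 : pullForm lam f =ᶠ[𝓝 ξ] (((1 / 2 : ℝ) • crossProdL : ℂ →L[ℝ] ℂ →L[ℝ] ℝ) : ℂ → _) := by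
    filter_upwards [h1, h2] with ξ' h6 h7
    refine ContinuousLinearMap.ext fun η => ?_
    have h8 : pullForm lam f ξ' η = pullForm lam Φ (ξ', 0) (η, 0) :=
      congrArg (lam.form (Φ (ξ', 0)) : Euc 3 →L[ℝ] ℝ)
        (mfderiv_comp_prodMk (h6.mdifferentiableAt (by simp)) η)
    rw [h8, h7]
    simp [crossProdL_apply]
  have h6 : skewDeriv (pullForm lam f) ξ η ζ = crossProd η ζ := by
    rw [skewDeriv, h5.fderiv_eq, ContinuousLinearMap.fderiv]
    simp [crossProdL_apply, crossProd]
    ring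
  rw [h6] at h4
  have h7 := mfderiv_comp_prodMk (h1.self_of_nhds.mdifferentiableAt (by simp))
  rw [← h4]
  exact congrArg₂ (fun x y : Euc 3 => (lam.d (Φ (ξ, 0)) : Euc 3 →L[ℝ] Euc 3 →L[ℝ] ℝ) x y)
    (h7 η).symm (h7 ζ).symm

omit [IsManifold (𝓡 3) ∞ M] in
theorem pushField_congr {p : M} {x : ℂ × ℝ} (h : Q p = x) (ζ : ℂ × ℝ) :
    pushField Φ Q ζ p = (mfderiv 𝓘(ℝ, ℂ × ℝ) (𝓡 3) Φ x : ℂ × ℝ →L[ℝ] Euc 3) ζ := by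
  subst h; rfl

theorem IsRadialParam.d_pushField_pos (h : IsRadialParam lam L Dstar Φ Q e) :
    0 < (lam.d e : Euc 3 →L[ℝ] Euc 3 →L[ℝ] ℝ) (pushField Φ Q (1, 0) e) (pushField Φ Q (I, 0) e) := by
  rw [pushField_congr h.center, pushField_congr h.center]
  have h1 := h.eventually_d_eq.self_of_nhds 1 I
  have h2 := d_congr lam h.apply_zero.symm
    ((mfderiv 𝓘(ℝ, ℂ × ℝ) (𝓡 3) Φ 0 : ℂ × ℝ →L[ℝ] Euc 3) (1, 0))
    ((mfderiv 𝓘(ℝ, ℂ × ℝ) (𝓡 3) Φ 0 : ℂ × ℝ →L[ℝ] Euc 3) (I, 0))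
  have h3 : crossProd 1 I = 1 := by simp [crossProd]
  rw [h3] at h1
  rw [h2]
  exact lt_of_lt_of_eq one_pos h1.symm

/-- Both sides are linear in `η`, so `η = 1` and `η = i` decide. Up to a multiple of `X`, the
rotation of the coordinate frame acts on the plane as multiplication by `i`; this is the property
`RadialAt.J_eq`. -/
theorem frameRotation_combination {α : Euc 3 →L[ℝ] ℝ} {β : Euc 3 →L[ℝ] Euc 3 →L[ℝ] ℝ} {X : Euc 3}
    (hβ : ∀ v w, β v w = -β w v) {D : ℂ × ℝ →L[ℝ] Euc 3} {ξ : ℂ} (h0 : 0 < β (D (1, 0)) (D (I, 0)))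
    (hα : ∀ η, α (D (η, 0)) = 1 / 2 * crossProd ξ η) (η : ℂ) :
    frameRotation α β X (D (1, 0)) (D (I, 0)) (D (η, 0)) =
      D (I * η, 0) - (1 / 2 * crossProd ξ (I * η)) • X := by
  have h1 : D (η, 0) = η.re • D (1, 0) + η.im • D (I, 0) := by
    rw [← map_smul, ← map_smul, ← map_add]
    congr 1
    ext <;> simp
  have h2 : D (I * η, 0) = η.re • D (I, 0) - η.im • D (1, 0) := by
    rw [← map_smul, ← map_smul, ← map_sub]
    congr 1
    exact Prod.ext (Complex.ext (by simp) (by simp)) (by simp)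
  have h3 : crossProd ξ (I * η) = η.re * crossProd ξ I - η.im * crossProd ξ 1 := by
    simp [crossProd]; ring
  rw [h1, h2, h3, map_add, map_smul, map_smul, frameRotation_apply_left hβ h0,
    frameRotation_apply_right hβ h0, hα, hα]
  module

theorem IsRadialParam.eventually_radialAt (h : IsRadialParam lam L Dstar Φ Q e) {J : CompatibleJ lam}
    (hJ : ∀ᶠ p in 𝓝 e,
      J.J p = rotationField lam (pushField Φ Q (1, 0)) (pushField Φ Q (I, 0)) p ∧
      0 < (lam.d p : Euc 3 →L[ℝ] Euc 3 →L[ℝ] ℝ)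
        (pushField Φ Q (1, 0) p) (pushField Φ Q (I, 0) p)) :
    ∀ᶠ ξ in 𝓝 (0 : ℂ), RadialAt J L Dstar Φ Q ξ := by
  have hl := h.left_inv
  rw [h.center] at hl
  filter_upwards [h.eventually_smooth, h.tendsto.eventually h.smooth_inv,
    tendsto_prodMk_zero.eventually hl, h.radial, h.eventually_d_eq, h.tendsto.eventually hJ, h.knot,
    h.surface] with ξ h1 h2 h3 h4 h5 h6 h7 h8
  refine ⟨h1, h2, h3, h4, h5, fun η => ?_, h7, h8⟩
  obtain ⟨h9, h10⟩ := h6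
  rw [pushField_congr h3, pushField_congr h3] at h10
  have h11 := frameRotation_combination (X := lam.reeb (Φ (ξ, 0))) (α := lam.form (Φ (ξ, 0)))
    (lam_d_skew lam (Φ (ξ, 0))) h10 h4 η
  have h12 : J.J (Φ (ξ, 0)) = frameRotation (lam.form (Φ (ξ, 0))) (lam.d (Φ (ξ, 0)))
      (lam.reeb (Φ (ξ, 0))) ((mfderiv 𝓘(ℝ, ℂ × ℝ) (𝓡 3) Φ (ξ, 0) : ℂ × ℝ →L[ℝ] Euc 3) (1, 0))
      ((mfderiv 𝓘(ℝ, ℂ × ℝ) (𝓡 3) Φ (ξ, 0) : ℂ × ℝ →L[ℝ] Euc 3) (I, 0)) := by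
    rw [h9, rotationField, pushField_congr h3, pushField_congr h3]
  rw [h12]
  exact h11

theorem stripHeight_mul (ε τ : ℝ) (z : ℝ × ℝ) : stripHeight (ε * τ) z =
    1 / 4 * (‖τ • halfDiscMap ε z‖ ^ 2 - (τ * ε) ^ 2) := by
  have : halfDiscMap (ε * τ) z = τ • halfDiscMap ε z := by
    rw [halfDiscMap, halfDiscMap, Complex.real_smul]; push_cast; ring
  rw [stripHeight, this, mul_comm ε τ]

theorem halfDiscMap_mul (ε τ : ℝ) (z : ℝ × ℝ) :
    halfDiscMap (ε * τ) z = τ • halfDiscMap ε z := by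
  rw [halfDiscMap, halfDiscMap, Complex.real_smul]; push_cast; ring

/-- The map solves an autonomous equation, its derivative being the polynomial `q` in its value, so
boundedness of the map bounds all derivatives. The constant second component lets the radius be
scaled together with the point. -/
theorem exists_bound_halfDiscMap {ε : ℝ} (hε : 0 < ε) (n : ℕ) : ∃ C, ∀ z ∈ strip,
    ‖iteratedFDerivWithin ℝ n (fun z => ((halfDiscMap ε z, ε) : ℂ × ℝ)) strip z‖ ≤ C := by
  have hε' : (ε : ℂ) ≠ 0 := by exact_mod_cast hε.ne'
  let q : ℂ × ℝ → ℂ := fun w => -(I * ε) * (↑(Real.pi / 4) * (1 - (I * (ε : ℂ)⁻¹ * w.1) ^ 2))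
  have hq : ContDiff ℝ ∞ q := contDiff_const.mul (contDiff_const.mul (contDiff_const.sub
    ((contDiff_const.mul contDiff_fst).pow 2)))
  let g : ℂ × ℝ → ℝ × ℝ →L[ℝ] ℂ × ℝ := fun w =>
    (ContinuousLinearMap.inl ℝ ℂ ℝ).comp ((ContinuousLinearMap.mul ℝ ℂ (q w)).comp pairToComplex)
  have hg : ContDiff ℝ ∞ g := contDiff_const.clm_comp
    (((ContinuousLinearMap.mul ℝ ℂ).contDiff.comp hq).clm_comp contDiff_const)
  refine exists_bound_iteratedFDerivWithin uniqueDiffOn_strip hg (fun z hz => ?_)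
    (R := ε) (fun z hz => ?_) n
  · have h1 := (hasFDerivAt_halfDiscMap ε hz).prodMk (hasFDerivAt_const ε z)
    refine (h1.congr_fderiv ?_).hasFDerivWithinAt
    have h2 : I * (ε : ℂ)⁻¹ * halfDiscMap ε z = stripDisc z := by
      rw [halfDiscMap]; field_simp; linear_combination -stripDisc z * Complex.I_sq
    refine ContinuousLinearMap.ext fun w => ?_
    simp only [g, q, h2]
    simp [halfDiscDeriv]
  · rw [Prod.norm_def]
    refine max_le ((norm_halfDiscMap_le ε hz).trans (abs_of_pos hε).le) ?_
    simp [abs_of_pos hε]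

/-- The family of solutions around the centre of a radial parametrization. -/
theorem IsRadialParam.exists_strips (h : IsRadialParam lam L Dstar Φ Q e) {J : CompatibleJ lam}
    (hJ : ∀ᶠ p in 𝓝 e,
      J.J p = rotationField lam (pushField Φ Q (1, 0)) (pushField Φ Q (I, 0)) p ∧
      0 < (lam.d p : Euc 3 →L[ℝ] Euc 3 →L[ℝ] ℝ)
        (pushField Φ Q (1, 0) p) (pushField Φ Q (I, 0) p))
    {N : Set (ℝ × M)} (hN : N ∈ 𝓝 ((0 : ℝ), e)) :
    ∃ U : ℝ → ℝ × ℝ → ℝ × M,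
      (∀ τ ∈ Ioo (0 : ℝ) 1,
        IsStripSolution J L Dstar (U τ) ∧ IsEmbeddedStrip (U τ) ∧ MapsTo (U τ) strip N) ∧
      (∀ τ ∈ Ioo (0 : ℝ) 1, ∀ τ' ∈ Ioo (0 : ℝ) 1, τ ≠ τ' →
        Disjoint (U τ '' strip) (U τ' '' strip)) ∧
      ConvergesWithDerivatives U e ∧
      ContMDiffOn 𝓘(ℝ, ℝ × (ℝ × ℝ)) (𝓘(ℝ, ℝ).prod (𝓡 3)) ∞
        (fun x : ℝ × (ℝ × ℝ) => U x.1 x.2) (Ioo (0 : ℝ) 1 ×ˢ strip) := by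
  have hsrc : ∀ᶠ ξ in 𝓝 (0 : ℂ), Φ (ξ, 0) ∈ (chartAt (Euc 3) e).source :=
    h.tendsto.eventually (eventually_mem_chart_source e)
  -- The second variable stands for the radius. In the chart the strip of radius `ε τ` is `H (τ •
  -- (halfDiscMap ε z, ε))`, so the whole family comes from one function by scaling.
  let H : ℂ × ℝ → ℝ × Euc 3 := fun w =>
    (1 / 4 * (‖w.1‖ ^ 2 - w.2 ^ 2), extChartAt (𝓡 3) e (Φ (w.1, 0)))
  have hfst : Tendsto (fun w : ℂ × ℝ => w.1) (𝓝 0) (𝓝 0) := continuous_fst.tendsto' _ _ rfl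
  have hH : SmoothNear H 0 := by
    filter_upwards [hfst.eventually h.eventually_smooth, hfst.eventually hsrc] with w h1 h2
    have h3 : ContDiffAt ℝ ∞ (fun w : ℂ × ℝ => ((w.1, 0) : ℂ × ℝ)) w :=
      contDiffAt_fst.prodMk contDiffAt_const
    have h4 : ContMDiffAt 𝓘(ℝ, ℂ × ℝ) 𝓘(ℝ, Euc 3) ∞
        (fun w : ℂ × ℝ => extChartAt (𝓡 3) e (Φ (w.1, 0))) w :=
      (contMDiffAt_extChartAt' h2).comp w
        (ContMDiffAt.comp (g := Φ) (f := fun w : ℂ × ℝ => ((w.1, 0) : ℂ × ℝ)) w h1 h3.contMDiffAt)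
    exact (contDiffAt_const.mul (((contDiffAt_fst.norm_sq ℝ)).sub (contDiffAt_snd.pow 2))).prodMk
      (contMDiffAt_iff_contDiffAt.1 h4)
  obtain ⟨Hx, hHx, hHe⟩ := hH.exists_contDiff
  have hNc : ∀ᶠ w in 𝓝 (0 : ℂ × ℝ), (w.2, Φ (w.1, 0)) ∈ N := by
    have h1 : Tendsto (fun w : ℂ × ℝ => (w.2, Φ (w.1, 0))) (𝓝 0) (𝓝 ((0 : ℝ), e)) :=
      (continuous_snd.tendsto' (0 : ℂ × ℝ) 0 rfl).prodMk_nhds (h.tendsto.comp hfst)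
    exact h1.eventually hN
  obtain ⟨r, hr, hball⟩ := Metric.eventually_nhds_iff_ball.1
    ((hfst.eventually ((h.eventually_radialAt hJ).and hsrc)).and (hNc.and hHe))
  -- The bound `r / 2` keeps everything strictly inside the ball; `ε ≤ 1` makes the heights, of size
  -- at most `ε² / 4`, smaller than `ε`.
  set ε := min 1 (r / 2) with hε
  have hε0 : 0 < ε := by positivity
  have hε1 : ε ≤ 1 := min_le_left _ _
  have hεr : ε < r := (min_le_right _ _).trans_lt (by linarith)
  have hbd : ∀ τ ∈ Ioo (0 : ℝ) 1, ∀ z ∈ strip, ‖halfDiscMap (ε * τ) z‖ ≤ ε := by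
    intro τ hτ z hz
    refine (norm_halfDiscMap_le _ hz).trans ?_
    rw [abs_of_pos (mul_pos hε0 hτ.1)]
    exact mul_le_of_le_one_right hε0.le hτ.2.le
  have hmem : ∀ ξ : ℂ, ∀ a : ℝ, ‖ξ‖ ≤ ε → |a| ≤ ε → (ξ, a) ∈ Metric.ball (0 : ℂ × ℝ) r := by
    intro ξ a h1 h2
    rw [mem_ball_zero_iff, Prod.norm_def]
    exact (max_le h1 h2).trans_lt hεr
  have hrad : ∀ τ ∈ Ioo (0 : ℝ) 1, ∀ z ∈ strip, RadialAt J L Dstar Φ Q (halfDiscMap (ε * τ) z) :=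
    fun τ hτ z hz => (hball _ (hmem _ 0 (hbd τ hτ z hz) (by simpa using hε0.le))).1.1
  have hpos : ∀ τ ∈ Ioo (0 : ℝ) 1, 0 < ε * τ := fun τ hτ => mul_pos hε0 hτ.1
  refine ⟨fun τ => radialStrip Φ (ε * τ), fun τ hτ => ⟨isStripSolution_radialStrip (hpos τ hτ)
    (hrad τ hτ), isEmbeddedStrip_radialStrip (hpos τ hτ) (hrad τ hτ), fun z hz => ?_⟩,
    fun τ hτ τ' hτ' hne => ?_, ⟨?_, fun k => ?_⟩, ?_⟩
  · refine (hball _ (hmem _ (stripHeight (ε * τ) z) (hbd τ hτ z hz) ?_)).2.1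
    have h1 := hbd τ hτ z hz
    have h2 : ε * τ ≤ ε := mul_le_of_le_one_right hε0.le hτ.2.le
    have h3 := hpos τ hτ
    rw [stripHeight, abs_le]
    constructor <;> nlinarith [norm_nonneg (halfDiscMap (ε * τ) z)]
  · exact disjoint_radialStrip (hpos τ hτ) (hpos τ' hτ') (fun h0 => hne (mul_left_cancel₀ hε0.ne' h0))
      (hrad τ hτ) (hrad τ' hτ')
  · filter_upwards [Ioo_mem_nhdsGT (zero_lt_one' ℝ)] with τ hτ z hz
    exact (hball _ (hmem _ 0 (hbd τ hτ z hz) (by simpa using hε0.le))).1.2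
  · have hy : ContDiffOn ℝ ∞ (fun z => ((halfDiscMap ε z, ε) : ℂ × ℝ)) strip := fun z hz =>
      ((contDiffAt_halfDiscMap ε hz).prodMk contDiffAt_const).contDiffWithinAt
    have h1 : TendstoUniformlyOn (fun τ : ℝ => iteratedFDerivWithin ℝ k
        (fun z => Hx (τ • ((halfDiscMap ε z, ε) : ℂ × ℝ))) strip)
        (iteratedFDerivWithin ℝ k (fun _ => Hx 0) strip) (𝓝[>] 0) strip := fun u hu =>
      (tendstoUniformlyOn_iteratedFDerivWithin_scaled hHx uniqueDiffOn_strip hy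
        (exists_bound_halfDiscMap hε0) k u hu).filter_mono nhdsWithin_le_nhds
    have h2 : Hx 0 = (0, extChartAt (𝓡 3) e e) := by
      rw [hHe.self_of_nhds]
      refine Prod.ext ?_ ?_
      · simp [H]
      · exact congrArg (extChartAt (𝓡 3) e) h.apply_zero
    rw [h2] at h1
    refine h1.congr ?_
    filter_upwards [Ioo_mem_nhdsGT (zero_lt_one' ℝ)] with τ hτ
    refine fun z hz => iteratedFDerivWithin_congr (fun z hz => ?_) hz k
    have h3 : τ • ((halfDiscMap ε z, ε) : ℂ × ℝ) ∈ Metric.ball (0 : ℂ × ℝ) r := by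
      rw [Prod.smul_mk, ← halfDiscMap_mul]
      refine hmem _ _ (hbd τ hτ z hz) ?_
      rw [smul_eq_mul, mul_comm, abs_of_pos (hpos τ hτ)]
      exact mul_le_of_le_one_right hε0.le hτ.2.le
    rw [(hball _ h3).2.2]
    refine Prod.ext (stripHeight_mul ε τ z).symm ?_
    simp only [H, radialStrip, Prod.smul_mk, halfDiscMap_mul]
  · rintro ⟨τ, z⟩ ⟨hτ, hz⟩
    have h1 : ContDiffAt ℝ ∞ (fun x : ℝ × (ℝ × ℝ) => halfDiscMap (ε * x.1) x.2) (τ, z) := by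
      have h2 : ContDiffAt ℝ ∞ (fun x : ℝ × (ℝ × ℝ) => x.1 • halfDiscMap ε x.2) (τ, z) :=
        contDiffAt_fst.smul ((contDiffAt_halfDiscMap ε hz).comp (τ, z) contDiffAt_snd)
      simpa only [halfDiscMap_mul] using h2
    have h3 : ContDiffAt ℝ ∞ (fun x : ℝ × (ℝ × ℝ) => stripHeight (ε * x.1) x.2) (τ, z) :=
      contDiffAt_const.mul ((h1.norm_sq ℝ).sub ((contDiffAt_const.mul contDiffAt_fst).pow 2))
    have h4 : ContDiffAt ℝ ∞ (fun x : ℝ × (ℝ × ℝ) => ((halfDiscMap (ε * x.1) x.2, 0) : ℂ × ℝ)) (τ, z) :=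
      h1.prodMk contDiffAt_const
    exact (h3.contMDiffAt.prodMk (ContMDiffAt.comp (g := Φ)
      (f := fun x : ℝ × (ℝ × ℝ) => ((halfDiscMap (ε * x.1) x.2, 0) : ℂ × ℝ)) (τ, z)
      (hrad τ hτ z hz).smooth h4.contMDiffAt)).contMDiffWithinAt

end RadialParametrization

/-! ### Ellipticity as a condition on trace and determinant. -/

section Eigenvalues

/-- For a real `2 × 2` characteristic polynomial: the roots do not lie on the imaginary axis and have
positive product if and only if the trace is nonzero and the determinant positive. -/
theorem exists_roots_iff (L : Euc 2 →ₗ[ℝ] Euc 2) {a b c d : ℝ}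
    (h0 : L (EuclideanSpace.single 0 1) = !₂[a, c]) (h1 : L (EuclideanSpace.single 1 1) = !₂[b, d]) :
    (∃ μ₁ μ₂ : ℂ, (L.charpoly.map (algebraMap ℝ ℂ)).roots = {μ₁, μ₂} ∧
      μ₁.re ≠ 0 ∧ μ₂.re ≠ 0 ∧ 0 < (μ₁ * μ₂).re) ↔ a + d ≠ 0 ∧ 0 < a * d - b * c := by
  have hmat : LinearMap.toMatrix (EuclideanSpace.basisFun (Fin 2) ℝ).toBasis
      (EuclideanSpace.basisFun (Fin 2) ℝ).toBasis L = !![a, b; c, d] := by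
    ext i j
    rw [LinearMap.toMatrix_apply]
    fin_cases j
    · fin_cases i <;> simp [h0]
    · fin_cases i <;> simp [h1]
  have hp : L.charpoly.map (algebraMap ℝ ℂ) =
      Polynomial.X ^ 2 - Polynomial.C ((a + d : ℝ) : ℂ) * Polynomial.X +
        Polynomial.C ((a * d - b * c : ℝ) : ℂ) := by
    rw [← LinearMap.charpoly_toMatrix L (EuclideanSpace.basisFun (Fin 2) ℝ).toBasis, hmat,
      Matrix.charpoly_fin_two]
    simp [Matrix.trace_fin_two, Matrix.det_fin_two]
  have hdeg : (Polynomial.X ^ 2 - Polynomial.C ((a + d : ℝ) : ℂ) * Polynomial.X +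
        Polynomial.C ((a * d - b * c : ℝ) : ℂ)).natDegree = 2 := by
    compute_degree!
  have hmonic : (Polynomial.X ^ 2 - Polynomial.C ((a + d : ℝ) : ℂ) * Polynomial.X +
        Polynomial.C ((a * d - b * c : ℝ) : ℂ)).Monic := by
    monicity!
  have hcard : (L.charpoly.map (algebraMap ℝ ℂ)).roots.card = 2 := by
    rw [hp]
    exact (IsAlgClosed.splits (k := ℂ) _).natDegree_eq_card_roots.symm.trans hdeg
  have hsum : ∀ μ₁ μ₂ : ℂ, (L.charpoly.map (algebraMap ℝ ℂ)).roots = {μ₁, μ₂} →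
      μ₁ + μ₂ = ((a + d : ℝ) : ℂ) ∧ μ₁ * μ₂ = ((a * d - b * c : ℝ) : ℂ) := by
    intro μ₁ μ₂ h
    have hprod := (IsAlgClosed.splits (Polynomial.X ^ 2 - Polynomial.C ((a + d : ℝ) : ℂ) *
      Polynomial.X + Polynomial.C ((a * d - b * c : ℝ) : ℂ))).eq_prod_roots_of_monic hmonic
    rw [← hp, h, hp] at hprod
    have e0 := congrArg (Polynomial.eval 0) hprod
    have e1 := congrArg (Polynomial.eval 1) hprod
    simp at e0 e1
    constructor
    · push_cast
      linear_combination e1 - e0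
    · push_cast
      linear_combination -e0
  constructor
  · rintro ⟨μ₁, μ₂, h, hr1, hr2, hpos⟩
    obtain ⟨hs, hm⟩ := hsum μ₁ μ₂ h
    rw [hm, Complex.ofReal_re] at hpos
    -- If the trace were zero the roots would be `±μ₁`. Their product `-μ₁²` is real and `re μ₁ ≠
    -- 0`, so `μ₁` is real and the product is not positive.
    refine ⟨fun h0 => ?_, hpos⟩
    rw [h0, Complex.ofReal_zero] at hs
    have h2 : μ₂ = -μ₁ := by linear_combination hs
    rw [h2] at hm
    have hre := congrArg Complex.re hm
    have him := congrArg Complex.im hm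
    simp only [Complex.mul_re, Complex.mul_im, Complex.neg_re, Complex.neg_im, Complex.ofReal_re,
      Complex.ofReal_im] at hre him
    have hi0 : μ₁.im = 0 := by
      have : μ₁.re * μ₁.im = 0 := by linarith
      exact (mul_eq_zero.1 this).resolve_left hr1
    rw [hi0] at hre
    nlinarith [sq_nonneg μ₁.re]
  · rintro ⟨htr, hdet⟩
    obtain ⟨μ₁, μ₂, h⟩ := Multiset.card_eq_two.1 hcard
    obtain ⟨hs, hm⟩ := hsum μ₁ μ₂ h
    -- Let `z` be purely imaginary. Then `re w` is the trace, which is nonzero, and the vanishing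
    -- imaginary part of `z w` forces `z = 0`, against the positive determinant.
    have key : ∀ z w : ℂ, z + w = ((a + d : ℝ) : ℂ) → z * w = ((a * d - b * c : ℝ) : ℂ) →
        z.re ≠ 0 := by
      intro z w hs hm hz
      have s1 := congrArg Complex.re hs
      have s2 := congrArg Complex.im hs
      have m1 := congrArg Complex.re hm
      have m2 := congrArg Complex.im hm
      simp only [Complex.mul_re, Complex.mul_im, Complex.add_re, Complex.add_im, Complex.ofReal_re,
        Complex.ofReal_im, hz, zero_mul, zero_add, zero_sub] at s1 s2 m1 m2
      rw [s1] at m2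
      have hzi : z.im = 0 := (mul_eq_zero.1 m2).resolve_right htr
      rw [hzi] at m1
      linarith
    refine ⟨μ₁, μ₂, h, key μ₁ μ₂ hs hm, key μ₂ μ₁ (by rw [add_comm]; exact hs)
      (by rw [mul_comm]; exact hm), ?_⟩
    rw [hm, Complex.ofReal_re]
    exact hdet

/-- The determinant of the matrix of a bilinear form on `ℂ` in the basis `1, i`. -/
def bilinDet (B : ℂ →L[ℝ] ℂ →L[ℝ] ℝ) : ℝ :=
  B 1 1 * B Complex.I Complex.I - B 1 Complex.I * B Complex.I 1

theorem bilin_complex_apply (B : ℂ →L[ℝ] ℂ →L[ℝ] ℝ) (v w : ℂ) :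
    B v w = v.re * w.re * B 1 1 + v.re * w.im * B 1 Complex.I + v.im * w.re * B Complex.I 1 +
      v.im * w.im * B Complex.I Complex.I := by
  have hv : v = v.re • (1 : ℂ) + v.im • Complex.I := by
    apply Complex.ext <;> simp
  have hw : w = w.re • (1 : ℂ) + w.im • Complex.I := by
    apply Complex.ext <;> simp
  rw [hv, hw]
  simp only [map_add, map_smul, add_apply, smul_apply, smul_eq_mul]
  simp
  ring

/-- Let `u`, `v` be the images under `A` of the two basis vectors. Then `L` has trace `-(v × u) (B 1
i - B i 1)` and determinant `(v × u)² det B`. Thus the conditions on the eigenvalues become: `B` is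
not symmetric and has positive determinant. -/
theorem exists_roots_iff_of_bilin (L : Euc 2 →ₗ[ℝ] Euc 2) (B : ℂ →L[ℝ] ℂ →L[ℝ] ℝ)
    (A : Euc 2 →L[ℝ] ℂ) (hA : Function.Injective A)
    (hL : ∀ w, L w = !₂[B (A w) (A (EuclideanSpace.single 1 1)),
      -B (A w) (A (EuclideanSpace.single 0 1))]) :
    (∃ μ₁ μ₂ : ℂ, (L.charpoly.map (algebraMap ℝ ℂ)).roots = {μ₁, μ₂} ∧
      μ₁.re ≠ 0 ∧ μ₂.re ≠ 0 ∧ 0 < (μ₁ * μ₂).re) ↔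
      B 1 Complex.I ≠ B Complex.I 1 ∧ 0 < bilinDet B := by
  rw [exists_roots_iff L (hL _) (hL _)]
  set u := A (EuclideanSpace.single 0 1) with hu
  set v := A (EuclideanSpace.single 1 1) with hv
  have hdet : crossProd v u ≠ 0 := by
    intro h0
    have hne : v ≠ 0 := by
      intro hv0
      have := hA (hv0.trans (map_zero A).symm)
      have h1 := congrArg (fun x : Euc 2 => x 1) this
      simp at h1
    simp only [crossProd] at h0
    have hcomb : (v.re) • u - (u.re) • v = 0 ∧ (v.im) • u - (u.im) • v = 0 := by
      constructor <;> apply Complex.ext <;> simp <;> linarith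
    have hinj : ∀ a b : ℝ, a • u - b • v = 0 → b = 0 := by
      intro a b hab
      rw [hu, hv, ← map_smul, ← map_smul, ← map_sub] at hab
      have := hA (hab.trans (map_zero A).symm)
      have h1 := congrArg (fun x : Euc 2 => x 1) this
      simpa using h1
    have hinj' : ∀ a b : ℝ, a • u - b • v = 0 → a = 0 := by
      intro a b hab
      rw [hu, hv, ← map_smul, ← map_smul, ← map_sub] at hab
      have := hA (hab.trans (map_zero A).symm)
      have h1 := congrArg (fun x : Euc 2 => x 0) this
      simpa using h1
    exact hne (Complex.ext (hinj' _ _ hcomb.1) (hinj' _ _ hcomb.2))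
  have e1 : B u v + -B v u = -(crossProd v u) * (B 1 Complex.I - B Complex.I 1) := by
    rw [bilin_complex_apply B u v, bilin_complex_apply B v u, crossProd]
    ring
  have e2 : B u v * -B v u - B v v * -B u u = crossProd v u ^ 2 * bilinDet B := by
    rw [bilin_complex_apply B u v, bilin_complex_apply B v u, bilin_complex_apply B u u,
      bilin_complex_apply B v v, crossProd, bilinDet]
    ring
  rw [e1, e2, mul_ne_zero_iff, neg_ne_zero, sub_ne_zero]
  have : 0 < crossProd v u ^ 2 := by positivity
  simp [hdet, this]

end Eigenvalues

/-! ### Singular and elliptic points in terms of the pulled-back form. -/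

section Criterion

variable {M : Type*} [TopologicalSpace M] [ChartedSpace (Euc 3) M] [IsManifold (𝓡 3) ∞ M]
  {S : Type*} [TopologicalSpace S] [ChartedSpace (EuclideanHalfSpace 2) S]

/-- The range and the kernel are both two-dimensional, so an inclusion is already an equality. -/
theorem range_comp_eq_ker_iff {A : Euc 2 →L[ℝ] ℂ} {D : ℂ →L[ℝ] Euc 3} {α : Euc 3 →L[ℝ] ℝ}
    (hA : Function.Injective A) (hD : Function.Injective D) (hα : α ≠ 0) :
    range (fun w => D (A w)) = {v | α v = 0} ↔ α.comp D = 0 := by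
  have hAs : Function.Surjective A := by
    have := (LinearMap.injective_iff_surjective_of_finrank_eq_finrank (f := A.toLinearMap)
      (by simp)).1 hA
    exact this
  constructor
  · intro h
    refine ContinuousLinearMap.ext fun w => ?_
    obtain ⟨x, rfl⟩ := hAs w
    exact h.subset ⟨x, rfl⟩
  · intro h
    have hle : LinearMap.range D.toLinearMap ≤ LinearMap.ker α.toLinearMap := by
      rintro _ ⟨w, rfl⟩
      exact congrArg (fun L : ℂ →L[ℝ] ℝ => L w) h
    have hα' : LinearMap.range α.toLinearMap = ⊤ :=
      LinearMap.range_eq_top.2 (LinearMap.surjective (fun h0 => hα (ContinuousLinearMap.ext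
        fun v => congrArg (fun L : Euc 3 →ₗ[ℝ] ℝ => L v) h0)))
    have h1 := α.toLinearMap.finrank_range_add_finrank_ker
    rw [hα', finrank_top] at h1
    have h2 := LinearMap.finrank_range_of_inj (f := D.toLinearMap) hD
    simp at h1 h2
    have heq := Submodule.eq_of_le_of_finrank_eq hle (by rw [h2]; omega)
    ext v
    constructor
    · rintro ⟨w, rfl⟩
      exact congrArg (fun L : ℂ →L[ℝ] ℝ => L (A w)) h
    · intro hv
      obtain ⟨w, rfl⟩ : v ∈ LinearMap.range D.toLinearMap := by
        rw [heq]; exact hv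
      obtain ⟨x, rfl⟩ := hAs w
      exact ⟨x, rfl⟩

theorem ContactForm.form_ne_zero (lam : ContactForm M) (p : M) :
    (lam.form p : Euc 3 →L[ℝ] ℝ) ≠ 0 := by
  intro h
  have := form_reeb lam p
  have h2 := congrArg (fun L : Euc 3 →L[ℝ] ℝ => L (lam.reeb p)) h
  exact one_ne_zero (this.symm.trans h2)

theorem isSingularAt_congr (lam : ContactForm M) {F F₁ : S → M} {q : S} (h : F =ᶠ[𝓝 q] F₁) :
    IsSingularAt lam F q ↔ IsSingularAt lam F₁ q := by
  unfold IsSingularAt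
  have h1 : (mfderiv (𝓡∂ 2) (𝓡 3) F q : Euc 2 → Euc 3) = mfderiv (𝓡∂ 2) (𝓡 3) F₁ q := by
    rw [h.mfderiv_eq]
    rfl
  have h2 : ({v | lam.form (F q) v = 0} : Set (Euc 3)) = {v | lam.form (F₁ q) v = 0} := by
    rw [h.eq_of_nhds]
    rfl
  exact (congrArg₂ (fun (f : Euc 2 → Euc 3) (s : Set (Euc 3)) => range f = s) h1 h2).to_iff

theorem isSingularAt_iff_pullForm (lam : ContactForm M) {F : S → M} {g : ℂ → M} {K : S → ℂ} {q : S}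
    (hK : MDifferentiableAt (𝓡∂ 2) 𝓘(ℝ, ℂ) K q)
    (hKi : Function.Injective (mfderiv (𝓡∂ 2) 𝓘(ℝ, ℂ) K q))
    (hg : MDifferentiableAt 𝓘(ℝ, ℂ) (𝓡 3) g (K q))
    (hgi : Function.Injective (mfderiv 𝓘(ℝ, ℂ) (𝓡 3) g (K q))) (h : F =ᶠ[𝓝 q] g ∘ K) :
    IsSingularAt lam F q ↔ pullForm lam g (K q) = 0 := by
  rw [isSingularAt_congr lam h, IsSingularAt, mfderiv_comp q hg hK]
  exact range_comp_eq_ker_iff (A := (mfderiv (𝓡∂ 2) 𝓘(ℝ, ℂ) K q : Euc 2 →L[ℝ] ℂ))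
    (D := (mfderiv 𝓘(ℝ, ℂ) (𝓡 3) g (K q) : ℂ →L[ℝ] Euc 3)) hKi hgi (lam.form_ne_zero _)

theorem charLinearization_congr (lam : ContactForm M) {F F₁ : S → M} {q : S} (h : F =ᶠ[𝓝 q] F₁) :
    charLinearization lam F q = charLinearization lam F₁ q := by
  have ht : Tendsto (extChartAt (𝓡∂ 2) q).symm (𝓝[range (𝓡∂ 2)] (extChartAt (𝓡∂ 2) q q)) (𝓝 q) := by
    have := (continuousAt_extChartAt_symm (I := 𝓡∂ 2) q).tendsto
    rw [extChartAt_to_inv] at this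
    exact this.mono_left nhdsWithin_le_nhds
  have hev : ∀ᶠ y in 𝓝[range (𝓡∂ 2)] (extChartAt (𝓡∂ 2) q q),
      charField lam F q y = charField lam F₁ q y := by
    filter_upwards [eventually_eventually_nhdsWithin.2 (ht.eventually h), ht.eventually h] with y hy hy'
    have hm : (mfderivWithin 𝓘(ℝ, Euc 2) (𝓡 3) (F ∘ (extChartAt (𝓡∂ 2) q).symm)
        (range (𝓡∂ 2)) y : Euc 2 →L[ℝ] Euc 3) =
        mfderivWithin 𝓘(ℝ, Euc 2) (𝓡 3) (F₁ ∘ (extChartAt (𝓡∂ 2) q).symm) (range (𝓡∂ 2)) y :=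
      EventuallyEq.mfderivWithin_eq hy hy'
    have hα : ∀ w : Euc 2, lam.form (F ((extChartAt (𝓡∂ 2) q).symm y))
        (mfderivWithin 𝓘(ℝ, Euc 2) (𝓡 3) (F ∘ (extChartAt (𝓡∂ 2) q).symm) (range (𝓡∂ 2)) y w) =
        lam.form (F₁ ((extChartAt (𝓡∂ 2) q).symm y))
        (mfderivWithin 𝓘(ℝ, Euc 2) (𝓡 3) (F₁ ∘ (extChartAt (𝓡∂ 2) q).symm) (range (𝓡∂ 2)) y w) := by
      intro w
      refine (form_congr lam hy' _).trans ?_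
      exact congrArg (fun L : Euc 2 →L[ℝ] Euc 3 => (lam.form (F₁ ((extChartAt (𝓡∂ 2) q).symm y)) :
        Euc 3 →L[ℝ] ℝ) (L w)) hm
    simp only [charField]
    rw [hα, hα]
  exact EventuallyEq.fderivWithin_eq hev (hev.self_of_nhdsWithin (mem_range_self _))

theorem isEllipticAt_congr (lam : ContactForm M) {F F₁ : S → M} {q : S} (h : F =ᶠ[𝓝 q] F₁) :
    IsEllipticAt lam F q ↔ IsEllipticAt lam F₁ q := by
  rw [IsEllipticAt, IsEllipticAt, isSingularAt_congr lam h, charLinearization_congr lam h]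

/-- Where the form vanishes, the derivative of `DK` is multiplied by zero. What remains is the
derivative of the form, with both arguments transported by `DK`, so ellipticity can be read off in
any coordinates. -/
theorem charLinearization_comp (lam : ContactForm M) {g : ℂ → M} {K : S → ℂ} {q : S}
    (hK : ContMDiffAt (𝓡∂ 2) 𝓘(ℝ, ℂ) ∞ K q) (hg : ContMDiffAt 𝓘(ℝ, ℂ) (𝓡 3) ∞ g (K q))
    (h0 : pullForm lam g (K q) = 0) (w : Euc 2) :
    charLinearization lam (g ∘ K) q w =
      !₂[fderiv ℝ (pullForm lam g) (K q) (mfderiv (𝓡∂ 2) 𝓘(ℝ, ℂ) K q w)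
          (mfderiv (𝓡∂ 2) 𝓘(ℝ, ℂ) K q (EuclideanSpace.single 1 1 : Euc 2)),
        -fderiv ℝ (pullForm lam g) (K q) (mfderiv (𝓡∂ 2) 𝓘(ℝ, ℂ) K q w)
          (mfderiv (𝓡∂ 2) 𝓘(ℝ, ℂ) K q (EuclideanSpace.single 0 1 : Euc 2))] := by
  set s := range (𝓡∂ 2) with hs
  set x := extChartAt (𝓡∂ 2) q q with hx
  set κ : Euc 2 → ℂ := K ∘ (extChartAt (𝓡∂ 2) q).symm with hκ
  have hxs : x ∈ s := mem_range_self _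
  have hus : UniqueDiffOn ℝ s := (𝓡∂ 2).uniqueDiffOn
  have hκx : κ x = K q := congrArg K (extChartAt_to_inv q)
  have hκs : ContDiffWithinAt ℝ ∞ κ s x := (contMDiffAt_iff.1 hK).2
  have hA : (mfderiv (𝓡∂ 2) 𝓘(ℝ, ℂ) K q : Euc 2 →L[ℝ] ℂ) = fderivWithin ℝ κ s x :=
    (hK.mdifferentiableAt (by simp)).mfderiv
  have hκe : ∀ᶠ y in 𝓝[s] x, DifferentiableWithinAt ℝ κ s y := by
    have := (hκs.of_le (m := 1) (by exact_mod_cast le_top)).eventually (by simp)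
    rw [insert_eq_of_mem hxs] at this
    filter_upwards [this] with y hy using hy.differentiableWithinAt (by simp)
  have hκt : Tendsto κ (𝓝[s] x) (𝓝 (K q)) := by
    have := hκs.continuousWithinAt.tendsto
    rwa [hκx] at this
  have hge : ∀ᶠ v in 𝓝 (K q), MDifferentiableAt 𝓘(ℝ, ℂ) (𝓡 3) g v := by
    have hg1 : ContMDiffAt 𝓘(ℝ, ℂ) (𝓡 3) 1 g (K q) := hg.of_le (by exact_mod_cast le_top)
    filter_upwards [(contMDiffAt_iff_contMDiffAt_nhds (by simp)).1 hg1] with v hv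
      using hv.mdifferentiableAt (by simp)
  set β := pullForm lam g with hβ
  have hcf : ∀ᶠ y in 𝓝[s] x, charField lam (g ∘ K) q y =
      !₂[β (κ y) (fderivWithin ℝ κ s y (EuclideanSpace.single 1 1)),
        -β (κ y) (fderivWithin ℝ κ s y (EuclideanSpace.single 0 1))] := by
    filter_upwards [hκe, hκt.eventually hge, self_mem_nhdsWithin] with y hy hgy hys
    have hm : mfderivWithin 𝓘(ℝ, Euc 2) (𝓡 3) ((g ∘ K) ∘ (extChartAt (𝓡∂ 2) q).symm) s y =
        (mfderiv 𝓘(ℝ, ℂ) (𝓡 3) g (κ y)).comp (fderivWithin ℝ κ s y) := by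
      have := mfderiv_comp_mfderivWithin (I := 𝓘(ℝ, Euc 2)) (I' := 𝓘(ℝ, ℂ)) (I'' := 𝓡 3)
        (g := g) (f := κ) y hgy hy.mdifferentiableWithinAt (hus.uniqueMDiffOn y hys)
      rw [mfderivWithin_eq_fderivWithin] at this
      exact this
    simp only [charField]
    rw [hm]
    rfl
  have hβd : HasFDerivAt β (fderiv ℝ β (κ x)) (κ x) := by
    rw [hκx]
    exact ((contDiffAt_pullForm lam hg).differentiableAt (by simp)).hasFDerivAt
  have h1 : HasFDerivWithinAt κ (fderivWithin ℝ κ s x) s x :=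
    (hκs.differentiableWithinAt (by simp)).hasFDerivWithinAt
  have h2 : HasFDerivWithinAt (fderivWithin ℝ κ s) (fderivWithin ℝ (fderivWithin ℝ κ s) s x) s x :=
    ((hκs.fderivWithin_right (m := ∞) hus (by simp) hxs).differentiableWithinAt
      (by simp)).hasFDerivWithinAt
  have hβ0 : β (κ x) = 0 := by rw [hκx, h0]
  have h3 : ∀ e : Euc 2, HasFDerivWithinAt (fun y => β (κ y) (fderivWithin ℝ κ s y e))
      (((fderiv ℝ β (κ x)).comp (fderivWithin ℝ κ s x)).flip (fderivWithin ℝ κ s x e)) s x := by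
    intro e
    have h4 := (h2.clm_apply (hasFDerivWithinAt_const e x s))
    have h5 := (hβd.comp_hasFDerivWithinAt x h1).clm_apply h4
    refine h5.congr_fderiv ?_
    refine ContinuousLinearMap.ext fun w => ?_
    simp [hβ0]
  have h6 : HasFDerivWithinAt (fun y => (!₂[β (κ y) (fderivWithin ℝ κ s y (EuclideanSpace.single 1 1)),
        -β (κ y) (fderivWithin ℝ κ s y (EuclideanSpace.single 0 1))] : Euc 2))
      (charLinearization lam (g ∘ K) q) s x := by
    have hd : DifferentiableWithinAt ℝ (fun y =>
        (!₂[β (κ y) (fderivWithin ℝ κ s y (EuclideanSpace.single 1 1)),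
        -β (κ y) (fderivWithin ℝ κ s y (EuclideanSpace.single 0 1))] : Euc 2)) s x := by
      rw [differentiableWithinAt_euclidean]
      intro i
      fin_cases i
      · exact (h3 _).differentiableWithinAt
      · exact (h3 _).neg.differentiableWithinAt
    have := hd.hasFDerivWithinAt
    rwa [← EventuallyEq.fderivWithin_eq hcf (hcf.self_of_nhdsWithin hxs)] at this
  rw [hasFDerivWithinAt_euclidean] at h6
  have g0 := (hus x hxs).eq (h6 0) (h3 (EuclideanSpace.single 1 1))
  have g1 := (hus x hxs).eq (h6 1) (h3 (EuclideanSpace.single 0 1)).neg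
  have g0' := congrArg (fun L : Euc 2 →L[ℝ] ℝ => L w) g0
  have g1' := congrArg (fun L : Euc 2 →L[ℝ] ℝ => L w) g1
  rw [← hκx]
  ext i
  fin_cases i
  · refine g0'.trans ?_
    simp [hA]
    rfl
  · refine g1'.trans ?_
    simp [hA]
    rfl

theorem isEllipticAt_iff_pullForm (lam : ContactForm M) {F : S → M} {g : ℂ → M} {K : S → ℂ} {q : S}
    (hK : ContMDiffAt (𝓡∂ 2) 𝓘(ℝ, ℂ) ∞ K q)
    (hKi : Function.Injective (mfderiv (𝓡∂ 2) 𝓘(ℝ, ℂ) K q))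
    (hg : ContMDiffAt 𝓘(ℝ, ℂ) (𝓡 3) ∞ g (K q))
    (hgi : Function.Injective (mfderiv 𝓘(ℝ, ℂ) (𝓡 3) g (K q))) (h : F =ᶠ[𝓝 q] g ∘ K) :
    IsEllipticAt lam F q ↔ pullForm lam g (K q) = 0 ∧
      fderiv ℝ (pullForm lam g) (K q) 1 Complex.I ≠ fderiv ℝ (pullForm lam g) (K q) Complex.I 1 ∧
      0 < bilinDet (fderiv ℝ (pullForm lam g) (K q)) := by
  rw [isEllipticAt_congr lam h, IsEllipticAt,
    isSingularAt_iff_pullForm lam (hK.mdifferentiableAt (by simp)) hKi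
      (hg.mdifferentiableAt (by simp)) hgi (EventuallyEq.refl _ _)]
  refine and_congr_right fun h0 => ?_
  exact exists_roots_iff_of_bilin _ (fderiv ℝ (pullForm lam g) (K q))
    (mfderiv (𝓡∂ 2) 𝓘(ℝ, ℂ) K q) hKi (charLinearization_comp lam hK hg h0)

end Criterion

/-! ### Local parametrizations. -/

section LocalParam

variable {M : Type*} [TopologicalSpace M] [ChartedSpace (Euc 3) M]
  {E : Type*} [NormedAddCommGroup E] [NormedSpace ℝ E]
  {E' : Type*} [NormedAddCommGroup E'] [NormedSpace ℝ E']

/-- Change of coordinates in a local parametrization. -/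
theorem IsLocalParam.comp {Φ : E → M} {Q : M → E} {e : M} (h : IsLocalParam Φ Q e) {α : E' → E}
    {α' : E → E'} (hα : SmoothNear α (α' (Q e))) (hα' : SmoothNear α' (Q e))
    (hl : ∀ᶠ x in 𝓝 (α' (Q e)), α' (α x) = x) (hr : ∀ᶠ x in 𝓝 (Q e), α (α' x) = x) :
    IsLocalParam (fun x => Φ (α x)) (fun q => α' (Q q)) e where
  smooth := by
    have h1 : Tendsto α (𝓝 (α' (Q e))) (𝓝 (Q e)) := by
      have := hα.continuousAt.tendsto
      rwa [hr.self_of_nhds] at this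
    filter_upwards [h1.eventually h.smooth, hα] with x hx hxα
    exact ContMDiffAt.comp (g := Φ) (f := α) x hx hxα.contMDiffAt
  smooth_inv := by
    filter_upwards [h.smooth_inv.self_of_nhds.continuousAt.eventually hα', h.smooth_inv] with q h1 h2
    exact ContDiffAt.comp_contMDiffAt (f := Q) h1 h2
  left_inv := by
    have h1 : Tendsto α (𝓝 (α' (Q e))) (𝓝 (Q e)) := by
      have := hα.continuousAt.tendsto
      rwa [hr.self_of_nhds] at this
    filter_upwards [h1.eventually h.left_inv, hl] with x h2 h3
    simp only [h2, h3]
  right_inv := by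
    filter_upwards [h.smooth_inv.self_of_nhds.continuousAt.eventually hr, h.right_inv] with q h1 h2
    simp only [h1, h2]

/-- A local parametrization restricts to a homeomorphism from small balls to open sets. -/
theorem IsLocalParam.eventually_ball {Φ : E → M} {Q : M → E} {e : M} (h : IsLocalParam Φ Q e)
    {W : Set M} (hW : W ∈ 𝓝 e) :
    ∀ᶠ r in 𝓝[>] (0 : ℝ), IsOpen (Φ '' Metric.ball (Q e) r) ∧ e ∈ Φ '' Metric.ball (Q e) r ∧
      Φ '' Metric.ball (Q e) r ⊆ W ∧
      (∀ x ∈ Metric.ball (Q e) r, ContMDiffAt 𝓘(ℝ, E) (𝓡 3) ∞ Φ x ∧ Q (Φ x) = x) ∧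
      ∀ p ∈ Φ '' Metric.ball (Q e) r,
        ContMDiffAt (𝓡 3) 𝓘(ℝ, E) ∞ Q p ∧ Φ (Q p) = p ∧ Q p ∈ Metric.ball (Q e) r := by
  obtain ⟨B, hB, hBo, heB⟩ := mem_nhds_iff.1 (h.smooth_inv.and (h.right_inv.and hW))
  have ht : Tendsto Φ (𝓝 (Q e)) (𝓝 e) := by
    have := h.smooth.self_of_nhds.continuousAt.tendsto
    rwa [h.right_inv.self_of_nhds] at this
  obtain ⟨ε, hε, hball⟩ := Metric.mem_nhds_iff.1
    (h.smooth.and (h.left_inv.and (ht.eventually (hBo.mem_nhds heB))))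
  filter_upwards [Ioo_mem_nhdsGT hε] with r hr
  have hb : ∀ x ∈ Metric.ball (Q e) r, ContMDiffAt 𝓘(ℝ, E) (𝓡 3) ∞ Φ x ∧ Q (Φ x) = x ∧ Φ x ∈ B :=
    fun x hx => hball (Metric.ball_subset_ball hr.2.le hx)
  -- Openness of the image comes from continuity of the inverse `Q` on the open set `B`.
  have himage : Φ '' Metric.ball (Q e) r = B ∩ Q ⁻¹' Metric.ball (Q e) r := by
    ext p
    constructor
    · rintro ⟨x, hx, rfl⟩
      refine ⟨(hb x hx).2.2, ?_⟩
      rw [mem_preimage, (hb x hx).2.1]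
      exact hx
    · rintro ⟨hpB, hp⟩
      exact ⟨Q p, hp, (hB hpB).2.1⟩
  have hQ : ContinuousOn Q B := fun p hp => (hB hp).1.continuousAt.continuousWithinAt
  rw [himage]
  refine ⟨hQ.isOpen_inter_preimage hBo Metric.isOpen_ball, ⟨heB, Metric.mem_ball_self hr.1⟩,
    fun p hp => (hB hp.1).2.2, fun x hx => ⟨(hb x hx).1, (hb x hx).2.1⟩, fun p hp =>
    ⟨(hB hp.1).1, (hB hp.1).2.1, hp.2⟩⟩

theorem IsLocalParam.injective_mfderiv {Φ : E → M} {Q : M → E} {x : E}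
    (hΦ : MDifferentiableAt 𝓘(ℝ, E) (𝓡 3) Φ x) (hQ : MDifferentiableAt (𝓡 3) 𝓘(ℝ, E) Q (Φ x))
    (h : ∀ᶠ y in 𝓝 x, Q (Φ y) = y) : Function.Injective (mfderiv 𝓘(ℝ, E) (𝓡 3) Φ x) := by
  have h1 := mfderiv_comp x hQ hΦ
  have h2 : mfderiv 𝓘(ℝ, E) 𝓘(ℝ, E) (Q ∘ Φ) x = mfderiv 𝓘(ℝ, E) 𝓘(ℝ, E) id x :=
    EventuallyEq.mfderiv_eq h
  rw [h2, mfderiv_id] at h1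
  intro v w hvw
  have := congrArg (fun L : E →L[ℝ] E => L v = L w) h1
  refine this.mpr ?_
  exact congrArg (mfderiv (𝓡 3) 𝓘(ℝ, E) Q (Φ x)) hvw

theorem IsLocalParam.of_mem_maximalAtlas {ψ : OpenPartialHomeomorph M (Euc 3)}
    (hψ : ψ ∈ IsManifold.maximalAtlas (𝓡 3) ∞ M) {e : M} (he : e ∈ ψ.source) :
    IsLocalParam ψ.symm ψ e where
  smooth := by
    filter_upwards [ψ.open_target.mem_nhds (ψ.map_source he)] with x hx
    exact contMDiffAt_symm_of_mem_maximalAtlas hψ hx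
  smooth_inv := by
    filter_upwards [ψ.open_source.mem_nhds he] with x hx
    exact contMDiffAt_of_mem_maximalAtlas hψ hx
  left_inv := by
    filter_upwards [ψ.open_target.mem_nhds (ψ.map_source he)] with x hx using ψ.right_inv hx
  right_inv := by
    filter_upwards [ψ.open_source.mem_nhds he] with x hx using ψ.left_inv hx

end LocalParam

/-! ### Immersions followed by a local diffeomorphism. -/

section Immersion

open Manifold

variable {M : Type*} [TopologicalSpace M] [ChartedSpace (Euc 3) M] [IsManifold (𝓡 3) ∞ M]
  {S : Type*} [TopologicalSpace S] [ChartedSpace (EuclideanHalfSpace 2) S]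
  {C : Type*} [NormedAddCommGroup C] [NormedSpace ℝ C]

/-- Immersions stay immersions under a local diffeomorphism of the target. -/
theorem Manifold.IsImmersionAtOfComplement.comp_left {F : S → M} {q : S}
    (h : IsImmersionAtOfComplement C (𝓡∂ 2) (𝓡 3) ∞ F q) {T T' : M → M}
    (hT : ∀ᶠ p in 𝓝 (F q), ContMDiffAt (𝓡 3) (𝓡 3) ∞ T p)
    (hT' : ∀ᶠ p in 𝓝 (T (F q)), ContMDiffAt (𝓡 3) (𝓡 3) ∞ T' p)
    (hl : ∀ᶠ p in 𝓝 (F q), T' (T p) = p) (hr : ∀ᶠ p in 𝓝 (T (F q)), T (T' p) = p) :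
    IsImmersionAtOfComplement C (𝓡∂ 2) (𝓡 3) ∞ (T ∘ F) q := by
  obtain ⟨U, hU, hUo, hqU⟩ := mem_nhds_iff.1 (hT.and hl)
  obtain ⟨V, hV, hVo, hqV⟩ := mem_nhds_iff.1 (hT'.and hr)
  have hcT : ContinuousOn T U := fun p hp => (hU hp).1.continuousAt.continuousWithinAt
  have hcT' : ContinuousOn T' V := fun p hp => (hV hp).1.continuousAt.continuousWithinAt
  let Θ : OpenPartialHomeomorph M M :=
    { toFun := T
      invFun := T'
      source := U ∩ T ⁻¹' V
      target := V ∩ T' ⁻¹' U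
      map_source' := fun p hp => ⟨hp.2, by rw [mem_preimage, (hU hp.1).2]; exact hp.1⟩
      map_target' := fun p hp => ⟨hp.2, by rw [mem_preimage, (hV hp.1).2]; exact hp.1⟩
      left_inv' := fun p hp => (hU hp.1).2
      right_inv' := fun p hp => (hV hp.1).2
      open_source := hcT.isOpen_inter_preimage hUo hVo
      open_target := hcT'.isOpen_inter_preimage hVo hUo
      continuousOn_toFun := hcT.mono inter_subset_left
      continuousOn_invFun := hcT'.mono inter_subset_left }
  have hq : F q ∈ Θ.source := ⟨hqU, hqV⟩
  have hcod := (IsManifold.mem_maximalAtlas_iff_contMDiffOn h.codChart).1 h.codChart_mem_maximalAtlas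
  -- The domain chart is shrunk so that `F` takes values where the local diffeomorphism is
  -- invertible.
  obtain ⟨O, hO, hOo, hqO⟩ := mem_nhds_iff.1 (h.continuousAt (Θ.open_source.mem_nhds hq))
  have hmono := isLocalSourceTargetProperty_immersionAtProp.mono_source (f := F) (φ := h.domChart)
    (ψ := h.codChart) hOo ⟨h.equiv, h.writtenInCharts⟩
  obtain ⟨equiv, hequiv⟩ := hmono
  -- Composing the codomain chart with the inverse of `T` cancels `T`, so the expression in charts
  -- is the one of `F`.
  refine IsImmersionAtOfComplement.mk_of_continuousAt
    ((hT.self_of_nhds.continuousAt).comp h.continuousAt) equiv (h.domChart.restr O)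
    (Θ.symm ≫ₕ h.codChart) ?_ ?_ ?_ ?_ ?_
  · rw [h.domChart.restr_source' O hOo]
    exact ⟨h.mem_domChart_source, hqO⟩
  · refine ⟨Θ.map_source hq, ?_⟩
    change T' (T (F q)) ∈ h.codChart.source
    rw [hl.self_of_nhds]
    exact h.mem_codChart_source
  · exact restr_mem_maximalAtlas (contDiffGroupoid ∞ (𝓡∂ 2)) h.domChart_mem_maximalAtlas hOo
  · rw [IsManifold.mem_maximalAtlas_iff_contMDiffOn]
    constructor
    · exact hcod.1.comp (fun p hp => (hV hp.1.1).1.contMDiffWithinAt) fun p hp => hp.2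
    · rintro x ⟨hx, hx2⟩
      exact ContMDiffWithinAt.comp (g := T) (f := h.codChart.symm) x (t := univ)
        ((hU hx2.1).1.contMDiffWithinAt)
        ((hcod.2 x hx).mono fun y hy => hy.1) (fun _ _ => trivial)
  · intro x hx
    rw [← hequiv hx]
    have hy : ((h.domChart.restr O).extend (𝓡∂ 2)).symm x ∈ (h.domChart.restr O).source := by
      rw [← (h.domChart.restr O).extend_source (I := 𝓡∂ 2)]
      exact PartialEquiv.map_target _ hx
    rw [h.domChart.restr_source' O hOo] at hy
    have := (hU (hO hy.2).1).2
    simp only [Function.comp_apply, OpenPartialHomeomorph.extend_coe,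
      OpenPartialHomeomorph.trans_apply]
    exact congrArg (fun p => (𝓡 3) (h.codChart p)) this

end Immersion

/-! ### Coordinates that flatten the surface at a boundary point. -/

section SurfaceParam

open Manifold

variable {M : Type*} [TopologicalSpace M] [ChartedSpace (Euc 3) M]
  {S : Type*} [TopologicalSpace S] [ChartedSpace (EuclideanHalfSpace 2) S]

theorem isBoundaryPoint_iff_of_mem_maximalAtlas [IsManifold (𝓡∂ 2) ∞ S]
    {φ : OpenPartialHomeomorph S (EuclideanHalfSpace 2)}
    (hφ : φ ∈ IsManifold.maximalAtlas (𝓡∂ 2) ∞ S) {q : S} (hq : q ∈ φ.source) :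
    (𝓡∂ 2).IsBoundaryPoint q ↔ (φ q).1 0 = 0 := by
  have hd : IsLocalDiffeomorphAt (𝓡∂ 2) (𝓡∂ 2) ∞ φ q :=
    ⟨{ toPartialEquiv := φ.toPartialEquiv
       open_source := φ.open_source
       open_target := φ.open_target
       contMDiffOn_toFun := contMDiffOn_of_mem_maximalAtlas hφ
       contMDiffOn_invFun := contMDiffOn_symm_of_mem_maximalAtlas hφ }, hq, fun _ _ => rfl⟩
  rw [hd.isBoundaryPoint_iff (by simp), ModelWithCorners.isBoundaryPoint_iff,
    frontier_range_modelWithCornersEuclideanHalfSpace]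
  simp
  exact eq_comm

theorem injective_mfderiv_of_mem_maximalAtlas [IsManifold (𝓡∂ 2) ∞ S]
    {φ : OpenPartialHomeomorph S (EuclideanHalfSpace 2)}
    (hφ : φ ∈ IsManifold.maximalAtlas (𝓡∂ 2) ∞ S) {q : S} (hq : q ∈ φ.source) (l : Euc 2 ≃L[ℝ] ℂ)
    (x₀ : Euc 2) :
    ContMDiffAt (𝓡∂ 2) 𝓘(ℝ, ℂ) ∞ (fun q => l (φ.extend (𝓡∂ 2) q - x₀)) q ∧
    Function.Injective (mfderiv (𝓡∂ 2) 𝓘(ℝ, ℂ) (fun q => l (φ.extend (𝓡∂ 2) q - x₀)) q) := by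
  have h1 : ContMDiffAt (𝓡∂ 2) (𝓡∂ 2) ∞ φ q := contMDiffAt_of_mem_maximalAtlas hφ hq
  have h2 : ContMDiffAt (𝓡∂ 2) (𝓡∂ 2) ∞ φ.symm (φ q) :=
    contMDiffAt_symm_of_mem_maximalAtlas hφ (φ.map_source hq)
  have h3 : HasMFDerivAt (𝓡∂ 2) 𝓘(ℝ, Euc 2) (𝓡∂ 2) (φ q) (ContinuousLinearMap.id ℝ (Euc 2)) :=
    (𝓡∂ 2).hasMFDerivAt
  have h4 : HasFDerivAt (fun x : Euc 2 => l (x - x₀)) (l : Euc 2 →L[ℝ] ℂ) ((𝓡∂ 2) (φ q)) := by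
    refine ((l : Euc 2 →L[ℝ] ℂ).hasFDerivAt.comp _
      ((hasFDerivAt_id ((𝓡∂ 2) (φ q))).sub_const x₀)).congr_fderiv ?_
    exact ContinuousLinearMap.comp_id _
  have h5 := (h1.mdifferentiableAt (by simp)).hasMFDerivAt
  have h6 := HasMFDerivAt.comp (g := (𝓡∂ 2)) (f := φ) q h3 h5
  have h7 := HasMFDerivAt.comp (g := fun x : Euc 2 => l (x - x₀)) (f := (𝓡∂ 2) ∘ φ) q h4.hasMFDerivAt h6
  constructor
  · have hl : ContDiff ℝ ∞ (fun x : Euc 2 => l (x - x₀)) := by fun_prop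
    exact ContDiffAt.comp_contMDiffAt (f := φ.extend (𝓡∂ 2)) (g := fun x : Euc 2 => l (x - x₀))
      hl.contDiffAt ((φ.contMDiffOn_extend hφ).contMDiffAt (φ.open_source.mem_nhds hq))
  · have h8 := h7.mfderiv
    have hinj : Function.Injective (mfderiv (𝓡∂ 2) (𝓡∂ 2) φ q) := by
      have h9 := HasMFDerivAt.comp (g := φ.symm) (f := φ) q
        (h2.mdifferentiableAt (by simp)).hasMFDerivAt h5
      have h10 : HasMFDerivAt (𝓡∂ 2) (𝓡∂ 2) (φ.symm ∘ φ) q (ContinuousLinearMap.id ℝ (Euc 2)) := by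
        refine (hasMFDerivAt_id q).congr_of_eventuallyEq ?_
        filter_upwards [φ.open_source.mem_nhds hq] with y hy using φ.left_inv hy
      have h11 := hasMFDerivAt_unique h9 h10
      intro v w hvw
      have := congrArg (fun L : Euc 2 →L[ℝ] Euc 2 => L v = L w) h11
      exact this.mp (congrArg (mfderiv (𝓡∂ 2) (𝓡∂ 2) φ.symm (φ q)) hvw)
    intro v w hvw
    have h12 : ∀ v : Euc 2, (mfderiv (𝓡∂ 2) 𝓘(ℝ, ℂ) (fun q => l (φ.extend (𝓡∂ 2) q - x₀)) q : Euc 2 →L[ℝ] ℂ) v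
        = l (mfderiv (𝓡∂ 2) (𝓡∂ 2) φ q v : Euc 2) := fun v =>
      congrArg (fun L : Euc 2 →L[ℝ] ℂ => L v) h8
    exact hinj (l.injective ((h12 v).symm.trans (hvw.trans (h12 w))))

/-- `Ψ` is a local parametrization of `M` around the boundary point `F q₀` of the surface `F`, in
which the surface is the half plane `{(v, 0) | 0 ≤ re v}`. -/
structure IsSurfaceParam (F : S → M) (Ψ : ℂ × ℝ → M) (R : M → ℂ × ℝ) (q₀ : S) : Prop
    extends IsLocalParam Ψ R (F q₀) where
  center : R (F q₀) = 0
  flat : ∀ᶠ q in 𝓝 q₀, (R (F q)).2 = 0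
  half : ∀ᶠ q in 𝓝 q₀, 0 ≤ (R (F q)).1.re ∧ (q ∈ (𝓡∂ 2).boundary S ↔ (R (F q)).1.re = 0)
  coord : ∀ᶠ q in 𝓝 q₀, ContMDiffAt (𝓡∂ 2) 𝓘(ℝ, ℂ) ∞ (fun q => (R (F q)).1) q ∧
    Function.Injective (mfderiv (𝓡∂ 2) 𝓘(ℝ, ℂ) (fun q => (R (F q)).1) q)
  fills : ∀ᶠ v in 𝓝 (0 : ℂ), 0 ≤ v.re → Ψ (v, 0) ∈ range F

/-- By dimension the complement `C` is a line. The plane is identified with `ℂ` so that the real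
part is the coordinate that cuts out the half space, and `x₀` is moved to the origin. -/
theorem exists_adapted_coordinates {C : Type*} [NormedAddCommGroup C] [NormedSpace ℝ C]
    (f : (Euc 2 × C) ≃L[ℝ] Euc 3) (x₀ : Euc 2) :
    ∃ (α : ℂ × ℝ → Euc 3) (α' : Euc 3 → ℂ × ℝ) (l : Euc 2 ≃L[ℝ] ℂ),
      ContDiff ℝ ∞ α ∧ ContDiff ℝ ∞ α' ∧ (∀ x, α' (α x) = x) ∧ (∀ x, α (α' x) = x) ∧
      (∀ x, (l x).re = x 0) ∧ (∀ y, α' (f (y, 0)) = (l (y - x₀), 0)) ∧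
      ∀ v, α (v, 0) = f (x₀ + l.symm v, 0) := by
  have hfin : FiniteDimensional ℝ (Euc 2 × C) := f.symm.toLinearEquiv.finiteDimensional
  have hfinC : FiniteDimensional ℝ C := Module.Finite.of_surjective
    (LinearMap.snd ℝ (Euc 2) C) LinearMap.snd_surjective
  have hC : Module.finrank ℝ C = Module.finrank ℝ ℝ := by
    have := f.toLinearEquiv.finrank_eq
    rw [Module.finrank_prod] at this
    simp at this ⊢
    omega
  let c : C ≃L[ℝ] ℝ := ContinuousLinearEquiv.ofFinrankEq hC
  let l : Euc 2 ≃L[ℝ] ℂ := Complex.orthonormalBasisOneI.repr.symm.toContinuousLinearEquiv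
  refine ⟨fun x => f (x₀ + l.symm x.1, c.symm x.2),
    fun y => (l ((f.symm y).1 - x₀), c (f.symm y).2), l, by fun_prop, by fun_prop,
    fun x => by simp, fun x => by simp, fun x => ?_, fun y => by simp, fun v => by simp⟩
  change (Complex.orthonormalBasisOneI.repr.symm x).re = x 0
  rw [Complex.orthonormalBasisOneI_repr_symm_apply]
  simp

theorem Manifold.IsImmersionAtOfComplement.codChart_apply {F : S → M}
    {C : Type*} [NormedAddCommGroup C] [NormedSpace ℝ C] {q₀ q : S}
    (h : IsImmersionAtOfComplement C (𝓡∂ 2) (𝓡 3) ∞ F q₀) (hq : q ∈ h.domChart.source) :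
    h.codChart (F q) = h.equiv (h.domChart.extend (𝓡∂ 2) q, 0) := by
  have h1 : h.domChart.extend (𝓡∂ 2) q ∈ (h.domChart.extend (𝓡∂ 2)).target :=
    PartialEquiv.map_source _ (by rwa [OpenPartialHomeomorph.extend_source])
  have h2 := h.writtenInCharts h1
  simp only [Function.comp_apply] at h2
  rw [OpenPartialHomeomorph.extend_left_inv _ hq] at h2
  exact h2

theorem exists_isSurfaceParam [IsManifold (𝓡∂ 2) ∞ S] {F : S → M}
    {C : Type*} [NormedAddCommGroup C] [NormedSpace ℝ C] {q₀ : S}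
    (h : IsImmersionAtOfComplement C (𝓡∂ 2) (𝓡 3) ∞ F q₀) (hq₀ : q₀ ∈ (𝓡∂ 2).boundary S) :
    ∃ Ψ R, IsSurfaceParam F Ψ R q₀ := by
  obtain ⟨φ, hφ⟩ : ∃ φ, φ = h.domChart := ⟨_, rfl⟩
  obtain ⟨ψ, hψ⟩ : ∃ ψ, ψ = h.codChart := ⟨_, rfl⟩
  have hφm := h.domChart_mem_maximalAtlas
  have hψm := h.codChart_mem_maximalAtlas
  have hφq := h.mem_domChart_source
  have hψq := h.mem_codChart_source
  have hsub := h.source_subset_preimage_source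
  have hw := fun q hq => h.codChart_apply (q := q) hq
  rw [← hφ] at hφm hφq hsub hw
  rw [← hψ] at hψm hψq hsub hw
  set x₀ : Euc 2 := φ.extend (𝓡∂ 2) q₀ with hx₀
  -- Since `q₀` is a boundary point, the translation by `x₀` is tangent to the boundary and
  -- preserves the half plane.
  have hx₀0 : x₀ 0 = 0 := (isBoundaryPoint_iff_of_mem_maximalAtlas hφm hφq).1 hq₀
  obtain ⟨α, α', l, hα, hα', hl, hr, hlre, hα'f, hαf⟩ := exists_adapted_coordinates h.equiv x₀
  have hlre' : ∀ v, (l.symm v) 0 = v.re := fun v => by rw [← hlre]; simp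
  have hR : ∀ q ∈ φ.source, α' (ψ (F q)) = (l (φ.extend (𝓡∂ 2) q - x₀), 0) := by
    intro q hq
    rw [hw q hq, hα'f]
  have hns : ∀ᶠ q in 𝓝 q₀, q ∈ φ.source := φ.open_source.mem_nhds hφq
  refine ⟨fun x => ψ.symm (α x), fun p => α' (ψ p), ⟨(IsLocalParam.of_mem_maximalAtlas hψm
    hψq).comp (hα.smoothNear _) (hα'.smoothNear _) (Eventually.of_forall hl)
    (Eventually.of_forall hr), ?_, ?_, ?_, ?_, ?_⟩⟩
  · rw [hR _ hφq]
    simp [hx₀]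
  · filter_upwards [hns] with q hq
    rw [hR q hq]
  · filter_upwards [hns] with q hq
    have hre : (α' (ψ (F q))).1.re = (φ q).1 0 := by
      rw [hR q hq]
      simp only [hlre]
      rw [PiLp.sub_apply, hx₀0, sub_zero]
      rfl
    rw [hre]
    exact ⟨(φ q).2, isBoundaryPoint_iff_of_mem_maximalAtlas hφm hq⟩
  · filter_upwards [hns] with q hq
    have heq : (fun q => (α' (ψ (F q))).1) =ᶠ[𝓝 q] fun q => l (φ.extend (𝓡∂ 2) q - x₀) := by
      filter_upwards [φ.open_source.mem_nhds hq] with y hy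
      rw [hR y hy]
    obtain ⟨h1, h2⟩ := injective_mfderiv_of_mem_maximalAtlas hφm hq l x₀
    exact ⟨h1.congr_of_eventuallyEq heq, (congrArg (fun L : Euc 2 →L[ℝ] ℂ =>
      Function.Injective L) heq.mfderiv_eq).mpr h2⟩
  · have hcont : Tendsto (fun v : ℂ => x₀ + l.symm v) (𝓝 0) (𝓝 x₀) := by
      have : Continuous (fun v : ℂ => x₀ + l.symm v) := by fun_prop
      simpa using this.tendsto 0
    have hnhds : ∀ᶠ y in 𝓝 x₀, y ∈ range (𝓡∂ 2) → y ∈ (φ.extend (𝓡∂ 2)).target :=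
      eventually_nhdsWithin_iff.1 (φ.extend_target_mem_nhdsWithin hφq)
    filter_upwards [hcont.eventually hnhds] with v hv hv0
    have hy := hv (by
      rw [range_modelWithCornersEuclideanHalfSpace]
      change 0 ≤ (x₀ + l.symm v) 0
      rw [PiLp.add_apply, hx₀0, hlre', zero_add]
      exact hv0)
    set q := (φ.extend (𝓡∂ 2)).symm (x₀ + l.symm v) with hq
    have hqs : q ∈ φ.source := by
      rw [← φ.extend_source (I := 𝓡∂ 2)]
      exact (φ.extend (𝓡∂ 2)).map_target hy
    refine ⟨q, ?_⟩
    have h1 : ψ (F q) = α (v, 0) := by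
      rw [hw q hqs, hq, (φ.extend (𝓡∂ 2)).right_inv hy, hαf]
    rw [← h1, ψ.left_inv (hsub hqs)]

end SurfaceParam

/-! ### Curves in a Legendrian knot. -/

section Legendrian

variable {M : Type*} [TopologicalSpace M] [ChartedSpace (Euc 3) M] [IsManifold (𝓡 3) ∞ M]

/-- A contact form vanishes on a smooth curve which runs in a Legendrian knot. -/
theorem IsLegendrianKnot.pullForm_eq_zero {lam : ContactForm M} {γ : Circle → M}
    (hγ : IsLegendrianKnot lam γ) {c : ℝ → M} {y : ℝ} (hc : ContMDiffAt 𝓘(ℝ, ℝ) (𝓡 3) ∞ c y)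
    (hr : ∀ᶠ t in 𝓝 y, c t ∈ range γ) : pullForm lam c y = 0 := by
  -- The lift of `c` through `γ`. It is continuous because `γ` is inducing and smooth because `γ` is
  -- an immersion, so `c'` is a multiple of the tangent of the knot.
  let z : ℝ → Circle := fun t => Function.invFun γ (c t)
  have hz : ∀ᶠ t in 𝓝 y, γ (z t) = c t := by
    filter_upwards [hr] with t ht using Function.invFun_eq ht
  have hzc : ContinuousAt z y := by
    rw [hγ.embedding.isEmbedding.isInducing.continuousAt_iff]
    exact hc.continuousAt.congr_of_eventuallyEq hz
  have hzs : ContMDiffAt 𝓘(ℝ, ℝ) (𝓡 1) ∞ z y := by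
    rw [ContMDiffAt.iff_comp_isImmersionAt (hγ.embedding.isImmersion.isImmersionAt (z y))]
    exact ⟨hzc, hc.congr_of_eventuallyEq hz⟩
  have hγs : MDifferentiableAt (𝓡 1) (𝓡 3) γ (z y) :=
    (hγ.embedding.contMDiff (z y)).mdifferentiableAt (by simp)
  rw [← pullForm_congr lam (f := γ ∘ z) hz]
  refine ContinuousLinearMap.ext fun w => ?_
  rw [pullForm_apply, mfderiv_comp y hγs (hzs.mdifferentiableAt (by simp))]
  exact hγ.legendrian (z y) _

end Legendrian

/-! ### The contact form on graphs over the plane. -/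

section GraphForm

/-- The restriction of a 1-form on `ℂ × ℝ` to the graph of `k`. -/
def graphForm (Λ : ℂ × ℝ → ℂ × ℝ →L[ℝ] ℝ) (k : ℂ → ℝ) (v : ℂ) : ℂ →L[ℝ] ℝ :=
  (Λ (v, k v)).comp (fderiv ℝ (fun v => (v, k v)) v)

variable {Λ : ℂ × ℝ → ℂ × ℝ →L[ℝ] ℝ} {k : ℂ → ℝ}

theorem fderiv_graph {v : ℂ} (hk : DifferentiableAt ℝ k v) (w : ℂ) :
    fderiv ℝ (fun v => (v, k v)) v w = (w, fderiv ℝ k v w) := by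
  exact congrArg (fun L : ℂ →L[ℝ] ℂ × ℝ => L w)
    ((hasFDerivAt_id (𝕜 := ℝ) v).prodMk hk.hasFDerivAt).fderiv

theorem graphForm_apply {v : ℂ} (hk : DifferentiableAt ℝ k v) (w : ℂ) :
    graphForm Λ k v w = Λ (v, k v) (w, 0) + fderiv ℝ k v w * Λ (v, k v) (0, 1) := by
  rw [graphForm, ContinuousLinearMap.comp_apply, fderiv_graph hk]
  have : ((w, fderiv ℝ k v w) : ℂ × ℝ) = (w, 0) + fderiv ℝ k v w • ((0, 1) : ℂ × ℝ) := by simp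
  rw [this, map_add, map_smul, smul_eq_mul]

theorem graphForm_congr {k' : ℂ → ℝ} {v : ℂ} (h : k =ᶠ[𝓝 v] k') :
    graphForm Λ k v = graphForm Λ k' v := by
  have h1 : (fun v => (v, k v)) =ᶠ[𝓝 v] fun v => (v, k' v) := by
    filter_upwards [h] with w hw
    rw [hw]
  rw [graphForm, graphForm, h.eq_of_nhds, h1.fderiv_eq]

theorem smoothNear_graphForm (hΛ : SmoothNear Λ 0) (hk : ContDiff ℝ ∞ k) (hk0 : k 0 = 0) :
    SmoothNear (graphForm Λ k) 0 := by
  have hg : ContDiff ℝ ∞ (fun v => (v, k v)) := contDiff_id.prodMk hk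
  have hΛ' : SmoothNear Λ ((0 : ℂ), k 0) := by rw [hk0]; exact hΛ
  have h1 : SmoothNear (fun v => Λ (v, k v)) 0 :=
    SmoothNear.comp (f := fun v => (v, k v)) hΛ' (hg.smoothNear 0)
  filter_upwards [h1, (hg.smoothNear 0).fderiv] with v h2 h3 using h2.clm_comp h3

theorem skewDeriv_graphForm (hΛ : SmoothNear Λ 0) (hk : ContDiff ℝ ∞ k) (hk0 : k 0 = 0)
    (hdk : fderiv ℝ k 0 = 0) (v w : ℂ) :
    skewDeriv (graphForm Λ k) 0 v w = skewDeriv Λ 0 (v, 0) (w, 0) := by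
  have hg : ContDiff ℝ ∞ (fun v => (v, k v)) := contDiff_id.prodMk hk
  have h := skewDeriv_pullback (β := Λ) (g := fun v => (v, k v)) (y := 0)
    (by simp only [hk0]; exact hΛ.differentiableAt) hg.contDiffAt v w
  have hd : DifferentiableAt ℝ k 0 := hk.contDiffAt.differentiableAt (by simp)
  rw [fderiv_graph hd, fderiv_graph hd, hdk, hk0] at h
  exact h

/-- Since `Λ (0, 1) ≠ 0` near the origin, the kernel of `Λ` is the graph of a slope form `f`, and
the graph of `k` is tangent to it in the direction `w` exactly if `Dk w = f w`. Radial graphs are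
therefore ray solutions, and zeros of `graphForm Λ k` are zeros of `Dk - f`. -/
theorem exists_adapted_graph (hΛ : SmoothNear Λ 0) (h0 : graphForm Λ (fun _ => 0) 0 = 0)
    (hz : Λ 0 (0, 1) ≠ 0)
    (hleg : ∀ᶠ v : ℂ in 𝓝 0, v.re = 0 → graphForm Λ (fun _ => 0) v v = 0)
    (hskew : fderiv ℝ (graphForm Λ fun _ => 0) 0 1 Complex.I ≠
      fderiv ℝ (graphForm Λ fun _ => 0) 0 Complex.I 1)
    (hdet : 0 < bilinDet (fderiv ℝ (graphForm Λ fun _ => 0) 0)) :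
    ∃ (h G : ℂ → ℝ), ContDiff ℝ ∞ h ∧ h 0 = 0 ∧ (∀ᶠ v : ℂ in 𝓝 0, v.re = 0 → h v = 0) ∧
      SmoothNear G 0 ∧ G 0 ≠ 0 ∧ (∀ᶠ v in 𝓝 0, ∀ w, graphForm Λ h v w = G v * crossProd v w) ∧
      ∀ᶠ ρ in 𝓝[>] (0 : ℝ), ∃ μ : ℂ → ℝ, ContDiff ℝ ∞ μ ∧ (∀ᶠ v in 𝓝 0, μ v = 1) ∧
        (∀ v, ρ ≤ ‖v‖ → μ v = 0) ∧ (∀ v, |μ v * h v| ≤ ρ) ∧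
        ∀ v, v ≠ 0 → ‖v‖ ≤ ρ → graphForm Λ (fun v => μ v * h v) v ≠ 0 := by
  have h00 : ∀ v : ℂ, graphForm Λ (fun _ => 0) v = (Λ (v, 0)).comp (.inl ℝ ℂ ℝ) := by
    intro v
    refine ContinuousLinearMap.ext fun w => ?_
    rw [graphForm_apply (by fun_prop)]
    simp
  -- the slope of the contact planes
  let c : ℂ × ℝ → ℝ := fun x => -(Λ x (0, 1))⁻¹
  let f : ℂ × ℝ → ℂ →L[ℝ] ℝ := fun x => c x • (Λ x).comp (.inl ℝ ℂ ℝ)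
  have hΛz : SmoothNear (fun x => Λ x (0, 1)) 0 := by
    filter_upwards [hΛ] with x hx using hx.clm_apply contDiffAt_const
  have hΛz0 : ∀ᶠ x in 𝓝 0, Λ x (0, 1) ≠ 0 := hΛz.continuousAt.eventually_ne hz
  have hc : SmoothNear c 0 := by
    filter_upwards [hΛz, hΛz0] with x h1 h2 using (h1.inv h2).neg
  have hf : SmoothNear f 0 := by
    filter_upwards [hc, hΛ] with x h1 h2 using h1.smul (h2.clm_comp contDiffAt_const)
  have hΛ00 : (Λ 0).comp (.inl ℝ ℂ ℝ) = 0 := by rw [← h0, h00]; rfl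
  have hf0 : f 0 = 0 := by simp only [f]; rw [hΛ00, smul_zero]
  have hiff : ∀ (k : ℂ → ℝ) (v w : ℂ), DifferentiableAt ℝ k v → Λ (v, k v) (0, 1) ≠ 0 →
      (graphForm Λ k v w = 0 ↔ fderiv ℝ k v w = f (v, k v) w) := by
    intro k v w hk hne
    rw [graphForm_apply hk]
    simp only [f, c, smul_apply, ContinuousLinearMap.comp_apply, ContinuousLinearMap.inl_apply,
      smul_eq_mul, neg_mul, ← div_eq_inv_mul]
    rw [eq_neg_iff_add_eq_zero, eq_comm (b := (0 : ℝ)), eq_comm (b := (0 : ℝ)), ← sub_eq_zero,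
      ← sub_eq_zero (a := (0 : ℝ))]
    field_simp
    constructor <;> intro h <;> linarith
  obtain ⟨h₁, hh₁, hh₁0, heq₁, hW₁⟩ := exists_ray_solution hf hf0
  obtain ⟨h, hh, hhh⟩ := hh₁.exists_contDiff
  have hh0 : h 0 = 0 := hhh.self_of_nhds.trans hh₁0
  have heq : ∀ᶠ v in 𝓝 0, fderiv ℝ h v v = f (v, h v) v := by
    filter_upwards [heq₁, hhh.eventually_nhds] with v h1 h2
    have h3 : h =ᶠ[𝓝 v] h₁ := h2
    rw [h3.fderiv_eq, h1, h3.eq_of_nhds]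
  have hW : ∀ᶠ v : ℂ in 𝓝 0, v.re = 0 → h v = 0 := by
    -- The Legendrian condition says that the zero function already solves the ray equation along
    -- the imaginary axis.
    have := hW₁ (LinearMap.ker Complex.reLm) (by
      filter_upwards [hleg] with v hv hvW
      have h1 := hv hvW
      rw [h00] at h1
      simp only [f, smul_apply]
      rw [h1, smul_zero])
    filter_upwards [this, hhh] with v h1 h2 hv
    rw [h2]
    exact h1 hv
  have hdh := fderiv_ray_solution_zero hf hf0 (hh.smoothNear 0) hh0 heq
  have hgraph : Tendsto (fun v : ℂ => (v, h v)) (𝓝 0) (𝓝 0) := by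
    have : Continuous (fun v : ℂ => (v, h v)) := continuous_id.prodMk hh.continuous
    have h1 := this.tendsto 0
    rw [hh0] at h1
    exact h1
  have hrad : ∀ᶠ v in 𝓝 0, graphForm Λ h v v = 0 := by
    filter_upwards [heq, hgraph.eventually hΛz0] with v h1 h2
    exact (hiff h v v (hh.contDiffAt.differentiableAt (by simp)) h2).2 h1
  obtain ⟨G, hG, hGeq, hG0⟩ := exists_eq_mul_crossProd (smoothNear_graphForm hΛ hh hh0) hrad
  have hG0' : G 0 ≠ 0 := by
    -- The graph of `h` and the plane are tangent at the origin, so the two restricted forms have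
    -- the same exterior derivative there. It is nonzero by ellipticity and equals `2 G 0` on the
    -- basis.
    rw [skewDeriv_graphForm hΛ hh hh0 hdh, ← skewDeriv_graphForm (k := fun _ => 0) hΛ
      contDiff_const rfl (by simp)] at hG0
    intro h1
    rw [h1, mul_zero] at hG0
    exact hskew (sub_eq_zero.1 hG0)
  -- the derivative of the slope
  have hfd : ∀ v w : ℂ, fderiv ℝ f 0 (v, 0) w = c 0 * fderiv ℝ (graphForm Λ fun _ => 0) 0 v w := by
    have e1 : graphForm Λ (fun _ => 0) = fun v : ℂ => (Λ (v, 0)).comp (.inl ℝ ℂ ℝ) := funext h00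
    have e2 : HasFDerivAt (fun v : ℂ => ((v, 0) : ℂ × ℝ)) (.inl ℝ ℂ ℝ) 0 :=
      (ContinuousLinearMap.inl ℝ ℂ ℝ).hasFDerivAt
    have e3 : HasFDerivAt f (fderiv ℝ f 0) ((fun v : ℂ => ((v, 0) : ℂ × ℝ)) 0) := hf.hasFDerivAt
    have e4 := e3.comp (0 : ℂ) e2
    have e5 : HasFDerivAt (fun v : ℂ => c (v, 0)) (fderiv ℝ (fun v : ℂ => c (v, 0)) 0) 0 := by
      have : HasFDerivAt c (fderiv ℝ c 0) ((fun v : ℂ => ((v, 0) : ℂ × ℝ)) 0) := hc.hasFDerivAt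
      exact (this.comp (0 : ℂ) e2).differentiableAt.hasFDerivAt
    have e6 := e5.smul (smoothNear_graphForm (k := fun _ => 0) hΛ contDiff_const rfl).hasFDerivAt
    have e7 : (f ∘ fun v : ℂ => ((v, 0) : ℂ × ℝ)) =
        (fun v : ℂ => c (v, 0)) • graphForm Λ (fun _ => 0) := by
      rw [e1]; rfl
    rw [e7] at e4
    have e8 := e4.unique e6
    intro v w
    have := congrArg (fun L : ℂ →L[ℝ] ℂ →L[ℝ] ℝ => L v w) e8
    simp only [h0] at this
    refine this.trans ?_
    simp
    exact Or.inl rfl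
  have hc0 : c 0 ≠ 0 := neg_ne_zero.2 (inv_ne_zero hz)
  have hcut := exists_cutoff_ray_solution hf hf0 hh hh0 heq (by
    simp only [hfd]
    have := mul_pos (pow_pos (abs_pos.2 hc0) 2) hdet
    rw [sq_abs, bilinDet] at this
    linarith) (by
    simp only [hfd]
    exact fun h1 => hskew (mul_left_cancel₀ hc0 h1))
  refine ⟨h, G, hh, hh0, hW, hG, hG0', hGeq, ?_⟩
  obtain ⟨ε, hε, hball⟩ := Metric.eventually_nhds_iff_ball.1 hΛz0
  filter_upwards [hcut, Ioo_mem_nhdsGT hε] with ρ ⟨μ, hμ, hμ1, hμ0, hμh, hne⟩ hρ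
  refine ⟨μ, hμ, hμ1, hμ0, hμh, fun v hv hvρ hzero => hne v hv hvρ ?_⟩
  refine ContinuousLinearMap.ext fun w => ?_
  refine (hiff (fun v => μ v * h v) v w ((hμ.mul hh).contDiffAt.differentiableAt (by simp)) ?_).1 ?_
  · refine hball _ ?_
    rw [mem_ball_zero_iff, Prod.norm_mk]
    exact max_lt (hvρ.trans_lt hρ.2) ((hμh v).trans_lt hρ.2)
  · rw [hzero]; rfl

theorem fderiv_graphForm_of_crossProd {β : ℂ → ℂ →L[ℝ] ℝ} {G : ℂ → ℝ} (hG : SmoothNear G 0)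
    (h : ∀ᶠ v in 𝓝 0, ∀ w, β v w = G v * crossProd v w) :
    β 0 = 0 ∧ ∀ v w, fderiv ℝ β 0 v w = G 0 * crossProd v w := by
  have h1 : β =ᶠ[𝓝 0] fun v => G v • crossProdL v := by
    filter_upwards [h] with v hv
    refine ContinuousLinearMap.ext fun w => ?_
    rw [hv w, smul_apply, crossProdL_apply, smul_eq_mul]
  have h2 : HasFDerivAt (fun v => G v • crossProdL v) _ 0 :=
    hG.hasFDerivAt.smul crossProdL.hasFDerivAt
  constructor
  · rw [h1.eq_of_nhds, map_zero, smul_zero]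
  · intro v w
    rw [h1.fderiv_eq, h2.fderiv]
    simp [crossProdL_apply]

end GraphForm

/-! ### Normalizing the factor of a radial one-form. -/

section Squeeze

/-- A 1-form `G · (x dy - y dx)` with `G 0 ≠ 0` becomes `(x dy - y dx) / 2` after a smooth change of
coordinates which preserves the sign of the real part. -/
theorem exists_radial_coordinates {G : ℂ → ℝ} (hG : SmoothNear G 0) (hG0 : G 0 ≠ 0) :
    ∃ N κ : ℂ → ℂ, SmoothNear N 0 ∧ SmoothNear κ 0 ∧ N 0 = 0 ∧ κ 0 = 0 ∧
      (∀ᶠ v in 𝓝 0, κ (N v) = v) ∧ (∀ᶠ ξ in 𝓝 0, N (κ ξ) = ξ) ∧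
      (∀ᶠ ξ in 𝓝 0, ∃ s : ℝ, 0 < s ∧ ξ.re = s * (κ ξ).re) ∧
      ∀ᶠ ξ in 𝓝 0, ∀ η, G (κ ξ) * crossProd (κ ξ) (fderiv ℝ κ ξ η) = 1 / 2 * crossProd ξ η := by
  -- The sign of `G 0`. If it is negative, complex conjugation reverses the orientation of the plane
  -- without changing real parts.
  obtain ⟨σ, hσ2, hσ⟩ : ∃ σ : ℝ, σ * σ = 1 ∧ 0 < σ * G 0 := by
    rcases lt_or_gt_of_ne hG0 with h | h
    · exact ⟨-1, by norm_num, by linarith⟩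
    · exact ⟨1, by norm_num, by linarith⟩
  let lin₀ : ℂ →L[ℝ] ℂ := Complex.ofRealCLM.comp Complex.reCLM +
    (σ • Complex.I) • Complex.ofRealCLM.comp Complex.imCLM
  have hlin₀re : ∀ v, (lin₀ v).re = v.re := fun v => by simp [lin₀]
  have hlin₀im : ∀ v, (lin₀ v).im = σ * v.im := fun v => by simp [lin₀]
  have hinv : ∀ v, lin₀ (lin₀ v) = v := by
    intro v
    apply Complex.ext
    · rw [hlin₀re, hlin₀re]
    · rw [hlin₀im, hlin₀im, ← mul_assoc, hσ2, one_mul]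
  let lin : ℂ ≃L[ℝ] ℂ := ContinuousLinearEquiv.equivOfInverse lin₀ lin₀ hinv hinv
  have hlincross : ∀ v w, crossProd (lin₀ v) (lin₀ w) = σ * crossProd v w := by
    intro v w
    simp only [crossProd, hlin₀re, hlin₀im]
    ring
  let s : ℂ → ℝ := fun v => Real.sqrt (2 * (σ * G v))
  have hpos : ∀ᶠ v in 𝓝 0, 0 < σ * G v :=
    (hG.continuousAt.const_mul σ).eventually (lt_mem_nhds hσ)
  have hs : SmoothNear s 0 := by
    filter_upwards [hpos, hG] with v h1 h2
    exact (contDiffAt_const.mul (contDiffAt_const.mul h2)).sqrt (by positivity)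
  have hs0 : ∀ᶠ v in 𝓝 0, 0 < s v := by
    filter_upwards [hpos] with v h1 using Real.sqrt_pos.2 (by positivity)
  have hss : ∀ᶠ v in 𝓝 0, s v * s v = 2 * (σ * G v) := by
    filter_upwards [hpos] with v h1 using Real.mul_self_sqrt (by positivity)
  let N : ℂ → ℂ := fun v => s v • lin₀ v
  have hN : SmoothNear N 0 := by
    filter_upwards [hs] with v h1 using h1.smul lin₀.contDiff.contDiffAt
  have hN0 : N 0 = 0 := by simp [N]
  have hNd : ∀ v, DifferentiableAt ℝ s v → HasFDerivAt N
      (s v • lin₀ + (fderiv ℝ s v).smulRight (lin₀ v)) v := by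
    intro v hv
    exact hv.hasFDerivAt.smul lin₀.hasFDerivAt
  have hu := hs0.self_of_nhds.ne'
  let e : ℂ ≃L[ℝ] ℂ := lin.trans (ContinuousLinearEquiv.smulLeft (Units.mk0 (s 0) hu))
  have he : HasFDerivAt N (e : ℂ →L[ℝ] ℂ) 0 := by
    refine (hNd 0 hs.differentiableAt).congr_fderiv ?_
    refine ContinuousLinearMap.ext fun v => ?_
    simp [e, lin]
  obtain ⟨κ, hκ0, hκ, hNκ, hκN⟩ := hN.exists_localInverse e he
  rw [hN0] at hκ0 hκ hNκ
  have hκt : Tendsto κ (𝓝 0) (𝓝 0) := by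
    have := hκ.continuousAt.tendsto
    rwa [hκ0] at this
  refine ⟨N, κ, hN, hκ, hN0, hκ0, hκN, hNκ, ?_, ?_⟩
  · filter_upwards [hNκ, hκt.eventually hs0] with ξ h1 h2
    refine ⟨s (κ ξ), h2, ?_⟩
    conv_lhs => rw [← h1]
    simp [N, hlin₀re]
  · filter_upwards [hNκ.eventually_nhds, hκt.eventually hss, hκt.eventually hs, hκ] with ξ h1 h2 h3 h4 η
    have h5 := hNd (κ ξ) (h3.differentiableAt (by simp))
    have h6 := (h5.comp ξ (h4.differentiableAt (by simp)).hasFDerivAt)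
    have h7 : HasFDerivAt (N ∘ κ) (ContinuousLinearMap.id ℝ ℂ) ξ :=
      (hasFDerivAt_id ξ).congr_of_eventuallyEq h1
    have h8 := congrArg (fun L : ℂ →L[ℝ] ℂ => L η) (h6.unique h7)
    set w := fderiv ℝ κ ξ η with hw
    have h9 : s (κ ξ) • lin₀ w + fderiv ℝ s (κ ξ) w • lin₀ (κ ξ) = η := h8
    have h10 : s (κ ξ) • lin₀ (κ ξ) = ξ := h1.self_of_nhds
    -- The derivative of the scalar factor `s` contributes a multiple of the vector `lin₀ (κ ξ)`,
    -- which is parallel to `ξ` and drops out of the cross product. Hence scaling by `s` multiplies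
    -- the form by exactly `s² = 2 σ G`.
    have h11 : crossProd ξ η = s (κ ξ) * s (κ ξ) * crossProd (lin₀ (κ ξ)) (lin₀ w) := by
      have key : ∀ (a b : ℝ) (x y : ℂ), crossProd (a • x) (a • y + b • x) = a * a * crossProd x y := by
        intro a b x y
        simp only [crossProd, Complex.add_re, Complex.add_im, Complex.real_smul, Complex.mul_re,
          Complex.mul_im, Complex.ofReal_re, Complex.ofReal_im]
        ring
      have := key (s (κ ξ)) (fderiv ℝ s (κ ξ) w) (lin₀ (κ ξ)) (lin₀ w)
      rwa [h9, h10] at this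
    rw [h11, h2, hlincross]
    linear_combination (-G (κ ξ) * crossProd (κ ξ) w) * hσ2

end Squeeze

/-! ### Radial parametrizations from radial graphs. -/

section RadialParam

variable {M : Type*} [TopologicalSpace M] [ChartedSpace (Euc 3) M] [IsManifold (𝓡 3) ∞ M]

theorem pullForm_graph (lam : ContactForm M) {Ψ : ℂ × ℝ → M} {k : ℂ → ℝ} {v : ℂ}
    (hΨ : MDifferentiableAt 𝓘(ℝ, ℂ × ℝ) (𝓡 3) Ψ (v, k v)) (hk : DifferentiableAt ℝ k v) :
    pullForm lam (fun v => Ψ (v, k v)) v = graphForm (pullForm lam Ψ) k v :=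
  pullForm_comp lam (f := Ψ) (g := fun v => (v, k v)) hΨ (differentiableAt_id.prodMk hk)

/-- Take `Φ (ξ, t) = Ψ (κ ξ, h (κ ξ) + t)`: the shear moves the plane onto the graph, and `κ`
normalizes `G`. The knot stays on the imaginary axis because `h` vanishes there and `κ` preserves
the sign of the real part. -/
theorem exists_isRadialParam (lam : ContactForm M) {L Dstar : Set M} {Ψ : ℂ × ℝ → M}
    {R : M → ℂ × ℝ} {e : M} (hΨ : IsLocalParam Ψ R e) (hR : R e = 0) {h G : ℂ → ℝ}
    (hh : ContDiff ℝ ∞ h) (hh0 : h 0 = 0) (hflat : ∀ᶠ v : ℂ in 𝓝 0, v.re = 0 → h v = 0)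
    (hG : SmoothNear G 0) (hG0 : G 0 ≠ 0)
    (hform : ∀ᶠ v in 𝓝 0, ∀ w, graphForm (pullForm lam Ψ) h v w = G v * crossProd v w)
    (hL : ∀ᶠ v : ℂ in 𝓝 0, v.re = 0 → Ψ (v, 0) ∈ L)
    (hD : ∀ᶠ v : ℂ in 𝓝 0, 0 ≤ v.re → v ≠ 0 → Ψ (v, h v) ∈ Dstar) :
    ∃ Φ Q, IsRadialParam lam L Dstar Φ Q e := by
  obtain ⟨N, κ, hN, hκ, hN0, hκ0, hκN, hNκ, hre, hcross⟩ := exists_radial_coordinates hG hG0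
  let α : ℂ × ℝ → ℂ × ℝ := fun x => (κ x.1, h (κ x.1) + x.2)
  let α' : ℂ × ℝ → ℂ × ℝ := fun x => (N x.1, x.2 - h x.1)
  have hfst : Tendsto (Prod.fst : ℂ × ℝ → ℂ) (𝓝 0) (𝓝 0) := continuous_fst.tendsto _
  have hκt : Tendsto κ (𝓝 0) (𝓝 0) := by
    have := hκ.continuousAt.tendsto
    rwa [hκ0] at this
  have hα : SmoothNear α 0 := by
    filter_upwards [hfst.eventually hκ] with x hx
    have h1 : ContDiffAt ℝ ∞ (fun x : ℂ × ℝ => κ x.1) x := hx.comp x contDiffAt_fst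
    exact h1.prodMk ((hh.contDiffAt.comp x h1).add contDiffAt_snd)
  have hα' : SmoothNear α' 0 := by
    filter_upwards [hfst.eventually hN] with x hx
    exact (hx.comp x contDiffAt_fst).prodMk
      (contDiffAt_snd.sub (hh.contDiffAt.comp x contDiffAt_fst))
  have hα'0 : α' 0 = 0 := by simp [α', hN0, hh0]
  have hα0 : α 0 = 0 := by simp [α, hκ0, hh0]
  have hparam : IsLocalParam (fun x => Ψ (α x)) (fun q => α' (R q)) e := by
    refine hΨ.comp ?_ ?_ ?_ ?_ <;> rw [hR]
    · rw [hα'0]; exact hα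
    · exact hα'
    · rw [hα'0]
      filter_upwards [hfst.eventually hNκ] with x hx
      simp [α, α', hx]
    · filter_upwards [hfst.eventually hκN] with x hx
      simp [α, α', hx]
  have hαt : Tendsto (fun ξ : ℂ => α (ξ, 0)) (𝓝 0) (𝓝 0) := by
    have := hα.continuousAt.tendsto
    rw [hα0] at this
    exact this.comp tendsto_prodMk_zero
  have hsm := hΨ.smooth
  rw [hR] at hsm
  refine ⟨fun x => Ψ (α x), fun q => α' (R q), ⟨hparam, ?_, ?_, ?_, ?_⟩⟩
  · rw [hR, hα'0]
  · filter_upwards [hcross, hαt.eventually hsm, tendsto_prodMk_zero.eventually hα, hκ,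
      hκt.eventually hform] with ξ h1 h2 h3 h4 h5 η
    have hdα := h3.differentiableAt (by simp)
    have hdκ := h4.differentiableAt (by simp)
    rw [show (fun x => Ψ (α x)) = Ψ ∘ α from rfl,
      pullForm_comp lam (h2.mdifferentiableAt (by simp)) hdα, ContinuousLinearMap.comp_apply]
    have e1 : HasFDerivAt (fun ξ : ℂ => α (ξ, 0))
        ((fderiv ℝ α (ξ, 0)).comp (.inl ℝ ℂ ℝ)) ξ :=
      HasFDerivAt.comp (g := α) (f := fun ξ : ℂ => ((ξ, 0) : ℂ × ℝ)) ξ hdα.hasFDerivAt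
        (ContinuousLinearMap.inl ℝ ℂ ℝ).hasFDerivAt
    have hdh : DifferentiableAt ℝ (fun v => (v, h v)) (κ ξ) :=
      differentiableAt_id.prodMk (hh.contDiffAt.differentiableAt (by simp))
    have e2 : HasFDerivAt (fun ξ : ℂ => α (ξ, 0))
        ((fderiv ℝ (fun v => (v, h v)) (κ ξ)).comp (fderiv ℝ κ ξ)) ξ := by
      refine (HasFDerivAt.comp (g := fun v => (v, h v)) (f := κ) ξ hdh.hasFDerivAt
        hdκ.hasFDerivAt).congr_of_eventuallyEq (Eventually.of_forall fun ξ => ?_)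
      simp [α]
    have e3 := congrArg (fun L : ℂ →L[ℝ] ℂ × ℝ => L η) (e1.unique e2)
    have e4 : fderiv ℝ α (ξ, 0) (η, 0) = fderiv ℝ (fun v => (v, h v)) (κ ξ) (fderiv ℝ κ ξ η) := e3
    have e5 : α (ξ, 0) = (κ ξ, h (κ ξ)) := by simp [α]
    rw [e4, e5, ← h1 η, ← h5]
    rfl
  · filter_upwards [hre, hκt.eventually hflat, hκt.eventually hL] with ξ ⟨s, hs, h1⟩ h2 h3 h4
    have h5 : (κ ξ).re = 0 := by
      rw [h4] at h1
      exact (mul_eq_zero.1 h1.symm).resolve_left hs.ne'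
    have h6 : α (ξ, 0) = (κ ξ, 0) := by simp [α, h2 h5]
    rw [h6]
    exact h3 h5
  · filter_upwards [hre, hNκ, hκt.eventually hD] with ξ ⟨s, hs, h1⟩ h2 h3 h4 h5
    have h6 : α (ξ, 0) = (κ ξ, h (κ ξ)) := by simp [α]
    rw [h6]
    refine h3 ?_ ?_
    · rw [h1] at h4
      exact nonneg_of_mul_nonneg_right h4 hs
    · intro h7
      rw [h7, hN0] at h2
      exact h5 h2.symm

end RadialParam

/-! ### Flat coordinates at an elliptic boundary point on the knot. -/

section AdaptedSurfaceParam

variable {M : Type*} [TopologicalSpace M] [ChartedSpace (Euc 3) M]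
  {S : Type*} [TopologicalSpace S] [ChartedSpace (EuclideanHalfSpace 2) S]
  {F : S → M} {Ψ : ℂ × ℝ → M} {R : M → ℂ × ℝ} {q₀ : S}

theorem IsSurfaceParam.apply_zero (h : IsSurfaceParam F Ψ R q₀) : Ψ 0 = F q₀ := by
  rw [← h.center]; exact h.right_inv.self_of_nhds

theorem IsSurfaceParam.tendsto (h : IsSurfaceParam F Ψ R q₀) : Tendsto Ψ (𝓝 0) (𝓝 (F q₀)) := by
  have h1 := h.smooth.self_of_nhds.continuousAt.tendsto
  rwa [h.right_inv.self_of_nhds, h.center] at h1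

omit [ChartedSpace (Euc 3) M] [ChartedSpace (EuclideanHalfSpace 2) S] in
-- An embedded surface does not return close to `F q₀` from far away in `S`, so properties near `q₀`
-- hold for all surface points near `F q₀`.
theorem eventually_preimage_of_isInducing (hF : Topology.IsInducing F) {P : S → Prop}
    (hP : ∀ᶠ q in 𝓝 q₀, P q) : ∀ᶠ p in 𝓝 (F q₀), ∀ q, F q = p → P q := by
  rw [hF.nhds_eq_comap] at hP
  exact eventually_comap.1 hP

/-- The points of the half plane parametrize the surface. -/
theorem IsSurfaceParam.eventually_exists (h : IsSurfaceParam F Ψ R q₀)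
    (hF : Topology.IsInducing F) : ∀ᶠ v : ℂ in 𝓝 0, 0 ≤ v.re →
      ∃ q, F q = Ψ (v, 0) ∧ (q ∈ (𝓡∂ 2).boundary S ↔ v.re = 0) := by
  have hl := h.left_inv
  rw [h.center] at hl
  filter_upwards [h.fills, (h.tendsto.comp tendsto_prodMk_zero).eventually
    (eventually_preimage_of_isInducing hF h.half), tendsto_prodMk_zero.eventually hl]
    with v h1 h2 h3 hv
  obtain ⟨q, hq⟩ := h1 hv
  refine ⟨q, hq, ?_⟩
  have := (h2 q hq).2
  rwa [hq, h3] at this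

theorem IsSurfaceParam.eventually_eq (h : IsSurfaceParam F Ψ R q₀) (hF : ContinuousAt F q₀) :
    F =ᶠ[𝓝 q₀] (fun v : ℂ => Ψ (v, 0)) ∘ fun q => (R (F q)).1 := by
  filter_upwards [hF.eventually h.right_inv, h.flat] with q h1 h2
  have h3 : R (F q) = ((R (F q)).1, 0) := Prod.ext rfl h2
  simp only [Function.comp_apply]
  rw [← h3, h1]

theorem IsLocalParam.injective_mfderiv_graph {k : ℂ → ℝ} {v : ℂ} (hk : ContDiffAt ℝ ∞ k v)
    (hΨ : ContMDiffAt 𝓘(ℝ, ℂ × ℝ) (𝓡 3) ∞ Ψ (v, k v))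
    (hR : ContMDiffAt (𝓡 3) 𝓘(ℝ, ℂ × ℝ) ∞ R (Ψ (v, k v)))
    (hl : ∀ᶠ x in 𝓝 (v, k v), R (Ψ x) = x) :
    ContMDiffAt 𝓘(ℝ, ℂ) (𝓡 3) ∞ (fun v => Ψ (v, k v)) v ∧
      Function.Injective (mfderiv 𝓘(ℝ, ℂ) (𝓡 3) (fun v => Ψ (v, k v)) v) := by
  have hg : ContDiffAt ℝ ∞ (fun v => (v, k v)) v := contDiffAt_id.prodMk hk
  have h1 : ContMDiffAt 𝓘(ℝ, ℂ) (𝓡 3) ∞ (fun v => Ψ (v, k v)) v :=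
    ContMDiffAt.comp (g := Ψ) (f := fun v => (v, k v)) v hΨ hg.contMDiffAt
  have h2 : ContMDiffAt (𝓡 3) 𝓘(ℝ, ℂ) ∞ (fun p => (R p).1) (Ψ (v, k v)) :=
    ContDiffAt.comp_contMDiffAt (f := R) (g := Prod.fst) contDiffAt_fst hR
  refine ⟨h1, IsLocalParam.injective_mfderiv (Q := fun p => (R p).1)
    (h1.mdifferentiableAt (by simp)) (h2.mdifferentiableAt (by simp)) ?_⟩
  filter_upwards [hg.continuousAt.eventually hl] with w hw
  rw [hw]

variable [IsManifold (𝓡 3) ∞ M]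

theorem IsSurfaceParam.smoothNear_pullForm (lam : ContactForm M) (h : IsSurfaceParam F Ψ R q₀) :
    SmoothNear (pullForm lam Ψ) 0 := by
  have := h.smooth
  rw [h.center] at this
  filter_upwards [this] with x hx using contDiffAt_pullForm lam hx

theorem IsSurfaceParam.eventually_pullForm_graph (lam : ContactForm M)
    (h : IsSurfaceParam F Ψ R q₀) {k : ℂ → ℝ} (hk : ContDiff ℝ ∞ k) (hk0 : k 0 = 0) :
    ∀ᶠ v in 𝓝 0, pullForm lam (fun v => Ψ (v, k v)) v = graphForm (pullForm lam Ψ) k v := by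
  have hs := h.smooth
  rw [h.center] at hs
  have ht : Tendsto (fun v : ℂ => (v, k v)) (𝓝 0) (𝓝 0) :=
    (continuous_id.prodMk hk.continuous).tendsto' _ _ (by simp only [id, hk0]; rfl)
  filter_upwards [ht.eventually hs] with v hv
  exact pullForm_graph lam (hv.mdifferentiableAt (by simp)) (hk.contDiffAt.differentiableAt (by simp))

/-- The ellipticity criterion in a surface parametrization. -/
theorem IsSurfaceParam.isEllipticAt_iff (lam : ContactForm M) (h : IsSurfaceParam F Ψ R q₀)
    {k : ℂ → ℝ} (hk : ContDiff ℝ ∞ k) (hk0 : k 0 = 0) {F₁ : S → M}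
    (hF₁ : F₁ =ᶠ[𝓝 q₀] (fun v : ℂ => Ψ (v, k v)) ∘ fun q => (R (F q)).1) :
    IsEllipticAt lam F₁ q₀ ↔ graphForm (pullForm lam Ψ) k 0 = 0 ∧
      fderiv ℝ (graphForm (pullForm lam Ψ) k) 0 1 Complex.I ≠
        fderiv ℝ (graphForm (pullForm lam Ψ) k) 0 Complex.I 1 ∧
      0 < bilinDet (fderiv ℝ (graphForm (pullForm lam Ψ) k) 0) := by
  have hK0 : (R (F q₀)).1 = 0 := by rw [h.center]; rfl
  have hs := h.smooth
  have hl := h.left_inv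
  rw [h.center] at hs hl
  have hzero : (((0 : ℂ), k 0) : ℂ × ℝ) = 0 := by rw [hk0]; rfl
  obtain ⟨hg, hgi⟩ := IsLocalParam.injective_mfderiv_graph (Ψ := Ψ) (R := R) (k := k) (v := 0)
    hk.contDiffAt (by rw [hzero]; exact hs.self_of_nhds)
    (by rw [hzero, h.apply_zero]; exact h.smooth_inv.self_of_nhds) (by rw [hzero]; exact hl)
  obtain ⟨hK, hKi⟩ := h.coord.self_of_nhds
  have hpull : pullForm lam (fun v => Ψ (v, k v)) =ᶠ[𝓝 0] graphForm (pullForm lam Ψ) k :=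
    h.eventually_pullForm_graph lam hk hk0
  -- The base point `(R (F q₀)).1` is zero only propositionally; a variable in its place can be
  -- substituted.
  have key : ∀ v₀, v₀ = (0 : ℂ) → (IsEllipticAt lam F₁ q₀ ↔ pullForm lam (fun v => Ψ (v, k v)) v₀ = 0 ∧
      fderiv ℝ (pullForm lam (fun v => Ψ (v, k v))) v₀ 1 Complex.I ≠
        fderiv ℝ (pullForm lam (fun v => Ψ (v, k v))) v₀ Complex.I 1 ∧
      0 < bilinDet (fderiv ℝ (pullForm lam (fun v => Ψ (v, k v))) v₀)) →
      (IsEllipticAt lam F₁ q₀ ↔ graphForm (pullForm lam Ψ) k 0 = 0 ∧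
      fderiv ℝ (graphForm (pullForm lam Ψ) k) 0 1 Complex.I ≠
        fderiv ℝ (graphForm (pullForm lam Ψ) k) 0 Complex.I 1 ∧
      0 < bilinDet (fderiv ℝ (graphForm (pullForm lam Ψ) k) 0)) := by
    rintro v₀ rfl hh
    rwa [hpull.fderiv_eq, hpull.eq_of_nhds] at hh
  exact key _ hK0 (isEllipticAt_iff_pullForm lam hK hKi (g := fun v => Ψ (v, k v))
    (by rw [hK0]; exact hg) (by rw [hK0]; exact hgi) hF₁)

theorem surjective_of_injective_euc {D : ℂ × ℝ →L[ℝ] Euc 3} (h : Function.Injective D) :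
    Function.Surjective D :=
  (LinearMap.injective_iff_surjective_of_finrank_eq_finrank (f := D.toLinearMap) (by simp)).1 h

/-- Around an elliptic boundary point on a Legendrian knot, there is a surface parametrization in
which the surface can be pushed into radial position. -/
theorem exists_adapted_surfaceParam [IsManifold (𝓡∂ 2) ∞ S] (lam : ContactForm M) {γ : Circle → M}
    (hγ : IsLegendrianKnot lam γ) (hF : Manifold.IsSmoothEmbedding (𝓡∂ 2) (𝓡 3) ∞ F)
    (hbd : F '' (𝓡∂ 2).boundary S = range γ) (hq₀ : q₀ ∈ (𝓡∂ 2).boundary S)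
    (hell : IsEllipticAt lam F q₀) :
    ∃ (Ψ : ℂ × ℝ → M) (R : M → ℂ × ℝ) (h G : ℂ → ℝ), IsSurfaceParam F Ψ R q₀ ∧
      (∀ᶠ v : ℂ in 𝓝 0, v.re = 0 → Ψ (v, 0) ∈ range γ) ∧
      ContDiff ℝ ∞ h ∧ h 0 = 0 ∧ (∀ᶠ v : ℂ in 𝓝 0, v.re = 0 → h v = 0) ∧
      SmoothNear G 0 ∧ G 0 ≠ 0 ∧
      (∀ᶠ v in 𝓝 0, ∀ w, graphForm (pullForm lam Ψ) h v w = G v * crossProd v w) ∧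
      ∀ᶠ ρ in 𝓝[>] (0 : ℝ), ∃ μ : ℂ → ℝ, ContDiff ℝ ∞ μ ∧ (∀ᶠ v in 𝓝 0, μ v = 1) ∧
        (∀ v, ρ ≤ ‖v‖ → μ v = 0) ∧ (∀ v, |μ v * h v| ≤ ρ) ∧
        ∀ v, v ≠ 0 → ‖v‖ ≤ ρ → graphForm (pullForm lam Ψ) (fun v => μ v * h v) v ≠ 0 := by
  obtain ⟨Ψ, R, hP⟩ := exists_isSurfaceParam (hF.isImmersion.isImmersionOfComplement_complement q₀) hq₀
  have hind := hF.isEmbedding.isInducing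
  have hs := hP.smooth
  have hl := hP.left_inv
  rw [hP.center] at hs hl
  have hΛ := hP.smoothNear_pullForm lam
  obtain ⟨h0, hskew, hdet⟩ := (hP.isEllipticAt_iff lam (k := fun _ => 0) contDiff_const rfl
    (hP.eventually_eq (hF.contMDiff q₀).continuousAt)).1 hell
  have hknot : ∀ᶠ v : ℂ in 𝓝 0, v.re = 0 → Ψ (v, 0) ∈ range γ := by
    filter_upwards [hP.eventually_exists hind] with v hv hv0
    obtain ⟨q, hq, hqb⟩ := hv hv0.ge
    rw [← hbd, ← hq]
    exact mem_image_of_mem _ (hqb.2 hv0)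
  -- At the singular point `λ` vanishes on the plane. If it also vanished on the transverse
  -- direction, it would be zero on the whole tangent space.
  have hz : pullForm lam Ψ 0 (0, 1) ≠ 0 := by
    intro hz
    have hzero : pullForm lam Ψ 0 = 0 := by
      refine ContinuousLinearMap.ext fun x => ?_
      have h1 : x = (x.1, 0) + x.2 • ((0, 1) : ℂ × ℝ) := by simp
      have h2 := congrArg (fun L : ℂ →L[ℝ] ℝ => L x.1) h0
      have h3 : pullForm lam Ψ 0 (x.1, 0) = 0 := by
        have h4 := graphForm_apply (Λ := pullForm lam Ψ) (k := fun _ => 0) (v := 0)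
          (differentiableAt_const _) x.1
        rw [h4] at h2
        have h5 : pullForm lam Ψ (0, 0) (x.1, 0) = 0 := by simpa using h2
        exact h5
      rw [h1, map_add, map_smul, hz, h3]
      simp
    have hinj : Function.Injective (mfderiv 𝓘(ℝ, ℂ × ℝ) (𝓡 3) Ψ 0) :=
      IsLocalParam.injective_mfderiv (Q := R) (hs.self_of_nhds.mdifferentiableAt (by simp))
        (by rw [hP.apply_zero]; exact hP.smooth_inv.self_of_nhds.mdifferentiableAt (by simp)) hl
    have hsurj : Function.Surjective (mfderiv 𝓘(ℝ, ℂ × ℝ) (𝓡 3) Ψ 0 : ℂ × ℝ →L[ℝ] Euc 3) :=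
      surjective_of_injective_euc hinj
    refine lam.form_ne_zero (Ψ 0) (ContinuousLinearMap.ext fun x => ?_)
    obtain ⟨y, rfl⟩ := hsurj x
    exact congrArg (fun L : ℂ × ℝ →L[ℝ] ℝ => L y) hzero
  -- The curve `t ↦ Ψ (t i, 0)` runs in the knot, and for `re v = 0` the vector `v` is a multiple of
  -- its velocity.
  have hleg : ∀ᶠ v : ℂ in 𝓝 0, v.re = 0 → graphForm (pullForm lam Ψ) (fun _ => 0) v v = 0 := by
    filter_upwards [hknot.eventually_nhds, tendsto_prodMk_zero.eventually hs,
      hP.eventually_pullForm_graph lam (k := fun _ => 0) contDiff_const rfl] with v h1 h2 h3 hv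
    have hv' : v = v.im • Complex.I := by apply Complex.ext <;> simp [hv]
    have hline : HasFDerivAt (fun t : ℝ => t • Complex.I)
        ((ContinuousLinearMap.id ℝ ℝ).smulRight Complex.I) v.im :=
      ((ContinuousLinearMap.id ℝ ℝ).smulRight Complex.I).hasFDerivAt
    have hlines : ContDiff ℝ ∞ (fun t : ℝ => t • Complex.I) := by fun_prop
    have hg : ContMDiffAt 𝓘(ℝ, ℂ) (𝓡 3) ∞ (fun v : ℂ => Ψ (v, 0)) (v.im • Complex.I) := by
      rw [← hv']
      exact ContMDiffAt.comp (g := Ψ) (f := fun v : ℂ => ((v, 0) : ℂ × ℝ)) v h2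
        (contDiffAt_id.prodMk contDiffAt_const).contMDiffAt
    have hcs : ContMDiffAt 𝓘(ℝ, ℝ) (𝓡 3) ∞
        ((fun v : ℂ => Ψ (v, 0)) ∘ fun t : ℝ => t • Complex.I) v.im :=
      ContMDiffAt.comp (g := fun v : ℂ => Ψ (v, 0)) (f := fun t : ℝ => t • Complex.I) v.im hg
        hlines.contDiffAt.contMDiffAt
    have hct : Tendsto (fun t : ℝ => t • Complex.I) (𝓝 v.im) (𝓝 v) := by
      have := hlines.continuous.tendsto v.im
      rwa [← hv'] at this
    have h4 := hγ.pullForm_eq_zero hcs (by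
      filter_upwards [hct.eventually h1] with t ht
      exact ht (by simp))
    rw [pullForm_comp lam (f := fun v : ℂ => Ψ (v, 0)) (g := fun t : ℝ => t • Complex.I)
      (hg.mdifferentiableAt (by simp)) hline.differentiableAt, hline.fderiv,
      ← hv', h3] at h4
    have h5 := congrArg (fun L : ℝ →L[ℝ] ℝ => L v.im) h4
    simp only [ContinuousLinearMap.comp_apply, ContinuousLinearMap.smulRight_apply] at h5
    have h6 : (ContinuousLinearMap.id ℝ ℝ) v.im • Complex.I = v := hv'.symm
    rw [h6] at h5
    exact h5
  obtain ⟨h, G, hh, hh0, hflat, hG, hG0, hform, hcut⟩ := exists_adapted_graph hΛ h0 hz hleg hskew hdet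
  exact ⟨Ψ, R, h, G, hP, hknot, hh, hh0, hflat, hG, hG0, hform, hcut⟩

end AdaptedSurfaceParam

/-! ### Replacing a piece of a surface by a graph. -/

section Perturbation

variable {M : Type*} [TopologicalSpace M] [ChartedSpace (Euc 3) M]
  {E : Type*} [NormedAddCommGroup E] [NormedSpace ℝ E]

/-- `Ψ` and `R` are mutually inverse diffeomorphisms between the open sets `U` and `B`. -/
structure IsLocalParamOn (Ψ : E → M) (R : M → E) (U : Set E) (B : Set M) : Prop where
  isOpen_source : IsOpen U
  isOpen_target : IsOpen B
  smooth : ∀ x ∈ U, ContMDiffAt 𝓘(ℝ, E) (𝓡 3) ∞ Ψ x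
  left_inv : ∀ x ∈ U, R (Ψ x) = x
  maps : ∀ x ∈ U, Ψ x ∈ B
  smooth_inv : ∀ p ∈ B, ContMDiffAt (𝓡 3) 𝓘(ℝ, E) ∞ R p
  right_inv : ∀ p ∈ B, Ψ (R p) = p
  maps_inv : ∀ p ∈ B, R p ∈ U

/-- A diffeomorphism of the coordinate space induces a local diffeomorphism. -/
theorem IsLocalParamOn.conj {Ψ : E → M} {R : M → E} {U : Set E} {B : Set M}
    (h : IsLocalParamOn Ψ R U B) {σ σ' : E → E} (hσ : ContDiff ℝ ∞ σ) (hl : ∀ x, σ' (σ x) = x)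
    {p : M} (hp : p ∈ B) (hσp : σ (R p) ∈ U) :
    ∀ᶠ p' in 𝓝 p, ContMDiffAt (𝓡 3) (𝓡 3) ∞ (fun p => Ψ (σ (R p))) p' ∧
      Ψ (σ' (R (Ψ (σ (R p'))))) = p' := by
  have hc : ContinuousAt (fun p => σ (R p)) p :=
    hσ.continuous.continuousAt.comp (h.smooth_inv p hp).continuousAt
  filter_upwards [h.isOpen_target.mem_nhds hp, hc.eventually (h.isOpen_source.mem_nhds hσp)]
    with p' h1 h2
  constructor
  · have h3 : ContMDiffAt (𝓡 3) 𝓘(ℝ, E) ∞ (fun p => σ (R p)) p' :=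
      ContDiffAt.comp_contMDiffAt (f := R) hσ.contDiffAt (h.smooth_inv p' h1)
    exact ContMDiffAt.comp (g := Ψ) (f := fun p => σ (R p)) p' (h.smooth _ h2) h3
  · rw [h.left_inv _ h2, hl, h.right_inv _ h1]

variable {S : Type*} {F : S → M} {Ψ : ℂ × ℝ → M} {R : M → ℂ × ℝ}

open Classical in
/-- The surface `F`, with the part in the coordinate domain `B` (where it is `{(v, 0)}`) replaced by
the graph of `k`. -/
def graphSurface (F : S → M) (Ψ : ℂ × ℝ → M) (R : M → ℂ × ℝ) (B : Set M) (k : ℂ → ℝ) (q : S) : M :=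
  if F q ∈ B then Ψ ((R (F q)).1, (R (F q)).2 + k (R (F q)).1) else F q

/-- A part of a surface on which it is the plane `{(v, 0)}` in coordinates, and a function `k` of
compact support whose graph stays in the coordinate domain. -/
structure IsGraphData (F : S → M) (Ψ : ℂ × ℝ → M) (R : M → ℂ × ℝ) (B : Set M) (k : ℂ → ℝ)
    (r ρ : ℝ) : Prop extends IsLocalParamOn Ψ R (Metric.ball 0 r) B where
  lt : ρ < r
  smooth_k : ContDiff ℝ ∞ k
  abs_le : ∀ v, |k v| ≤ ρ
  support : ∀ v, ρ ≤ ‖v‖ → k v = 0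
  flat : ∀ q, F q ∈ B → (R (F q)).2 = 0

variable {B : Set M} {k : ℂ → ℝ} {r ρ : ℝ}

theorem IsGraphData.eq_coord (h : IsGraphData F Ψ R B k r ρ) {q : S} (hq : F q ∈ B) :
    R (F q) = ((R (F q)).1, 0) := Prod.ext rfl (h.flat q hq)

theorem IsGraphData.apply_coord (h : IsGraphData F Ψ R B k r ρ) {q : S} (hq : F q ∈ B) :
    Ψ ((R (F q)).1, 0) = F q := by
  rw [← h.eq_coord hq, h.right_inv _ hq]

theorem IsGraphData.norm_lt (h : IsGraphData F Ψ R B k r ρ) {q : S} (hq : F q ∈ B) :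
    ‖(R (F q)).1‖ < r :=
  (norm_fst_le _).trans_lt (mem_ball_zero_iff.1 (h.maps_inv _ hq))

theorem IsGraphData.mem_ball (h : IsGraphData F Ψ R B k r ρ) {v : ℂ} (hv : ‖v‖ < r) :
    ((v, k v) : ℂ × ℝ) ∈ Metric.ball 0 r := by
  rw [mem_ball_zero_iff, Prod.norm_mk]
  exact max_lt hv ((h.abs_le v).trans_lt h.lt)

theorem IsGraphData.graphSurface_of_mem (h : IsGraphData F Ψ R B k r ρ) {q : S} (hq : F q ∈ B) :
    graphSurface F Ψ R B k q = Ψ ((R (F q)).1, k (R (F q)).1) := by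
  rw [graphSurface, if_pos hq, h.flat q hq, zero_add]

omit [TopologicalSpace M] [ChartedSpace (Euc 3) M] in
theorem graphSurface_of_notMem {q : S} (hq : F q ∉ B) : graphSurface F Ψ R B k q = F q := if_neg hq

theorem IsGraphData.graphSurface_eq (h : IsGraphData F Ψ R B k r ρ) {q : S} (hq : F q ∈ B)
    (hk : k (R (F q)).1 = 0) : graphSurface F Ψ R B k q = F q := by
  rw [h.graphSurface_of_mem hq, hk, h.apply_coord hq]

theorem IsGraphData.graphSurface_mem (h : IsGraphData F Ψ R B k r ρ) {q : S} (hq : F q ∈ B) :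
    graphSurface F Ψ R B k q ∈ B := by
  rw [h.graphSurface_of_mem hq]
  exact h.maps _ (h.mem_ball (h.norm_lt hq))

/-- Moved points keep their coordinate `v` and stay in `B`, while points outside `B` do not move. -/
theorem IsGraphData.injective (h : IsGraphData F Ψ R B k r ρ) (hF : Function.Injective F) :
    Function.Injective (graphSurface F Ψ R B k) := by
  intro q q' hqq'
  by_cases hq : F q ∈ B <;> by_cases hq' : F q' ∈ B
  · rw [h.graphSurface_of_mem hq, h.graphSurface_of_mem hq'] at hqq'
    have h1 := congrArg R hqq'
    rw [h.left_inv _ (h.mem_ball (h.norm_lt hq)), h.left_inv _ (h.mem_ball (h.norm_lt hq'))] at h1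
    have h2 := congrArg Prod.fst h1
    simp only at h2
    apply hF
    rw [← h.apply_coord hq, ← h.apply_coord hq', h2]
  · have := h.graphSurface_mem hq
    rw [hqq', graphSurface_of_notMem hq'] at this
    exact absurd this hq'
  · have := h.graphSurface_mem hq'
    rw [← hqq', graphSurface_of_notMem hq] at this
    exact absurd this hq
  · rw [graphSurface_of_notMem hq, graphSurface_of_notMem hq'] at hqq'
    exact hF hqq'

variable [TopologicalSpace S]

/-- The coordinate disc of radius `ρ` has compact, hence closed, image in `M`, and off it nothing
moves. So the definition by cases causes no trouble at the edge of `B`. -/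
theorem IsGraphData.eventually_eq_or [T2Space M] (h : IsGraphData F Ψ R B k r ρ)
    (hF : Continuous F) (q : S) :
    (graphSurface F Ψ R B k =ᶠ[𝓝 q] F) ∨ (F q ∈ B ∧ ‖(R (F q)).1‖ ≤ ρ) := by
  let Z : Set M := (fun v : ℂ => Ψ (v, 0)) '' Metric.closedBall 0 ρ
  have hmem : ∀ v ∈ Metric.closedBall (0 : ℂ) ρ, ((v, 0) : ℂ × ℝ) ∈ Metric.ball 0 r := by
    intro v hv
    rw [mem_closedBall_zero_iff] at hv
    rw [mem_ball_zero_iff, Prod.norm_mk, norm_zero]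
    exact max_lt (hv.trans_lt h.lt) ((norm_nonneg v).trans_lt (hv.trans_lt h.lt))
  have hZ : IsClosed Z := by
    refine IsCompact.isClosed (IsCompact.image_of_continuousOn (isCompact_closedBall 0 ρ) ?_)
    intro v hv
    have h1 : ContinuousAt (fun v : ℂ => ((v, 0) : ℂ × ℝ)) v := by fun_prop
    exact (ContinuousAt.comp (g := Ψ) (f := fun v : ℂ => ((v, 0) : ℂ × ℝ))
      (h.smooth _ (hmem v hv)).continuousAt h1).continuousWithinAt
  by_cases hq : F q ∈ Z
  · right
    obtain ⟨v, hv, hvq⟩ := hq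
    have hv' := hmem v hv
    simp only at hvq
    rw [← hvq, h.left_inv _ hv']
    exact ⟨h.maps _ hv', mem_closedBall_zero_iff.1 hv⟩
  · left
    filter_upwards [(hZ.isOpen_compl.preimage hF).mem_nhds hq] with q' hq'
    by_cases hB : F q' ∈ B
    · refine h.graphSurface_eq hB (h.support _ ?_)
      by_contra hlt
      rw [not_le] at hlt
      exact hq' ⟨(R (F q')).1, mem_closedBall_zero_iff.2 hlt.le, h.apply_coord hB⟩
    · exact graphSurface_of_notMem hB

/-- Locally the new map is `F` or `F` followed by the diffeomorphism `(v, z) ↦ (v, z + k v)` in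
coordinates, hence an immersion. It is injective, and `S` is compact. -/
theorem IsGraphData.isSmoothEmbedding [ChartedSpace (EuclideanHalfSpace 2) S] [IsManifold (𝓡 3) ∞ M] [T2Space M] [CompactSpace S]
    (h : IsGraphData F Ψ R B k r ρ) (hF : Manifold.IsSmoothEmbedding (𝓡∂ 2) (𝓡 3) ∞ F) :
    Manifold.IsSmoothEmbedding (𝓡∂ 2) (𝓡 3) ∞ (graphSurface F Ψ R B k) := by
  have hFc : Continuous F := hF.isEmbedding.continuous
  have himm : Manifold.IsImmersionOfComplement hF.isImmersion.complement (𝓡∂ 2) (𝓡 3) ∞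
      (graphSurface F Ψ R B k) := by
    intro q
    have hq := hF.isImmersion.isImmersionOfComplement_complement q
    rcases h.eventually_eq_or hFc q with heq | ⟨hqB, -⟩
    · exact hq.congr_of_eventuallyEq heq.symm
    · let σ : ℂ × ℝ → ℂ × ℝ := fun x => (x.1, x.2 + k x.1)
      let σ' : ℂ × ℝ → ℂ × ℝ := fun x => (x.1, x.2 - k x.1)
      have hσ : ContDiff ℝ ∞ σ := contDiff_fst.prodMk (contDiff_snd.add (h.smooth_k.comp contDiff_fst))
      have hσ' : ContDiff ℝ ∞ σ' :=
        contDiff_fst.prodMk (contDiff_snd.sub (h.smooth_k.comp contDiff_fst))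
      have hl : ∀ x, σ' (σ x) = x := fun x => by simp [σ, σ']
      have hr : ∀ x, σ (σ' x) = x := fun x => by simp [σ, σ']
      have hσq : σ (R (F q)) ∈ Metric.ball 0 r := by
        simp only [σ]
        rw [h.flat q hqB, zero_add]
        exact h.mem_ball (h.norm_lt hqB)
      have h1 := h.toIsLocalParamOn.conj hσ hl hqB hσq
      have h2 := h.toIsLocalParamOn.conj hσ' hr (p := Ψ (σ (R (F q)))) (h.maps _ hσq) (by
        rw [h.left_inv _ hσq, hl]
        exact h.maps_inv _ hqB)
      refine (Manifold.IsImmersionAtOfComplement.comp_left hq (T := fun p => Ψ (σ (R p)))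
        (T' := fun p => Ψ (σ' (R p))) (h1.mono fun _ hp => hp.1) (h2.mono fun _ hp => hp.1)
        (h1.mono fun _ hp => hp.2) (h2.mono fun _ hp => hp.2)).congr_of_eventuallyEq ?_
      filter_upwards [(h.isOpen_target.preimage hFc).mem_nhds hqB] with q' hq'
      exact (if_pos hq').symm
  have hc : Continuous (graphSurface F Ψ R B k) := himm.contMDiff.continuous
  exact ⟨himm.isImmersion, (hc.isClosedEmbedding (h.injective hF.isEmbedding.injective)).isEmbedding⟩

end Perturbation

/-! ### Making the surface radial at one elliptic point. -/

section RadialPerturbation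

variable {M : Type*} [TopologicalSpace M] [ChartedSpace (Euc 3) M]
  {S : Type*} [TopologicalSpace S] [ChartedSpace (EuclideanHalfSpace 2) S]
  {F : S → M} {q₀ : S}

theorem IsSurfaceParam.eventually_isLocalParamOn {Ψ : ℂ × ℝ → M} {R : M → ℂ × ℝ}
    (h : IsSurfaceParam F Ψ R q₀) {W : Set M} (hW : W ∈ 𝓝 (F q₀)) :
    ∀ᶠ r in 𝓝[>] (0 : ℝ), IsLocalParamOn Ψ R (Metric.ball 0 r) (Ψ '' Metric.ball 0 r) ∧
      Ψ '' Metric.ball 0 r ⊆ W := by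
  have h1 := h.eventually_ball hW
  rw [h.center] at h1
  filter_upwards [h1] with r ⟨ho, _, hsub, hx, hp⟩
  exact ⟨⟨Metric.isOpen_ball, ho, fun x hxr => (hx x hxr).1, fun x hxr => (hx x hxr).2,
    fun x hxr => mem_image_of_mem _ hxr, fun p hpr => (hp p hpr).1, fun p hpr => (hp p hpr).2.1,
    fun p hpr => (hp p hpr).2.2⟩, hsub⟩

variable [IsManifold (𝓡 3) ∞ M]

theorem IsGraphData.isSingularAt_iff (lam : ContactForm M) {Ψ : ℂ × ℝ → M} {R : M → ℂ × ℝ}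
    {B : Set M} {k : ℂ → ℝ} {r ρ : ℝ} (h : IsGraphData F Ψ R B k r ρ) (hF : Continuous F) {q : S}
    (hq : F q ∈ B) (hK : MDifferentiableAt (𝓡∂ 2) 𝓘(ℝ, ℂ) (fun q => (R (F q)).1) q)
    (hKi : Function.Injective (mfderiv (𝓡∂ 2) 𝓘(ℝ, ℂ) (fun q => (R (F q)).1) q)) :
    IsSingularAt lam (graphSurface F Ψ R B k) q ↔
      graphForm (pullForm lam Ψ) k (R (F q)).1 = 0 := by
  have hmem := h.mem_ball (h.norm_lt hq)
  obtain ⟨hg, hgi⟩ := IsLocalParam.injective_mfderiv_graph (Ψ := Ψ) (R := R) h.smooth_k.contDiffAt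
    (h.smooth _ hmem) (h.smooth_inv _ (h.maps _ hmem))
    (by filter_upwards [h.isOpen_source.mem_nhds hmem] with x hx using h.left_inv x hx)
  rw [← pullForm_graph lam ((h.smooth _ hmem).mdifferentiableAt (by simp))
    (h.smooth_k.contDiffAt.differentiableAt (by simp))]
  refine isSingularAt_iff_pullForm lam hK hKi (g := fun v => Ψ (v, k v))
    (hg.mdifferentiableAt (by simp)) hgi ?_
  filter_upwards [(h.isOpen_target.preimage hF).mem_nhds hq] with q' hq'
  exact h.graphSurface_of_mem hq'

/-- Near an elliptic boundary point on a Legendrian knot, the surface can be perturbed such that it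
becomes radial there, keeping the boundary and the (elliptic) singular points. -/
theorem exists_radial_perturbation [T2Space M] [CompactSpace S] [IsManifold (𝓡∂ 2) ∞ S] (lam : ContactForm M) {γ : Circle → M}
    (hγ : IsLegendrianKnot lam γ) (hF : Manifold.IsSmoothEmbedding (𝓡∂ 2) (𝓡 3) ∞ F)
    (hbd : F '' (𝓡∂ 2).boundary S = range γ) (hfin : (singularPoints lam F).Finite)
    (hq₀ : q₀ ∈ (𝓡∂ 2).boundary S) (hell : IsEllipticAt lam F q₀)
    {W : Set M} (hW : W ∈ 𝓝 (F q₀)) :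
    ∃ F₁ : S → M, Manifold.IsSmoothEmbedding (𝓡∂ 2) (𝓡 3) ∞ F₁ ∧
      (∀ q, F₁ q = F q ∨ F q ∈ W ∧ F₁ q ∈ W) ∧
      (∀ q ∈ (𝓡∂ 2).boundary S, F₁ q = F q) ∧
      (∀ q, IsSingularAt lam F q → F₁ q = F q) ∧
      (∀ q, IsSingularAt lam F₁ q ↔ IsSingularAt lam F q) ∧
      (∀ q, IsEllipticAt lam F₁ q ↔ IsEllipticAt lam F q) ∧
      ∃ Φ Q, IsRadialParam lam (range γ) (range F₁ \ singularPoints lam F₁) Φ Q (F q₀) := by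
  obtain ⟨Ψ, R, h, G, hP, hknot, hh, hh0, hflat, hG, hG0, hform, hcut⟩ :=
    exists_adapted_surfaceParam lam hγ hF hbd hq₀ hell
  have hFc : Continuous F := hF.isEmbedding.continuous
  have hinj := hF.isEmbedding.injective
  -- Finiteness isolates the singular point, so a small coordinate domain contains no other.
  have hsing : ∀ᶠ p in 𝓝 (F q₀), p ∈ singularPoints lam F → p = F q₀ := by
    have := (hfin.subset (sdiff_subset (t := {F q₀}))).isClosed.isOpen_compl.mem_nhds
      (x := F q₀) (fun h => h.2 rfl)
    filter_upwards [this] with p hp hps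
    by_contra hne
    exact hp ⟨hps, hne⟩
  have hgood := eventually_preimage_of_isInducing hF.isEmbedding.isInducing
    (hP.flat.and (hP.half.and hP.coord))
  have hpos : ∀ᶠ r in 𝓝[>] (0 : ℝ), 0 < r := self_mem_nhdsWithin
  obtain ⟨r, hr0, hparam, hsub⟩ := (hpos.and
    (hP.eventually_isLocalParamOn (inter_mem hW (hsing.and hgood)))).exists
  obtain ⟨ε, hε, hball⟩ := Metric.eventually_nhds_iff_ball.1 hflat
  -- `ρ < r` keeps the graph in the coordinate domain; `ρ < ε` makes `h` vanish on the imaginary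
  -- axis wherever the cutoff does not, so the boundary is fixed.
  have hIoo : ∀ᶠ ρ in 𝓝[>] (0 : ℝ), ρ ∈ Ioo 0 (min r ε) := Ioo_mem_nhdsGT (lt_min hr0 hε)
  obtain ⟨ρ, hρ, μ, hμ, hμ1, hμ0, hμh, hne⟩ := (hIoo.and hcut).exists
  set B := Ψ '' Metric.ball 0 r with hBdef
  set k : ℂ → ℝ := fun v => μ v * h v with hk
  have hksm : ContDiff ℝ ∞ k := hμ.mul hh
  have hk0 : k 0 = 0 := by simp [hk, hh0]
  have hkh : k =ᶠ[𝓝 0] h := by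
    filter_upwards [hμ1] with v hv
    simp [hk, hv]
  have hkre : ∀ v : ℂ, v.re = 0 → k v = 0 := by
    intro v hv
    by_cases hvρ : ρ ≤ ‖v‖
    · simp [hk, hμ0 v hvρ]
    · have : h v = 0 := hball v (mem_ball_zero_iff.2
        ((not_le.1 hvρ).trans (hρ.2.trans_le (min_le_right _ _)))) hv
      simp [hk, this]
  have hB := fun q (hq : F q ∈ B) => (hsub hq).2.2 q rfl
  have D : IsGraphData F Ψ R B k r ρ :=
    { toIsLocalParamOn := hparam
      lt := hρ.2.trans_le (min_le_left _ _)
      smooth_k := hksm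
      abs_le := hμh
      support := fun v hv => by simp [hk, hμ0 v hv]
      flat := fun q hq => (hB q hq).1 }
  have hq₀B : F q₀ ∈ B := ⟨0, Metric.mem_ball_self hr0, hP.apply_zero⟩
  have hBn : ∀ᶠ q in 𝓝 q₀, F q ∈ B := (D.isOpen_target.preimage hFc).mem_nhds hq₀B
  have hK0 : ∀ q, F q ∈ B → q ≠ q₀ → (R (F q)).1 ≠ 0 := by
    intro q hq hne h0
    apply hne
    apply hinj
    rw [← D.apply_coord hq, h0, ← hP.apply_zero]
    rfl
  have hsingB : ∀ q, F q ∈ B → IsSingularAt lam F q → q = q₀ := fun q hq hs =>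
    hinj ((hsub hq).2.1 ⟨q, hs, rfl⟩)
  set F₁ := graphSurface F Ψ R B k with hF₁
  have hF₁q₀ : F₁ q₀ = F q₀ := D.graphSurface_eq hq₀B (by rw [hP.center]; exact hk0)
  have hform' : ∀ᶠ v in 𝓝 0, ∀ w, graphForm (pullForm lam Ψ) k v w = G v * crossProd v w := by
    filter_upwards [hform, hkh.eventually_nhds] with v h1 h2 w
    rw [graphForm_congr h2, h1 w]
  -- Near the origin `k = h`, so the restricted form is `G` times the radial one. Its derivative is
  -- `G 0` times the area form, with determinant `(G 0)²` and nonzero skew part.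
  have hell₁ : IsEllipticAt lam F₁ q₀ := by
    obtain ⟨e1, e2⟩ := fderiv_graphForm_of_crossProd hG hform'
    refine (hP.isEllipticAt_iff lam hksm hk0 ?_).2 ⟨e1, ?_, ?_⟩
    · filter_upwards [hBn] with q hq using D.graphSurface_of_mem hq
    · rw [e2, e2]
      simp only [crossProd, Complex.one_re, Complex.one_im, Complex.I_re, Complex.I_im]
      intro h1
      apply hG0
      linarith
    · rw [bilinDet, e2, e2, e2, e2]
      simp only [crossProd, Complex.one_re, Complex.one_im, Complex.I_re, Complex.I_im]
      nlinarith [mul_self_pos.2 hG0]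
  -- Here the cutoff estimate enters: on the moved part the graph is singular only at `q₀`.
  have hns : ∀ q, F q ∈ B → ‖(R (F q)).1‖ ≤ ρ → q ≠ q₀ → ¬ IsSingularAt lam F₁ q := by
    intro q hq hle hqq hs
    exact hne _ (hK0 q hq hqq) hle ((D.isSingularAt_iff lam hFc hq
      ((hB q hq).2.2.1.mdifferentiableAt (by simp)) (hB q hq).2.2.2).1 hs)
  have hsiff : ∀ q, IsSingularAt lam F₁ q ↔ IsSingularAt lam F q := by
    intro q
    rcases D.eventually_eq_or hFc q with heq | ⟨hq, hle⟩
    · exact isSingularAt_congr lam heq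
    · by_cases hqq : q = q₀
      · rw [hqq]
        exact iff_of_true hell₁.1 hell.1
      · exact iff_of_false (hns q hq hle hqq) fun hs => hqq (hsingB q hq hs)
  have hD : ∀ᶠ v : ℂ in 𝓝 0, 0 ≤ v.re → v ≠ 0 →
      Ψ (v, h v) ∈ range F₁ \ singularPoints lam F₁ := by
    have hnorm : ∀ᶠ v : ℂ in 𝓝 0, ‖v‖ < ρ := by
      filter_upwards [Metric.ball_mem_nhds (0 : ℂ) hρ.1] with v hv using mem_ball_zero_iff.1 hv
    filter_upwards [hP.eventually_exists hF.isEmbedding.isInducing, hkh, hnorm] with v h1 h2 h3 hv hv0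
    obtain ⟨q, hq, -⟩ := h1 hv
    have hmem : ((v, 0) : ℂ × ℝ) ∈ Metric.ball 0 r := by
      rw [mem_ball_zero_iff, Prod.norm_mk, norm_zero]
      exact max_lt (h3.trans D.lt) hr0
    have hqB : F q ∈ B := ⟨_, hmem, hq.symm⟩
    have hKq : (R (F q)).1 = v := by rw [hq, D.left_inv _ hmem]
    have hF₁q : F₁ q = Ψ (v, h v) := by rw [← h2, hF₁, D.graphSurface_of_mem hqB, hKq]
    have hqq : q ≠ q₀ := by
      rintro rfl
      rw [hP.center] at hKq
      exact hv0 hKq.symm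
    rw [← hF₁q]
    refine ⟨mem_range_self _, ?_⟩
    rintro ⟨q', hq', heq⟩
    rw [D.injective hinj heq] at hq'
    exact hns q hqB (by rw [hKq]; exact h3.le) hqq hq'
  refine ⟨F₁, D.isSmoothEmbedding hF, ?_, ?_, ?_, hsiff, ?_,
    exists_isRadialParam lam hP.toIsLocalParam hP.center hh hh0 hflat hG hG0 hform hknot hD⟩
  · intro q
    by_cases hq : F q ∈ B
    · exact Or.inr ⟨(hsub hq).1, (hsub (D.graphSurface_mem hq)).1⟩
    · exact Or.inl (graphSurface_of_notMem hq)
  · intro q hq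
    by_cases hqB : F q ∈ B
    · exact D.graphSurface_eq hqB (hkre _ ((hB q hqB).2.1.2.1 hq))
    · exact graphSurface_of_notMem hqB
  · intro q hq
    by_cases hqB : F q ∈ B
    · rw [hsingB q hqB hq]
      exact hF₁q₀
    · exact graphSurface_of_notMem hqB
  · intro q
    rcases D.eventually_eq_or hFc q with heq | ⟨hq, hle⟩
    · exact isEllipticAt_congr lam heq
    · by_cases hqq : q = q₀
      · rw [hqq]
        exact iff_of_true hell₁ hell
      · exact iff_of_false (fun hs => hns q hq hle hqq hs.1) fun hs => hqq (hsingB q hq hs.1)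

end RadialPerturbation

/-! ### All elliptic points on the knot, by induction. -/

section RadialSurface

variable {M : Type*} [TopologicalSpace M] [ChartedSpace (Euc 3) M] [IsManifold (𝓡 3) ∞ M]
  {S : Type*} [TopologicalSpace S] [ChartedSpace (EuclideanHalfSpace 2) S]

theorem IsRadialParam.mono {lam : ContactForm M} {L D D' : Set M} {Φ : ℂ × ℝ → M} {Q : M → ℂ × ℝ}
    {e : M} (h : IsRadialParam lam L D Φ Q e) (hD : ∀ᶠ p in 𝓝 e, p ∈ D → p ∈ D') :
    IsRadialParam lam L D' Φ Q e where
  toIsLocalParam := h.toIsLocalParam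
  center := h.center
  radial := h.radial
  knot := h.knot
  surface := by
    filter_upwards [h.surface, h.tendsto.eventually hD] with ξ h1 h2 h3 h4 using h2 (h1 h3 h4)

/-- `F` has the same boundary values and the same (elliptic) singular points as `F'`, and differs from
it only by motions within the sets `W e`, `e ∈ T`. -/
structure IsPerturbation (lam : ContactForm M) (F' F : S → M) (T : Set M) (W : M → Set M) : Prop where
  embedding : Manifold.IsSmoothEmbedding (𝓡∂ 2) (𝓡 3) ∞ F
  close : ∀ q, F q = F' q ∨ ∃ e ∈ T, F q ∈ W e ∧ F' q ∈ W e
  boundary : ∀ q ∈ (𝓡∂ 2).boundary S, F q = F' q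
  singular : ∀ q, IsSingularAt lam F' q → F q = F' q
  singular_iff : ∀ q, IsSingularAt lam F q ↔ IsSingularAt lam F' q
  elliptic_iff : ∀ q, IsEllipticAt lam F q ↔ IsEllipticAt lam F' q

theorem IsPerturbation.image_boundary {lam : ContactForm M} {F F' : S → M} {T : Set M} {W : M → Set M}
    (h : IsPerturbation lam F' F T W) : F '' (𝓡∂ 2).boundary S = F' '' (𝓡∂ 2).boundary S :=
  image_congr h.boundary

theorem IsPerturbation.singularPoints_eq {lam : ContactForm M} {F F' : S → M} {T : Set M}
    {W : M → Set M} (h : IsPerturbation lam F' F T W) :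
    singularPoints lam F = singularPoints lam F' := by
  rw [singularPoints, singularPoints, show {q | IsSingularAt lam F q} = {q | IsSingularAt lam F' q}
    from Set.ext h.singular_iff]
  exact image_congr h.singular

theorem IsPerturbation.ellipticPoints_eq {lam : ContactForm M} {F F' : S → M} {T : Set M}
    {W : M → Set M} (h : IsPerturbation lam F' F T W) :
    ellipticPoints lam F = ellipticPoints lam F' := by
  rw [ellipticPoints, ellipticPoints, show {q | IsEllipticAt lam F q} = {q | IsEllipticAt lam F' q}
    from Set.ext h.elliptic_iff]
  exact image_congr fun q hq => h.singular q hq.1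

/-- The surface can be perturbed such that it is radial at all elliptic boundary points. -/
theorem exists_radial_surface [T2Space M] [CompactSpace S] [IsManifold (𝓡∂ 2) ∞ S]
    (lam : ContactForm M) {γ : Circle → M} (hγ : IsLegendrianKnot lam γ) {F' : S → M}
    (hF' : Manifold.IsSmoothEmbedding (𝓡∂ 2) (𝓡 3) ∞ F')
    (hbd : F' '' (𝓡∂ 2).boundary S = range γ) (hfin : (singularPoints lam F').Finite)
    {T : Set M} (hT : T.Finite) (hTe : T ⊆ ellipticPoints lam F' ∩ range γ) {W : M → Set M}
    (hW : ∀ e ∈ T, W e ∈ 𝓝 e) (hWd : T.PairwiseDisjoint W) :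
    ∃ F, IsPerturbation lam F' F T W ∧ ∀ e ∈ T, ∃ Φ Q,
      IsRadialParam lam (range γ) (range F \ singularPoints lam F) Φ Q e := by
  suffices h : ∀ A ⊆ T, A.Finite → ∃ F, IsPerturbation lam F' F T W ∧ ∀ e ∈ A, ∃ Φ Q,
      IsRadialParam lam (range γ) (range F \ singularPoints lam F) Φ Q e from h T Subset.rfl hT
  intro A hAT hA
  induction A, hA using Set.Finite.induction_on with
  | empty =>
    exact ⟨F', ⟨hF', fun q => Or.inl rfl, fun _ _ => rfl, fun _ _ => rfl, fun _ => Iff.rfl,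
      fun _ => Iff.rfl⟩, fun e he => absurd he (notMem_empty e)⟩
  | @insert e A heA hA ih =>
    obtain ⟨F, hF, hrad⟩ := ih ((subset_insert _ _).trans hAT)
    have heT : e ∈ T := hAT (mem_insert _ _)
    obtain ⟨⟨q₀, hq₀, hq₀e⟩, heγ⟩ := hTe heT
    rw [← hbd] at heγ
    obtain ⟨q₁, hq₁, hq₁e⟩ := heγ
    have hq₁₀ : q₁ = q₀ := hF'.isEmbedding.injective (hq₁e.trans hq₀e.symm)
    rw [hq₁₀] at hq₁
    have hFe : F q₀ = e := (hF.singular q₀ hq₀.1).trans hq₀e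
    obtain ⟨F₁, hF₁, hclose, hb, hs, hsiff, heiff, hrad₁⟩ := exists_radial_perturbation lam hγ
      hF.embedding (hF.image_boundary.trans hbd) (by rw [hF.singularPoints_eq]; exact hfin) hq₁
      ((hF.elliptic_iff q₀).2 hq₀) (W := W e) (by rw [hFe]; exact hW e heT)
    rw [hFe] at hrad₁
    refine ⟨F₁, ⟨hF₁, fun q => ?_, fun q hq => (hb q hq).trans (hF.boundary q hq),
      fun q hq => (hs q ((hF.singular_iff q).2 hq)).trans (hF.singular q hq),
      fun q => (hsiff q).trans (hF.singular_iff q), fun q => (heiff q).trans (hF.elliptic_iff q)⟩,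
      fun e' he' => ?_⟩
    · rcases hclose q with h1 | ⟨h1, h2⟩
      · rw [h1]
        exact hF.close q
      -- A point moved now and before had its intermediate position in both neighbourhoods, so by
      -- disjointness these are the same and the two motions do not add up.
      · rcases hF.close q with h3 | ⟨e', he', h3, h4⟩
        · exact Or.inr ⟨e, heT, h2, h3 ▸ h1⟩
        · have : e = e' := hWd.elim heT he' (not_disjoint_iff.2 ⟨F q, h1, h3⟩)
          exact Or.inr ⟨e, heT, h2, this ▸ h4⟩
    · rcases he' with rfl | he'
      · exact hrad₁
      · obtain ⟨Φ, Q, hΦ⟩ := hrad e' he'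
        have he'T : e' ∈ T := hAT (mem_insert_of_mem _ he')
        have hne : e ≠ e' := fun h => heA (h ▸ he')
        -- Points in `W e'` are not affected by the motion inside `W e`, so the earlier
        -- parametrization remains radial for the new surface.
        refine ⟨Φ, Q, hΦ.mono ?_⟩
        filter_upwards [hW e' he'T] with p hp ⟨⟨q, hq⟩, hps⟩
        have hF₁q : F₁ q = p := by
          rcases hclose q with h1 | ⟨h1, -⟩
          · rw [h1, hq]
          · rw [hq] at h1
            exact absurd (hWd.elim heT he'T (not_disjoint_iff.2 ⟨p, h1, hp⟩)) hne
        refine ⟨⟨q, hF₁q⟩, ?_⟩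
        rintro ⟨q', hq', hq'p⟩
        have : q' = q := hF₁.isEmbedding.injective (hq'p.trans hF₁q.symm)
        rw [this] at hq'
        exact hps ⟨q, (hsiff q).1 hq', hq⟩

omit [ChartedSpace (Euc 3) M] [IsManifold (𝓡 3) ∞ M] in
theorem exists_disjoint_small_nhds [T2Space M] {V : Set (M × M)} (hV : V ∈ 𝓝ˢ (diagonal M))
    {T : Set M} (hT : T.Finite) :
    ∃ W : M → Set M, (∀ e, W e ∈ 𝓝 e ∧ W e ×ˢ W e ⊆ V) ∧ T.PairwiseDisjoint W := by
  obtain ⟨U, hU, hUd⟩ := hT.t2_separation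
  have hex : ∀ e : M, ∃ u ∈ 𝓝 e, u ×ˢ u ⊆ V := by
    intro e
    have h1 : V ∈ 𝓝 e ×ˢ 𝓝 e := by
      rw [← nhds_prod_eq]
      exact mem_nhdsSet_iff_forall.1 hV (e, e) rfl
    exact mem_prod_same_iff.1 h1
  choose u hu huV using hex
  refine ⟨fun e => U e ∩ u e, fun e => ⟨inter_mem ((hU e).2.mem_nhds (hU e).1) (hu e),
    (prod_mono inter_subset_right inter_subset_right).trans (huV e)⟩, ?_⟩
  exact hUd.mono fun e => inter_subset_left

end RadialSurface

end

/-! ### Assembly of the theorem. -/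

theorem theorem1p3
    -- the contact 3-manifold `(M, λ)`
    {M : Type*} [TopologicalSpace M] [T2Space M] [SecondCountableTopology M]
    [ChartedSpace (Euc 3) M] [IsManifold (𝓡 3) ∞ M] (lam : ContactForm M)
    -- the Legendrian knot, the range of `γ`
    (γ : Circle → M) (hγ : IsLegendrianKnot lam γ)
    -- the compact embedded surface `D'`, the range of `F'`, with boundary the knot
    {S : Type*} [TopologicalSpace S] [CompactSpace S]
    [ChartedSpace (EuclideanHalfSpace 2) S] [IsManifold (𝓡∂ 2) ∞ S]
    (F' : S → M) (hF' : Manifold.IsSmoothEmbedding (𝓡∂ 2) (𝓡 3) ∞ F')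
    (hbd : F' '' (𝓡∂ 2).boundary S = range γ)
    (hfin : (singularPoints lam F').Finite)
    -- a prescribed `C^0`-tolerance
    (V : Set (M × M)) (hV : V ∈ 𝓝ˢ (diagonal M)) :
    -- the perturbed surface `D`, the range of `F`
    ∃ F : S → M, Manifold.IsSmoothEmbedding (𝓡∂ 2) (𝓡 3) ∞ F ∧
      (∀ q, (F' q, F q) ∈ V) ∧
      F '' (𝓡∂ 2).boundary S = range γ ∧
      singularPoints lam F = singularPoints lam F' ∧
      ellipticPoints lam F = ellipticPoints lam F' ∧
      ∃ J : CompatibleJ lam,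
        ∀ e ∈ range γ, e ∈ ellipticPoints lam F →
        ∀ N ∈ 𝓝 ((0 : ℝ), e),
        ∃ U : ℝ → ℝ × ℝ → ℝ × M,
          (∀ τ ∈ Ioo (0 : ℝ) 1,
            IsStripSolution J (range γ) (range F \ singularPoints lam F) (U τ) ∧
            IsEmbeddedStrip (U τ) ∧
            MapsTo (U τ) strip N) ∧
          (∀ τ ∈ Ioo (0 : ℝ) 1, ∀ τ' ∈ Ioo (0 : ℝ) 1, τ ≠ τ' →
            Disjoint (U τ '' strip) (U τ' '' strip)) ∧
          ConvergesWithDerivatives U e ∧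
          ContMDiffOn 𝓘(ℝ, ℝ × (ℝ × ℝ)) (𝓘(ℝ, ℝ).prod (𝓡 3)) ∞
            (fun x : ℝ × (ℝ × ℝ) => U x.1 x.2) (Ioo (0 : ℝ) 1 ×ˢ strip) := by
  set T := ellipticPoints lam F' ∩ range γ with hT
  have hTfin : T.Finite := hfin.subset fun e he => image_mono (fun _ hq => hq.1) he.1
  obtain ⟨W, hW, hWd⟩ := exists_disjoint_small_nhds hV hTfin
  obtain ⟨F, hF, hrad⟩ := exists_radial_surface lam hγ hF' hbd hfin hTfin Subset.rfl
    (fun e _ => (hW e).1) hWd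
  have hex : ∀ e, ∃ Φ Q, e ∈ T →
      IsRadialParam lam (range γ) (range F \ singularPoints lam F) Φ Q e := by
    intro e
    by_cases he : e ∈ T
    · obtain ⟨Φ, Q, h⟩ := hrad e he
      exact ⟨Φ, Q, fun _ => h⟩
    · exact ⟨fun _ => e, fun _ => 0, fun h => absurd h he⟩
  choose Φ Q hΦ using hex
  -- One global `J` serves all points of `T`: near each of them it rotates the images of the
  -- coordinate vectors `1` and `i`, projected to `ker λ`.
  obtain ⟨J, hJ⟩ := exists_compatibleJ lam hTfin (Φ := Φ) (Q := Q) (η := (1, 0))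
    (ζ := (Complex.I, 0)) fun e he => ⟨(hΦ e he).toIsLocalParam, (hΦ e he).d_pushField_pos⟩
  refine ⟨F, hF.embedding, fun q => ?_, hF.image_boundary.trans hbd, hF.singularPoints_eq,
    hF.ellipticPoints_eq, J, fun e heγ hell N hN => ?_⟩
  · rcases hF.close q with h | ⟨e, -, h1, h2⟩
    · rw [h]
      exact subset_of_mem_nhdsSet hV rfl
    · exact (hW e).2 ⟨h2, h1⟩
  · have he : e ∈ T := ⟨hF.ellipticPoints_eq ▸ hell, heγ⟩
    exact (hΦ e he).exists_strips (hJ e he) hN
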